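/- **Setting.** Let $F$ be a non-archimedean local field of characteristic $0$ with ring of integers $\mathcal O$, maximal ideal $\mathfrak p$, residue field of cardinality $q$, normalized additive valuation $\nu$ and $|x|=q^{-\nu(x)}$. Let $K$ be a quadratic étale $F$-algebra (a quadratic field extension, or $F\times F$), $\mathcal O_K$ the integral closure of $\mathcal O$ in $K$, and $T=K^\times/F^\times$, with the Haar measure $d^\times t$ for which the image of $\mathcal O_K^\times$ has volume $1$. Let $P\subset \mathrm{GL}_2(F)$ be the group of upper triangular matrices. Fix an embedding of $F$-algebras $\iota:K\to M_2(F)$ with $\iota(K^\times)\not\subset P$. Fix Haar measures $dg$ on $\mathrm{GL}_2(F)$ and $dx$ on $F$, and put $\mathcal K=\mathrm{GL}_2(\mathcal O)$. *Representations.* For $\alpha\in\mathbb C^\times$ let $\bar V_\alpha$ be the space of locally constant $\phi:\mathrm{GL}_2(F)\to\mathbb C$ with $\phi(bg)=\mu_\alpha(b)\phi(g)$ for all $b=\begin{pmatrix}t_1&x\\0&t_2\end{pmatrix}\in P$, where $\mu_\alpha(b)=\alpha^{\nu(t_2/t_1)}$. The group $\mathrm{GL}_2(F)$ acts by right translation.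 Let $V_\alpha=\bar V_\alpha$ if $\alpha\ne\pm1$, and let $V_\alpha$ be the quotient of $\bar V_\alpha$ by the line spanned by $g\mapsto\alpha^{\nu(\det g)}$ if $\alpha=\pm1$; write $\pi_\alpha$ for the representation on $V_\alpha$. The centre acts trivially, so $T$ acts on $V_\alpha$ through $\iota$. Let $C_\circ(T,\mathbb C)$ be the space of locally constant functions with compact support on $T$. For $f\in C_\circ(T,\mathbb C)$ let $\delta_T(f)\in V_\alpha$ be the class of the function that sends $b\,\iota(t)$ to $\mu_\alpha(b)f(t^{-1})$ for $b\in P$, $t\in K^\times$, and vanishes outside $P\iota(K^\times)$. *Pairings.* Assume $|\alpha|^2=q$ or $\alpha=\pm1$. For $\phi\in\bar V_\alpha$ let $\phi_s(bk)=q^{s\,\nu(t_2/t_1)}\phi(bk)$ ($b\in P$ as above, $k\in\mathcal K$) and let $\Lambda(\phi)(g)$ be the value at $s=0$ of the meromorphic continuation of $$I(\phi,s,g)=\int_F\phi_s\!\left(\begin{pmatrix}1&0\\x&1\end{pmatrix}\begin{pmatrix}0&-1\\1&0\end{pmatrix}g\right)dx\qquad(\mathrm{Re}\,s>1/2).$$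 Put $\langle\phi_1,\phi_2\rangle=\int_{\mathcal K}\phi_1\overline{\phi_2}\,dg$ if $|\alpha|^2=q$ and $\langle\phi_1,\phi_2\rangle=\int_{\mathcal K}\phi_1\overline{\Lambda(\phi_2)}\,dg$ if $\alpha=\pm1$; this gives a pairing on $V_\alpha$, computed on representatives. For a continuous unitary character $\chi$ of $T$ and $u,w\in V_\alpha$ put $$\beta_{\pi_\alpha,\chi}(u,w)=\int_T\langle\pi_\alpha(t)u,w\rangle\,\chi(t)\,d^\times t,\qquad \alpha_{\pi_\alpha,\chi}(u,w)=\frac{L(1,\eta)\,L(1,\pi_\alpha,\mathrm{ad})}{\zeta(2)\,L(1/2,\pi_\alpha,\chi)}\,\beta_{\pi_\alpha,\chi}(u,w).$$ *Local factors.* $\zeta(s)=(1-q^{-s})^{-1}$. $L(s,\eta)$ is $(1-q^{-s})^{-1}$, $(1+q^{-s})^{-1}$ or $1$ according as $K$ is split, inert or ramified. $L(s,\pi_\alpha,\mathrm{ad})$ is $(1-q^{-s-1})^{-1}$ if $\alpha=\pm1$ and $\big((1-\alpha^2q^{-s-1})(1-q^{-s})(1-\alpha^{-2}q^{1-s})\big)^{-1}$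 if $|\alpha|^2=q$. For $a\in\mathbb C^\times$ let $E_a(s)=1$ if $\chi$ is non-trivial on the image of $\mathcal O_K^\times$, and otherwise $$E_a(s)=\begin{cases}(1-a\chi(\varpi_K)q^{-s-1/2})(1-a\chi(\varpi_K)^{-1}q^{-s-1/2}),&K\text{ split},\\ 1-a^2q^{-2s-1},&K\text{ inert},\\ 1-a\chi(\varpi_K)q^{-s-1/2},&K\text{ ramified},\end{cases}$$ where $\varpi_K\in\mathcal O_K$ is an element whose norm is a uniformizer of $F$. Then $L(s,\pi_\alpha,\chi)=E_\alpha(s)^{-1}$ if $\alpha=\pm1$ and $L(s,\pi_\alpha,\chi)=(E_\alpha(s)E_{q/\alpha}(s))^{-1}$ if $|\alpha|^2=q$; at a zero of $E_\alpha$ the quantity $1/L(s,\pi_\alpha,\chi)$ means $E_\alpha(s)=0$. The conductor $n_\chi$ is the least $n\ge0$ such that $\chi$ is trivial on the image of $(\mathcal O+\mathfrak p^n\mathcal O_K)^\times$. **Corollary 3.17.** There are real constants $c_T,C_T>0$ and an integer $n_T$, independent of $\alpha,\chi,f_1,f_2$, such that $\int_{\mathcal K}h\,dg=c_T\int_Th(\iota(t))\,d^\times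 t$ and $\int_Fh\!\left(\begin{pmatrix}1&0\\x&1\end{pmatrix}\begin{pmatrix}0&-1\\1&0\end{pmatrix}\right)dx=C_T\int_Th(\iota(t))\,d^\times t$ for all locally constant $h$ on $\mathrm{GL}_2(F)$ with $h(bg)=|t_1/t_2|\,h(g)$ ($b\in P$), such that the lower left entries of the elements of $\iota(\mathcal O_K)$ form the fractional ideal $\mathfrak p^{n_T}$, and such that the following holds. For every $\alpha\in\mathbb C^\times$ with $|\alpha|^2=q$ or $\alpha=\pm1$ put $$K_T=\begin{cases}c_T\,\dfrac{L(1,\eta)}{\zeta(2)},&|\alpha|^2=q,\\[2mm] c_TC_T\,\dfrac{L(1,\eta)^2\zeta(-1)q^{2n_T}}{\zeta(2)},&\alpha=\pm1.\end{cases}$$ Then $K_T\neq0$, and for every continuous unitary character $\chi$ of $T$ and all $f_1,f_2\in C_\circ(T,\mathbb C)$ the integral defining $\beta_{\pi_\alpha,\chi}(\delta_T(f_1),\delta_T(f_2))$ converges absolutely and $$\alpha_{\pi_\alpha,\chi}(\delta_T(f_1),\delta_T(f_2))=K_T\;e(\pi_\alpha,\chi)\left(\int_Tf_1(t)\chi^{-1}(t)\,d^\times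 t\right)\overline{\left(\int_Tf_2(t)\chi^{-1}(t)\,d^\times t\right)},$$ where $$e(\pi_\alpha,\chi)=\begin{cases}\dfrac{L(1,\pi_\alpha,\mathrm{ad})}{L(1/2,\pi_\alpha,\chi)},&|\alpha|^2=q,\\[2mm]\dfrac1{L(-1/2,\pi_\alpha,\chi)},&\alpha=\pm1,\ \chi|_{\mathcal O_K^\times}=1,\\[2mm]\dfrac{q^{n_\chi}}{L(1/2,\pi_\alpha,\chi)},&\alpha=\pm1,\ \chi|_{\mathcal O_K^\times}\ne1.\end{cases}$$ -/

import Mathlib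

open MeasureTheory ValuativeRel
open scoped Topology WithZero ComplexConjugate

noncomputable section

namespace LocalToric

/-! ### The local field -/

section LocalField

variable (F : Type*) [Field F] [ValuativeRel F] [TopologicalSpace F] [IsNonarchimedeanLocalField F]

/-- The cardinality `q` of the residue field. -/
def resCard : ℕ := Nat.card 𝓀[F]

/-- The local zeta function `ζ(s) = (1 - q^{-s})⁻¹`. -/
def zetaLoc (s : ℂ) : ℂ := (1 - (resCard F : ℂ) ^ (-s))⁻¹

variable {F}

/-- The valuation, with the value group identified with `ℤᵐ⁰`. -/
def valZ (x : F) : ℤᵐ⁰ := IsNonarchimedeanLocalField.valueGroupWithZeroIsoInt F (valuation F x)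

/-- The normalized additive valuation `ν` of a nonzero element, so that `ν(ϖ) = 1`
(the value at `0` is not used). -/
def ord (x : F) : ℤ := -WithZero.log (valZ x)

/-- The quasicharacter `μ_a(t₂/t₁) = a^{ν(t₂/t₁)}` of upper triangular matrices
`(t₁, x; 0, t₂)`. -/
def borelChar (a : ℂˣ) (b : GL (Fin 2) F) : ℂ := ((a ^ ord (b 1 1 / b 0 0) : ℂˣ) : ℂ)

/-- The modular quasicharacter `κ(t₁, x; 0, t₂) = |t₁/t₂|` of upper triangular matrices. -/
def modChar (b : GL (Fin 2) F) : ℂ := (resCard F : ℂ) ^ (-ord (b 0 0 / b 1 1))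

variable (F) in
/-- The maximal compact subgroup `GL₂(𝒪)` of `GL₂(F)`, as a set: the entries of `g` and of its
inverse are integers. -/
def maxCompact : Set (GL (Fin 2) F) :=
  {g | ∀ i j, g i j ∈ 𝒪[F] ∧ (g⁻¹ : GL (Fin 2) F) i j ∈ 𝒪[F]}

/-- The product `n ω`, where `n = (1, 0; x, 1)` and `ω = (0, -1; 1, 0)`. -/
def lowerUnipOmega (x : F) : GL (Fin 2) F :=
  Matrix.GeneralLinearGroup.mkOfDetNeZero !![1, 0; x, 1] (by simp [Matrix.det_fin_two]) *
    Matrix.GeneralLinearGroup.mkOfDetNeZero !![0, -1; 1, 0] (by simp [Matrix.det_fin_two])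

end LocalField

/-! ### The induced representations -/

section Representation

variable {F : Type*} [Field F] [ValuativeRel F] [TopologicalSpace F] [IsNonarchimedeanLocalField F]

variable (F) in
/-- The induced representation space `V̄_α` over `ℂ` with the discrete topology: continuous
(that is, locally constant) functions `φ` on `GL₂(F)` with `φ(b g) = μ_α(t₂/t₁) φ(g)`. -/
def IndSpace (α : ℂˣ) : Submodule ℂ (GL (Fin 2) F → ℂ) where
  carrier := {φ | IsLocallyConstant φ ∧
    ∀ b g : GL (Fin 2) F, b 1 0 = 0 → φ (b * g) = borelChar α b * φ g}
  add_mem' := by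
    rintro φ ψ ⟨h1, h2⟩ ⟨h3, h4⟩
    exact ⟨h1.add h3, fun b g hb => by simp [h2 b g hb, h4 b g hb, mul_add]⟩
  zero_mem' := ⟨IsLocallyConstant.const 0, fun b g _ => by simp⟩
  smul_mem' := by
    rintro c φ ⟨h1, h2⟩
    exact ⟨h1.comp (fun z => c * z), fun b g hb => by simp [h2 b g hb]; ring⟩

/-- The function `φ₀(g) = α^{ν(det g)}`. -/
def detChar (α : ℂˣ) (g : GL (Fin 2) F) : ℂ := ((α ^ ord (g : Matrix (Fin 2) (Fin 2) F).det : ℂˣ) : ℂ)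

open Classical in
variable (F) in
/-- The subrepresentation to divide out: the line spanned by `φ₀` if `α = ±1`, and `0` otherwise. -/
def detLine (α : ℂˣ) : Submodule ℂ (IndSpace F α) :=
  if α = 1 ∨ α = -1 then (Submodule.span ℂ {detChar α}).comap (IndSpace F α).subtype else ⊥

variable (F) in
/-- The representation space `V_α`. -/
abbrev RepSpace (α : ℂˣ) : Type _ := IndSpace F α ⧸ detLine F α

/-- Right translation `(g φ)(x) = φ(x g)` on `V̄_α`. -/
def rightTranslate (α : ℂˣ) (g : GL (Fin 2) F) :
    IndSpace F α →ₗ[ℂ] IndSpace F α where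
  toFun φ := ⟨fun x => φ.1 (x * g), φ.2.1.comp_continuous (continuous_mul_const g),
    fun b x hb => by simpa only [mul_assoc] using φ.2.2 b (x * g) hb⟩
  map_add' _ _ := rfl
  map_smul' _ _ := rfl

lemma valZ_mul (x y : F) : valZ (x * y) = valZ x * valZ y := by simp [valZ]

lemma valZ_ne_zero {x : F} (hx : x ≠ 0) : valZ x ≠ 0 := by simpa [valZ] using hx

lemma ord_mul {x y : F} (hx : x ≠ 0) (hy : y ≠ 0) : ord (x * y) = ord x + ord y := by
  rw [ord, valZ_mul, WithZero.log_mul (valZ_ne_zero hx) (valZ_ne_zero hy), ord, ord]; ring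

lemma det_coe_ne_zero {F : Type*} [Field F] (g : GL (Fin 2) F) : (g : Matrix (Fin 2) (Fin 2) F).det ≠ 0 :=
  ((Matrix.isUnit_iff_isUnit_det _).1 g.isUnit).ne_zero

lemma detChar_mul (α : ℂˣ) (g h : GL (Fin 2) F) :
    detChar α (g * h) = detChar α g * detChar α h := by
  rw [detChar, Units.val_mul, Matrix.det_mul, ord_mul (det_coe_ne_zero g) (det_coe_ne_zero h),
    zpow_add, Units.val_mul, detChar, detChar]

lemma detLine_le (α : ℂˣ) (g : GL (Fin 2) F) :
    detLine F α ≤ (detLine F α).comap (rightTranslate α g) := by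
  intro φ hφ
  by_cases h : α = 1 ∨ α = -1
  · simp only [detLine, h, if_true, Submodule.mem_comap, Submodule.mem_span_singleton] at hφ ⊢
    obtain ⟨c, hc⟩ := hφ
    refine ⟨c * detChar α g, ?_⟩
    funext x
    have := congrFun hc (x * g)
    simp only [Pi.smul_apply, smul_eq_mul, Submodule.subtype_apply, detChar_mul] at this
    simp only [Pi.smul_apply, smul_eq_mul, Submodule.subtype_apply, rightTranslate,
      LinearMap.coe_mk, AddHom.coe_mk]
    rw [← this]; ring
  · simp only [detLine, h, if_false, Submodule.mem_comap, Submodule.mem_bot] at hφ ⊢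
    rw [hφ, map_zero]

variable (F) in
/-- The representation `π_α` of `GL₂(F)` on `V_α`. -/
def rep (α : ℂˣ) : Representation ℂ (GL (Fin 2) F) (RepSpace F α) where
  toFun g := (detLine F α).mapQ (detLine F α) (rightTranslate α g) (detLine_le α g)
  map_one' := by
    ext φ
    simp only [LinearMap.comp_apply, Submodule.mkQ_apply, Submodule.mapQ_apply, Module.End.one_apply]
    congr 1
    ext x
    simp [rightTranslate]
  map_mul' g h := by
    ext φ
    simp only [LinearMap.comp_apply, Submodule.mkQ_apply, Submodule.mapQ_apply, Module.End.mul_apply]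
    congr 1
    ext x
    simp [rightTranslate, mul_assoc]

end Representation

/-! ### Intertwining operator and invariant pairing -/

section Pairing

variable {F : Type*} [Field F] [ValuativeRel F] [TopologicalSpace F] [IsNonarchimedeanLocalField F]

/-- If `g = b k` with `b = (t₁, x; 0, t₂)` upper triangular and `k ∈ GL₂(𝒪)`, this is the integer
`ν(t₂/t₁)`, see `iwasawaExp_mul`. -/
def iwasawaExp (g : GL (Fin 2) F) : ℤ :=
  -2 * WithZero.log (max (valZ (g 1 0)) (valZ (g 1 1))) - ord (g : Matrix (Fin 2) (Fin 2) F).det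

lemma valZ_le_one {x : F} (hx : x ∈ 𝒪[F]) : valZ x ≤ 1 := by
  have h : valuation F x ≤ 1 := hx
  simpa [valZ] using (IsNonarchimedeanLocalField.valueGroupWithZeroIsoInt F).strictMono.monotone h

lemma valZ_add (x y : F) : valZ (x + y) ≤ max (valZ x) (valZ y) := by
  have := (IsNonarchimedeanLocalField.valueGroupWithZeroIsoInt F).strictMono.monotone
    ((valuation F).map_add x y)
  rwa [(IsNonarchimedeanLocalField.valueGroupWithZeroIsoInt F).strictMono.monotone.map_max] at this

lemma valZ_neg (x : F) : valZ (-x) = valZ x := by simp [valZ]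

lemma ord_div {x y : F} (hx : x ≠ 0) (hy : y ≠ 0) : ord (x / y) = ord x - ord y := by
  have := ord_mul (div_ne_zero hx hy) hy
  rw [div_mul_cancel₀ x hy] at this
  omega

lemma iwasawaExp_mul (b k : GL (Fin 2) F) (hb : b 1 0 = 0) (hk : k ∈ maxCompact F) :
    iwasawaExp (b * k) = ord (b 1 1 / b 0 0) := by
  have hbd : (b : Matrix (Fin 2) (Fin 2) F).det = b 0 0 * b 1 1 := by
    rw [Matrix.det_fin_two, hb]; ring
  have hb0 : b 0 0 ≠ 0 ∧ b 1 1 ≠ 0 := by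
    have := det_coe_ne_zero b
    rw [hbd] at this
    exact mul_ne_zero_iff.1 this
  have hle : ∀ x y z w : F, x ∈ 𝒪[F] → y ∈ 𝒪[F] → z ∈ 𝒪[F] → w ∈ 𝒪[F] →
      valZ (x * y - z * w) ≤ max (valZ w) (valZ y) := by
    intro x y z w hx hy hz hw
    rw [sub_eq_add_neg]
    refine (valZ_add _ _).trans ?_
    rw [valZ_neg, valZ_mul, valZ_mul, max_comm]
    exact max_le_max (mul_le_of_le_one_left' (valZ_le_one hz))
      (mul_le_of_le_one_left' (valZ_le_one hx))
  have hd : ∀ g ∈ maxCompact F, valZ (g : Matrix (Fin 2) (Fin 2) F).det ≤ 1 := by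
    intro g hg
    rw [Matrix.det_fin_two]
    exact (hle _ _ _ _ (hg 0 0).1 (hg 1 1).1 (hg 0 1).1 (hg 1 0).1).trans
      (max_le (valZ_le_one (hg 1 0).1) (valZ_le_one (hg 1 1).1))
  have hk' : k⁻¹ ∈ maxCompact F := fun i j => ⟨(hk i j).2, by simpa using (hk i j).1⟩
  have hprod : valZ (k : Matrix (Fin 2) (Fin 2) F).det *
      valZ ((k⁻¹ : GL (Fin 2) F) : Matrix (Fin 2) (Fin 2) F).det = 1 := by
    rw [← valZ_mul, ← Matrix.det_mul, ← Units.val_mul, mul_inv_cancel, Units.val_one,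
      Matrix.det_one]
    simp [valZ]
  have hdet : valZ (k : Matrix (Fin 2) (Fin 2) F).det = 1 := by
    refine le_antisymm (hd k hk) ?_
    rw [← hprod]
    exact mul_le_of_le_one_right' (hd _ hk')
  have hrow : max (valZ (k 1 0)) (valZ (k 1 1)) = 1 := by
    refine le_antisymm (max_le (valZ_le_one (hk 1 0).1) (valZ_le_one (hk 1 1).1)) ?_
    rw [← hdet, Matrix.det_fin_two]
    exact hle _ _ _ _ (hk 0 0).1 (hk 1 1).1 (hk 0 1).1 (hk 1 0).1
  have e : ∀ j, (b * k : GL (Fin 2) F) 1 j = b 1 1 * k 1 j := by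
    intro j
    rw [Units.val_mul, Matrix.mul_apply, Fin.sum_univ_two, hb, zero_mul, zero_add]
  have hmax : max (valZ ((b * k : GL (Fin 2) F) 1 0)) (valZ ((b * k : GL (Fin 2) F) 1 1)) =
      valZ (b 1 1) := by
    rw [e, e, valZ_mul, valZ_mul]
    have hm : Monotone fun x : ℤᵐ⁰ => valZ (b 1 1) * x := fun x y h => mul_le_mul_right h _
    refine (hm.map_max (a := valZ (k 1 0)) (b := valZ (k 1 1))).symm.trans ?_
    rw [hrow, mul_one]
  have hordk : ord (k : Matrix (Fin 2) (Fin 2) F).det = 0 := by rw [ord, hdet]; simp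
  rw [iwasawaExp, hmax, Units.val_mul, Matrix.det_mul, ord_mul (det_coe_ne_zero b)
    (det_coe_ne_zero k), hordk, hbd, ord_mul hb0.1 hb0.2, ord_div hb0.2 hb0.1]
  have : WithZero.log (valZ (b 1 1)) = - ord (b 1 1) := by rw [ord]; ring
  rw [this]; ring

/-- The flat section through `φ ∈ V̄_α`: the function `φ_s ∈ V̄_{α q^s}` which agrees with `φ` on
`GL₂(𝒪)`, that is, `φ_s(b k) = (q^s)^{ν(t₂/t₁)} φ(b k)`. -/
def flatSection (φ : GL (Fin 2) F → ℂ) (s : ℂ) (g : GL (Fin 2) F) : ℂ :=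
  (resCard F : ℂ) ^ (s * (iwasawaExp g : ℂ)) * φ g

variable [MeasurableSpace F] (μN : Measure F)

/-- The integral `I(φ, s, g) = ∫ φ_s(n ω g) dn` over the lower unipotent matrices; it converges
for `Re s > 1/2`. -/
def intertwiningIntegral (φ : GL (Fin 2) F → ℂ) (s : ℂ) (g : GL (Fin 2) F) : ℂ :=
  ∫ x : F, flatSection φ s (lowerUnipOmega x * g) ∂μN

/-- `J` is a meromorphic continuation of `s ↦ I(φ, s, g)` to `ℂ` which is analytic at `0`. -/
def IsContinuation (φ : GL (Fin 2) F → ℂ) (g : GL (Fin 2) F) (J : ℂ → ℂ) : Prop :=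
  Meromorphic J ∧ AnalyticAt ℂ J 0 ∧
    ∀ s : ℂ, 1 / 2 < s.re → J s = intertwiningIntegral μN φ s g

open Classical in
/-- The intertwining operator `Λ(φ)(g) = I(φ, 0, g)`, the value at `s = 0` of the continuation. -/
def intertwiner (φ : GL (Fin 2) F → ℂ) (g : GL (Fin 2) F) : ℂ :=
  if h : ∃ J, IsContinuation μN φ g J then h.choose 0 else 0

variable [MeasurableSpace (GL (Fin 2) F)] (μG : Measure (GL (Fin 2) F))

open Classical in
/-- The invariant hermitian pairing on functions in `V̄_α`: the integral over `GL₂(𝒪)` of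
`φ₁ · conj φ₂` if `|α|² = q`, and of `φ₁ · conj Λ(φ₂)` if `α = ±1`. -/
def pairingBar (α : ℂˣ) (φ₁ φ₂ : IndSpace F α) : ℂ :=
  if ‖(α : ℂ)‖ ^ 2 = resCard F then ∫ g in maxCompact F, φ₁.1 g * conj (φ₂.1 g) ∂μG
  else ∫ g in maxCompact F, φ₁.1 g * conj (intertwiner μN φ₂.1 g) ∂μG

/-- The invariant hermitian pairing on `V_α`, computed on representatives in `V̄_α`. -/
def pairing (α : ℂˣ) (u w : RepSpace F α) : ℂ :=
  pairingBar μN μG α (Function.surjInv (detLine F α).mkQ_surjective u)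
    (Function.surjInv (detLine F α).mkQ_surjective w)

end Pairing

/-! ### The torus -/

section Torus

variable (F K : Type*) [Field F] [ValuativeRel F] [TopologicalSpace F]
  [IsNonarchimedeanLocalField F] [CommRing K] [Algebra F K]

/-- The subgroup `Fˣ` of `Kˣ`. -/
abbrev scalarUnits : Subgroup Kˣ := (Units.map (algebraMap F K : F →* K)).range

/-- The torus `T = Kˣ / Fˣ`, with the quotient topology. -/
abbrev Torus : Type _ := Kˣ ⧸ scalarUnits F K

/-- The images `H_n` in `T` of the unit groups of the orders `𝒪_F + 𝔭ⁿ 𝒪_K`, where `𝒪_K` is the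
integral closure of `𝒪_F` in `K`. In particular `H_0` is the image of `𝒪_Kˣ`. -/
def unitFiltration (n : ℕ) : Set (Torus F K) :=
  {t | ∃ u : Kˣ, t = QuotientGroup.mk u ∧ IsIntegral 𝒪[F] (u : K) ∧
    IsIntegral 𝒪[F] ((u⁻¹ : Kˣ) : K) ∧
    ∃ a : 𝒪[F], ∃ r ∈ 𝓂[F] ^ n, ∃ y : K, IsIntegral 𝒪[F] y ∧
      (u : K) = algebraMap F K a + algebraMap F K r * y}

variable {F K}
variable (χ : Torus F K →* ℂˣ)

/-- `χ` is trivial on the image of `𝒪_Kˣ`. -/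
def IsUnramified : Prop := ∀ t ∈ unitFiltration F K 0, χ t = 1

/-- The conductor: the least `n` such that `χ` is trivial on `H_n`. -/
def conductor : ℕ := sInf {n : ℕ | ∀ t ∈ unitFiltration F K n, χ t = 1}

variable (F K)

/-- `K` is split (isomorphic to `F × F`). -/
def IsSplit : Prop := ¬ IsField K

/-- `K` is the unramified quadratic field extension of `F`. -/
def IsInert : Prop :=
  IsField K ∧ (Ideal.map (algebraMap 𝒪[F] (integralClosure 𝒪[F] K)) 𝓂[F]).IsPrime

/-- If `K` is split or ramified, an element of `𝒪_K` whose norm is a uniformizer of `F`: it is a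
uniformizer `ϖ_K` in the ramified case, and it is `(ϖ, 1)` or `(1, ϖ)` up to units of `𝒪_K` in
the split case `𝒪_K = 𝒪_F × 𝒪_F`. -/
def primeElement : Kˣ :=
  Classical.epsilon fun z : Kˣ => IsIntegral 𝒪[F] (z : K) ∧ ord (Algebra.norm F (z : K)) = 1

open Classical in
/-- The local `L`-factor `L(s, η)` of the quadratic character `η` attached to `K/F`. -/
def lEta (s : ℂ) : ℂ :=
  if IsSplit K then (1 - (resCard F : ℂ) ^ (-s))⁻¹
  else if IsInert F K then (1 + (resCard F : ℂ) ^ (-s))⁻¹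
  else 1

variable {F K}

open Classical in
/-- The polynomial in `q^{-s}` whose inverse is the local `L`-factor over `K` of the unramified
character with parameter `a q^{-1/2}` of `Fˣ`, composed with the norm of `K/F` and twisted by `χ`. -/
def eulerPoly (a : ℂˣ) (s : ℂ) : ℂ :=
  if ¬ IsUnramified χ then 1
  else if IsSplit K then
    (1 - a * χ (QuotientGroup.mk (primeElement F K)) * (resCard F : ℂ) ^ (-s - 1 / 2)) *
      (1 - a * ((χ (QuotientGroup.mk (primeElement F K)))⁻¹ : ℂˣ) *
        (resCard F : ℂ) ^ (-s - 1 / 2))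
  else if IsInert F K then 1 - (a : ℂ) ^ 2 * (resCard F : ℂ) ^ (-2 * s - 1)
  else 1 - a * χ (QuotientGroup.mk (primeElement F K)) * (resCard F : ℂ) ^ (-s - 1 / 2)

variable (F) in
lemma resCard_ne_zero : (resCard F : ℂ) ≠ 0 := by
  simpa [resCard] using Nat.card_pos.ne'

open Classical in
/-- The local factor `L(s, π_α, χ)` of the base change of `π_α` to `K`, twisted by `χ`. The Satake
parameters of `π_α` are `α q^{-1/2}` and `(q/α) q^{-1/2}` if `π_α` is an irreducible principal
series; only the first one contributes if `α = ±1`, when `π_α` is a twist of Steinberg. -/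
def lBaseChange (α : ℂˣ) (s : ℂ) : ℂ :=
  if α = 1 ∨ α = -1 then (eulerPoly χ α s)⁻¹
  else (eulerPoly χ α s * eulerPoly χ (Units.mk0 _ (resCard_ne_zero F) / α) s)⁻¹

variable (F) in
open Classical in
/-- The adjoint local factor `L(s, π_α, ad)`. -/
def lAdjoint (α : ℂˣ) (s : ℂ) : ℂ :=
  if α = 1 ∨ α = -1 then (1 - (resCard F : ℂ) ^ (-s - 1))⁻¹
  else ((1 - (α : ℂ) ^ 2 * (resCard F : ℂ) ^ (-s - 1)) * (1 - (resCard F : ℂ) ^ (-s)) *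
    (1 - (α : ℂ)⁻¹ ^ 2 * (resCard F : ℂ) ^ (1 - s)))⁻¹

end Torus

/-! ### The morphism `δ_T` and the local toric pairing -/

section Delta

variable {F K : Type*} [Field F] [ValuativeRel F] [TopologicalSpace F]
  [IsNonarchimedeanLocalField F] [CommRing K] [Algebra F K]
  (ι : K →ₐ[F] Matrix (Fin 2) (Fin 2) F)

/-- The embedding `Kˣ → GL₂(F)` given by `ι`. -/
def unitsEmb : Kˣ →* GL (Fin 2) F := Units.map (ι : K →* Matrix (Fin 2) (Fin 2) F)

lemma scalarUnits_le_ker (α : ℂˣ) :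
    scalarUnits F K ≤ ((rep F α).comp (unitsEmb ι)).ker := by
  rintro _ ⟨c, rfl⟩
  rw [MonoidHom.mem_ker]
  set z : GL (Fin 2) F := unitsEmb ι (Units.map (algebraMap F K : F →* K) c) with hz
  have hzv : (z : Matrix (Fin 2) (Fin 2) F) = algebraMap F _ (c : F) := by
    rw [hz]
    exact ι.commutes _
  change rep F α z = 1
  apply LinearMap.ext
  intro u
  obtain ⟨φ, rfl⟩ := (detLine F α).mkQ_surjective u
  change (detLine F α).mkQ (rightTranslate α z φ) = (detLine F α).mkQ φ
  congr 1
  ext x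
  change φ.1 (x * z) = φ.1 x
  have hcomm : x * z = z * x := by
    ext1
    rw [Units.val_mul, Units.val_mul, hzv]
    exact (Algebra.commutes _ _).symm
  have h10 : z 1 0 = 0 := by rw [hzv]; simp [Matrix.algebraMap_matrix_apply]
  have h11 : borelChar α z = 1 := by
    rw [borelChar, hzv]
    simp [Matrix.algebraMap_matrix_apply, ord, valZ]
  rw [hcomm, φ.2.2 z x h10, h11, one_mul]

/-- The representation of `T` on `V_α` obtained by restricting `π_α` to `Kˣ`; the centre acts
trivially. -/
def torusRep (α : ℂˣ) : Torus F K →* Module.End ℂ (RepSpace F α) :=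
  QuotientGroup.lift (scalarUnits F K) ((rep F α).comp (unitsEmb ι)) (scalarUnits_le_ker ι α)

lemma unitsEmb_val (t : Kˣ) : ((unitsEmb ι t : GL (Fin 2) F) : Matrix (Fin 2) (Fin 2) F) = ι t := rfl

/-- The image of `Kˣ` is not contained in the group of upper triangular matrices. -/
def NotInBorel : Prop := ∃ t : Kˣ, ι (t : K) 1 0 ≠ 0

variable [Algebra.IsQuadraticExtension F K]

/-- The bottom row of `ι x`. -/
def bottomRow : K →ₗ[F] (Fin 2 → F) where
  toFun x := ι x 1
  map_add' x y := by rw [map_add]; rfl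
  map_smul' a x := by rw [map_smul]; rfl

variable {ι} (hι : NotInBorel ι)

lemma mem_scalars_of_lower_eq_zero (hι : NotInBorel ι) {x : K} (hx : ι x 1 0 = 0) : ∃ a : F, algebraMap F K a = x := by
  have hfin : Module.finrank F K = 2 := Algebra.IsQuadraticExtension.finrank_eq_two F K
  have : Module.Finite F K := Module.finite_of_finrank_pos (by omega)
  have : Nontrivial K := Module.nontrivial_of_finrank_pos (R := F) (by omega)
  let c : K →ₗ[F] F := (LinearMap.proj 0 : (Fin 2 → F) →ₗ[F] F).comp (bottomRow ι)
  have hc : ∀ y, c y = ι y 1 0 := fun y => rfl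
  obtain ⟨t, ht⟩ := hι
  have hrange : LinearMap.range c = ⊤ := by
    refine LinearMap.range_eq_top.2 (LinearMap.surjective ?_)
    intro h
    exact ht (by rw [← hc, h]; rfl)
  have hker : Module.finrank F (LinearMap.ker c) = 1 := by
    have := c.finrank_range_add_finrank_ker
    rw [hrange, finrank_top, Module.finrank_self, hfin] at this
    omega
  have hle : Submodule.span F {(1 : K)} ≤ LinearMap.ker c := by
    rw [Submodule.span_singleton_le_iff_mem, LinearMap.mem_ker, hc, map_one]
    simp
  have heq := Submodule.eq_of_le_of_finrank_eq hle
    (by rw [hker, finrank_span_singleton one_ne_zero])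
  have : x ∈ Submodule.span F {(1 : K)} := by
    rw [heq, LinearMap.mem_ker, hc, hx]
  obtain ⟨a, ha⟩ := Submodule.mem_span_singleton.1 this
  exact ⟨a, by rw [Algebra.algebraMap_eq_smul_one, ha]⟩

lemma bottomRow_injective (hι : NotInBorel ι) : Function.Injective (bottomRow ι) := by
  rw [injective_iff_map_eq_zero]
  intro x hx
  have h0 : ι x 1 0 = 0 := congrFun hx 0
  have h1 : ι x 1 1 = 0 := congrFun hx 1
  obtain ⟨a, rfl⟩ := mem_scalars_of_lower_eq_zero hι h0
  rw [ι.commutes] at h1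
  have : a = 0 := by simpa [Matrix.algebraMap_matrix_apply] using h1
  rw [this, map_zero]

lemma emb_injective (hι : NotInBorel ι) : Function.Injective ι := by
  intro x y h
  exact bottomRow_injective hι (congrFun h 1)

lemma finite_of_quadratic {F K : Type*} [Field F] [CommRing K] [Algebra F K]
    [Algebra.IsQuadraticExtension F K] : Module.Finite F K :=
  Module.finite_of_finrank_pos (by rw [Algebra.IsQuadraticExtension.finrank_eq_two F K]; omega)

open Classical in
/-- The function `δ̄_T(f)` on `GL₂(F)`: its value at `g = b t` is `μ_α(b) f(t⁻¹)` for `b` upper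
triangular and `t ∈ Kˣ`, see `deltaFun_mul`, and it is `0` at the other elements. -/
def deltaFun (ι : K →ₐ[F] Matrix (Fin 2) (Fin 2) F) (α : ℂˣ) (f : Torus F K → ℂ)
    (g : GL (Fin 2) F) : ℂ :=
  if h : ∃ b : GL (Fin 2) F, ∃ t : Kˣ, b 1 0 = 0 ∧ g = b * unitsEmb ι t then
    borelChar α h.choose * f (QuotientGroup.mk h.choose_spec.choose)⁻¹
  else 0

lemma deltaFun_mul (hι : NotInBorel ι) (α : ℂˣ) (f : Torus F K → ℂ) (b : GL (Fin 2) F) (t : Kˣ) (hb : b 1 0 = 0) :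
    deltaFun ι α f (b * unitsEmb ι t) = borelChar α b * f (QuotientGroup.mk t)⁻¹ := by
  have h : ∃ b' : GL (Fin 2) F, ∃ t' : Kˣ, b' 1 0 = 0 ∧ b * unitsEmb ι t = b' * unitsEmb ι t' :=
    ⟨b, t, hb, rfl⟩
  rw [deltaFun, dif_pos h]
  obtain ⟨hb', he⟩ := h.choose_spec.choose_spec
  set b' := h.choose
  set t' := h.choose_spec.choose
  set z : Kˣ := t' * t⁻¹ with hz
  have hbz : b = b' * unitsEmb ι z := by
    rw [hz, map_mul, ← mul_assoc, ← he, mul_assoc, ← map_mul]; simp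
  have hrow : b 1 0 = b' 1 1 * ι (z : K) 1 0 := by
    conv_lhs => rw [hbz]
    rw [Units.val_mul, Matrix.mul_apply, Fin.sum_univ_two, hb', zero_mul, zero_add]
    rfl
  have hb11 : b' 1 1 ≠ 0 := by
    intro h0
    apply det_coe_ne_zero b'
    rw [Matrix.det_fin_two, hb', h0]; ring
  have hz0 : ι (z : K) 1 0 = 0 := by
    rw [hb] at hrow
    exact (mul_eq_zero.1 hrow.symm).resolve_left hb11
  obtain ⟨a, ha⟩ := mem_scalars_of_lower_eq_zero hι hz0
  have ha0 : a ≠ 0 := by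
    rintro rfl
    have := det_coe_ne_zero (unitsEmb ι z)
    apply this
    change (ι (z : K)).det = 0
    rw [← ha, map_zero, map_zero, Matrix.det_zero]
  have hmem : z ∈ scalarUnits F K := ⟨Units.mk0 a ha0, Units.ext ha⟩
  have ht : (QuotientGroup.mk t' : Torus F K) = QuotientGroup.mk t := by
    have : t' = t * z := by rw [hz]; simp [mul_comm]
    rw [this, QuotientGroup.mk_mul_of_mem _ hmem]
  have hval : (b : Matrix (Fin 2) (Fin 2) F) = a • (b' : Matrix (Fin 2) (Fin 2) F) := by
    rw [hbz, Units.val_mul]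
    change (b' : Matrix (Fin 2) (Fin 2) F) * ι (z : K) = _
    rw [← ha, ι.commutes, Algebra.algebraMap_eq_smul_one, mul_smul_comm, mul_one]
  have hchar : borelChar α b = borelChar α b' := by
    rw [borelChar, borelChar, hval]
    simp only [Matrix.smul_apply, smul_eq_mul]
    rw [mul_div_mul_left _ _ ha0]
  rw [ht, hchar]

/-- The element `x` of `K` such that `ι x` and `g` have the same bottom row. -/
def rowLift (g : GL (Fin 2) F) : K :=
  haveI := finite_of_quadratic (F := F) (K := K)
  ((bottomRow ι).linearEquivOfInjective (bottomRow_injective hι)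
    (by rw [Algebra.IsQuadraticExtension.finrank_eq_two F K]; simp)).symm (g.1 1)

lemma emb_rowLift (g : GL (Fin 2) F) : ι (rowLift hι g) 1 = g.1 1 := by
  have := finite_of_quadratic (F := F) (K := K)
  have := ((bottomRow ι).linearEquivOfInjective (bottomRow_injective hι)
    (by rw [Algebra.IsQuadraticExtension.finrank_eq_two F K]; simp)).apply_symm_apply (g.1 1)
  exact this

/-- The inverse of `rowLift` when it is a unit of `K`. -/
def rowLiftInv (g : GL (Fin 2) F) : K :=
  (ι (rowLift hι g)).det⁻¹ •
    (algebraMap F K (ι (rowLift hι g)).trace - rowLift hι g)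

lemma rowLift_mul_inv (g : GL (Fin 2) F) (hg : (ι (rowLift hι g)).det ≠ 0) :
    rowLift hι g * rowLiftInv hι g = 1 := by
  apply emb_injective hι
  rw [rowLiftInv, map_mul, map_smul, map_sub, ι.commutes, map_one]
  set A := ι (rowLift hι g)
  have : algebraMap F (Matrix (Fin 2) (Fin 2) F) A.trace - A = A.adjugate := by
    ext i j
    fin_cases i <;> fin_cases j <;>
      simp [Matrix.adjugate_fin_two, Matrix.algebraMap_matrix_apply, Matrix.trace_fin_two]
  rw [this, mul_smul_comm, Matrix.mul_adjugate, smul_smul, inv_mul_cancel₀ hg, one_smul]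

/-- `rowLift` as a unit of `K`. -/
def rowUnit (g : {g : GL (Fin 2) F // (ι (rowLift hι g)).det ≠ 0}) : Kˣ :=
  ⟨rowLift hι g, rowLiftInv hι g, rowLift_mul_inv hι g g.2,
    by rw [mul_comm]; exact rowLift_mul_inv hι g g.2⟩

lemma lower_eq_zero (g : {g : GL (Fin 2) F // (ι (rowLift hι g)).det ≠ 0}) (j : Fin 2) :
    (g.1 * (unitsEmb ι (rowUnit hι g))⁻¹ : GL (Fin 2) F) 1 j = (1 : Matrix (Fin 2) (Fin 2) F) 1 j := by
  have h1 : (unitsEmb ι (rowUnit hι g) : Matrix (Fin 2) (Fin 2) F) *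
      ((unitsEmb ι (rowUnit hι g))⁻¹ : GL (Fin 2) F) = 1 := Units.mul_inv _
  rw [← h1, Units.val_mul, Matrix.mul_apply, Matrix.mul_apply]
  refine Finset.sum_congr rfl fun k _ => ?_
  congr 1
  exact (congrFun (emb_rowLift hι g.1) k).symm

lemma deltaFun_of_ne (α : ℂˣ) (f : Torus F K → ℂ)
    (g : {g : GL (Fin 2) F // (ι (rowLift hι g)).det ≠ 0}) :
    deltaFun ι α f g.1 =
      ((α ^ (ord (ι (rowLift hι g.1)).det - ord (g.1 : Matrix (Fin 2) (Fin 2) F).det) : ℂˣ) : ℂ) *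
        f (QuotientGroup.mk (rowUnit hι g))⁻¹ := by
  set b : GL (Fin 2) F := g.1 * (unitsEmb ι (rowUnit hι g))⁻¹ with hbdef
  have hb : b 1 0 = 0 := by rw [lower_eq_zero hι g 0]; simp
  have hb1 : b 1 1 = 1 := by rw [lower_eq_zero hι g 1]; simp
  have hg : g.1 = b * unitsEmb ι (rowUnit hι g) := by simp [hbdef]
  have hdet : (g.1 : Matrix (Fin 2) (Fin 2) F).det = b 0 0 * (ι (rowLift hι g.1)).det := by
    conv_lhs => rw [hg]
    rw [Units.val_mul, Matrix.det_mul, Matrix.det_fin_two (b : Matrix (Fin 2) (Fin 2) F), hb, hb1]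
    rw [mul_zero, sub_zero, mul_one]
    rfl
  have hb0 : b 0 0 ≠ 0 := by
    intro h0
    apply det_coe_ne_zero g.1
    rw [hdet, h0, zero_mul]
  conv_lhs => rw [hg]
  rw [deltaFun_mul hι α f b _ hb, borelChar, hb1, hdet, ord_mul hb0 g.2, ord_div one_ne_zero hb0]
  congr 3
  have : ord (1 : F) = 0 := by simp [ord, valZ]
  rw [this]; ring

lemma deltaFun_of_eq (α : ℂˣ) (f : Torus F K → ℂ) (g : GL (Fin 2) F)
    (hg : (ι (rowLift hι g)).det = 0) : deltaFun ι α f g = 0 := by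
  rw [deltaFun, dif_neg]
  rintro ⟨b, t, hb, rfl⟩
  have hx : rowLift hι (b * unitsEmb ι t) = b 1 1 • (t : K) := by
    apply bottomRow_injective hι
    funext j
    change ι (rowLift hι (b * unitsEmb ι t)) 1 j = ι (b 1 1 • (t : K)) 1 j
    rw [emb_rowLift hι, map_smul, Units.val_mul, Matrix.mul_apply, Fin.sum_univ_two, hb, zero_mul,
      zero_add]
    rfl
  rw [hx, map_smul, Matrix.det_smul] at hg
  have h1 := det_coe_ne_zero (unitsEmb ι t)
  rw [unitsEmb_val] at h1
  have h2 : b 1 1 ≠ 0 := by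
    intro h0
    apply det_coe_ne_zero b
    rw [Matrix.det_fin_two, hb, h0]; ring
  exact mul_ne_zero (pow_ne_zero _ h2) h1 hg

/-! Local constancy of `δ̄_T(f)`. -/

lemma eventually_valZ_lt (x : F) {γ : ℤᵐ⁰} (hγ : γ ≠ 0) : ∀ᶠ y in 𝓝 x, valZ (y - x) < γ := by
  set e := IsNonarchimedeanLocalField.valueGroupWithZeroIsoInt F
  have h0 : e.symm γ ≠ 0 := by simpa using hγ
  refine IsValuativeTopology.mem_nhds_iff.2 ⟨Units.mk0 _ h0, ?_⟩
  rintro _ ⟨z, hz, rfl⟩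
  have hz' : valuation F z < e.symm γ := hz
  have := e.strictMono hz'
  have h2 : e (e.symm γ) = γ := e.toEquiv.apply_symm_apply γ
  rw [h2] at this
  simpa [valZ, e] using this

lemma eventually_valZ_eq {x : F} (hx : x ≠ 0) : ∀ᶠ y in 𝓝 x, valZ y = valZ x := by
  filter_upwards [eventually_valZ_lt x (valZ_ne_zero hx)] with y hy
  have : valuation F (y - x) < valuation F x :=
    (IsNonarchimedeanLocalField.valueGroupWithZeroIsoInt F).strictMono.lt_iff_lt.1 hy
  rw [valZ, Valuation.map_eq_of_sub_lt _ this, valZ]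

lemma continuous_ord {X : Type*} [TopologicalSpace X] {h : X → F} (hc : Continuous h)
    (h0 : ∀ x, h x ≠ 0) : Continuous fun x => ord (h x) := by
  refine ((IsLocallyConstant.iff_eventually_eq _).2 fun x => ?_).continuous
  filter_upwards [hc.continuousAt.eventually (eventually_valZ_eq (h0 x))] with y hy
  rw [ord, ord, hy]

lemma eventually_max_eq {x y : F} (h : x ≠ 0 ∨ y ≠ 0) :
    ∀ᶠ p : F × F in 𝓝 (x, y), max (valZ p.1) (valZ p.2) = max (valZ x) (valZ y) := by
  set m := max (valZ x) (valZ y) with hm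
  have hm0 : m ≠ 0 := by
    intro h0
    have h1 : valZ x ≤ 0 := h0 ▸ le_max_left _ _
    have h2 : valZ y ≤ 0 := h0 ▸ le_max_right _ _
    rcases h with h | h
    · exact valZ_ne_zero h (le_antisymm h1 bot_le)
    · exact valZ_ne_zero h (le_antisymm h2 bot_le)
  have key : ∀ a b : F, valZ a ≤ m → valZ (b - a) < m →
      valZ b ≤ m ∧ (valZ a = m → valZ b = m) := by
    intro a b ha hab
    refine ⟨?_, fun h => ?_⟩
    · have := valZ_add (b - a) a
      rw [sub_add_cancel] at this
      exact this.trans (max_le hab.le ha)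
    · rw [← h] at hab
      have h2 : valuation F (b - a) < valuation F a :=
        (IsNonarchimedeanLocalField.valueGroupWithZeroIsoInt F).strictMono.lt_iff_lt.1 hab
      rw [← h, valZ, Valuation.map_eq_of_sub_lt _ h2, valZ]
  have ex : ∀ᶠ p : F × F in 𝓝 (x, y), valZ (p.1 - x) < m :=
    (continuous_fst.tendsto (x, y)).eventually (eventually_valZ_lt x hm0)
  have ey : ∀ᶠ p : F × F in 𝓝 (x, y), valZ (p.2 - y) < m :=
    (continuous_snd.tendsto (x, y)).eventually (eventually_valZ_lt y hm0)
  filter_upwards [ex, ey]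
  rintro ⟨z, w⟩ hz hw
  obtain ⟨hz1, hz2⟩ := key x z (le_max_left _ _) hz
  obtain ⟨hw1, hw2⟩ := key y w (le_max_right _ _) hw
  refine le_antisymm (max_le hz1 hw1) ?_
  rcases max_choice (valZ x) (valZ y) with h | h
  · exact (hz2 (h.symm.trans hm.symm)).ge.trans (le_max_left _ _)
  · exact (hw2 (h.symm.trans hm.symm)).ge.trans (le_max_right _ _)

lemma continuous_entry {F : Type*} [Field F] [TopologicalSpace F] (i j : Fin 2) :
    Continuous fun g : GL (Fin 2) F => g i j :=
  Continuous.matrix_elem Units.continuous_val i j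

lemma continuous_det {F : Type*} [Field F] [TopologicalSpace F] [IsTopologicalRing F] :
    Continuous fun g : GL (Fin 2) F => (g : Matrix (Fin 2) (Fin 2) F).det :=
  Continuous.matrix_det Units.continuous_val

lemma row_ne_zero {F : Type*} [Field F] (g : GL (Fin 2) F) : g 1 0 ≠ 0 ∨ g 1 1 ≠ 0 := by
  by_contra! h
  apply det_coe_ne_zero g
  rw [Matrix.det_fin_two, h.1, h.2]; ring

lemma eventually_rowMax_eq (g : GL (Fin 2) F) :
    ∀ᶠ h in 𝓝 g, max (valZ (h 1 0)) (valZ (h 1 1)) = max (valZ (g 1 0)) (valZ (g 1 1)) := by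
  have h2 : Continuous fun h : GL (Fin 2) F => (h 1 0, h 1 1) :=
    (continuous_entry 1 0).prodMk (continuous_entry 1 1)
  exact (h2.tendsto g).eventually (eventually_max_eq (row_ne_zero g))

lemma continuous_iwasawaExp : Continuous (iwasawaExp (F := F)) := by
  refine ((IsLocallyConstant.iff_eventually_eq _).2 fun g => ?_).continuous
  have h1 : IsLocallyConstant fun g : GL (Fin 2) F => ord (g : Matrix (Fin 2) (Fin 2) F).det :=
    (IsLocallyConstant.iff_continuous _).2 (continuous_ord continuous_det det_coe_ne_zero)
  filter_upwards [eventually_rowMax_eq g, h1.eventually_eq g] with h hh hd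
  rw [iwasawaExp, iwasawaExp, hh, hd]

variable [TopologicalSpace K] [IsModuleTopology F K]

lemma continuous_emb {F K : Type*} [Field F] [TopologicalSpace F] [IsTopologicalRing F]
    [CommRing K] [Algebra F K] [TopologicalSpace K] [IsModuleTopology F K]
    (ι : K →ₐ[F] Matrix (Fin 2) (Fin 2) F) : Continuous ι :=
  IsModuleTopology.continuous_of_linearMap ι.toLinearMap

lemma continuous_unitsEmb (ι : K →ₐ[F] Matrix (Fin 2) (Fin 2) F) : Continuous (unitsEmb ι) :=
  Continuous.units_map _ (continuous_emb ι)

lemma continuous_rowLift : Continuous (rowLift hι) := by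
  have := IsModuleTopology.toContinuousAdd F K
  refine (IsModuleTopology.continuous_of_linearMap (R := F) (LinearEquiv.toLinearMap _)).comp ?_
  exact continuous_pi fun j => continuous_entry 1 j

lemma continuous_rowUnit : Continuous (rowUnit hι) := by
  have := finite_of_quadratic (F := F) (K := K)
  have := IsModuleTopology.isTopologicalRing F K
  have h1 : Continuous fun g : {g : GL (Fin 2) F // (ι (rowLift hι g)).det ≠ 0} =>
      rowLift hι g.1 := (continuous_rowLift hι).comp continuous_subtype_val
  have h2 := (continuous_emb ι).comp h1
  rw [Units.continuous_iff]
  refine ⟨h1, ?_⟩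
  change Continuous fun g : {g : GL (Fin 2) F // (ι (rowLift hι g)).det ≠ 0} =>
    (ι (rowLift hι g.1)).det⁻¹ • (algebraMap F K (ι (rowLift hι g.1)).trace - rowLift hι g.1)
  refine Continuous.smul ?_ (Continuous.sub ?_ h1)
  · exact (Continuous.matrix_det h2).inv₀ fun g => g.2
  · exact (IsModuleTopology.continuous_of_linearMap (Algebra.linearMap F K)).comp
      (Continuous.matrix_trace h2)

/-- The integer `ν(t₂/t₁)` of `ι u⁻¹ = (t₁, x; 0, t₂) k`, as a function on the torus. -/
def torusExp (ι : K →ₐ[F] Matrix (Fin 2) (Fin 2) F) : Torus F K → ℤ :=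
  Quotient.lift (fun u : Kˣ => iwasawaExp (unitsEmb ι u⁻¹)) (by
    intro u v huv
    obtain ⟨c, hc⟩ := QuotientGroup.leftRel_apply.1 huv
    have hu : u⁻¹ = Units.map (algebraMap F K : F →* K) c * v⁻¹ := by rw [hc]; simp
    have hval : ((unitsEmb ι u⁻¹ : GL (Fin 2) F) : Matrix (Fin 2) (Fin 2) F) =
        (c : F) • ((unitsEmb ι v⁻¹ : GL (Fin 2) F) : Matrix (Fin 2) (Fin 2) F) := by
      rw [hu, map_mul, Units.val_mul, unitsEmb_val, Units.coe_map]
      change ι (algebraMap F K c) * _ = _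
      rw [ι.commutes, Algebra.algebraMap_eq_smul_one, smul_mul_assoc, one_mul]
    have hc0 : valZ (c : F) ≠ 0 := valZ_ne_zero c.ne_zero
    set w := (unitsEmb ι v⁻¹ : GL (Fin 2) F)
    have hmax : max (valZ ((c : F) * w 1 0)) (valZ ((c : F) * w 1 1)) =
        valZ (c : F) * max (valZ (w 1 0)) (valZ (w 1 1)) := by
      rw [valZ_mul, valZ_mul]
      have hm : Monotone fun x : ℤᵐ⁰ => valZ (c : F) * x := fun x y h => mul_le_mul_right h _
      exact (hm.map_max (a := valZ (w 1 0)) (b := valZ (w 1 1))).symm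
    have hw0 : max (valZ (w 1 0)) (valZ (w 1 1)) ≠ 0 := by
      intro h0
      rcases row_ne_zero w with h | h
      · exact valZ_ne_zero h (le_antisymm (h0 ▸ le_max_left _ _) bot_le)
      · exact valZ_ne_zero h (le_antisymm (h0 ▸ le_max_right _ _) bot_le)
    change iwasawaExp (unitsEmb ι u⁻¹) = iwasawaExp w
    rw [iwasawaExp, hval, Matrix.det_smul]
    simp only [Matrix.smul_apply, smul_eq_mul, Fintype.card_fin]
    rw [hmax, WithZero.log_mul hc0 hw0, ord_mul (pow_ne_zero 2 c.ne_zero) (det_coe_ne_zero w), pow_two,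
      ord_mul c.ne_zero c.ne_zero, iwasawaExp]
    have : WithZero.log (valZ (c : F)) = -ord (c : F) := by rw [ord]; ring
    rw [this]; ring)

lemma continuous_torusExp (ι : K →ₐ[F] Matrix (Fin 2) (Fin 2) F) : Continuous (torusExp ι) := by
  have := finite_of_quadratic (F := F) (K := K)
  have := IsModuleTopology.isTopologicalRing F K
  exact Continuous.quotient_lift
    (continuous_iwasawaExp.comp ((continuous_unitsEmb ι).comp continuous_inv)) _

lemma deltaFun_isLocallyConstant (hι : NotInBorel ι) (α : ℂˣ) {f : Torus F K → ℂ} (hf : IsLocallyConstant f)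
    (hc : HasCompactSupport f) : IsLocallyConstant (deltaFun ι α f) := by
  have := finite_of_quadratic (F := F) (K := K)
  have := IsModuleTopology.isTopologicalRing F K
  have hdet : Continuous fun g : GL (Fin 2) F => (ι (rowLift hι g)).det :=
    Continuous.matrix_det ((continuous_emb ι).comp (continuous_rowLift hι))
  rw [IsLocallyConstant.iff_eventually_eq]
  intro g
  by_cases hg : (ι (rowLift hι g)).det = 0
  · rw [deltaFun_of_eq hι α f g hg]
    obtain ⟨M, hM⟩ := hc.isCompact.bddBelow_image (continuous_torusExp ι).continuousOn
    set m := max (valZ (g 1 0)) (valZ (g 1 1))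
    have hsmall : ∀ᶠ h in 𝓝 g,
        valZ (ι (rowLift hι h)).det < WithZero.exp (M + 2 * WithZero.log m) := by
      have := eventually_valZ_lt (ι (rowLift hι g)).det
        (γ := WithZero.exp (M + 2 * WithZero.log m)) WithZero.exp_ne_zero
      rw [hg] at this
      have := (hg ▸ hdet.tendsto g).eventually this
      simpa using this
    filter_upwards [hsmall, eventually_rowMax_eq g] with h hh hmax
    by_cases hh0 : (ι (rowLift hι h)).det = 0
    · exact deltaFun_of_eq hι α f h hh0
    · rw [deltaFun_of_ne hι α f ⟨h, hh0⟩]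
      set u := rowUnit hι ⟨h, hh0⟩
      suffices f (QuotientGroup.mk u)⁻¹ = 0 by rw [this, mul_zero]
      by_contra hne
      have h1 : (QuotientGroup.mk u : Torus F K)⁻¹ ∈ tsupport f := subset_tsupport f hne
      have h2 : M ≤ torusExp ι (QuotientGroup.mk u : Torus F K)⁻¹ := hM ⟨_, h1, rfl⟩
      have h3 : torusExp ι (QuotientGroup.mk u : Torus F K)⁻¹ = iwasawaExp (unitsEmb ι u) := by
        change iwasawaExp (unitsEmb ι u⁻¹⁻¹) = _
        rw [inv_inv]
      have h4 : iwasawaExp (unitsEmb ι u) =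
          -2 * WithZero.log m + WithZero.log (valZ (ι (rowLift hι h)).det) := by
        have hr : ∀ j, (unitsEmb ι u : GL (Fin 2) F) 1 j = h 1 j := fun j =>
          congrFun (emb_rowLift hι h) j
        have hd : ((unitsEmb ι u : GL (Fin 2) F) : Matrix (Fin 2) (Fin 2) F).det =
          (ι (rowLift hι h)).det := rfl
        rw [iwasawaExp, hr, hr, hmax, hd, ord]; ring
      have h5 : WithZero.log (valZ (ι (rowLift hι h)).det) < M + 2 * WithZero.log m :=
        (WithZero.log_lt_iff_lt_exp (valZ_ne_zero hh0)).2 hh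
      rw [h3, h4] at h2
      omega
  · have hopen : IsOpen {g : GL (Fin 2) F | (ι (rowLift hι g)).det ≠ 0} := by
      rw [isOpen_iff_mem_nhds]
      intro h hh
      filter_upwards [(hdet.tendsto h).eventually (eventually_valZ_eq hh)] with y hy h0
      rw [h0] at hy
      exact valZ_ne_zero hh (hy.symm.trans (by simp [valZ]))
    have hsub : IsLocallyConstant
        fun h : {g : GL (Fin 2) F // (ι (rowLift hι g)).det ≠ 0} => deltaFun ι α f h.1 := by
      have h1 : IsLocallyConstant
          fun h : {g : GL (Fin 2) F // (ι (rowLift hι g)).det ≠ 0} =>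
            ord (ι (rowLift hι h.1)).det - ord (h.1 : Matrix (Fin 2) (Fin 2) F).det :=
        (IsLocallyConstant.iff_continuous _).2
          ((continuous_ord (hdet.comp continuous_subtype_val) fun h => h.2).sub
            (continuous_ord (continuous_det.comp continuous_subtype_val)
              fun h => det_coe_ne_zero h.1))
      have h2 : IsLocallyConstant
          fun h : {g : GL (Fin 2) F // (ι (rowLift hι g)).det ≠ 0} =>
            f (QuotientGroup.mk (rowUnit hι h))⁻¹ := by
        have hcont : Continuous fun h : {g : GL (Fin 2) F // (ι (rowLift hι g)).det ≠ 0} =>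
            (QuotientGroup.mk ((rowUnit hι h)⁻¹) : Torus F K) :=
          continuous_quot_mk.comp (continuous_rowUnit hι).inv
        exact hf.comp_continuous hcont
      have h3 := (h1.comp fun n => ((α ^ n : ℂˣ) : ℂ)).mul h2
      convert h3 using 1
      funext h
      exact deltaFun_of_ne hι α f h
    have h1 := hsub.eventually_eq ⟨g, hg⟩
    have h2 := (hopen.isOpenEmbedding_subtypeVal.map_nhds_eq ⟨g, hg⟩)
    rw [← h2]
    exact h1

variable (F K) in
/-- The space `C_∘(T, ℂ)` of locally constant functions with compact support on `T` (continuous and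
compactly supported functions to the discrete space `ℂ`). -/
def TestSpace : Submodule ℂ (Torus F K → ℂ) where
  carrier := {f | IsLocallyConstant f ∧ HasCompactSupport f}
  add_mem' h1 h2 := ⟨h1.1.add h2.1, h1.2.add h2.2⟩
  zero_mem' := ⟨IsLocallyConstant.const 0, HasCompactSupport.zero⟩
  smul_mem' c _ h := ⟨h.1.comp fun z => c * z, h.2.smul_left⟩

lemma diag_ne_zero {F : Type*} [Field F] {b : GL (Fin 2) F} (hb : b 1 0 = 0) :
    b 0 0 ≠ 0 ∧ b 1 1 ≠ 0 := by
  have h := det_coe_ne_zero b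
  rw [Matrix.det_fin_two, hb, mul_zero, sub_zero] at h
  exact mul_ne_zero_iff.1 h

lemma mul_lower {F : Type*} [Field F] {b c : GL (Fin 2) F} (hb : b 1 0 = 0) (hc : c 1 0 = 0) :
    (b * c : GL (Fin 2) F) 1 0 = 0 ∧ (b * c : GL (Fin 2) F) 0 0 = b 0 0 * c 0 0 ∧
      (b * c : GL (Fin 2) F) 1 1 = b 1 1 * c 1 1 := by
  refine ⟨?_, ?_, ?_⟩ <;> rw [Units.val_mul, Matrix.mul_apply, Fin.sum_univ_two] <;> simp [hb, hc]

lemma inv_lower {F : Type*} [Field F] {b : GL (Fin 2) F} (hb : b 1 0 = 0) :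
    (b⁻¹ : GL (Fin 2) F) 1 0 = 0 := by
  have h : (b * b⁻¹ : GL (Fin 2) F) 1 0 = 0 := by rw [mul_inv_cancel]; simp
  rw [Units.val_mul, Matrix.mul_apply, Fin.sum_univ_two, hb, zero_mul, zero_add] at h
  exact (mul_eq_zero.1 h).resolve_left (diag_ne_zero hb).2

lemma borelChar_mul (α : ℂˣ) {b c : GL (Fin 2) F} (hb : b 1 0 = 0) (hc : c 1 0 = 0) :
    borelChar α (b * c) = borelChar α b * borelChar α c := by
  obtain ⟨-, h0, h1⟩ := mul_lower hb hc
  obtain ⟨hb0, hb1⟩ := diag_ne_zero hb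
  obtain ⟨hc0, hc1⟩ := diag_ne_zero hc
  rw [borelChar, h0, h1, mul_div_mul_comm, ord_mul (div_ne_zero hb1 hb0) (div_ne_zero hc1 hc0),
    zpow_add, Units.val_mul, borelChar, borelChar]

lemma deltaFun_mem (hι : NotInBorel ι) (α : ℂˣ) (f : TestSpace F K) :
    deltaFun ι α f.1 ∈ IndSpace F α := by
  refine ⟨deltaFun_isLocallyConstant hι α f.2.1 f.2.2, ?_⟩
  intro b g hb
  by_cases h : ∃ c : GL (Fin 2) F, ∃ t : Kˣ, c 1 0 = 0 ∧ g = c * unitsEmb ι t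
  · obtain ⟨c, t, hc, rfl⟩ := h
    rw [← mul_assoc, deltaFun_mul hι α f.1 _ t (mul_lower hb hc).1, deltaFun_mul hι α f.1 c t hc,
      borelChar_mul α hb hc, mul_assoc]
  · have h' : ¬ ∃ c : GL (Fin 2) F, ∃ t : Kˣ, c 1 0 = 0 ∧ b * g = c * unitsEmb ι t := by
      rintro ⟨c, t, hc, he⟩
      exact h ⟨b⁻¹ * c, t, (mul_lower (inv_lower hb) hc).1, by rw [mul_assoc, ← he]; simp⟩
    rw [deltaFun, dif_neg h', deltaFun, dif_neg h, mul_zero]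

/-- The morphism `δ_T : C_∘(T, ℂ) → V_α`: the class of `δ̄_T(f)`. -/
def deltaT (α : ℂˣ) (f : TestSpace F K) : RepSpace F α :=
  (detLine F α).mkQ ⟨deltaFun ι α f.1, deltaFun_mem hι α f⟩

end Delta

/-! ### The local toric pairing and the constants -/

section ToricPairing

variable {F K : Type*} [Field F] [ValuativeRel F] [TopologicalSpace F]
  [IsNonarchimedeanLocalField F] [CommRing K] [Algebra F K] [TopologicalSpace K]
  [MeasurableSpace F] [MeasurableSpace (GL (Fin 2) F)] [MeasurableSpace (Torus F K)]
  (ι : K →ₐ[F] Matrix (Fin 2) (Fin 2) F)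
  (μN : Measure F) (μG : Measure (GL (Fin 2) F)) (μT : Measure (Torus F K))

/-- The integrand `⟨π_α(t) u, w⟩ χ(t)` of the toric pairing. -/
def toricIntegrand (α : ℂˣ) (χ : Torus F K →* ℂˣ) (u w : RepSpace F α) (t : Torus F K) : ℂ :=
  pairing μN μG α (torusRep ι α t u) w * χ t

/-- The toric pairing `β(u, w) = ∫_T ⟨π_α(t) u, w⟩ χ(t) dt`. -/
def betaPairing (α : ℂˣ) (χ : Torus F K →* ℂˣ) (u w : RepSpace F α) : ℂ :=
  ∫ t, toricIntegrand ι μN μG α χ u w t ∂μT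

/-- The normalized toric pairing
`L(1, η) L(1, π_α, ad) / (ζ(2) L(1/2, π_α, χ)) · β(u, w)`. -/
def alphaPairing (α : ℂˣ) (χ : Torus F K →* ℂˣ) (u w : RepSpace F α) : ℂ :=
  lEta F K 1 * lAdjoint F α 1 / (zetaLoc F 2 * lBaseChange χ α (1 / 2)) *
    betaPairing ι μN μG μT α χ u w

/-- Locally constant functions `h` on `GL₂(F)` with `h(b g) = κ(b) h(g)`. -/
def IsModular (h : GL (Fin 2) F → ℂ) : Prop :=
  IsLocallyConstant h ∧ ∀ b g : GL (Fin 2) F, b 1 0 = 0 → h (b * g) = modChar b * h g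

/-- The integral over `T` of a function `h` on `GL₂(F)` which is invariant under the centre. -/
def torusIntegral (h : GL (Fin 2) F → ℂ) : ℂ :=
  ∫ t : Torus F K, h (unitsEmb ι (Quotient.out t)) ∂μT

/-- `c` is the constant comparing integration over `GL₂(𝒪)` with integration over `T`. -/
def IsCompactComparison (c : ℝ) : Prop :=
  ∀ h : GL (Fin 2) F → ℂ, IsModular h → ∫ g in maxCompact F, h g ∂μG = c * torusIntegral ι μT h

/-- `C` is the constant comparing integration over the lower unipotent group with integration
over `T`. -/
def IsUnipotentComparison (C : ℝ) : Prop :=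
  ∀ h : GL (Fin 2) F → ℂ, IsModular h → ∫ x, h (lowerUnipOmega x) ∂μN = C * torusIntegral ι μT h

/-- `n` is the integer such that the lower left entries of the elements of `ι(𝒪_K)` form the
fractional ideal `𝔭ⁿ`. -/
def IsEmbeddingExponent (n : ℤ) : Prop :=
  ∀ y : F, (∃ x : K, IsIntegral 𝒪[F] x ∧ ι x 1 0 = y) ↔ y = 0 ∨ n ≤ ord y

variable (F K)

open Classical in
/-- The constant `K_T`, depending only on `T` (through `c`, `C`, `n` and `η`) and `π_α`. -/
def toricConstant (c C : ℝ) (n : ℤ) (α : ℂˣ) : ℂ :=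
  if ‖(α : ℂ)‖ ^ 2 = resCard F then c * (lEta F K 1 / zetaLoc F 2)
  else c * C * (lEta F K 1 ^ 2 * zetaLoc F (-1) * (resCard F : ℂ) ^ (2 * n) / zetaLoc F 2)

variable {F K}

open Classical in
/-- The local Euler factor `e(π_α, χ)`. -/
def eulerFactor (α : ℂˣ) (χ : Torus F K →* ℂˣ) : ℂ :=
  if ‖(α : ℂ)‖ ^ 2 = resCard F then lAdjoint F α 1 / lBaseChange χ α (1 / 2)
  else if IsUnramified χ then 1 / lBaseChange χ α (-1 / 2)
  else (resCard F : ℂ) ^ conductor χ / lBaseChange χ α (1 / 2)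

end ToricPairing

end LocalToric

end

open LocalToric

set_option linter.unusedSectionVars false
open Filter
open scoped NNReal ENNReal

noncomputable section

namespace LocalToric

/-! ### Absolute value and topology of the local field -/

section AbsoluteValue

variable {F : Type*} [Field F] [ValuativeRel F] [TopologicalSpace F] [IsNonarchimedeanLocalField F]

/-! Let τ generate O_K over O. The classes of z + τ, for z in F with N(z + τ) ≠ 0, fill T except for
the class of 1, and everything is computed in this chart. Multiplication by a + bτ becomes a
fractional linear substitution in z with determinant N(a + bτ). As N is multiplicative and
homogeneous of degree 2, the measure |N(z + τ)|⁻¹ dz is translation invariant (`lintegral_moebius`,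
`chartMeasure_preimage`), so the Haar measure of T is c times it (`exists_chart_const`). The volume
of the image of O_Kˣ depends only on the roots of the norm form modulo 𝔭, and normalizing it to 1
gives c · vol(O) = L(1, η) (`chart_const_mul_volO`). The big-cell coordinate of ι(z + τ) is affine
in z with slope -1/ι(τ)₁₀. Hence C_T = |ι(τ)₁₀| / c, while n_T = ν(ι(τ)₁₀). Integrals over GL₂(O)
and over the big cell are compared by Fubini (`integral_maxCompact_eq`).

On T the function δ_T(f) is f(t⁻¹). If |α|² = q, the product of φ₁ and the conjugate of φ₂ is
modular, so the pairing is c_T times an inner product on T. Then β is the Fourier coefficient of a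
convolution, that is, the product of the two integrals (`integral_convolution`).

If α = ±1, the value at s = 0 of the continued intertwining integral is the absolutely convergent
integral of φ(nωg) - φ(g): the tail of |x|^{-2s} over the complement of a ball continues to minus
the volume of the ball (`exists_isContinuation`). After the twist by ω(t) = α^{ν(N t)}, the operator
Λ restricted to T is |ι(τ)₁₀|⁻¹ times the translation-commuting operator sending A to u ↦ ∫ (A((z +
τ)u) - A(u)) dz (`regIntertwiner_unitsEmb`). It kills constants and its values have integral zero,
so representatives modulo the line of φ₀ do not matter. On the Fourier side it is a multiplier,
which brings the scalar I = ∫ ((χω)(z + τ) - 1) dz into β (`toricPairing_of_sq`).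

It remains to show that I · E_α(1/2) is -vol(O) q⁻¹(1 + q⁻¹) times E_α(-1/2) for unramified χ and
times q^{n_χ} for ramified χ (`chartIntegral_mul_eulerPoly`). For unramified χ the integrand is
explicit near the roots of the norm form modulo 𝔭 and vanishes elsewhere. For ramified χ, put M =
n_χ - 1. The character is orthogonal to an H_M-invariant function on T whose product with the chart
density is 1 for |z| ≤ q^M and q^{2M}|z|⁻² beyond, where χ = 1. This determines the integral of χ
over the ball (`chartIntegral_ramified`). Multiplying by L(1, ad) = (1 - q⁻²)⁻¹ turns the constant
into vol(O) ζ(-1). -/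

variable (F) in
lemma one_lt_resCard : 1 < resCard F := Finite.one_lt_card (α := 𝓀[F])

variable (F) in
/-- The residue cardinality as a nonnegative real number. -/
def qN : ℝ≥0 := resCard F

variable (F) in
lemma one_lt_qN : 1 < qN F := by
  have := one_lt_resCard F
  unfold qN
  exact_mod_cast this

variable (F) in
lemma qN_pos : 0 < qN F := zero_lt_one.trans (one_lt_qN F)

variable (F) in
lemma qN_ne_zero : qN F ≠ 0 := (qN_pos F).ne'

/-- The normalized absolute value. -/
def absF (x : F) : ℝ≥0 := WithZeroMulInt.toNNReal (qN_ne_zero F) (valZ x)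

lemma absF_mul (x y : F) : absF (x * y) = absF x * absF y := by simp [absF, valZ_mul]

lemma valZ_zero : valZ (0 : F) = 0 := by simp [valZ]

lemma valZ_one : valZ (1 : F) = 1 := by simp [valZ]

@[simp] lemma absF_zero : absF (0 : F) = 0 := by simp [absF, valZ_zero]

@[simp] lemma absF_one : absF (1 : F) = 1 := by simp [absF, valZ_one]

lemma absF_ne_zero {x : F} (hx : x ≠ 0) : absF x ≠ 0 :=
  WithZeroMulInt.toNNReal_ne_zero _ (valZ_ne_zero hx)

lemma absF_eq_zero {x : F} : absF x = 0 ↔ x = 0 :=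
  ⟨fun h => by_contra fun hx => absF_ne_zero hx h, fun h => h ▸ absF_zero⟩

lemma absF_pos {x : F} : 0 < absF x ↔ x ≠ 0 := by rw [pos_iff_ne_zero, ne_eq, absF_eq_zero]

/-- The absolute value as a morphism of monoids with zero. -/
def absHom : F →*₀ ℝ≥0 where
  toFun := absF
  map_zero' := absF_zero
  map_one' := absF_one
  map_mul' := absF_mul

lemma absF_inv (x : F) : absF x⁻¹ = (absF x)⁻¹ := map_inv₀ absHom x

lemma absF_div (x y : F) : absF (x / y) = absF x / absF y := map_div₀ absHom x y

lemma absF_pow (x : F) (n : ℕ) : absF (x ^ n) = absF x ^ n := map_pow absHom x n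

lemma absF_zpow (x : F) (n : ℤ) : absF (x ^ n) = absF x ^ n := map_zpow₀ absHom x n

@[simp] lemma absF_neg (x : F) : absF (-x) = absF x := by rw [absF, valZ_neg, absF]

lemma absF_sub_comm (x y : F) : absF (x - y) = absF (y - x) := by
  rw [← neg_sub, absF_neg]

lemma absF_le_iff {x y : F} : absF x ≤ absF y ↔ valZ x ≤ valZ y :=
  (WithZeroMulInt.toNNReal_strictMono (one_lt_qN F)).le_iff_le

lemma absF_add_le (x y : F) : absF (x + y) ≤ max (absF x) (absF y) := by
  have hm := (WithZeroMulInt.toNNReal_strictMono (one_lt_qN F)).monotone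
  have := hm (valZ_add x y)
  rwa [hm.map_max] at this

lemma absF_sub_le (x y : F) : absF (x - y) ≤ max (absF x) (absF y) := by
  rw [sub_eq_add_neg, ← absF_neg y]
  exact absF_add_le _ _

lemma absF_add_eq_of_lt {x y : F} (h : absF y < absF x) : absF (x + y) = absF x := by
  refine le_antisymm ((absF_add_le x y).trans (max_le le_rfl h.le)) ?_
  by_contra! h1
  have := absF_sub_le (x + y) y
  rw [add_sub_cancel_right] at this
  exact absurd this (not_le.2 (max_lt h1 h))

lemma absF_eq_zpow {x : F} (hx : x ≠ 0) : absF x = qN F ^ (-ord x) := by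
  have := valZ_ne_zero hx
  rw [absF, WithZeroMulInt.toNNReal_neg_apply _ this, ord, neg_neg]
  congr 1
  conv_rhs => rw [← WithZero.coe_unzero this]
  rfl

lemma absF_le_zpow_iff {x : F} (hx : x ≠ 0) {n : ℤ} : absF x ≤ qN F ^ n ↔ -n ≤ ord x := by
  rw [absF_eq_zpow hx, zpow_le_zpow_iff_right₀ (one_lt_qN F)]
  omega

/-- The nonzero values are integral powers of q, so a strict bound is a weak bound one power lower.
This makes balls clopen and underlies the index shifts by one below. -/
lemma absF_lt_zpow_iff {x : F} {n : ℤ} : absF x < qN F ^ (n + 1) ↔ absF x ≤ qN F ^ n := by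
  rcases eq_or_ne x 0 with rfl | hx
  · simp [zpow_pos (qN_pos F)]
  · rw [absF_eq_zpow hx, zpow_le_zpow_iff_right₀ (one_lt_qN F), zpow_lt_zpow_iff_right₀ (one_lt_qN F)]
    omega

lemma mem_integer_iff {x : F} : x ∈ 𝒪[F] ↔ absF x ≤ 1 := by
  rw [← absF_one (F := F), absF_le_iff, valZ, valZ,
    (IsNonarchimedeanLocalField.valueGroupWithZeroIsoInt F).strictMono.le_iff_le, map_one]
  rfl

variable (F) in
lemma exists_uniformizer : ∃ p : F, absF p = (qN F)⁻¹ := by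
  obtain ⟨x, hx⟩ := ValuativeRel.valuation_surjective
    ((IsNonarchimedeanLocalField.valueGroupWithZeroIsoInt F).symm (WithZero.exp (-1)))
  have h : valZ x = WithZero.exp (-1) := by
    rw [valZ, hx]
    exact (IsNonarchimedeanLocalField.valueGroupWithZeroIsoInt F).toEquiv.apply_symm_apply _
  have h0 : x ≠ 0 := by
    rintro rfl
    rw [valZ_zero] at h
    exact WithZero.exp_ne_zero h.symm
  refine ⟨x, ?_⟩
  rw [absF_eq_zpow h0, ord, h]
  simp

variable (F) in
/-- A uniformizer of the local field. -/
def unif : F := (exists_uniformizer F).choose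

variable (F) in
lemma absF_unif : absF (unif F) = (qN F)⁻¹ := (exists_uniformizer F).choose_spec

variable (F) in
lemma unif_ne_zero : unif F ≠ 0 := by
  rw [← absF_pos, absF_unif]
  exact inv_pos.2 (qN_pos F)

lemma absF_unif_zpow (n : ℤ) : absF (unif F ^ n) = qN F ^ (-n) := by
  rw [absF_zpow, absF_unif, inv_zpow, zpow_neg]

lemma absF_lt_one_iff {x : F} : absF x < 1 ↔ absF x ≤ (qN F)⁻¹ := by
  have := absF_lt_zpow_iff (x := x) (n := -1)
  simpa using this

lemma ord_eq_iff {x : F} (hx : x ≠ 0) {n : ℤ} : ord x = n ↔ absF x = qN F ^ (-n) := by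
  rw [absF_eq_zpow hx, zpow_right_inj₀ (qN_pos F) (one_lt_qN F).ne']
  omega

/-- The ball of radius `q ^ n`. -/
def ballF (n : ℤ) : Set F := {x | absF x ≤ qN F ^ n}

lemma mem_ballF {n : ℤ} {x : F} : x ∈ ballF n ↔ absF x ≤ qN F ^ n := Iff.rfl

/-! ### Topology and countability of the local field -/

lemma mem_nhds_ballF (x : F) (n : ℤ) : {y : F | absF (y - x) ≤ qN F ^ n} ∈ 𝓝 x := by
  filter_upwards [eventually_valZ_lt x (γ := valZ (unif F ^ (-n)))
    (valZ_ne_zero (zpow_ne_zero _ (unif_ne_zero F)))] with y hy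
  have := absF_le_iff.2 hy.le
  rwa [absF_unif_zpow, neg_neg] at this

lemma hasBasis_nhds (x : F) :
    (𝓝 x).HasBasis (fun _ : ℕ => True) fun n => {y : F | absF (y - x) ≤ qN F ^ (-(n : ℤ))} := by
  refine ⟨fun s => ⟨fun hs => ?_, fun ⟨n, _, hn⟩ => mem_of_superset (mem_nhds_ballF x _) hn⟩⟩
  obtain ⟨γ, hγ⟩ := IsValuativeTopology.mem_nhds_iff.1 hs
  set e := IsNonarchimedeanLocalField.valueGroupWithZeroIsoInt F
  have h0 : e γ ≠ 0 := by simp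
  obtain ⟨n, hn⟩ : ∃ n : ℕ, WithZero.exp (-(n : ℤ)) < e γ := by
    refine ⟨(1 - WithZero.log (e γ)).toNat, ?_⟩
    rw [← WithZero.exp_log h0, WithZero.exp_lt_exp]
    rw [WithZero.log_exp]
    omega
  refine ⟨n, trivial, fun y hy => hγ ⟨y - x, ?_, by simp⟩⟩
  have h1 : valZ (y - x) < e γ := by
    refine lt_of_le_of_lt ?_ hn
    rcases eq_or_ne (y - x) 0 with h | h
    · rw [h, valZ_zero]; exact zero_le
    · have := (absF_le_zpow_iff h).1 hy
      rw [← WithZero.log_le_iff_le_exp (valZ_ne_zero h)]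
      rw [ord] at this
      omega
  exact e.strictMono.lt_iff_lt.1 h1

instance : (𝓝 (0 : F)).IsCountablyGenerated := (hasBasis_nhds (0 : F)).isCountablyGenerated

lemma exists_zpow_lt {r : ℝ≥0} (hr : 0 < r) : ∃ n : ℕ, qN F ^ (-(n : ℤ)) < r := by
  obtain ⟨n, hn⟩ := exists_pow_lt_of_lt_one hr (inv_lt_one_of_one_lt₀ (one_lt_qN F))
  exact ⟨n, by simpa using hn⟩

lemma exists_lt_zpow (r : ℝ≥0) : ∃ n : ℕ, r < qN F ^ (n : ℤ) := by
  obtain ⟨n, hn⟩ := pow_unbounded_of_one_lt r (one_lt_qN F)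
  exact ⟨n, by simpa using hn⟩

instance : T2Space F := by
  refine t2Space_iff_disjoint_nhds.2 fun x y hxy => ?_
  obtain ⟨n, hn⟩ := exists_zpow_lt (F := F) (absF_pos.2 (sub_ne_zero.2 hxy))
  refine Filter.disjoint_of_disjoint_of_mem ?_ (mem_nhds_ballF x (-n)) (mem_nhds_ballF y (-n))
  rw [Set.disjoint_left]
  intro z hz1 hz2
  have := absF_sub_le (z - y) (z - x)
  rw [sub_sub_sub_cancel_left] at this
  exact absurd (this.trans (max_le hz2 hz1)) (not_le.2 hn)

lemma isCompact_ballF (n : ℤ) : IsCompact (ballF n : Set F) := by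
  convert IsNonarchimedeanLocalField.isCompact_closedBall F (valuation F (unif F ^ (-n))) using 1
  ext x
  rw [mem_ballF]
  have : qN F ^ n = absF (unif F ^ (-n)) := by rw [absF_unif_zpow, neg_neg]
  rw [this, absF_le_iff, valZ, valZ,
    (IsNonarchimedeanLocalField.valueGroupWithZeroIsoInt F).strictMono.le_iff_le]
  rfl

lemma iUnion_ballF : ⋃ n : ℕ, (ballF n : Set F) = Set.univ := by
  refine Set.eq_univ_of_forall fun x => ?_
  obtain ⟨n, hn⟩ := exists_lt_zpow (F := F) (absF x)
  exact Set.mem_iUnion.2 ⟨n, hn.le⟩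

instance : SigmaCompactSpace F := ⟨fun n : ℕ => ballF n, fun n => isCompact_ballF n, iUnion_ballF⟩

/-- The additive uniformity has a countable basis, hence comes from a pseudometric, and F is a
countable union of compact balls. Second countability makes Borel structures on products compatible,
as Fubini arguments require. -/
instance : SecondCountableTopology F := by
  let := IsTopologicalAddGroup.rightUniformSpace F
  have := isUniformAddGroup_of_addCommGroup (G := F)
  have := IsUniformAddGroup.uniformity_countably_generated (α := F)
  let := UniformSpace.pseudoMetricSpace F
  exact EMetric.secondCountable_of_sigmaCompact F

lemma isLocallyConstant_absF : ∀ x : F, x ≠ 0 → ∀ᶠ y in 𝓝 x, absF y = absF x := by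
  intro x hx
  filter_upwards [eventually_valZ_eq hx] with y hy
  rw [absF, hy, absF]

lemma continuous_absF : Continuous (absF : F → ℝ≥0) := by
  rw [continuous_iff_continuousAt]
  intro x
  rcases eq_or_ne x 0 with rfl | hx
  · rw [ContinuousAt, absF_zero]
    refine tendsto_order.2 ⟨fun a ha => absurd ha not_lt_zero, fun r hr => ?_⟩
    obtain ⟨n, hn⟩ := exists_zpow_lt (F := F) hr
    filter_upwards [mem_nhds_ballF 0 (-n)] with y hy
    rw [sub_zero] at hy
    exact hy.trans_lt hn
  · exact (continuousAt_const (y := absF x)).congr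
      ((isLocallyConstant_absF x hx).mono fun y hy => hy.symm)

lemma isClosed_ballF (n : ℤ) : IsClosed (ballF n : Set F) :=
  isClosed_le continuous_absF continuous_const

lemma isOpen_ballF (n : ℤ) : IsOpen (ballF n : Set F) := by
  have : (ballF n : Set F) = {x | absF x < qN F ^ (n + 1)} := by
    ext x
    exact absF_lt_zpow_iff.symm
  rw [this]
  exact isOpen_lt continuous_absF continuous_const

variable [MeasurableSpace F] [BorelSpace F]

lemma measurable_absF : Measurable (absF : F → ℝ≥0) := continuous_absF.measurable

lemma measurableSet_ballF (n : ℤ) : MeasurableSet (ballF n : Set F) :=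
  (isClosed_ballF n).measurableSet

end AbsoluteValue

end LocalToric

end

noncomputable section

namespace LocalToric

/-! ### Haar measure on the local field -/

section HaarField

variable {F : Type*} [Field F] [ValuativeRel F] [TopologicalSpace F] [IsNonarchimedeanLocalField F]
  [MeasurableSpace F] [BorelSpace F] (μ : Measure F) [μ.IsAddHaarMeasure]

lemma measure_ballF_ne_top (n : ℤ) : μ (ballF n) ≠ ∞ := (isCompact_ballF n).measure_lt_top.ne

lemma measure_ballF_ne_zero (n : ℤ) : μ (ballF n) ≠ 0 :=
  ((isOpen_ballF n).measure_pos μ ⟨0, by simp [mem_ballF]⟩).ne'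

/-- The volume of the ring of integers. -/
def volO : ℝ≥0 := (μ (ballF 0)).toNNReal

lemma coe_volO : (volO μ : ℝ≥0∞) = μ (ballF 0) := ENNReal.coe_toNNReal (measure_ballF_ne_top μ 0)

lemma volO_pos : 0 < volO μ := by
  rw [← ENNReal.coe_pos, coe_volO, pos_iff_ne_zero]
  exact measure_ballF_ne_zero μ 0

lemma exists_map_mul_left {a : F} (ha : a ≠ 0) : ∃ c : ℝ≥0, μ.map (a * ·) = c • μ := by
  have h : (μ.map (AddMonoidHom.mulLeft a)).IsAddHaarMeasure := by
    refine Measure.isAddHaarMeasure_map μ (AddMonoidHom.mulLeft a) (continuous_const_mul a)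
      (fun y => ⟨a⁻¹ * y, ?_⟩) (Homeomorph.mulLeft₀ a ha).isClosedEmbedding.tendsto_cocompact
    simp [mul_inv_cancel_left₀ ha]
  exact ⟨_, Measure.isAddLeftInvariant_eq_smul (μ.map (AddMonoidHom.mulLeft a)) μ⟩

open Classical in
/-- The factor by which multiplication by `a` contracts the measure. -/
def scaleFactor (a : F) : ℝ≥0 :=
  if ha : a ≠ 0 then (exists_map_mul_left μ ha).choose else 0

lemma measure_preimage_mul {a : F} (ha : a ≠ 0) (s : Set F) :
    μ ((a * ·) ⁻¹' s) = scaleFactor μ a * μ s := by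
  have h := (exists_map_mul_left μ ha).choose_spec
  rw [scaleFactor, dif_pos ha]
  have := congrArg (fun ν : Measure F => ν s) h
  exact ((Homeomorph.mulLeft₀ a ha).toMeasurableEquiv.map_apply (μ := μ) s).symm.trans this

lemma preimage_mul_ballF {a : F} {m : ℤ} (ha : absF a = qN F ^ m) (n : ℤ) :
    (a * ·) ⁻¹' (ballF n : Set F) = ballF (n - m) := by
  ext x
  simp only [Set.mem_preimage, mem_ballF, absF_mul, ha]
  rw [zpow_sub₀ (qN_ne_zero F), le_div_iff₀ (zpow_pos (qN_pos F) m), mul_comm]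

/-- O is the disjoint union of q translates of 𝔭, one for each chosen lift of a residue class. -/
lemma measure_ballF_zero_eq : μ (ballF 0 : Set F) = qN F * μ (ballF (-1)) := by
  classical
  have : Fintype 𝓀[F] := Fintype.ofFinite _
  let s : 𝓀[F] → 𝒪[F] := Function.surjInv (IsLocalRing.residue_surjective (R := 𝒪[F]))
  have hs : ∀ r, IsLocalRing.residue 𝒪[F] (s r) = r :=
    Function.surjInv_eq (IsLocalRing.residue_surjective (R := 𝒪[F]))
  have hmax : ∀ x : 𝒪[F], IsLocalRing.residue 𝒪[F] x = 0 ↔ absF (x : F) ≤ qN F ^ (-1 : ℤ) := by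
    intro x
    rw [IsLocalRing.residue_eq_zero_iff, IsLocalRing.mem_maximalIdeal, mem_nonunits_iff, zpow_neg_one,
      ← absF_lt_one_iff]
    constructor
    · intro h
      refine lt_of_le_of_ne (mem_integer_iff.1 x.2) fun h1 => h ?_
      have hx0 : (x : F) ≠ 0 := by rw [← absF_pos, h1]; exact one_pos
      refine IsUnit.of_mul_eq_one ⟨(x : F)⁻¹, mem_integer_iff.2 (by rw [absF_inv, h1, inv_one])⟩ ?_
      ext
      exact mul_inv_cancel₀ hx0
    · rintro h ⟨u, rfl⟩
      have h1 : ((u : 𝒪[F]) : F) * ((u⁻¹ : 𝒪[F]ˣ) : 𝒪[F]) = 1 := by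
        exact congrArg (Subtype.val) u.mul_inv
      have h2 := congrArg absF h1
      rw [absF_mul, absF_one] at h2
      have h3 := mem_integer_iff.1 ((u⁻¹ : 𝒪[F]ˣ) : 𝒪[F]).2
      exact absurd h2 (mul_lt_one_of_lt_of_le h h3).ne
  have hU : (ballF 0 : Set F) = ⋃ r : 𝓀[F], (fun x => -(s r : F) + x) ⁻¹' ballF (-1) := by
    ext x
    rw [Set.mem_iUnion, mem_ballF, zpow_zero]
    constructor
    · intro h
      refine ⟨IsLocalRing.residue 𝒪[F] ⟨x, mem_integer_iff.2 h⟩, ?_⟩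
      have := (hmax (-(s (IsLocalRing.residue 𝒪[F] ⟨x, mem_integer_iff.2 h⟩)) +
        ⟨x, mem_integer_iff.2 h⟩)).1 (by rw [map_add, map_neg, hs]; simp)
      exact this
    · rintro ⟨r, hr⟩
      have h1 := absF_add_le (s r : F) (-(s r : F) + x)
      rw [add_neg_cancel_left] at h1
      refine h1.trans (max_le (mem_integer_iff.1 (s r).2) ?_)
      have hr' : absF (-(s r : F) + x) ≤ qN F ^ (-1 : ℤ) := hr
      refine hr'.trans ?_
      rw [zpow_neg_one]
      exact (inv_lt_one_of_one_lt₀ (one_lt_qN F)).le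
  rw [hU, measure_iUnion]
  · simp_rw [measure_preimage_add]
    rw [tsum_fintype, Finset.sum_const, Finset.card_univ, nsmul_eq_mul, ← Nat.card_eq_fintype_card]
    rfl
  · intro r r' hrr'
    rw [Function.onFun, Set.disjoint_left]
    intro x hx hx'
    apply hrr'
    have h1 : absF (-(s r : F) + x) ≤ qN F ^ (-1 : ℤ) := hx
    have h2 : absF (-(s r' : F) + x) ≤ qN F ^ (-1 : ℤ) := hx'
    have h3 := (absF_sub_le (-(s r' : F) + x) (-(s r : F) + x)).trans (max_le h2 h1)
    have h4 := (hmax (s r - s r')).2 (by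
      convert h3 using 2
      simp only [AddSubgroupClass.coe_sub]
      ring)
    rwa [map_sub, hs, hs, sub_eq_zero] at h4
  · intro r
    exact (measurableSet_ballF (-1)).preimage (measurable_const_add _)

lemma scaleFactor_mul {a b : F} (ha : a ≠ 0) (hb : b ≠ 0) :
    scaleFactor μ (a * b) = scaleFactor μ a * scaleFactor μ b := by
  have h1 := measure_preimage_mul μ (mul_ne_zero ha hb) (ballF 0)
  have h2 : ((a * b) * ·) ⁻¹' (ballF 0 : Set F) = (b * ·) ⁻¹' ((a * ·) ⁻¹' ballF 0) := by
    ext x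
    simp [mul_assoc]
  rw [h2, measure_preimage_mul μ hb, measure_preimage_mul μ ha, ← mul_assoc,
    ENNReal.mul_left_inj (measure_ballF_ne_zero μ 0) (measure_ballF_ne_top μ 0)] at h1
  rw [mul_comm (scaleFactor μ a)]
  exact_mod_cast h1.symm

/-- The factor is multiplicative, trivial on units because they preserve O, and equal to q at a
uniformizer by the coset count. Every nonzero element is a unit times a power of the uniformizer. -/
lemma scaleFactor_eq {a : F} (ha : a ≠ 0) : scaleFactor μ a = (absF a)⁻¹ := by
  have hunit : ∀ u : F, absF u = 1 → scaleFactor μ u = 1 := by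
    intro u hu
    have hu0 : u ≠ 0 := by rw [← absF_pos, hu]; exact one_pos
    have h1 := measure_preimage_mul μ hu0 (ballF 0)
    rw [preimage_mul_ballF (m := 0) (by simpa using hu), sub_zero] at h1
    have h2 : ((1 : ℝ≥0) : ℝ≥0∞) * μ (ballF 0) = scaleFactor μ u * μ (ballF 0) := by
      rw [← h1, ENNReal.coe_one, one_mul]
    rw [ENNReal.mul_left_inj (measure_ballF_ne_zero μ 0) (measure_ballF_ne_top μ 0)] at h2
    exact_mod_cast h2.symm
  have hp : scaleFactor μ (unif F) = qN F := by
    have h1 := measure_preimage_mul μ (unif_ne_zero F) (ballF (-1))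
    rw [preimage_mul_ballF (m := -1) (by rw [absF_unif, zpow_neg_one]), sub_self,
      measure_ballF_zero_eq μ, ENNReal.mul_left_inj (measure_ballF_ne_zero μ _)
        (measure_ballF_ne_top μ _)] at h1
    exact_mod_cast h1.symm
  have h1 : scaleFactor μ (1 : F) = 1 := hunit 1 absF_one
  have hpn : ∀ n : ℕ, scaleFactor μ (unif F ^ n) = qN F ^ n := by
    intro n
    induction n with
    | zero => simp [h1]
    | succ n ih =>
      rw [pow_succ, scaleFactor_mul μ (pow_ne_zero _ (unif_ne_zero F)) (unif_ne_zero F), ih, hp, pow_succ]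
  have hinv : ∀ b : F, b ≠ 0 → scaleFactor μ b * scaleFactor μ b⁻¹ = 1 := by
    intro b hb
    rw [← scaleFactor_mul μ hb (inv_ne_zero hb), mul_inv_cancel₀ hb, h1]
  have hpz : ∀ n : ℤ, scaleFactor μ (unif F ^ n) = qN F ^ n := by
    intro n
    obtain ⟨k, rfl | rfl⟩ := n.eq_nat_or_neg
    · simpa using hpn k
    · have := hinv _ (pow_ne_zero k (unif_ne_zero F))
      rw [hpn] at this
      rw [zpow_neg, zpow_natCast, zpow_neg, zpow_natCast]
      exact (inv_eq_of_mul_eq_one_right this).symm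
  have hau : absF (a * unif F ^ (-ord a)) = 1 := by
    rw [absF_mul, absF_unif_zpow, absF_eq_zpow ha, ← zpow_add₀ (qN_ne_zero F)]
    simp
  have hz : unif F ^ (ord a) ≠ 0 := zpow_ne_zero _ (unif_ne_zero F)
  have : a = (a * unif F ^ (-ord a)) * unif F ^ (ord a) := by
    rw [zpow_neg, mul_assoc, inv_mul_cancel₀ hz, mul_one]
  conv_lhs => rw [this]
  rw [scaleFactor_mul μ (mul_ne_zero ha (zpow_ne_zero _ (unif_ne_zero F))) hz, hunit _ hau, hpz,
    absF_eq_zpow ha, zpow_neg, inv_inv, one_mul]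

lemma map_mul_left_eq {a : F} (ha : a ≠ 0) : μ.map (a * ·) = (absF a)⁻¹ • μ := by
  ext s hs
  rw [Measure.map_apply (measurable_const_mul a) hs, measure_preimage_mul μ ha, scaleFactor_eq μ ha]
  rfl

lemma measure_ballF (n : ℤ) : μ (ballF n) = ((qN F ^ n * volO μ : ℝ≥0) : ℝ≥0∞) := by
  have h := measure_preimage_mul μ (zpow_ne_zero n (unif_ne_zero F)) (ballF 0)
  rw [preimage_mul_ballF (m := -n) (absF_unif_zpow n), scaleFactor_eq μ
    (zpow_ne_zero n (unif_ne_zero F)), absF_unif_zpow, zpow_neg, inv_inv, ← coe_volO] at h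
  simpa using h

lemma measureReal_ballF (n : ℤ) : μ.real (ballF n) = qN F ^ n * volO μ := by
  rw [Measure.real, measure_ballF]
  simp

lemma measure_closedBall (x : F) (n : ℤ) :
    μ {y | absF (y - x) ≤ qN F ^ n} = ((qN F ^ n * volO μ : ℝ≥0) : ℝ≥0∞) := by
  rw [← measure_ballF μ n, ← measure_preimage_add μ (-x) (ballF n)]
  congr 1
  ext y
  simp [mem_ballF, sub_eq_neg_add]

lemma measure_point (x : F) : μ {x} = 0 := by
  refine le_antisymm (le_of_forall_gt fun r hr => ?_) bot_le
  obtain ⟨r', hr'0, hr'⟩ := ENNReal.lt_iff_exists_nnreal_btwn.1 hr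
  obtain ⟨n, hn⟩ := exists_zpow_lt (F := F) (div_pos (ENNReal.coe_pos.1 hr'0) (volO_pos μ))
  refine lt_of_le_of_lt ?_ hr'
  refine (measure_mono (t := {y | absF (y - x) ≤ qN F ^ (-(n : ℤ))}) ?_).trans ?_
  · rintro _ rfl
    simp
  · rw [measure_closedBall]
    rw [lt_div_iff₀ (volO_pos μ)] at hn
    exact_mod_cast hn.le

instance : NullSingletonClass μ := ⟨measure_point μ⟩

lemma lintegral_mul_left {a : F} (ha : a ≠ 0) (f : F → ℝ≥0∞) :
    ∫⁻ x, f (a * x) ∂μ = ((absF a)⁻¹ : ℝ≥0) * ∫⁻ x, f x ∂μ := by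
  have h := lintegral_map_equiv (μ := μ) f (Homeomorph.mulLeft₀ a ha).toMeasurableEquiv
  have h1 : μ.map (Homeomorph.mulLeft₀ a ha).toMeasurableEquiv = (absF a)⁻¹ • μ :=
    map_mul_left_eq μ ha
  rw [h1, lintegral_smul_measure] at h
  exact h.symm

lemma integral_mul_left_eq {a : F} (ha : a ≠ 0) (f : F → ℂ) :
    ∫ x, f (a * x) ∂μ = (absF a : ℂ)⁻¹ * ∫ x, f x ∂μ := by
  have h := integral_map_equiv (μ := μ) (Homeomorph.mulLeft₀ a ha).toMeasurableEquiv f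
  have h1 : μ.map (Homeomorph.mulLeft₀ a ha).toMeasurableEquiv = (absF a)⁻¹ • μ :=
    map_mul_left_eq μ ha
  rw [h1, integral_smul_nnreal_measure] at h
  refine h.symm.trans ?_
  rw [NNReal.smul_def, Complex.real_smul]
  simp

lemma ae_ne_zero : ∀ᵐ x : F ∂μ, x ≠ 0 := by simp [ae_iff]

lemma measurable_inv_sq : Measurable fun x : F => ((absF x ^ 2)⁻¹ : ℝ≥0) :=
  Measurable.inv (measurable_absF.pow_const 2)

instance : MeasurableInv F := ⟨measurable_of_continuousOn_compl_singleton 0 continuousOn_inv₀⟩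

/-- Substitution of `x⁻¹` in an integral with respect to `dx / |x|`. -/
lemma lintegral_inv_abs {f : F → ℝ≥0∞} (hf : Measurable f) :
    ∫⁻ x, f x * ((absF x)⁻¹ : ℝ≥0) ∂μ = ∫⁻ x, f x⁻¹ * ((absF x)⁻¹ : ℝ≥0) ∂μ := by
  set w : F → ℝ≥0∞ := fun x => ((absF x)⁻¹ : ℝ≥0) with hw
  have hwm : Measurable w := measurable_absF.inv.coe_nnreal_ennreal
  -- The indicator of the units is an auxiliary weight with finite nonzero integral, so it can be
  -- cancelled at the end.
  set g : F → ℝ≥0∞ := Set.indicator {x | absF x = 1} 1 with hg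
  have hgs : MeasurableSet {x : F | absF x = 1} := measurable_absF (measurableSet_singleton 1)
  have hgm : Measurable g := measurable_one.indicator hgs
  have hae := ae_ne_zero μ
  have hscale : ∀ (h : F → ℝ≥0∞) (a : F), a ≠ 0 → ∫⁻ x, h (a * x) * w x ∂μ = ∫⁻ x, h x * w x ∂μ := by
    intro h a ha
    have h1 : ∀ x, h (a * x) * w x = absF a * (h (a * x) * w (a * x)) := by
      intro x
      have : w x = absF a * w (a * x) := by
        simp only [hw]
        rw [← ENNReal.coe_mul, absF_mul, mul_inv, mul_inv_cancel_left₀ (absF_ne_zero ha)]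
      rw [this]; ring
    simp_rw [h1]
    rw [lintegral_const_mul' _ _ ENNReal.coe_ne_top, lintegral_mul_left μ ha fun x => h x * w x,
      ← mul_assoc, ← ENNReal.coe_mul, mul_inv_cancel₀ (absF_ne_zero ha), ENNReal.coe_one, one_mul]
  have hI : ∫⁻ x, g x * w x ∂μ ≠ 0 ∧ ∫⁻ x, g x * w x ∂μ ≠ ∞ := by
    have h1 : ∀ x, g x * w x = g x := by
      intro x
      by_cases hx : absF x = 1 <;> simp [hg, hw, hx]
    simp_rw [h1]
    rw [hg, lintegral_indicator_one hgs]
    constructor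
    · have : {x : F | absF x = 1} ∈ 𝓝 (1 : F) := by
        filter_upwards [isLocallyConstant_absF (1 : F) one_ne_zero] with y hy
        simpa using hy
      exact (Measure.measure_pos_of_mem_nhds μ this).ne'
    · refine ((measure_mono ?_).trans_lt (isCompact_ballF (F := F) 0).measure_lt_top).ne
      intro x hx
      rw [mem_ballF, zpow_zero]
      exact le_of_eq hx
  -- Here dx/|x| is invariant under scaling. In the double integral of f(x) g(xy), replacing x by x
  -- y⁻¹ and then y by xy turns f(x) g(xy) into f(y⁻¹) g(x). The two orders of integration give the
  -- two sides.
  have key : (∫⁻ x, f x * w x ∂μ) * ∫⁻ x, g x * w x ∂μ =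
      (∫⁻ x, f x⁻¹ * w x ∂μ) * ∫⁻ x, g x * w x ∂μ := by
    have hm : Measurable fun p : F × F => (f p.1 * w p.1) * (g (p.1 * p.2) * w p.2) := by
      fun_prop
    have hm2 : Measurable fun p : F × F => (f (p.1 * p.2⁻¹) * g p.1) * (w p.1 * w p.2) := by
      fun_prop
    calc (∫⁻ x, f x * w x ∂μ) * ∫⁻ x, g x * w x ∂μ
        = ∫⁻ x, f x * w x * (∫⁻ y, g y * w y ∂μ) ∂μ := by
          rw [lintegral_mul_const _ (by fun_prop)]
      _ = ∫⁻ x, ∫⁻ y, (f x * w x) * (g (x * y) * w y) ∂μ ∂μ := by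
          refine lintegral_congr_ae ?_
          filter_upwards [hae] with x hx
          rw [lintegral_const_mul _ (by fun_prop), hscale g x hx]
      _ = ∫⁻ y, ∫⁻ x, (f x * w x) * (g (x * y) * w y) ∂μ ∂μ :=
          lintegral_lintegral_swap hm.aemeasurable
      _ = ∫⁻ y, ∫⁻ x, (f (x * y⁻¹) * g x) * (w x * w y) ∂μ ∂μ := by
          refine lintegral_congr_ae ?_
          filter_upwards [hae] with y hy
          have := hscale (fun x => f (x * y⁻¹) * g x * w y) y hy
          calc _ = ∫⁻ x, f (y * x * y⁻¹) * g (y * x) * w y * w x ∂μ := by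
                refine lintegral_congr fun x => ?_
                rw [mul_comm y x, mul_inv_cancel_right₀ hy]; ring
            _ = _ := this
            _ = _ := lintegral_congr fun x => by ring
      _ = ∫⁻ x, ∫⁻ y, (f (x * y⁻¹) * g x) * (w x * w y) ∂μ ∂μ :=
          (lintegral_lintegral_swap hm2.aemeasurable).symm
      _ = ∫⁻ x, g x * w x * (∫⁻ y, f y⁻¹ * w y ∂μ) ∂μ := by
          refine lintegral_congr_ae ?_
          filter_upwards [hae] with x hx
          have := hscale (fun y => f (x * y⁻¹)) x hx
          rw [show (fun y => f (x * (x * y)⁻¹) * w y) = fun y => f y⁻¹ * w y by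
            funext y; rw [mul_inv, mul_inv_cancel_left₀ hx]] at this
          rw [this, ← lintegral_const_mul _ (by fun_prop)]
          exact lintegral_congr fun x => by ring
      _ = _ := by rw [lintegral_mul_const _ (by fun_prop), mul_comm]
  exact (ENNReal.mul_left_inj hI.1 hI.2).1 key

/-- The image of `|x|⁻² dx` under inversion is `dx`. -/
lemma map_inv_withDensity :
    (μ.withDensity fun x => ((absF x ^ 2)⁻¹ : ℝ≥0)).map (MeasurableEquiv.inv F) = μ := by
  have hae := ae_ne_zero μ
  have hw : Measurable fun x : F => ((absF x ^ 2)⁻¹ : ℝ≥0) := measurable_inv_sq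
  have ha := measurable_absF (F := F)
  refine Measure.ext_of_lintegral _ fun f hf => ?_
  rw [lintegral_map_equiv, lintegral_withDensity_eq_lintegral_mul _ hw.coe_nnreal_ennreal
    (by exact hf.comp (MeasurableEquiv.inv F).measurable)]
  have h := lintegral_inv_abs μ (f := fun x => f x * absF x) (by fun_prop)
  have h1 : ∫⁻ x, f x * absF x * ((absF x)⁻¹ : ℝ≥0) ∂μ = ∫⁻ x, f x ∂μ := by
    refine lintegral_congr_ae ?_
    filter_upwards [hae] with x hx
    rw [mul_assoc, ← ENNReal.coe_mul, mul_inv_cancel₀ (absF_ne_zero hx), ENNReal.coe_one, mul_one]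
  rw [← h1, h]
  refine lintegral_congr fun x => ?_
  simp only [Pi.mul_apply, MeasurableEquiv.inv_apply, absF_inv]
  rw [mul_assoc, ← ENNReal.coe_mul, mul_comm, pow_two, mul_inv]

/-- No measurability of f is needed: inversion is a measurable equivalence and the density is
measurable and finite. The later substitutions inherit this generality. -/
lemma lintegral_inv (f : F → ℝ≥0∞) :
    ∫⁻ x, ((absF x ^ 2)⁻¹ : ℝ≥0) * f x⁻¹ ∂μ = ∫⁻ x, f x ∂μ := by
  conv_rhs => rw [← map_inv_withDensity μ]
  rw [lintegral_map_equiv, lintegral_withDensity_eq_lintegral_mul_non_measurable _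
    measurable_inv_sq.coe_nnreal_ennreal (by simp)]
  rfl

lemma integral_inv_eq (f : F → ℂ) :
    ∫ x, ((absF x ^ 2)⁻¹ : ℝ≥0) • f x⁻¹ ∂μ = ∫ x, f x ∂μ := by
  conv_rhs => rw [← map_inv_withDensity μ]
  rw [integral_map_equiv, integral_withDensity_eq_integral_smul
    measurable_inv_sq]
  rfl

/-- The integral of `|x|⁻²` over the complement of a ball. -/
lemma lintegral_tail (n : ℤ) :
    ∫⁻ x in (ballF n)ᶜ, ((absF x ^ 2)⁻¹ : ℝ≥0) ∂μ = ((qN F ^ (-n - 1) * volO μ : ℝ≥0) : ℝ≥0∞) := by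
  rw [← measure_ballF, ← lintegral_indicator_one (measurableSet_ballF _), ← lintegral_inv μ,
    ← lintegral_indicator (measurableSet_ballF n).compl]
  have hae := ae_ne_zero μ
  refine lintegral_congr_ae ?_
  filter_upwards [hae] with x hx
  -- By discreteness |x| > q^n is equivalent to |x⁻¹| ≤ q^{-n-1}, so inversion carries the tail to a
  -- punctured ball.
  have hiff : x ∈ (ballF n : Set F)ᶜ ↔ x⁻¹ ∈ (ballF (-n - 1) : Set F) := by
    rw [Set.mem_compl_iff, mem_ballF, mem_ballF, ← absF_lt_zpow_iff (n := -n - 1), absF_inv,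
      sub_add_cancel, zpow_neg,
      inv_lt_inv₀ (absF_pos.2 hx) (zpow_pos (qN_pos F) n), not_le]
  by_cases h : x ∈ (ballF n : Set F)ᶜ
  · rw [Set.indicator_of_mem h, Set.indicator_of_mem (hiff.1 h)]; simp
  · rw [Set.indicator_of_notMem h, Set.indicator_of_notMem (mt hiff.2 h)]; simp

end HaarField

end LocalToric

end

noncomputable section

namespace LocalToric

/-! ### Fractional linear substitutions -/

section Moebius

variable {F : Type*} [Field F] [ValuativeRel F] [TopologicalSpace F] [IsNonarchimedeanLocalField F]
  [MeasurableSpace F] [BorelSpace F] (μ : Measure F) [μ.IsAddHaarMeasure]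

lemma lintegral_affine {a : F} (ha : a ≠ 0) (b : F) (f : F → ℝ≥0∞) :
    ∫⁻ x, f (b + a * x) ∂μ = ((absF a)⁻¹ : ℝ≥0) * ∫⁻ x, f x ∂μ := by
  rw [lintegral_mul_left μ ha fun x => f (b + x), lintegral_add_left_eq_self]

lemma integral_affine {a : F} (ha : a ≠ 0) (b : F) (f : F → ℂ) :
    ∫ x, f (b + a * x) ∂μ = ((absF a)⁻¹ : ℝ≥0) * ∫ x, f x ∂μ := by
  rw [integral_mul_left_eq μ ha fun x => f (b + x), integral_add_left_eq_self]
  simp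

lemma abs_det_identity {s d : F} (hs : s ≠ 0) (hd : d ≠ 0) :
    (absF s ^ 2)⁻¹ * (absF (-(d / s ^ 2)))⁻¹ = (absF d)⁻¹ := by
  have := absF_ne_zero hs
  have := absF_ne_zero hd
  rw [absF_neg, absF_div, absF_pow]
  field_simp

lemma abs_div_identity {p t : F} (hp : p ≠ 0) (ht : t ≠ 0) :
    (absF p ^ 2)⁻¹ * (absF (t / p))⁻¹ = (absF (p * t))⁻¹ := by
  have := absF_ne_zero hp
  have := absF_ne_zero ht
  rw [absF_mul, absF_div]
  field_simp

/-- Fractional linear substitution in the integral of a function on the plane which is homogeneous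
of degree `-2`. -/
lemma lintegral_moebius {H : F → F → ℝ≥0∞}
    (hH : ∀ c a b : F, c ≠ 0 → H (c * a) (c * b) = ((absF c ^ 2)⁻¹ : ℝ≥0) * H a b)
    {p r s t : F} (hd : p * t - r * s ≠ 0) :
    ∫⁻ z, H (p + z * s) (r + z * t) ∂μ = ((absF (p * t - r * s))⁻¹ : ℝ≥0) * ∫⁻ z, H 1 z ∂μ := by
  rcases eq_or_ne s 0 with rfl | hs
  · rw [mul_zero, sub_zero] at hd ⊢
    obtain ⟨hp, ht⟩ := mul_ne_zero_iff.1 hd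
    have h1 : ∀ z, H (p + z * 0) (r + z * t) = ((absF p ^ 2)⁻¹ : ℝ≥0) * H 1 (r / p + t / p * z) := by
      intro z
      rw [← hH p _ _ hp]
      congr 1 <;> field_simp <;> ring
    simp_rw [h1]
    rw [lintegral_const_mul' _ _ ENNReal.coe_ne_top, lintegral_affine μ (div_ne_zero ht hp),
      ← mul_assoc, ← ENNReal.coe_mul, abs_div_identity hp ht]
  -- For s ≠ 0 a translation makes the first argument zs. Pulling out z and s by homogeneity leaves
  -- an affine function of z⁻¹, and the factor |z|⁻² produced by degree -2 is exactly the Jacobian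
  -- of inversion.
  · have h2 : ∫⁻ z, H (p + z * s) (r + z * t) ∂μ =
        ∫⁻ z, H (z * s) (z * t - (p * t - r * s) / s) ∂μ := by
      rw [← lintegral_add_left_eq_self _ (-(p / s))]
      refine lintegral_congr fun z => ?_
      congr 1 <;> field_simp <;> ring
    have h3 : ∀ᵐ z ∂μ, H (z * s) (z * t - (p * t - r * s) / s) = ((absF s ^ 2)⁻¹ : ℝ≥0) *
        (((absF z ^ 2)⁻¹ : ℝ≥0) * H 1 (t / s + -((p * t - r * s) / s ^ 2) * z⁻¹)) := by
      filter_upwards [ae_ne_zero μ] with z hz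
      rw [← hH z _ _ hz, ← hH s _ _ hs]
      congr 1 <;> field_simp <;> ring
    rw [h2, lintegral_congr_ae h3, lintegral_const_mul' _ _ ENNReal.coe_ne_top,
      lintegral_inv μ fun z => H 1 (t / s + -((p * t - r * s) / s ^ 2) * z),
      lintegral_affine μ (neg_ne_zero.2 (div_ne_zero hd (pow_ne_zero 2 hs))),
      ← mul_assoc, ← ENNReal.coe_mul, abs_det_identity hs hd]

/-- The same substitutions for complex values. Each one is an identity of Bochner integrals along a
measurable equivalence, so integrability is not required. -/
lemma integral_moebius {H : F → F → ℂ}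
    (hH : ∀ c a b : F, c ≠ 0 → H (c * a) (c * b) = ((absF c ^ 2)⁻¹ : ℝ≥0) * H a b)
    {p r s t : F} (hd : p * t - r * s ≠ 0) :
    ∫ z, H (p + z * s) (r + z * t) ∂μ = ((absF (p * t - r * s))⁻¹ : ℝ≥0) * ∫ z, H 1 z ∂μ := by
  rcases eq_or_ne s 0 with rfl | hs
  · rw [mul_zero, sub_zero] at hd ⊢
    obtain ⟨hp, ht⟩ := mul_ne_zero_iff.1 hd
    have h1 : ∀ z, H (p + z * 0) (r + z * t) = ((absF p ^ 2)⁻¹ : ℝ≥0) * H 1 (r / p + t / p * z) := by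
      intro z
      rw [← hH p _ _ hp]
      congr 1 <;> field_simp <;> ring
    simp_rw [h1]
    rw [integral_const_mul, integral_affine μ (div_ne_zero ht hp),
      ← mul_assoc, ← abs_div_identity hp ht]
    push_cast
    ring
  · have h2 : ∫ z, H (p + z * s) (r + z * t) ∂μ =
        ∫ z, H (z * s) (z * t - (p * t - r * s) / s) ∂μ := by
      rw [← integral_add_left_eq_self _ (-(p / s))]
      refine integral_congr_ae (Eventually.of_forall fun z => ?_)
      change H _ _ = H _ _
      congr 1 <;> field_simp <;> ring
    have h3 : ∀ᵐ z ∂μ, H (z * s) (z * t - (p * t - r * s) / s) = ((absF s ^ 2)⁻¹ : ℝ≥0) *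
        (((absF z ^ 2)⁻¹ : ℝ≥0) • H 1 (t / s + -((p * t - r * s) / s ^ 2) * z⁻¹)) := by
      filter_upwards [ae_ne_zero μ] with z hz
      rw [NNReal.smul_def, Complex.real_smul, ← hH z _ _ hz, ← hH s _ _ hs]
      congr 1 <;> field_simp <;> ring
    rw [h2, integral_congr_ae h3, integral_const_mul,
      integral_inv_eq μ fun z => H 1 (t / s + -((p * t - r * s) / s ^ 2) * z),
      integral_affine μ (neg_ne_zero.2 (div_ne_zero hd (pow_ne_zero 2 hs))),
      ← mul_assoc, ← abs_det_identity hs hd]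
    push_cast
    ring

end Moebius

/-! ### Decompositions of `GL₂` -/

section Decomposition

variable {F : Type*} [Field F] [ValuativeRel F] [TopologicalSpace F] [IsNonarchimedeanLocalField F]

lemma ord_eq_neg_log (x : F) : WithZero.log (valZ x) = -ord x := by rw [ord, neg_neg]

lemma ord_one : ord (1 : F) = 0 := by simp [ord, valZ]

lemma ord_inv (x : F) : ord x⁻¹ = -ord x := by simp [ord, valZ]

lemma ord_neg (x : F) : ord (-x) = ord x := by rw [ord, valZ_neg, ord]

lemma ord_unif : ord (unif F) = 1 := by
  rw [ord_eq_iff (unif_ne_zero F), absF_unif, zpow_neg_one]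

lemma coe_qN : ((qN F : ℝ) : ℂ) = resCard F := by simp [qN]

lemma coe_absF {x : F} (hx : x ≠ 0) : ((absF x : ℝ) : ℂ) = (resCard F : ℂ) ^ (-ord x) := by
  rw [absF_eq_zpow hx, ← coe_qN]
  push_cast
  rfl

lemma modChar_eq {b : GL (Fin 2) F} (hb : b 1 0 = 0) :
    modChar b = (absF (b 0 0 / b 1 1) : ℝ) := by
  obtain ⟨h0, h1⟩ := diag_ne_zero hb
  rw [modChar, coe_absF (div_ne_zero h0 h1)]

lemma iwasawaExp_borel_mul {b : GL (Fin 2) F} (hb : b 1 0 = 0) (g : GL (Fin 2) F) :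
    iwasawaExp (b * g) = ord (b 1 1 / b 0 0) + iwasawaExp g := by
  obtain ⟨hb0, hb1⟩ := diag_ne_zero hb
  have hbd : (b : Matrix (Fin 2) (Fin 2) F).det = b 0 0 * b 1 1 := by
    rw [Matrix.det_fin_two, hb]; ring
  have e : ∀ j, (b * g : GL (Fin 2) F) 1 j = b 1 1 * g 1 j := by
    intro j
    rw [Units.val_mul, Matrix.mul_apply, Fin.sum_univ_two, hb, zero_mul, zero_add]
  have hm : Monotone fun x : ℤᵐ⁰ => valZ (b 1 1) * x := fun x y h => mul_le_mul_right h _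
  have hmax : max (valZ ((b * g : GL (Fin 2) F) 1 0)) (valZ ((b * g : GL (Fin 2) F) 1 1)) =
      valZ (b 1 1) * max (valZ (g 1 0)) (valZ (g 1 1)) := by
    rw [e, e, valZ_mul, valZ_mul]
    exact (hm.map_max (a := valZ (g 1 0)) (b := valZ (g 1 1))).symm
  have hg0 : max (valZ (g 1 0)) (valZ (g 1 1)) ≠ 0 := by
    intro h0
    rcases row_ne_zero g with h | h
    · exact valZ_ne_zero h (le_antisymm (h0 ▸ le_max_left _ _) bot_le)
    · exact valZ_ne_zero h (le_antisymm (h0 ▸ le_max_right _ _) bot_le)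
  rw [iwasawaExp, hmax, Units.val_mul, Matrix.det_mul, ord_mul (det_coe_ne_zero b)
    (det_coe_ne_zero g), hbd, ord_mul hb0 hb1, ord_div hb1 hb0,
    WithZero.log_mul (valZ_ne_zero hb1) hg0, ord_eq_neg_log, iwasawaExp]
  ring

lemma lowerUnipOmega_val (x : F) :
    (lowerUnipOmega x : Matrix (Fin 2) (Fin 2) F) = !![0, -1; 1, -x] := by
  rw [lowerUnipOmega, Units.val_mul]
  simp [Matrix.GeneralLinearGroup.mkOfDetNeZero]

/-- Bruhat decomposition. -/
lemma exists_borel_mul_lowerUnipOmega (g : GL (Fin 2) F) (hg : g 1 0 ≠ 0) :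
    ∃ b : GL (Fin 2) F, b 1 0 = 0 ∧ b 1 1 = g 1 0 ∧
      b 0 0 = (g : Matrix (Fin 2) (Fin 2) F).det / g 1 0 ∧
      g = b * lowerUnipOmega (-(g 1 1 / g 1 0)) := by
  have hD := det_coe_ne_zero g
  refine ⟨Matrix.GeneralLinearGroup.mkOfDetNeZero
    !![(g : Matrix (Fin 2) (Fin 2) F).det / g 1 0, g 0 0; 0, g 1 0] ?_, rfl, rfl, rfl, ?_⟩
  · simp [Matrix.det_fin_two_of, hg, hD]
  · ext i j
    rw [Units.val_mul, lowerUnipOmega_val]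
    fin_cases i <;> fin_cases j <;>
      simp [Matrix.GeneralLinearGroup.mkOfDetNeZero, Matrix.det_fin_two] <;> field_simp <;> ring

/-- Iwasawa decomposition. -/
lemma exists_borel_mul_maxCompact (g : GL (Fin 2) F) :
    ∃ b k : GL (Fin 2) F, b 1 0 = 0 ∧ k ∈ maxCompact F ∧ g = b * k := by
  have key : ∃ k ∈ maxCompact F, k 1 0 * g 1 1 = k 1 1 * g 1 0 := by
    rcases le_total (absF (g 1 0)) (absF (g 1 1)) with h | h
    · have h1 : g 1 1 ≠ 0 := by
        intro h1
        rw [h1, absF_zero, nonpos_iff_eq_zero, absF_eq_zero] at h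
        rcases row_ne_zero g with h2 | h2 <;> contradiction
      have hint : absF (g 1 0 / g 1 1) ≤ 1 := by
        rw [absF_div]
        exact div_le_one_of_le₀ h zero_le
      refine ⟨⟨!![1, 0; g 1 0 / g 1 1, 1], !![1, 0; -(g 1 0 / g 1 1), 1], ?_, ?_⟩, ?_, ?_⟩
      · ext i j; fin_cases i <;> fin_cases j <;> simp
      · ext i j; fin_cases i <;> fin_cases j <;> simp
      · intro i j
        simp only [mem_integer_iff]
        fin_cases i <;> fin_cases j <;> simpa using hint
      · simp [h1]
    · have h1 : g 1 0 ≠ 0 := by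
        intro h1
        rw [h1, absF_zero, nonpos_iff_eq_zero, absF_eq_zero] at h
        rcases row_ne_zero g with h2 | h2 <;> contradiction
      have hint : absF (g 1 1 / g 1 0) ≤ 1 := by
        rw [absF_div]
        exact div_le_one_of_le₀ h zero_le
      refine ⟨⟨!![0, -1; 1, g 1 1 / g 1 0], !![g 1 1 / g 1 0, 1; -1, 0], ?_, ?_⟩, ?_, ?_⟩
      · ext i j; fin_cases i <;> fin_cases j <;> simp
      · ext i j; fin_cases i <;> fin_cases j <;> simp
      · intro i j
        simp only [mem_integer_iff]
        fin_cases i <;> fin_cases j <;> simpa using hint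
      · simp [h1]
  obtain ⟨k, hk, hrow⟩ := key
  refine ⟨g * k⁻¹, k, ?_, hk, by simp⟩
  rw [Units.val_mul, Matrix.mul_apply, Fin.sum_univ_two, Matrix.coe_units_inv, Matrix.inv_def,
    Matrix.adjugate_fin_two]
  simp only [Matrix.smul_apply, smul_eq_mul, Matrix.of_apply, Matrix.cons_val', Matrix.cons_val_zero,
    Matrix.cons_val_one, Matrix.cons_val_fin_one]
  linear_combination (-Ring.inverse (k : Matrix (Fin 2) (Fin 2) F).det) * hrow

lemma inv_mem_maxCompact {k : GL (Fin 2) F} (hk : k ∈ maxCompact F) : k⁻¹ ∈ maxCompact F :=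
  fun i j => ⟨(hk i j).2, by simpa using (hk i j).1⟩

lemma mul_mem_maxCompact {k l : GL (Fin 2) F} (hk : k ∈ maxCompact F) (hl : l ∈ maxCompact F) :
    k * l ∈ maxCompact F := by
  intro i j
  constructor
  · rw [Units.val_mul, Matrix.mul_apply]
    exact sum_mem fun x _ => mul_mem (hk i x).1 (hl x j).1
  · rw [mul_inv_rev, Units.val_mul, Matrix.mul_apply]
    exact sum_mem fun x _ => mul_mem (hl i x).2 (hk x j).2

lemma iwasawaExp_maxCompact {k : GL (Fin 2) F} (hk : k ∈ maxCompact F) : iwasawaExp k = 0 := by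
  have := iwasawaExp_mul 1 k (by simp) hk
  rw [one_mul] at this
  rw [this]
  simp [ord_one]

lemma iwasawaExp_mul_maxCompact (g : GL (Fin 2) F) {k : GL (Fin 2) F} (hk : k ∈ maxCompact F) :
    iwasawaExp (g * k) = iwasawaExp g := by
  obtain ⟨b, l, hb, hl, rfl⟩ := exists_borel_mul_maxCompact g
  rw [mul_assoc, iwasawaExp_mul b _ hb (mul_mem_maxCompact hl hk), iwasawaExp_mul b l hb hl]

variable (F) in
-- The pair (g, g⁻¹) embeds GL₂ as a closed subset of a product of two matrix spaces, and the group
-- is the preimage of a product of compact sets.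
lemma isCompact_maxCompact : IsCompact (maxCompact F) := by
  have hO : IsCompact (𝒪[F] : Set F) := by
    convert isCompact_ballF (F := F) 0 using 1
    ext x
    rw [mem_ballF, zpow_zero, ← mem_integer_iff]
    rfl
  have hM : IsCompact {A : Matrix (Fin 2) (Fin 2) F | ∀ i j, A i j ∈ 𝒪[F]} :=
    isCompact_pi_infinite (s := fun _ : Fin 2 => {v : Fin 2 → F | ∀ j, v j ∈ 𝒪[F]})
      fun _ => isCompact_pi_infinite fun _ => hO
  have h1 := (hM.prod (MulOpposite.opHomeomorph.isCompact_image.2 hM))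
  convert Units.isClosedEmbedding_embedProduct.isCompact_preimage h1 using 1
  ext g
  simp only [maxCompact, Set.mem_ofPred_eq, Set.mem_preimage, Units.embedProduct_apply, Set.mem_prod,
    MulOpposite.opHomeomorph_apply, Set.mem_image]
  constructor
  · intro h
    exact ⟨fun i j => (h i j).1, _, fun i j => (h i j).2, rfl⟩
  · rintro ⟨h1, A, h2, h3⟩ i j
    rw [MulOpposite.op_inj.1 h3] at h2
    exact ⟨h1 i j, h2 i j⟩

variable (F) in
lemma isOpen_maxCompact : IsOpen (maxCompact F) := by
  have hO : IsOpen (𝒪[F] : Set F) := by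
    convert isOpen_ballF (F := F) 0 using 1
    ext x
    rw [mem_ballF, zpow_zero, ← mem_integer_iff]
    rfl
  have : maxCompact F = ⋂ i, ⋂ j, ((fun g : GL (Fin 2) F => g i j) ⁻¹' 𝒪[F]) ∩
      ((fun g : GL (Fin 2) F => (g⁻¹ : GL (Fin 2) F) i j) ⁻¹' 𝒪[F]) := by
    ext g
    simp [maxCompact]
  rw [this]
  refine isOpen_iInter_of_finite fun i => isOpen_iInter_of_finite fun j => ?_
  exact (hO.preimage (continuous_entry i j)).inter
    (hO.preimage ((continuous_entry i j).comp continuous_inv))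

variable (F) in
lemma one_mem_maxCompact : (1 : GL (Fin 2) F) ∈ maxCompact F := by
  intro i j
  rw [inv_one, Units.val_one, and_self, mem_integer_iff]
  fin_cases i <;> fin_cases j <;> simp

lemma continuous_lowerUnipOmega : Continuous (lowerUnipOmega : F → GL (Fin 2) F) := by
  rw [Units.continuous_iff]
  constructor
  · change Continuous fun x : F => (lowerUnipOmega x : Matrix (Fin 2) (Fin 2) F)
    simp_rw [lowerUnipOmega_val]
    refine continuous_matrix fun i j => ?_
    fin_cases i <;> fin_cases j <;> simp <;> fun_prop
  · simp_rw [Matrix.coe_units_inv, lowerUnipOmega_val, Matrix.inv_def, Matrix.adjugate_fin_two,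
      Matrix.det_fin_two]
    refine continuous_matrix fun i j => ?_
    fin_cases i <;> fin_cases j <;> simp <;> fun_prop

end Decomposition

end LocalToric

end

noncomputable section

namespace LocalToric

/-! ### Invariant functionals on modular functions -/

section Modular

variable {F : Type*} [Field F] [ValuativeRel F] [TopologicalSpace F] [IsNonarchimedeanLocalField F]

/-- The spherical modular function, equal to `1` on the maximal compact subgroup. -/
def sphericalFun (g : GL (Fin 2) F) : ℝ≥0 := qN F ^ iwasawaExp g

lemma sphericalFun_pos (g : GL (Fin 2) F) : 0 < sphericalFun g := zpow_pos (qN_pos F) _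

lemma continuous_sphericalFun : Continuous (sphericalFun (F := F)) :=
  (continuous_of_discreteTopology (f := fun n : ℤ => qN F ^ n)).comp continuous_iwasawaExp

lemma modChar_eq_spherical {b g : GL (Fin 2) F} (hb : b 1 0 = 0) :
    modChar b * (sphericalFun g : ℝ) = (sphericalFun (b * g) : ℝ) := by
  obtain ⟨h0, h1⟩ := diag_ne_zero hb
  rw [modChar_eq hb, sphericalFun, sphericalFun, iwasawaExp_borel_mul hb, zpow_add₀ (qN_ne_zero F),
    absF_eq_zpow (div_ne_zero h0 h1), ord_div h0 h1, ord_div h1 h0, neg_sub]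
  push_cast
  rfl

lemma sphericalFun_maxCompact {k : GL (Fin 2) F} (hk : k ∈ maxCompact F) : sphericalFun k = 1 := by
  rw [sphericalFun, iwasawaExp_maxCompact hk, zpow_zero]

lemma sphericalFun_lowerUnipOmega (x : F) :
    sphericalFun (lowerUnipOmega x) = if absF x ≤ 1 then 1 else (absF x ^ 2)⁻¹ := by
  have hd : (lowerUnipOmega x : Matrix (Fin 2) (Fin 2) F).det = 1 := by
    rw [lowerUnipOmega_val]; simp
  have h0 : lowerUnipOmega x 1 0 = 1 := by rw [lowerUnipOmega_val]; simp
  have h1 : lowerUnipOmega x 1 1 = -x := by rw [lowerUnipOmega_val]; simp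
  rw [sphericalFun, iwasawaExp, hd, h0, h1, valZ_neg, valZ_one, ord_one, sub_zero]
  split_ifs with h
  · rw [← absF_one (F := F), absF_le_iff, valZ_one] at h
    rw [max_eq_left h]
    simp
  · rw [← absF_one (F := F), absF_le_iff, valZ_one, not_le] at h
    have hx : x ≠ 0 := by
      rintro rfl
      rw [valZ_zero] at h
      exact not_lt_zero h
    rw [max_eq_right h.le, ord_eq_neg_log, absF_eq_zpow hx, ← zpow_natCast, ← zpow_mul, ← zpow_neg]
    congr 1
    push_cast
    ring

/-- A function on `GL₂` with the transformation law of a modular function. -/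
def HasModularLaw (h : GL (Fin 2) F → ℂ) : Prop :=
  ∀ b g : GL (Fin 2) F, b 1 0 = 0 → h (b * g) = modChar b * h g

/-- By the Bruhat decomposition a modular function is |det g| times a function of the bottom row
which is homogeneous of degree -2. This is the form to which `integral_moebius` applies. -/
lemma HasModularLaw.apply {h : GL (Fin 2) F → ℂ} (hh : HasModularLaw h) {g : GL (Fin 2) F}
    (hg : g 1 0 ≠ 0) : h g = (absF (g : Matrix (Fin 2) (Fin 2) F).det : ℝ) *
      ((((absF (g 1 0) ^ 2)⁻¹ : ℝ≥0) : ℝ) * h (lowerUnipOmega (-(g 1 1 / g 1 0)))) := by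
  obtain ⟨b, hb, h1, h0, hgb⟩ := exists_borel_mul_lowerUnipOmega g hg
  conv_lhs => rw [hgb]
  rw [hh b _ hb, modChar_eq hb, h0, h1, absF_div, absF_div, ← mul_assoc]
  push_cast
  ring

variable [MeasurableSpace F] [BorelSpace F] (μ : Measure F) [μ.IsAddHaarMeasure]

/-- The integral over the big cell is invariant under right translation. -/
lemma integral_lowerUnipOmega_mul {h : GL (Fin 2) F → ℂ} (hh : HasModularLaw h) (g : GL (Fin 2) F) :
    ∫ x, h (lowerUnipOmega x * g) ∂μ = ∫ x, h (lowerUnipOmega x) ∂μ := by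
  classical
  -- The value 0 on the line c = 0 keeps the homogeneity law valid there; it is only met on a null
  -- set.
  set H : F → F → ℂ := fun c d =>
    if c = 0 then 0 else (((absF c ^ 2)⁻¹ : ℝ≥0) : ℝ) * h (lowerUnipOmega (-(d / c))) with hHdef
  have hH : ∀ c a b : F, c ≠ 0 → H (c * a) (c * b) = ((absF c ^ 2)⁻¹ : ℝ≥0) * H a b := by
    intro c a b hc
    by_cases ha : a = 0
    · simp [hHdef, ha]
    · simp only [hHdef, ha, mul_ne_zero hc ha, if_false]
      rw [mul_div_mul_left _ _ hc, absF_mul, mul_pow, mul_inv]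
      push_cast
      ring
  have hD := det_coe_ne_zero g
  have hd : g 0 0 * g 1 1 - g 0 1 * g 1 0 ≠ 0 := by rwa [Matrix.det_fin_two] at hD
  have hm := integral_moebius μ hH hd
  have hrow0 : ∀ x, (lowerUnipOmega x * g : GL (Fin 2) F) 1 0 = g 0 0 - x * g 1 0 := by
    intro x
    rw [Units.val_mul, lowerUnipOmega_val, Matrix.mul_apply, Fin.sum_univ_two]
    simp [sub_eq_add_neg]
  have hrow1 : ∀ x, (lowerUnipOmega x * g : GL (Fin 2) F) 1 1 = g 0 1 - x * g 1 1 := by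
    intro x
    rw [Units.val_mul, lowerUnipOmega_val, Matrix.mul_apply, Fin.sum_univ_two]
    simp [sub_eq_add_neg]
  have hdet : ∀ x, ((lowerUnipOmega x * g : GL (Fin 2) F) : Matrix (Fin 2) (Fin 2) F).det =
      (g : Matrix (Fin 2) (Fin 2) F).det := by
    intro x
    rw [Units.val_mul, Matrix.det_mul, lowerUnipOmega_val]
    simp
  have hae : ∀ᵐ x ∂μ, g 0 0 - x * g 1 0 ≠ 0 := by
    rw [ae_iff]
    refine Set.Subsingleton.measure_zero ?_ μ
    intro x hx y hy
    simp only [ne_eq, not_not, Set.mem_ofPred_eq] at hx hy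
    have hne : g 1 0 ≠ 0 := by
      intro h0
      rw [h0, mul_zero, sub_zero] at hx
      exact hd (by rw [h0, hx]; ring)
    exact mul_right_cancel₀ hne (by linear_combination hy - hx)
  have h1 : ∀ᵐ x ∂μ, h (lowerUnipOmega x * g) =
      (absF (g : Matrix (Fin 2) (Fin 2) F).det : ℝ) * H (g 0 0 - x * g 1 0) (g 0 1 - x * g 1 1) := by
    filter_upwards [hae] with x hx
    rw [hh.apply (by rwa [hrow0]), hdet, hrow0, hrow1]
    simp only [hHdef, hx, if_false]
  have h2 : ∫ x, H (g 0 0 - x * g 1 0) (g 0 1 - x * g 1 1) ∂μ =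
      ∫ x, H (g 0 0 + x * g 1 0) (g 0 1 + x * g 1 1) ∂μ := by
    rw [← integral_neg_eq_self]
    refine integral_congr_ae (Eventually.of_forall fun x => ?_)
    simp [sub_eq_add_neg]
  have h3 : ∫ x, h (lowerUnipOmega x) ∂μ = ∫ x, H 1 x ∂μ := by
    rw [← integral_neg_eq_self]
    refine integral_congr_ae (Eventually.of_forall fun x => ?_)
    simp [hHdef]
  rw [integral_congr_ae h1, integral_const_mul, h2, hm, h3, ← mul_assoc, Matrix.det_fin_two]
  have := absF_ne_zero hd
  push_cast
  rw [mul_inv_cancel₀ (by exact_mod_cast this), one_mul]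

lemma integrable_sphericalFun :
    Integrable (fun x : F => (sphericalFun (lowerUnipOmega x) : ℝ)) μ := by
  have hc : Continuous fun x : F => (sphericalFun (lowerUnipOmega x) : ℝ) :=
    NNReal.continuous_coe.comp (continuous_sphericalFun.comp continuous_lowerUnipOmega)
  rw [← integrableOn_univ, ← Set.union_compl_self (ballF 0)]
  refine IntegrableOn.union (hc.continuousOn.integrableOn_compact (isCompact_ballF 0)) ?_
  refine ⟨hc.aestronglyMeasurable, ?_⟩
  rw [hasFiniteIntegral_iff_enorm]
  have : ∫⁻ x in (ballF 0)ᶜ, ‖(sphericalFun (lowerUnipOmega x) : ℝ)‖ₑ ∂μ =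
      ∫⁻ x in (ballF 0)ᶜ, ((absF x ^ 2)⁻¹ : ℝ≥0) ∂μ := by
    refine setLIntegral_congr_fun (measurableSet_ballF 0).compl fun x hx => ?_
    rw [sphericalFun_lowerUnipOmega, if_neg (by simpa [mem_ballF] using hx), NNReal.enorm_eq]
  rw [this, lintegral_tail]
  exact ENNReal.coe_lt_top

lemma integral_sphericalFun_pos : 0 < ∫ x : F, (sphericalFun (lowerUnipOmega x) : ℝ) ∂μ := by
  rw [integral_pos_iff_support_of_nonneg (fun x => NNReal.coe_nonneg _) (integrable_sphericalFun μ)]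
  have : (Function.support fun x : F => (sphericalFun (lowerUnipOmega x) : ℝ)) = Set.univ := by
    refine Set.eq_univ_of_forall fun x => ?_
    simpa using (sphericalFun_pos _).ne'
  rw [this]
  exact isOpen_univ.measure_pos μ ⟨0, trivial⟩

variable [MeasurableSpace (GL (Fin 2) F)] [BorelSpace (GL (Fin 2) F)]
  (μG : Measure (GL (Fin 2) F)) [μG.IsHaarMeasure]

lemma integral_maxCompact_translate (h : GL (Fin 2) F → ℂ) {l : GL (Fin 2) F}
    (hl : l ∈ maxCompact F) :
    ∫ k in maxCompact F, h (l * k) ∂μG = ∫ k in maxCompact F, h k ∂μG := by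
  have hm := (isOpen_maxCompact F).measurableSet
  rw [← integral_indicator hm, ← integral_indicator hm, 
    ← integral_mul_left_eq_self ((maxCompact F).indicator h) l]
  congr 1
  ext k
  have : l * k ∈ maxCompact F ↔ k ∈ maxCompact F :=
    ⟨fun h => by simpa using mul_mem_maxCompact (inv_mem_maxCompact hl) h, mul_mem_maxCompact hl⟩
  by_cases hk : k ∈ maxCompact F
  · rw [Set.indicator_of_mem hk, Set.indicator_of_mem (this.2 hk)]
  · rw [Set.indicator_of_notMem hk, Set.indicator_of_notMem (mt this.1 hk)]

/-- Integration of modular functions over the maximal compact subgroup is proportional to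
integration over the big cell. -/
lemma integral_maxCompact_eq {h : GL (Fin 2) F → ℂ} (hh : HasModularLaw h) (hc : Continuous h) :
    (∫ x : F, (sphericalFun (lowerUnipOmega x) : ℝ) ∂μ : ℝ) * ∫ k in maxCompact F, h k ∂μG =
      μG.real (maxCompact F) * ∫ x, h (lowerUnipOmega x) ∂μ := by
  have hfin : IsFiniteMeasure (μG.restrict (maxCompact F)) :=
    ⟨by simpa using (isCompact_maxCompact F).measure_lt_top⟩
  obtain ⟨M, hM⟩ := (isCompact_maxCompact F).exists_bound_of_continuousOn hc.continuousOn
  -- By the Iwasawa decomposition h is controlled by its maximum on the compact group. The majorant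
  -- is right invariant under that group and integrable over the big cell, which justifies Fubini.
  have hbound : ∀ g, ‖h g‖ ≤ M * sphericalFun g := by
    intro g
    obtain ⟨b, k, hb, hk, rfl⟩ := exists_borel_mul_maxCompact g
    have h1 := modChar_eq_spherical (g := k) hb
    rw [sphericalFun_maxCompact hk] at h1
    rw [hh b k hb]
    have h2 : modChar b = (sphericalFun (b * k) : ℝ) := by simpa using h1
    rw [h2, norm_mul, mul_comm]
    refine mul_le_mul (hM k hk) (by simp) (norm_nonneg _) ((norm_nonneg _).trans (hM k hk))
  have hcont : Continuous fun p : F × GL (Fin 2) F => h (lowerUnipOmega p.1 * p.2) :=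
    hc.comp ((continuous_lowerUnipOmega.comp continuous_fst).mul continuous_snd)
  have hint : Integrable (Function.uncurry fun (x : F) (k : GL (Fin 2) F) => h (lowerUnipOmega x * k))
      (μ.prod (μG.restrict (maxCompact F))) := by
    refine Integrable.mono' (((integrable_sphericalFun μ).const_mul M).comp_fst
      (μG.restrict (maxCompact F))) hcont.aestronglyMeasurable ?_
    have hK : ∀ᵐ p : F × GL (Fin 2) F ∂(μ.prod (μG.restrict (maxCompact F))), p.2 ∈ maxCompact F := by
      have h1 : ∀ᵐ k ∂(μG.restrict (maxCompact F)), k ∈ maxCompact F :=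
        ae_restrict_mem (isOpen_maxCompact F).measurableSet
      exact Measure.quasiMeasurePreserving_snd.ae h1
    filter_upwards [hK] with p hp
    refine (hbound _).trans ?_
    rw [sphericalFun, iwasawaExp_mul_maxCompact _ hp, sphericalFun]
  have hswap := integral_integral_swap hint
  -- With nω = b l in Iwasawa form, b contributes the modular factor, which is the spherical
  -- function at nω, and l is absorbed by invariance. In the other order the inner integral does not
  -- depend on k, by right invariance over the big cell.
  have hL : ∀ x : F, ∫ k in maxCompact F, h (lowerUnipOmega x * k) ∂μG =
      (sphericalFun (lowerUnipOmega x) : ℝ) * ∫ k in maxCompact F, h k ∂μG := by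
    intro x
    obtain ⟨b, l, hb, hl, hx⟩ := exists_borel_mul_maxCompact (lowerUnipOmega x)
    have h1 := modChar_eq_spherical (g := l) hb
    rw [sphericalFun_maxCompact hl, ← hx] at h1
    rw [← h1, ← integral_maxCompact_translate μG h hl, hx]
    simp_rw [mul_assoc, hh b _ hb]
    rw [integral_const_mul]
    simp
  simp_rw [hL] at hswap
  rw [integral_mul_const, integral_complex_ofReal] at hswap
  rw [hswap]
  simp_rw [integral_lowerUnipOmega_mul μ hh]
  rw [integral_const, Complex.real_smul]
  congr 2
  rw [Measure.real, Measure.real, Measure.restrict_apply_univ]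

/-- There is a constant comparing the integrals over the maximal compact subgroup and the
big cell. -/
lemma exists_maxCompact_const : ∃ c : ℝ, 0 < c ∧ ∀ h : GL (Fin 2) F → ℂ, IsModular h →
    ∫ k in maxCompact F, h k ∂μG = c * ∫ x, h (lowerUnipOmega x) ∂μ := by
  have hI := integral_sphericalFun_pos μ
  have hK : 0 < μG.real (maxCompact F) := ENNReal.toReal_pos
    ((isOpen_maxCompact F).measure_pos μG ⟨1, one_mem_maxCompact F⟩).ne'
    (isCompact_maxCompact F).measure_lt_top.ne
  refine ⟨μG.real (maxCompact F) / ∫ x : F, (sphericalFun (lowerUnipOmega x) : ℝ) ∂μ,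
    div_pos hK hI, fun h hh => ?_⟩
  have := integral_maxCompact_eq μ μG hh.2 hh.1.continuous
  have hne : ((∫ x : F, (sphericalFun (lowerUnipOmega x) : ℝ) ∂μ : ℝ) : ℂ) ≠ 0 := by
    exact_mod_cast hI.ne'
  rw [Complex.ofReal_div, div_mul_eq_mul_div, eq_div_iff hne, mul_comm, this]

end Modular

end LocalToric

end

noncomputable section

namespace LocalToric

/-! ### The quadratic algebra -/

section QuadraticAlgebra

variable {F K : Type*} [Field F] [ValuativeRel F] [TopologicalSpace F]
  [IsNonarchimedeanLocalField F] [CommRing K] [Algebra F K] [Algebra.IsQuadraticExtension F K]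
  (ι : K →ₐ[F] Matrix (Fin 2) (Fin 2) F)

/-- The norm, computed as the determinant of the image under the embedding. -/
def nrm (x : K) : F := (ι x).det

/-- The trace, computed as the trace of the image under the embedding. -/
def trc (x : K) : F := (ι x).trace

/-- The conjugate of an element. -/
def cnj (x : K) : K := algebraMap F K (trc ι x) - x

variable {ι}

lemma nrm_mul (x y : K) : nrm ι (x * y) = nrm ι x * nrm ι y := by simp [nrm]

lemma nrm_algebraMap (a : F) : nrm ι (algebraMap F K a) = a ^ 2 := by
  rw [nrm, ι.commutes, Algebra.algebraMap_eq_smul_one]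
  simp

lemma nrm_smul (a : F) (x : K) : nrm ι (a • x) = a ^ 2 * nrm ι x := by
  rw [Algebra.smul_def, nrm_mul, nrm_algebraMap]

lemma nrm_one : nrm ι (1 : K) = 1 := by simp [nrm]

/-- Conjugation becomes the adjugate, so x x̄ = N(x) and multiplicativity are identities of 2 × 2
matrices. The argument is uniform in fields and the split algebra. -/
lemma emb_cnj (x : K) : ι (cnj ι x) = (ι x).adjugate := by
  rw [cnj, map_sub, ι.commutes, trc]
  ext i j
  fin_cases i <;> fin_cases j <;>
    simp [Matrix.adjugate_fin_two, Matrix.algebraMap_matrix_apply, Matrix.trace_fin_two]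

variable (hι : NotInBorel ι)

include hι

lemma mul_cnj (x : K) : x * cnj ι x = algebraMap F K (nrm ι x) := by
  apply emb_injective hι
  rw [map_mul, emb_cnj, Matrix.mul_adjugate, ι.commutes, Algebra.algebraMap_eq_smul_one, nrm]

lemma cnj_mul (x y : K) : cnj ι (x * y) = cnj ι x * cnj ι y := by
  apply emb_injective hι
  rw [emb_cnj, map_mul, Matrix.adjugate_mul_distrib, mul_comm (cnj ι x), map_mul, emb_cnj, emb_cnj]

lemma isUnit_of_nrm_ne_zero {x : K} (hx : nrm ι x ≠ 0) : IsUnit x := by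
  refine IsUnit.of_mul_eq_one ((nrm ι x)⁻¹ • cnj ι x) ?_
  rw [mul_smul_comm, mul_cnj hι, Algebra.algebraMap_eq_smul_one, smul_smul, inv_mul_cancel₀ hx, one_smul]

lemma nrm_units_ne_zero (u : Kˣ) : nrm ι (u : K) ≠ 0 := det_coe_ne_zero (unitsEmb ι u)

lemma nrm_cnj (x : K) : nrm ι (cnj ι x) = nrm ι x := by
  rw [nrm, emb_cnj, Matrix.det_adjugate]
  simp [nrm]

lemma algebraMap_injective_of_emb : Function.Injective (algebraMap F K) := by
  intro a b h
  have h1 := congrArg ι h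
  rw [ι.commutes, ι.commutes] at h1
  have := congrFun (congrFun h1 0) 0
  simpa [Matrix.algebraMap_matrix_apply] using this

lemma isIntegral_algebraMap_iff_abs {a : F} : IsIntegral 𝒪[F] (algebraMap F K a) ↔ absF a ≤ 1 := by
  rw [isIntegral_algebraMap_iff (algebraMap_injective_of_emb hι), ← mem_integer_iff]
  constructor
  · exact Valuation.Integers.mem_of_integral (Valuation.integer.integers (valuation F))
  · intro ha
    exact isIntegral_algebraMap (x := (⟨a, ha⟩ : 𝒪[F]))

/-- Conjugation as a ring homomorphism. -/
def cnjHom : K →+* K where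
  toFun := cnj ι
  map_one' := by
    apply emb_injective hι
    rw [emb_cnj, map_one, Matrix.adjugate_one]
  map_mul' := cnj_mul hι
  map_zero' := by simp [cnj, trc]
  map_add' x y := by simp only [cnj, trc, map_add, Matrix.trace_add]; ring

lemma cnj_algebraMap (a : F) : cnj ι (algebraMap F K a) = algebraMap F K a := by
  rw [cnj, trc, ι.commutes]
  have : (algebraMap F (Matrix (Fin 2) (Fin 2) F) a).trace = a + a := by
    simp [Matrix.trace_fin_two, Matrix.algebraMap_matrix_apply]
  rw [this, map_add, add_sub_cancel_right]

lemma isIntegral_cnj {x : K} (hx : IsIntegral 𝒪[F] x) : IsIntegral 𝒪[F] (cnj ι x) := by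
  let f : K →ₐ[𝒪[F]] K := { cnjHom hι with
    commutes' := fun r => cnj_algebraMap hι (r : F) }
  exact hx.map f

/-- Conjugation is an O-algebra map, so it preserves integrality, and x + x̄ and x x̄ are integral
elements of F when x is integral. Conversely x is a root of X² - tr(x) X + N(x). -/
lemma isIntegral_iff {x : K} : IsIntegral 𝒪[F] x ↔ absF (trc ι x) ≤ 1 ∧ absF (nrm ι x) ≤ 1 := by
  constructor
  · intro hx
    have hc := isIntegral_cnj hι hx
    rw [← isIntegral_algebraMap_iff_abs hι, ← isIntegral_algebraMap_iff_abs hι (a := nrm ι x),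
      ← mul_cnj hι]
    refine ⟨?_, hx.mul hc⟩
    have : algebraMap F K (trc ι x) = x + cnj ι x := by rw [cnj]; ring
    rw [this]
    exact hx.add hc
  · rintro ⟨h1, h2⟩
    rw [← mem_integer_iff] at h1 h2
    refine ⟨Polynomial.X ^ 2 - Polynomial.C ⟨_, h1⟩ * Polynomial.X + Polynomial.C ⟨_, h2⟩, by monicity!, ?_⟩
    have h3 := mul_cnj hι x
    rw [cnj] at h3
    have e1 : algebraMap 𝒪[F] K ⟨trc ι x, h1⟩ = algebraMap F K (trc ι x) := rfl
    have e2 : algebraMap 𝒪[F] K ⟨nrm ι x, h2⟩ = algebraMap F K (nrm ι x) := rfl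
    simp only [Polynomial.eval₂_add, Polynomial.eval₂_sub, Polynomial.eval₂_pow, Polynomial.eval₂_X,
      Polynomial.eval₂_mul, Polynomial.eval₂_C]
    rw [e1, e2]
    linear_combination -h3

omit hι in
-- The bottom row identifies K with F², and multiplication by x becomes right multiplication of row
-- vectors by ι(x). The norm is therefore the determinant of the transpose of ι(x).
lemma norm_eq_nrm (hι : NotInBorel ι) (x : K) : Algebra.norm F x = nrm ι x := by
  have hfin := finite_of_quadratic (F := F) (K := K)
  let e := (bottomRow ι).linearEquivOfInjective (bottomRow_injective hι)
    (by rw [Algebra.IsQuadraticExtension.finrank_eq_two F K]; simp)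
  have he : ∀ y, e y = ι y 1 := fun y => rfl
  rw [Algebra.norm_apply, ← LinearMap.det_conj _ e]
  have : (e : K →ₗ[F] Fin 2 → F) ∘ₗ (LinearMap.mul F K x) ∘ₗ (e.symm : (Fin 2 → F) →ₗ[F] K) =
      Matrix.toLin' (ι x).transpose := by
    refine LinearMap.ext fun v => ?_
    obtain ⟨y, rfl⟩ := e.surjective v
    simp only [LinearMap.comp_apply, LinearEquiv.coe_coe, LinearEquiv.symm_apply_apply,
      Matrix.toLin'_apply, Matrix.mulVec_transpose]
    rw [he, he, LinearMap.mul_apply', mul_comm, map_mul]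
    rfl
  refine (congrArg LinearMap.det this).trans ?_
  rw [LinearMap.det_toLin', Matrix.det_transpose, nrm]

end QuadraticAlgebra

/-! ### Integral generators -/

section Generator

variable {F K : Type*} [Field F] [ValuativeRel F] [TopologicalSpace F]
  [IsNonarchimedeanLocalField F] [CommRing K] [Algebra F K] [Algebra.IsQuadraticExtension F K]
  (ι : K →ₐ[F] Matrix (Fin 2) (Fin 2) F)

/-- The element `a + b τ`. -/
def lin (τ : K) (a b : F) : K := algebraMap F K a + b • τ

/-- The quadratic form `a² + a b S + b² P`. -/
def qform (τ : K) (a b : F) : F := a ^ 2 + a * b * trc ι τ + b ^ 2 * nrm ι τ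

/-- `τ` generates the ring of integers of `K` over the ring of integers of `F`. -/
structure IsGen (τ : K) : Prop where
  notInBorel : NotInBorel ι
  lower_ne_zero : ι τ 1 0 ≠ 0
  isIntegral_iff : ∀ a b : F, IsIntegral 𝒪[F] (lin τ a b) ↔ absF a ≤ 1 ∧ absF b ≤ 1

variable {ι} {τ : K}

lemma nrm_lin (a b : F) : nrm ι (lin τ a b) = qform ι τ a b := by
  rw [nrm, lin, map_add, map_smul, ι.commutes, qform, trc, nrm, Matrix.det_fin_two, Matrix.det_fin_two,
    Matrix.trace_fin_two]
  simp [Matrix.algebraMap_matrix_apply]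
  ring

lemma emb_lin_lower (a b : F) : ι (lin τ a b) 1 0 = b * ι τ 1 0 := by
  rw [lin, map_add, map_smul, ι.commutes]
  simp [Matrix.algebraMap_matrix_apply]

lemma emb_lin_diag (a b : F) : ι (lin τ a b) 1 1 = a + b * ι τ 1 1 := by
  rw [lin, map_add, map_smul, ι.commutes]
  simp [Matrix.algebraMap_matrix_apply]

lemma smul_lin (c a b : F) : c • lin τ a b = lin τ (c * a) (c * b) := by
  rw [lin, lin, smul_add, smul_smul, map_mul, Algebra.smul_def]

lemma lin_one_zero : lin τ (1 : F) 0 = 1 := by simp [lin]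

lemma lin_zero_right (a : F) : lin τ a 0 = algebraMap F K a := by simp [lin]

variable (ι) in
/-- The coefficient of `τ`. -/
def coB (τ x : K) : F := ι x 1 0 / ι τ 1 0

variable (ι) in
/-- The constant coefficient with respect to the basis `1, τ`. -/
def coA (τ x : K) : F := ι x 1 1 - coB ι τ x * ι τ 1 1

lemma lin_coA_coB (hτ : IsGen ι τ) (x : K) : lin τ (coA ι τ x) (coB ι τ x) = x := by
  apply bottomRow_injective hτ.notInBorel
  funext j
  change ι (lin τ (coA ι τ x) (coB ι τ x)) 1 j = ι x 1 j
  fin_cases j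
  · exact (emb_lin_lower _ _).trans (div_mul_cancel₀ _ hτ.lower_ne_zero)
  · exact (emb_lin_diag _ _).trans (sub_add_cancel _ _)

lemma coB_lin (hτ : IsGen ι τ) (a b : F) : coB ι τ (lin τ a b) = b := by
  rw [coB, emb_lin_lower, mul_div_cancel_right₀ _ hτ.lower_ne_zero]

lemma coA_lin (hτ : IsGen ι τ) (a b : F) : coA ι τ (lin τ a b) = a := by
  rw [coA, coB_lin hτ, emb_lin_diag, add_sub_cancel_right]

lemma exists_lin (hτ : IsGen ι τ) (x : K) : ∃ a b : F, x = lin τ a b :=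
  ⟨_, _, (lin_coA_coB hτ x).symm⟩

lemma isIntegral_gen (hτ : IsGen ι τ) : IsIntegral 𝒪[F] τ := by
  have := (hτ.isIntegral_iff 0 1).2 ⟨by simp, by simp⟩
  simpa [lin] using this

lemma abs_trc_gen (hτ : IsGen ι τ) : absF (trc ι τ) ≤ 1 :=
  ((isIntegral_iff hτ.notInBorel).1 (isIntegral_gen hτ)).1

lemma abs_nrm_gen (hτ : IsGen ι τ) : absF (nrm ι τ) ≤ 1 :=
  ((isIntegral_iff hτ.notInBorel).1 (isIntegral_gen hτ)).2

lemma gen_sq (hτ : IsGen ι τ) : τ * τ = lin τ (-nrm ι τ) (trc ι τ) := by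
  have := mul_cnj hτ.notInBorel τ
  rw [cnj] at this
  rw [lin, map_neg, ← this, Algebra.smul_def]
  ring

lemma lin_mul_lin (hτ : IsGen ι τ) (a b c d : F) : lin τ a b * lin τ c d =
    lin τ (a * c - b * d * nrm ι τ) (a * d + b * c + b * d * trc ι τ) := by
  have h := gen_sq hτ
  simp only [lin, Algebra.smul_def, map_sub, map_add, map_mul, map_neg] at h ⊢
  linear_combination (algebraMap F K b * algebraMap F K d) * h

lemma cnj_lin (a b : F) : cnj ι (lin τ a b) = lin τ (a + b * trc ι τ) (-b) := by
  have h : trc ι (lin τ a b) = a + a + b * trc ι τ := by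
    rw [trc, lin, map_add, map_smul, ι.commutes, Matrix.trace_add, Matrix.trace_smul, trc]
    simp [Matrix.trace_fin_two, Matrix.algebraMap_matrix_apply]
  rw [cnj, h, lin, lin, Algebra.smul_def, Algebra.smul_def]
  simp only [map_add, map_mul, map_neg]
  ring

lemma abs_qform_le (hτ : IsGen ι τ) (a b : F) :
    absF (qform ι τ a b) ≤ max (absF a) (absF b) ^ 2 := by
  have hS := abs_trc_gen hτ
  have hP := abs_nrm_gen hτ
  set m := max (absF a) (absF b)
  have ha : absF a ≤ m := le_max_left _ _
  have hb : absF b ≤ m := le_max_right _ _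
  rw [qform]
  refine (absF_add_le _ _).trans (max_le ((absF_add_le _ _).trans (max_le ?_ ?_)) ?_)
  · rw [absF_pow]; gcongr
  · rw [absF_mul, absF_mul, pow_two]
    calc absF a * absF b * absF (trc ι τ) ≤ m * m * 1 := by gcongr
      _ = m * m := mul_one _
  · rw [absF_mul, absF_pow]
    calc absF b ^ 2 * absF (nrm ι τ) ≤ m ^ 2 * 1 := by gcongr
      _ = m ^ 2 := mul_one _

lemma abs_qform_of_lt (hτ : IsGen ι τ) {a b : F} (h : absF b < absF a) :
    absF (qform ι τ a b) = absF a ^ 2 := by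
  have hS := abs_trc_gen hτ
  have hP := abs_nrm_gen hτ
  have ha : 0 < absF a := lt_of_le_of_lt zero_le h
  rw [qform, add_assoc, absF_add_eq_of_lt, absF_pow]
  rw [absF_pow]
  refine (absF_add_le _ _).trans_lt (max_lt ?_ ?_)
  · rw [absF_mul, absF_mul, pow_two]
    calc absF a * absF b * absF (trc ι τ) ≤ absF a * absF b * 1 := by gcongr
      _ = absF a * absF b := mul_one _
      _ < absF a * absF a := by gcongr
  · rw [absF_mul, absF_pow]
    calc absF b ^ 2 * absF (nrm ι τ) ≤ absF b ^ 2 * 1 := by gcongr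
      _ = absF b ^ 2 := mul_one _
      _ < absF a ^ 2 := by gcongr

lemma qform_mul (c a b : F) : qform ι τ (c * a) (c * b) = c ^ 2 * qform ι τ a b := by
  rw [qform, qform]; ring

/-- Existence of an integral generator. -/
lemma exists_isGen [CharZero F] [Algebra.Etale F K] (hι : NotInBorel ι) : ∃ τ : K, IsGen ι τ := by
  obtain ⟨t, ht⟩ := hι
  have hι : NotInBorel ι := ⟨t, ht⟩
  have hred : IsReduced K := Algebra.FormallyUnramified.isReduced_of_field F K
  set disc : K → F := fun x => trc ι x ^ 2 - 4 * nrm ι x with hdisc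
  -- ι(t)₁₀ x - ι(x)₁₀ t has lower left entry zero and is therefore a scalar. So the discriminant is
  -- a constant multiple of the square of the lower left entry.
  have hdlin : ∀ x : K, disc x * (ι t 1 0) ^ 2 = (ι x 1 0) ^ 2 * disc t := by
    intro x
    obtain ⟨a, ha⟩ := mem_scalars_of_lower_eq_zero hι
      (x := (ι t 1 0) • x - (ι x 1 0) • (t : K)) (by simp [mul_comm])
    have hx : (ι t 1 0) • x = lin (t : K) a (ι x 1 0) := by rw [lin, ha]; ring
    have h1 : nrm ι ((ι t 1 0) • x) = qform ι (t : K) a (ι x 1 0) := by rw [hx, nrm_lin]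
    have h2 : trc ι ((ι t 1 0) • x) = a + a + ι x 1 0 * trc ι (t : K) := by
      rw [hx, trc, lin, map_add, map_smul, ι.commutes, Matrix.trace_add, Matrix.trace_smul, trc]
      simp [Matrix.trace_fin_two, Matrix.algebraMap_matrix_apply]
    rw [nrm_smul] at h1
    have h2' : ι t 1 0 * trc ι x = a + a + ι x 1 0 * trc ι (t : K) := by
      rw [← h2, trc, trc, map_smul, Matrix.trace_smul, smul_eq_mul]
    rw [qform] at h1
    simp only [hdisc]
    linear_combination (ι t 1 0 * trc ι x + (a + a + ι x 1 0 * trc ι (t : K))) * h2' - 4 * h1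
  -- If the discriminant vanished, 2t - tr(t) would have square zero, hence be zero because an étale
  -- algebra is reduced. Its lower left entry 2ι(t)₁₀ is nonzero in characteristic 0.
  have hd0 : disc t ≠ 0 := by
    intro h0
    set y : K := (2 : F) • (t : K) - algebraMap F K (trc ι (t : K)) with hy
    have hyy : y ^ 2 = 0 := by
      have h1 := mul_cnj hι (t : K)
      rw [cnj] at h1
      have h2 : algebraMap F K (disc t) = 0 := by rw [h0, map_zero]
      simp only [hdisc, map_sub, map_mul, map_pow, map_ofNat] at h2
      rw [hy, Algebra.smul_def, map_ofNat]
      linear_combination h2 - 4 * h1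
    have hy0 : y = 0 := by
      exact (pow_eq_zero_iff two_ne_zero).1 hyy
    have h3 : ι y 1 0 = 2 * ι t 1 0 := by
      rw [hy, map_sub, map_smul, ι.commutes]
      simp [Matrix.algebraMap_matrix_apply]
    rw [hy0, map_zero] at h3
    exact mul_ne_zero two_ne_zero ht h3.symm
  -- The generator is a nonscalar integral element whose lower left entry has least valuation. The
  -- valuations are bounded below because integral elements have integral discriminant.
  set Q : ℤ → Prop := fun n => ∃ x : K, IsIntegral 𝒪[F] x ∧ ι x 1 0 ≠ 0 ∧ ord (ι x 1 0) = n with hQ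
  have hbdd : ∃ b, ∀ z, Q z → b ≤ z := by
    have hr : 0 < absF (disc t) / absF (ι t 1 0) ^ 2 :=
      div_pos (absF_pos.2 hd0) (pow_pos (absF_pos.2 ht) 2)
    obtain ⟨N, hN⟩ := exists_zpow_lt (F := F) hr
    refine ⟨-N, ?_⟩
    rintro z ⟨x, hx, hx0, rfl⟩
    obtain ⟨h1, h2⟩ := (isIntegral_iff hι).1 hx
    have h4 : absF (4 : F) ≤ 1 := by
      have : (4 : F) ∈ 𝒪[F] := ofNat_mem _ 4
      exact mem_integer_iff.1 this
    have hdx : absF (disc x) ≤ 1 := by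
      refine (absF_sub_le _ _).trans (max_le ?_ ?_)
      · rw [absF_pow]; exact pow_le_one₀ zero_le h1
      · rw [absF_mul]; exact mul_le_one₀ h4 zero_le h2
    have h5 := congrArg absF (hdlin x)
    rw [absF_mul, absF_mul, absF_pow, absF_pow] at h5
    have h6 : absF (ι x 1 0) ^ 2 * (absF (disc t) / absF (ι t 1 0) ^ 2) ≤ 1 := by
      rw [← mul_div_assoc, ← h5, mul_div_cancel_right₀ _ (pow_pos (absF_pos.2 ht) 2).ne']
      exact hdx
    by_contra! hlt
    have h7 : qN F ^ (N : ℤ) < absF (ι x 1 0) := by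
      rw [absF_eq_zpow hx0]
      exact zpow_lt_zpow_right₀ (one_lt_qN F) (by omega)
    have h8 : (1 : ℝ≥0) ≤ qN F ^ (N : ℤ) := one_le_zpow₀ (one_lt_qN F).le (by omega)
    have h9 : qN F ^ (N : ℤ) ≤ absF (ι x 1 0) ^ 2 := by
      rw [pow_two]
      exact h7.le.trans (le_mul_of_one_le_left zero_le (h8.trans h7.le))
    have h10 : (1 : ℝ≥0) < absF (ι x 1 0) ^ 2 * (absF (disc t) / absF (ι t 1 0) ^ 2) := by
      calc (1 : ℝ≥0) = qN F ^ (N : ℤ) * qN F ^ (-(N : ℤ)) := by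
            rw [← zpow_add₀ (qN_ne_zero F)]; simp
        _ < qN F ^ (N : ℤ) * (absF (disc t) / absF (ι t 1 0) ^ 2) := by
            gcongr
        _ ≤ _ := by gcongr
    exact absurd h6 (not_le.2 h10)
  -- A large power of the uniformizer makes the given nonscalar element t integral.
  have hne : ∃ z, Q z := by
    obtain ⟨N, hN⟩ := exists_lt_zpow (F := F) (max (absF (trc ι (t : K))) (absF (nrm ι (t : K))))
    have hN1 : (1 : ℝ≥0) ≤ qN F ^ (N : ℤ) := one_le_zpow₀ (one_lt_qN F).le (by omega)
    have hup : absF (unif F ^ (N : ℤ)) * qN F ^ (N : ℤ) = 1 := by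
      rw [absF_unif_zpow, ← zpow_add₀ (qN_ne_zero F)]; simp
    refine ⟨_, unif F ^ (N : ℤ) • (t : K), (isIntegral_iff hι).2 ⟨?_, ?_⟩, ?_, rfl⟩
    · rw [trc, map_smul, Matrix.trace_smul, smul_eq_mul, absF_mul, ← hup]
      gcongr
      exact (le_max_left _ _).trans hN.le
    · rw [nrm_smul, absF_mul, absF_pow, ← hup]
      have : absF (unif F ^ (N : ℤ)) ^ 2 ≤ absF (unif F ^ (N : ℤ)) := by
        refine pow_le_of_le_one zero_le ?_ two_ne_zero
        rw [← hup]
        exact le_mul_of_one_le_right zero_le hN1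
      gcongr
      exact (le_max_right _ _).trans hN.le
    · rw [map_smul, Matrix.smul_apply, smul_eq_mul]
      exact mul_ne_zero (zpow_ne_zero _ (unif_ne_zero F)) ht
  obtain ⟨n, ⟨τ, hτ, hτ0, hn⟩, hmin⟩ := Int.exists_least_of_bdd hbdd hne
  refine ⟨τ, hι, hτ0, fun a b => ⟨fun h => ?_, fun ⟨ha, hb⟩ => ?_⟩⟩
  · have hb : absF b ≤ 1 := by
      rcases eq_or_ne b 0 with rfl | hb
      · simp
      · have h1 : ι (lin τ a b) 1 0 ≠ 0 := by
          rw [emb_lin_lower]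
          exact mul_ne_zero hb hτ0
        have h2 := hmin _ ⟨_, h, h1, rfl⟩
        rw [emb_lin_lower, ord_mul hb hτ0, hn] at h2
        have := absF_le_zpow_iff hb (n := 0)
        rw [zpow_zero] at this
        rw [this]
        omega
    refine ⟨?_, hb⟩
    rw [← isIntegral_algebraMap_iff_abs hι]
    have h3 : IsIntegral 𝒪[F] (b • τ) := by
      rw [Algebra.smul_def]
      exact ((isIntegral_algebraMap_iff_abs hι).2 hb).mul hτ
    have : algebraMap F K a = lin τ a b - b • τ := by rw [lin]; ring
    rw [this]
    exact h.sub h3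
  · rw [lin, Algebra.smul_def]
    exact ((isIntegral_algebraMap_iff_abs hι).2 ha).add (((isIntegral_algebraMap_iff_abs hι).2 hb).mul hτ)

lemma isEmbeddingExponent_gen (hτ : IsGen ι τ) : IsEmbeddingExponent ι (ord (ι τ 1 0)) := by
  have h0 := hτ.lower_ne_zero
  intro y
  constructor
  · rintro ⟨x, hx, rfl⟩
    obtain ⟨a, b, rfl⟩ := exists_lin hτ x
    obtain ⟨-, hb⟩ := (hτ.isIntegral_iff a b).1 hx
    rw [emb_lin_lower]
    rcases eq_or_ne b 0 with rfl | hb0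
    · simp
    · right
      rw [ord_mul hb0 h0]
      have := (absF_le_zpow_iff hb0 (n := 0)).1 (by simpa using hb)
      omega
  · intro h
    refine ⟨lin τ 0 (y / ι τ 1 0), (hτ.isIntegral_iff _ _).2 ⟨by simp, ?_⟩, ?_⟩
    · rcases eq_or_ne y 0 with rfl | hy
      · simp
      · have h1 := h.resolve_left hy
        rw [← zpow_zero (qN F), absF_le_zpow_iff (div_ne_zero hy h0), ord_div hy h0]
        omega
    · rw [emb_lin_lower, div_mul_cancel₀ _ h0]

end Generator

end LocalToric

end

noncomputable section

namespace LocalToric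

/-! ### The torus as a quotient of the projective line chart -/

/-- The torus as a commutative group. -/
abbrev torusCommGroup (F K : Type*) [Field F] [CommRing K] [Algebra F K] : CommGroup (Torus F K) :=
  { (QuotientGroup.Quotient.group (scalarUnits F K) : Group (Torus F K)) with
    mul_comm := fun a b => mul_comm (G := Torus F K) a b }

section TorusChart

attribute [local instance] torusCommGroup

variable {F K : Type*} [Field F] [ValuativeRel F] [TopologicalSpace F]
  [IsNonarchimedeanLocalField F] [CommRing K] [Algebra F K] [Algebra.IsQuadraticExtension F K]
  {ι : K →ₐ[F] Matrix (Fin 2) (Fin 2) F} {τ : K}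

lemma maximalIdeal_eq_span : 𝓂[F] = Ideal.span
    {(⟨unif F, mem_integer_iff.2 (by
      rw [absF_unif]; exact (inv_lt_one_of_one_lt₀ (one_lt_qN F)).le)⟩ : 𝒪[F])} := by
  ext x
  rw [IsLocalRing.mem_maximalIdeal, mem_nonunits_iff, Ideal.mem_span_singleton]
  constructor
  · intro h
    have h1 : absF (x : F) < 1 := by
      refine lt_of_le_of_ne (mem_integer_iff.1 x.2) fun h1 => h ?_
      have hx0 : (x : F) ≠ 0 := by rw [← absF_pos, h1]; exact one_pos
      refine IsUnit.of_mul_eq_one ⟨(x : F)⁻¹, mem_integer_iff.2 (by rw [absF_inv, h1, inv_one])⟩ ?_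
      ext
      exact mul_inv_cancel₀ hx0
    rw [absF_lt_one_iff] at h1
    refine ⟨⟨(x : F) / unif F, mem_integer_iff.2 ?_⟩, ?_⟩
    · rw [absF_div, absF_unif]
      exact div_le_one_of_le₀ h1 zero_le
    · ext
      exact (mul_div_cancel₀ _ (unif_ne_zero F)).symm
  · rintro ⟨y, rfl⟩ h
    obtain ⟨u, hu⟩ := h
    have h1 : unif F * (y : F) * ((u⁻¹ : 𝒪[F]ˣ) : 𝒪[F]) = 1 := by
      have := u.mul_inv
      rw [hu] at this
      exact congrArg Subtype.val this
    have h2 := congrArg absF h1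
    rw [absF_mul, absF_mul, absF_one, mul_assoc] at h2
    have h3 := mem_integer_iff.1 ((u⁻¹ : 𝒪[F]ˣ) : 𝒪[F]).2
    have h4 := mem_integer_iff.1 y.2
    refine absurd h2 (mul_lt_one_of_lt_of_le ?_ (mul_le_one₀ h4 zero_le h3)).ne
    rw [absF_unif]
    exact inv_lt_one_of_one_lt₀ (one_lt_qN F)

lemma mem_maximalIdeal_pow_iff (n : ℕ) (r : 𝒪[F]) :
    r ∈ 𝓂[F] ^ n ↔ absF (r : F) ≤ qN F ^ (-(n : ℤ)) := by
  rw [maximalIdeal_eq_span, Ideal.span_singleton_pow, Ideal.mem_span_singleton]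
  have hp : absF (unif F ^ n) = qN F ^ (-(n : ℤ)) := by
    rw [absF_pow, absF_unif, zpow_neg, zpow_natCast, inv_pow]
  have h0 : unif F ^ n ≠ 0 := pow_ne_zero _ (unif_ne_zero F)
  constructor
  · rintro ⟨y, rfl⟩
    change absF (unif F ^ n * (y : F)) ≤ _
    rw [absF_mul, hp]
    exact mul_le_of_le_one_right' (mem_integer_iff.1 y.2)
  · intro h
    refine ⟨⟨(r : F) / unif F ^ n, mem_integer_iff.2 ?_⟩, ?_⟩
    · rw [absF_div, hp]
      exact div_le_one_of_le₀ h zero_le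
    · ext
      exact (mul_div_cancel₀ _ h0).symm

open Classical in
variable (F) in
/-- The class in the torus of a unit of `K`, extended by `1`. -/
def toT (x : K) : Torus F K := if h : IsUnit x then QuotientGroup.mk h.unit else 1

lemma toT_units (u : Kˣ) : toT F (u : K) = QuotientGroup.mk u := by
  rw [toT, dif_pos u.isUnit]
  congr 1
  ext
  rfl

lemma toT_mul {x y : K} (hx : IsUnit x) (hy : IsUnit y) : toT F (x * y) = toT F x * toT F y := by
  obtain ⟨u, rfl⟩ := hx
  obtain ⟨v, rfl⟩ := hy
  rw [← Units.val_mul, toT_units, toT_units, toT_units]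
  rfl

lemma toT_algebraMap {c : F} (hc : c ≠ 0) : toT F (algebraMap F K c) = 1 := by
  have h : algebraMap F K c = (Units.map (algebraMap F K : F →* K) (Units.mk0 c hc) : Kˣ) := rfl
  rw [h, toT_units, QuotientGroup.eq_one_iff]
  exact ⟨_, rfl⟩

lemma toT_smul {c : F} (hc : c ≠ 0) (x : K) : toT F (c • x) = toT F x := by
  have hu : IsUnit (algebraMap F K c) := (isUnit_iff_ne_zero.2 hc).map _
  by_cases hx : IsUnit x
  · rw [Algebra.smul_def, toT_mul hu hx, toT_algebraMap hc, one_mul]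
  · have h : ¬ IsUnit (c • x) := by
      rw [Algebra.smul_def]
      exact fun h => hx (isUnit_of_mul_isUnit_right h)
    rw [toT, dif_neg h, toT, dif_neg hx]

lemma toT_one : toT F (1 : K) = 1 := toT_units (1 : Kˣ)

lemma out_mk (u : Kˣ) : ∃ c : F, c ≠ 0 ∧
    (((QuotientGroup.mk u : Torus F K).out : Kˣ) : K) = c • (u : K) := by
  obtain ⟨⟨_, c, rfl⟩, h⟩ := QuotientGroup.mk_out_eq_mul (scalarUnits F K) u
  refine ⟨c, c.ne_zero, ?_⟩
  rw [h, Units.val_mul, Algebra.smul_def, mul_comm]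
  rfl

lemma isUnit_lin (hτ : IsGen ι τ) {a b : F} (h : qform ι τ a b ≠ 0) : IsUnit (lin τ a b) :=
  isUnit_of_nrm_ne_zero hτ.notInBorel (by rwa [nrm_lin])

/-- The gauge of an order in the quadratic algebra, in coordinates. -/
def gauge (n : ℕ) (a b : F) : ℝ≥0 := max (absF b) (qN F ^ (-(n : ℤ)) * absF a)

lemma gauge_mul (n : ℕ) (c a b : F) : gauge n (c * a) (c * b) = absF c * gauge n a b := by
  rw [gauge, gauge, absF_mul, absF_mul, mul_max_of_nonneg _ _ zero_le]
  congr 1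
  ring

variable (ι) in
/-- The quotient of the norm by the square of the gauge. -/
def kfun (τ : K) (n : ℕ) (x : K) : ℝ≥0 :=
  absF (nrm ι x) / gauge n (coA ι τ x) (coB ι τ x) ^ 2

lemma kfun_lin (hτ : IsGen ι τ) (n : ℕ) (a b : F) :
    kfun ι τ n (lin τ a b) = absF (qform ι τ a b) / gauge n a b ^ 2 := by
  rw [kfun, nrm_lin, coA_lin hτ, coB_lin hτ]

lemma kfun_smul (hτ : IsGen ι τ) (n : ℕ) {c : F} (hc : c ≠ 0) (x : K) :
    kfun ι τ n (c • x) = kfun ι τ n x := by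
  obtain ⟨a, b, rfl⟩ := exists_lin hτ x
  rw [smul_lin, kfun_lin hτ, kfun_lin hτ, qform_mul, gauge_mul, absF_mul, absF_pow, mul_pow]
  exact mul_div_mul_left _ _ (pow_ne_zero 2 (absF_ne_zero hc))

variable (ι) in
/-- The function on the torus defined by `kfun`. -/
def kT (τ : K) (n : ℕ) (t : Torus F K) : ℝ≥0 := kfun ι τ n (t.out : Kˣ)

lemma kT_toT (hτ : IsGen ι τ) (n : ℕ) {x : K} (hx : IsUnit x) : kT ι τ n (toT F x) = kfun ι τ n x := by
  obtain ⟨u, rfl⟩ := hx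
  obtain ⟨c, hc, h⟩ := out_mk (F := F) u
  rw [toT_units, kT, h, kfun_smul hτ n hc]

lemma kT_chart (hτ : IsGen ι τ) (n : ℕ) {z : F} (hz : qform ι τ z 1 ≠ 0) :
    kT ι τ n (toT F (lin τ z 1)) =
      absF (qform ι τ z 1) / max 1 (qN F ^ (-(n : ℤ)) * absF z) ^ 2 := by
  rw [kT_toT hτ n (isUnit_lin hτ hz), kfun_lin hτ, gauge, absF_one]

/-- Membership in the unit filtration, in coordinates. -/
lemma mk_mem_unitFiltration_iff (hτ : IsGen ι τ) (n : ℕ) (u : Kˣ) :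
    (QuotientGroup.mk u : Torus F K) ∈ unitFiltration F K n ↔ ∃ c a b : F, c ≠ 0 ∧
      absF a ≤ 1 ∧ absF b ≤ qN F ^ (-(n : ℤ)) ∧ absF (qform ι τ a b) = 1 ∧ (u : K) = c • lin τ a b := by
  have hle : qN F ^ (-(n : ℤ)) ≤ 1 := zpow_le_one_of_nonpos₀ (one_lt_qN F).le (by omega)
  constructor
  · rintro ⟨v, huv, hv, hv', a, r, hr, y, hy, hva⟩
    obtain ⟨c, hc⟩ := QuotientGroup.eq.1 huv
    obtain ⟨a', b', rfl⟩ := exists_lin hτ y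
    obtain ⟨ha', hb'⟩ := (hτ.isIntegral_iff _ _).1 hy
    rw [mem_maximalIdeal_pow_iff] at hr
    have hr1 : absF (r : F) ≤ 1 := mem_integer_iff.1 r.2
    have h4 : (v : K) = lin τ (a + r * a') (r * b') := by
      rw [hva, lin, lin, Algebra.smul_def, Algebra.smul_def]
      simp only [map_add, map_mul]
      ring
    refine ⟨(c⁻¹ : Fˣ), a + r * a', r * b', Units.ne_zero _, ?_, ?_, ?_, ?_⟩
    · refine (absF_add_le _ _).trans (max_le (mem_integer_iff.1 a.2) ?_)
      rw [absF_mul]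
      exact mul_le_one₀ hr1 zero_le ha'
    · rw [absF_mul]
      exact (mul_le_of_le_one_right' hb').trans hr
    · have h1 := ((isIntegral_iff hτ.notInBorel).1 hv).2
      have h2 := ((isIntegral_iff hτ.notInBorel).1 hv').2
      have h3 : absF (nrm ι (v : K)) * absF (nrm ι ((v⁻¹ : Kˣ) : K)) = 1 := by
        rw [← absF_mul, ← nrm_mul, Units.mul_inv, nrm_one, absF_one]
      rw [← nrm_lin, ← h4]
      refine le_antisymm h1 ?_
      rw [← h3]
      exact mul_le_of_le_one_right' h2
    · rw [← h4]
      have h5 : v = u * Units.map (algebraMap F K : F →* K) c := by rw [hc]; simp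
      have h6 : (v : K) = (c : F) • (u : K) := by
        rw [h5, Algebra.smul_def, mul_comm]; rfl
      rw [h6, smul_smul, Units.inv_mul, one_smul]
  · rintro ⟨c, a, b, hc, ha, hb, hq, hu⟩
    have hq0 : qform ι τ a b ≠ 0 := by rw [← absF_pos, hq]; exact one_pos
    have hbu := hb.trans hle
    obtain ⟨v, hv⟩ := isUnit_lin hτ hq0
    have hn : nrm ι (v : K) = qform ι τ a b := by rw [hv, nrm_lin]
    have hint : IsIntegral 𝒪[F] (v : K) := by
      rw [hv]
      exact (hτ.isIntegral_iff _ _).2 ⟨ha, hbu⟩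
    refine ⟨v, ?_, hint, ?_, ⟨a, mem_integer_iff.2 ha⟩,
      ⟨unif F ^ n, mem_integer_iff.2 ?_⟩, ?_, lin τ 0 (b / unif F ^ n), ?_, ?_⟩
    · rw [← toT_units, hu, toT_smul hc, ← hv, toT_units]
    · have h1 : ((v⁻¹ : Kˣ) : K) = (qform ι τ a b)⁻¹ • cnj ι (v : K) := by
        have h2 := mul_cnj hτ.notInBorel (v : K)
        rw [hn] at h2
        apply v.isUnit.mul_left_cancel
        rw [Units.mul_inv, mul_smul_comm, h2, Algebra.smul_def, ← map_mul, inv_mul_cancel₀ hq0, map_one]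
      rw [h1, Algebra.smul_def]
      refine IsIntegral.mul ((isIntegral_algebraMap_iff_abs hτ.notInBorel).2 ?_)
        (isIntegral_cnj hτ.notInBorel hint)
      rw [absF_inv, hq, inv_one]
    · rw [absF_pow, absF_unif]
      exact pow_le_one₀ zero_le (inv_lt_one_of_one_lt₀ (one_lt_qN F)).le
    · rw [mem_maximalIdeal_pow_iff]
      simp [absF_pow, absF_unif]
    · refine (hτ.isIntegral_iff _ _).2 ⟨by simp, ?_⟩
      rw [absF_div, absF_pow, absF_unif]
      refine div_le_one_of_le₀ ?_ zero_le
      rwa [zpow_neg, zpow_natCast, ← inv_pow] at hb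
    · rw [hv, lin, lin]
      simp only [map_zero, zero_add]
      rw [Algebra.smul_def, Algebra.smul_def, ← mul_assoc, ← map_mul,
        mul_div_cancel₀ _ (pow_ne_zero n (unif_ne_zero F))]

lemma one_mem_unitFiltration (n : ℕ) : (1 : Torus F K) ∈ unitFiltration F K n :=
  ⟨1, rfl, isIntegral_one, by simpa using isIntegral_one, 1, 0, zero_mem _, 0, isIntegral_zero, by simp⟩

/-- For `n ≥ 1` the group `H_n` is a neighbourhood of infinity in the chart. -/
lemma toT_lin_mem_unitFiltration (hτ : IsGen ι τ) {n : ℕ} (hn : 1 ≤ n) {a b : F} (ha : a ≠ 0)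
    (h : absF b ≤ qN F ^ (-(n : ℤ)) * absF a) : toT F (lin τ a b) ∈ unitFiltration F K n := by
  have hlt : qN F ^ (-(n : ℤ)) < 1 := zpow_lt_one_of_neg₀ (one_lt_qN F) (by omega)
  have hb : absF (b / a) ≤ qN F ^ (-(n : ℤ)) := by
    rw [absF_div]
    exact div_le_of_le_mul₀ zero_le zero_le h
  have hq : absF (qform ι τ 1 (b / a)) = 1 := by
    rw [abs_qform_of_lt hτ (by rw [absF_one]; exact hb.trans_lt hlt), absF_one, one_pow]
  have hq0 : qform ι τ 1 (b / a) ≠ 0 := by rw [← absF_pos, hq]; exact one_pos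
  obtain ⟨u, hu⟩ := isUnit_lin hτ hq0
  have h1 : lin τ a b = a • (u : K) := by rw [hu, smul_lin, mul_one, mul_div_cancel₀ _ ha]
  rw [h1, toT_smul ha, toT_units, mk_mem_unitFiltration_iff hτ]
  exact ⟨1, 1, b / a, one_ne_zero, absF_one.le, hb, hq, by rw [one_smul, hu]⟩

/-- The complement of this ball is |z| ≥ q^n, where z + τ = z(1 + τ/z) with τ/z in 𝔭ⁿO_K. The
hypothesis n ≥ 1 makes 1 + τ/z a unit automatically. -/
lemma mem_unitFiltration_of_chart (hτ : IsGen ι τ) {n : ℕ} (hn : 1 ≤ n) {z : F}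
    (hz : z ∉ ballF ((n : ℤ) - 1)) : toT F (lin τ z 1) ∈ unitFiltration F K n := by
  have h1 : qN F ^ (n : ℤ) ≤ absF z := by
    rw [mem_ballF, ← absF_lt_zpow_iff, not_lt, sub_add_cancel] at hz
    exact hz
  have hz0 : z ≠ 0 := by
    rintro rfl
    rw [absF_zero, nonpos_iff_eq_zero] at h1
    exact (zpow_pos (qN_pos F) _).ne' h1
  refine toT_lin_mem_unitFiltration hτ hn hz0 ?_
  rw [absF_one]
  calc (1 : ℝ≥0) = qN F ^ (-(n : ℤ)) * qN F ^ (n : ℤ) := by rw [← zpow_add₀ (qN_ne_zero F)]; simp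
    _ ≤ _ := by gcongr

lemma gauge_pos (hn : ℕ) {a b : F} (h : qform ι τ a b ≠ 0) : 0 < gauge hn a b := by
  rw [gauge, lt_max_iff, absF_pos, mul_pos_iff_of_pos_left (zpow_pos (qN_pos F) _), absF_pos]
  by_contra! h0
  rw [h0.1, h0.2] at h
  simp [qform] at h

/-- Up to the factor q^n the gauge is the norm of the lattice O + 𝔭ⁿτ. This lattice is an order, and
a + bτ belongs to it, so multiplication by it cannot increase the gauge. -/
lemma gauge_mul_le (hτ : IsGen ι τ) (n : ℕ) {a b : F} (ha : absF a ≤ 1)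
    (hb : absF b ≤ qN F ^ (-(n : ℤ))) (c d : F) :
    gauge n (a * c - b * d * nrm ι τ) (a * d + b * c + b * d * trc ι τ) ≤ gauge n c d := by
  have hS := abs_trc_gen hτ
  have hP := abs_nrm_gen hτ
  have hle : qN F ^ (-(n : ℤ)) ≤ 1 := zpow_le_one_of_nonpos₀ (one_lt_qN F).le (by omega)
  have hd : absF d ≤ gauge n c d := le_max_left _ _
  have hc : qN F ^ (-(n : ℤ)) * absF c ≤ gauge n c d := le_max_right _ _
  have hbc : absF (b * c) ≤ gauge n c d := by
    rw [absF_mul]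
    exact (mul_le_mul_left hb _).trans hc
  have hb1 : absF b ≤ 1 := hb.trans hle
  refine max_le ?_ ?_
  · refine (absF_add_le _ _).trans (max_le ((absF_add_le _ _).trans (max_le ?_ hbc)) ?_)
    · rw [absF_mul]
      exact (mul_le_of_le_one_left' ha).trans hd
    · rw [absF_mul, absF_mul]
      exact (mul_le_of_le_one_right' hS).trans ((mul_le_of_le_one_left' hb1).trans hd)
  · refine (mul_le_mul_right (absF_sub_le _ _) _).trans ?_
    rw [mul_max_of_nonneg _ _ zero_le]
    refine max_le ?_ ?_
    · rw [absF_mul]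
      exact (mul_le_mul_right (mul_le_of_le_one_left' ha) _).trans hc
    · rw [absF_mul, absF_mul]
      exact (mul_le_of_le_one_left' hle).trans ((mul_le_of_le_one_right' hP).trans
        ((mul_le_of_le_one_left' hb1).trans hd))

/-- The functions `kT` are invariant under the unit filtration. -/
lemma kT_mul (hτ : IsGen ι τ) (n : ℕ) {h : Torus F K} (hh : h ∈ unitFiltration F K n)
    (t : Torus F K) : kT ι τ n (h * t) = kT ι τ n t := by
  have hle : ∀ a b c d : F, absF a ≤ 1 → absF b ≤ qN F ^ (-(n : ℤ)) → absF (qform ι τ a b) = 1 →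
      qform ι τ c d ≠ 0 → kfun ι τ n (lin τ c d) ≤ kfun ι τ n (lin τ a b * lin τ c d) := by
    intro a b c d ha hb hq hcd
    have h1 : absF (qform ι τ (a * c - b * d * nrm ι τ) (a * d + b * c + b * d * trc ι τ)) =
        absF (qform ι τ c d) := by
      rw [← nrm_lin, ← lin_mul_lin hτ, nrm_mul, nrm_lin, nrm_lin, absF_mul, hq, one_mul]
    rw [lin_mul_lin hτ, kfun_lin hτ, kfun_lin hτ, h1]
    have h2 : qform ι τ (a * c - b * d * nrm ι τ) (a * d + b * c + b * d * trc ι τ) ≠ 0 := by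
      rw [← absF_pos, h1, absF_pos]
      exact hcd
    have h3 := gauge_pos n h2
    have h4 := gauge_mul_le hτ n ha hb c d
    gcongr
  obtain ⟨u, rfl⟩ := QuotientGroup.mk_surjective h
  obtain ⟨v, rfl⟩ := QuotientGroup.mk_surjective t
  obtain ⟨c, a, b, hc, ha, hb, hq, hu⟩ := (mk_mem_unitFiltration_iff hτ n u).1 hh
  obtain ⟨x, y, hxy⟩ := exists_lin hτ (v : K)
  have hq0 : qform ι τ a b ≠ 0 := by rw [← absF_pos, hq]; exact one_pos
  have hxq : qform ι τ x y ≠ 0 := by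
    rw [← nrm_lin, ← hxy]
    exact nrm_units_ne_zero hτ.notInBorel v
  have hlu := isUnit_lin hτ hq0
  have hlv := isUnit_lin hτ hxq
  rw [← toT_units u, ← toT_units v, hu, hxy, toT_smul hc, ← toT_mul hlu hlv, kT_toT hτ n (hlu.mul hlv),
    kT_toT hτ n hlv]
  -- The reverse inequality is the first one for the conjugate of a + bτ, which lies in the same
  -- order and has the same norm. The two multiplications compose to a scalar, which `kfun` ignores.
  refine le_antisymm ?_ (hle a b x y ha hb hq hxq)
  have hle1 : qN F ^ (-(n : ℤ)) ≤ 1 := zpow_le_one_of_nonpos₀ (one_lt_qN F).le (by omega)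
  have hc1 : absF (a + b * trc ι τ) ≤ 1 := by
    refine (absF_add_le _ _).trans (max_le ha ?_)
    rw [absF_mul]
    exact mul_le_one₀ (hb.trans hle1) zero_le (abs_trc_gen hτ)
  have hc2 : absF (-b) ≤ qN F ^ (-(n : ℤ)) := by rwa [absF_neg]
  have hcq : qform ι τ (a + b * trc ι τ) (-b) = qform ι τ a b := by
    rw [← nrm_lin, ← cnj_lin, nrm_cnj hτ.notInBorel, nrm_lin]
  obtain ⟨x', y', hxy'⟩ := exists_lin hτ (lin τ a b * lin τ x y)
  have hq' : qform ι τ x' y' ≠ 0 := by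
    rw [← nrm_lin, ← hxy', nrm_mul, nrm_lin, nrm_lin]
    exact mul_ne_zero hq0 hxq
  have h5 := hle _ _ x' y' hc1 hc2 (by rw [hcq, hq]) hq'
  rw [← hxy', ← mul_assoc, ← cnj_lin, mul_comm (cnj ι _), mul_cnj hτ.notInBorel, nrm_lin,
    ← Algebra.smul_def, kfun_smul hτ n hq0] at h5
  exact h5

/-- The unit filtration as level sets. -/
lemma mem_unitFiltration_iff_kT (hτ : IsGen ι τ) (n : ℕ) (t : Torus F K) :
    t ∈ unitFiltration F K n ↔ kT ι τ n t = qN F ^ (2 * (n : ℤ)) := by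
  have hone : kT ι τ n (1 : Torus F K) = qN F ^ (2 * (n : ℤ)) := by
    rw [← toT_one, kT_toT hτ n isUnit_one, ← lin_one_zero (F := F) (τ := τ), kfun_lin hτ, gauge]
    simp [qform]
    rw [← zpow_natCast, ← zpow_natCast, ← zpow_mul]
    congr 1
    push_cast
    ring
  constructor
  · intro h
    have := kT_mul hτ n h 1
    rwa [mul_one, hone] at this
  · intro h
    obtain ⟨u, rfl⟩ := QuotientGroup.mk_surjective t
    obtain ⟨a, b, hab⟩ := exists_lin hτ (u : K)
    have hq : qform ι τ a b ≠ 0 := by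
      rw [← nrm_lin, ← hab]
      exact nrm_units_ne_zero hτ.notInBorel u
    have hg := gauge_pos n hq
    rw [← toT_units, hab, kT_toT hτ n (isUnit_lin hτ hq), kfun_lin hτ, div_eq_iff (pow_pos hg 2).ne'] at h
    have hle := abs_qform_le hτ a b
    rcases Nat.eq_zero_or_pos n with rfl | hn
    -- For n = 0 the gauge is the larger coordinate. Dividing by that coordinate gives a
    -- representative with integral coefficients and unit norm.
    · have hc : ∃ c : F, c ≠ 0 ∧ absF c = max (absF a) (absF b) := by
        rcases max_choice (absF a) (absF b) with h1 | h1
        · refine ⟨a, ?_, h1.symm⟩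
          rintro rfl
          rw [absF_zero, max_eq_left_iff, nonpos_iff_eq_zero, absF_eq_zero] at h1
          rw [h1] at hq
          simp [qform] at hq
        · refine ⟨b, ?_, h1.symm⟩
          rintro rfl
          rw [absF_zero, max_eq_right_iff, nonpos_iff_eq_zero, absF_eq_zero] at h1
          rw [h1] at hq
          simp [qform] at hq
      obtain ⟨c, hc0, hc⟩ := hc
      rw [mk_mem_unitFiltration_iff hτ]
      have hcp := absF_pos.2 hc0
      refine ⟨c, a / c, b / c, hc0, ?_, ?_, ?_, ?_⟩
      · rw [absF_div, hc]
        exact div_le_one_of_le₀ (le_max_left _ _) zero_le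
      · rw [absF_div, hc]
        simpa using div_le_one_of_le₀ (le_max_right (absF a) (absF b)) zero_le
      · have h2 := qform_mul (ι := ι) (τ := τ) c (a / c) (b / c)
        rw [mul_div_cancel₀ _ hc0, mul_div_cancel₀ _ hc0] at h2
        rw [h2, absF_mul, absF_pow, gauge] at h
        simp only [Nat.cast_zero, mul_zero, zpow_zero, neg_zero, one_mul] at h
        rw [max_comm, ← hc] at h
        exact mul_left_cancel₀ (pow_pos hcp 2).ne' (h.trans (mul_one _).symm)
      · rw [hab, smul_lin, mul_div_cancel₀ _ hc0, mul_div_cancel₀ _ hc0]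
    · rw [← toT_units, hab]
      by_cases hlt : absF b ≤ qN F ^ (-(n : ℤ)) * absF a
      · refine toT_lin_mem_unitFiltration hτ hn ?_ hlt
        rintro rfl
        rw [absF_zero, mul_zero, nonpos_iff_eq_zero, absF_eq_zero] at hlt
        rw [hlt] at hq
        simp [qform] at hq
      -- In this range the gauge is |b|, so the hypothesis says |N| = q^{2n}|b|². This exceeds the
      -- bound max(|a|, |b|)², as both |a| and |b| are below q^n|b|.
      · exfalso
        rw [not_le] at hlt
        rw [gauge, max_eq_left hlt.le] at h
        rw [h] at hle
        have hqn : 1 < qN F ^ (n : ℤ) := one_lt_zpow₀ (one_lt_qN F) (by omega)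
        have hb : 0 < absF b := lt_of_le_of_lt zero_le hlt
        have h3 : absF a < qN F ^ (n : ℤ) * absF b := by
          calc absF a = qN F ^ (n : ℤ) * (qN F ^ (-(n : ℤ)) * absF a) := by
                rw [← mul_assoc, ← zpow_add₀ (qN_ne_zero F)]; simp
            _ < _ := by gcongr
        have h4 : absF b < qN F ^ (n : ℤ) * absF b := lt_mul_of_one_lt_left hb hqn
        have h5 : max (absF a) (absF b) ^ 2 < (qN F ^ (n : ℤ) * absF b) ^ 2 := by
          have := max_lt h3 h4
          gcongr
        have h6 : (qN F ^ (n : ℤ)) ^ 2 = qN F ^ (2 * (n : ℤ)) := by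
          rw [← zpow_natCast, ← zpow_mul, mul_comm]
          rfl
        rw [mul_pow, h6] at h5
        exact absurd hle (not_le.2 h5)

end TorusChart

end LocalToric

end

noncomputable section

namespace LocalToric

/-! ### Topology of the torus -/

section TorusTopology

attribute [local instance] torusCommGroup

variable {F K : Type*} [Field F] [ValuativeRel F] [TopologicalSpace F]
  [IsNonarchimedeanLocalField F] [CommRing K] [Algebra F K] [Algebra.IsQuadraticExtension F K]
  [TopologicalSpace K] [IsModuleTopology F K] [IsTopologicalRing K]
  {ι : K →ₐ[F] Matrix (Fin 2) (Fin 2) F} {τ : K}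

lemma continuous_nrm : Continuous (nrm ι) := Continuous.matrix_det (continuous_emb ι)

lemma continuous_algebraMap_module : Continuous (algebraMap F K) :=
  IsModuleTopology.continuous_of_linearMap (Algebra.linearMap F K)

lemma continuous_cnj : Continuous (cnj ι) :=
  (continuous_algebraMap_module.comp (Continuous.matrix_trace (continuous_emb ι))).sub continuous_id

lemma continuous_coB : Continuous (coB ι τ) :=
  (Continuous.matrix_elem (continuous_emb ι) 1 0).div_const _

lemma continuous_coA : Continuous (coA ι τ) :=
  (Continuous.matrix_elem (continuous_emb ι) 1 1).sub (continuous_coB.mul_const _)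

lemma continuous_lin : Continuous fun p : F × F => lin τ p.1 p.2 := by
  have h : (fun p : F × F => lin τ p.1 p.2) =
      fun p : F × F => algebraMap F K p.1 + algebraMap F K p.2 * τ := by
    funext p
    rw [lin, Algebra.smul_def]
  rw [h]
  exact (continuous_algebraMap_module.comp continuous_fst).add
    ((continuous_algebraMap_module.comp continuous_snd).mul_const _)

/-- Coordinates with respect to the basis `1, τ`. -/
def linHomeo (hτ : IsGen ι τ) : F × F ≃ₜ K where
  toFun p := lin τ p.1 p.2
  invFun x := (coA ι τ x, coB ι τ x)
  left_inv p := by simp only [coA_lin hτ, coB_lin hτ]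
  right_inv x := lin_coA_coB hτ x
  continuous_toFun := continuous_lin
  continuous_invFun := continuous_coA.prodMk continuous_coB

lemma t2Space_of_gen (hτ : IsGen ι τ) : T2Space K := (linHomeo hτ).t2Space

lemma secondCountable_torus (hτ : IsGen ι τ) : SecondCountableTopology (Torus F K) := by
  have h1 : SecondCountableTopology K := (linHomeo hτ).symm.isEmbedding.secondCountableTopology
  have h2 : SecondCountableTopology Kᵐᵒᵖ :=
    MulOpposite.opHomeomorph.symm.isEmbedding.secondCountableTopology
  have h3 : SecondCountableTopology Kˣ := Units.isEmbedding_embedProduct.secondCountableTopology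
  infer_instance

lemma locallyCompact_torus (hτ : IsGen ι τ) : LocallyCompactSpace (Torus F K) := by
  have h0 := t2Space_of_gen hτ
  have h1 : LocallyCompactSpace K := (linHomeo hτ).symm.isClosedEmbedding.locallyCompactSpace
  have h2 : LocallyCompactSpace Kᵐᵒᵖ :=
    MulOpposite.opHomeomorph.symm.isClosedEmbedding.locallyCompactSpace
  have h3 : LocallyCompactSpace Kˣ := Units.isClosedEmbedding_embedProduct.locallyCompactSpace
  infer_instance

lemma continuousOn_toT (hι : NotInBorel ι) : ContinuousOn (toT F (K := K)) {x | nrm ι x ≠ 0} := by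
  rw [continuousOn_iff_continuous_domRestrict]
  let g : {x : K // nrm ι x ≠ 0} → Kˣ := fun x => ⟨x, (nrm ι x.1)⁻¹ • cnj ι x.1, by
    rw [mul_smul_comm, mul_cnj hι, Algebra.smul_def, ← map_mul, inv_mul_cancel₀ x.2, map_one], by
    rw [smul_mul_assoc, mul_comm, mul_cnj hι, Algebra.smul_def, ← map_mul, inv_mul_cancel₀ x.2,
      map_one]⟩
  have hg : Continuous g := by
    rw [Units.continuous_iff]
    refine ⟨continuous_subtype_val, ?_⟩
    change Continuous fun x : {x : K // nrm ι x ≠ 0} => (nrm ι x.1)⁻¹ • cnj ι x.1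
    refine Continuous.smul ?_ (continuous_cnj.comp continuous_subtype_val)
    exact (continuous_nrm.comp continuous_subtype_val).inv₀ fun x => x.2
  have h : Set.domRestrict {x | nrm ι x ≠ 0} (toT F (K := K)) =
      fun x => (QuotientGroup.mk (g x) : Torus F K) := by
    funext x
    exact toT_units (g x)
  rw [h]
  exact continuous_quot_mk.comp hg

lemma continuous_of_units {X : Type*} [TopologicalSpace X] {f : Torus F K → X}
    (h : Continuous fun u : Kˣ => f (QuotientGroup.mk u)) : Continuous f :=
  (isQuotientMap_quot_mk (r := (QuotientGroup.leftRel (scalarUnits F K)).r)).continuous_iff.2 h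

lemma continuous_kT (hτ : IsGen ι τ) (n : ℕ) : Continuous (kT ι τ n : Torus F K → ℝ≥0) := by
  refine continuous_of_units ?_
  have h : (fun u : Kˣ => kT ι τ n (QuotientGroup.mk u)) = fun u : Kˣ => kfun ι τ n (u : K) := by
    funext u
    rw [← toT_units, kT_toT hτ n u.isUnit]
  rw [h]
  have hv : Continuous fun u : Kˣ => (u : K) := Units.continuous_val
  have hc := (continuous_absF (F := F))
  have h1 : Continuous fun u : Kˣ => gauge n (coA ι τ (u : K)) (coB ι τ (u : K)) :=
    (hc.comp (continuous_coB.comp hv)).max ((hc.comp (continuous_coA.comp hv)).const_mul _)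
  refine (hc.comp (continuous_nrm.comp hv)).div₀ (h1.pow 2) fun u => ?_
  refine (pow_pos (gauge_pos (ι := ι) (τ := τ) n ?_) 2).ne'
  rw [← nrm_lin, lin_coA_coB hτ]
  exact nrm_units_ne_zero hτ.notInBorel u

lemma isClosed_unitFiltration (hτ : IsGen ι τ) (n : ℕ) : IsClosed (unitFiltration F K n) := by
  have : unitFiltration F K n = kT ι τ n ⁻¹' {qN F ^ (2 * (n : ℤ))} := by
    ext t
    exact mem_unitFiltration_iff_kT hτ n t
  rw [this]
  exact isClosed_singleton.preimage (continuous_kT hτ n)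

/-- The unit filtration is a basis of neighbourhoods of the identity. -/
lemma exists_unitFiltration_subset (hτ : IsGen ι τ) {U : Set (Torus F K)} (hU : U ∈ 𝓝 1) :
    ∃ n : ℕ, 1 ≤ n ∧ unitFiltration F K n ⊆ U := by
  have hι := hτ.notInBorel
  have hc : ContinuousAt (fun w : F => toT F (lin τ 1 w)) 0 := by
    have h1 : ContinuousAt (toT F (K := K)) (lin τ 1 (0 : F)) := by
      refine (continuousOn_toT hι).continuousAt ?_
      refine (isOpen_compl_singleton.preimage (continuous_nrm (ι := ι))).mem_nhds ?_
      simp [lin_one_zero, nrm_one]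
    exact ContinuousAt.comp (f := fun w : F => lin τ 1 w) (x := 0) h1
      (continuous_lin.comp (continuous_const.prodMk continuous_id)).continuousAt
  rw [← toT_one (F := F) (K := K), ← lin_one_zero (F := F) (τ := τ)] at hU
  obtain ⟨n, -, hn⟩ := (hasBasis_nhds (0 : F)).mem_iff.1 (hc hU)
  refine ⟨n + 1, by omega, ?_⟩
  intro t ht
  obtain ⟨u, rfl⟩ := QuotientGroup.mk_surjective t
  obtain ⟨c, a, b, hc0, ha, hb, hq, hu⟩ := (mk_mem_unitFiltration_iff hτ (n + 1) u).1 ht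
  have hlt : qN F ^ (-((n + 1 : ℕ) : ℤ)) < 1 := zpow_lt_one_of_neg₀ (one_lt_qN F) (by omega)
  -- As |b| < 1, the norm could not be a unit if |a| < 1. So the element is a times 1 + wτ with w =
  -- b/a small, and continuity at w = 0 applies.
  have ha1 : absF a = 1 := by
    by_contra hne
    have h1 := abs_qform_le hτ a b
    rw [hq] at h1
    have h2 : max (absF a) (absF b) < 1 := max_lt (lt_of_le_of_ne ha hne) (hb.trans_lt hlt)
    exact absurd h1 (not_le.2 (pow_lt_one₀ zero_le h2 two_ne_zero))
  have ha0 : a ≠ 0 := by rw [← absF_pos, ha1]; exact one_pos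
  have h3 : lin τ a b = a • lin τ 1 (b / a) := by rw [smul_lin, mul_one, mul_div_cancel₀ _ ha0]
  rw [← toT_units, hu, toT_smul hc0, h3, toT_smul ha0]
  refine hn ?_
  change absF (b / a - 0) ≤ _
  rw [sub_zero, absF_div, ha1, div_one]
  refine hb.trans (zpow_le_zpow_right₀ (one_lt_qN F).le ?_)
  push_cast
  omega

/-- The only value of `kT` at level 1 above 1 is q², so H_1 is also a superlevel set of a continuous
function. A nonempty open set of finite volume is what makes the chart measure finite on compact
sets. -/
lemma isOpen_unitFiltration_one (hτ : IsGen ι τ) : IsOpen (unitFiltration F K 1) := by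
  have : unitFiltration F K 1 = kT ι τ 1 ⁻¹' Set.Ioi 1 := by
    ext t
    rw [mem_unitFiltration_iff_kT hτ, Set.mem_preimage, Set.mem_Ioi]
    constructor
    · intro h
      rw [h]
      exact one_lt_zpow₀ (one_lt_qN F) (by norm_num)
    · intro h
      rw [← mem_unitFiltration_iff_kT hτ]
      obtain ⟨u, rfl⟩ := QuotientGroup.mk_surjective t
      obtain ⟨a, b, hab⟩ := exists_lin hτ (u : K)
      have hq : qform ι τ a b ≠ 0 := by
        rw [← nrm_lin, ← hab]
        exact nrm_units_ne_zero hτ.notInBorel u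
      have hg := gauge_pos 1 hq
      rw [← toT_units, hab, kT_toT hτ 1 (isUnit_lin hτ hq), kfun_lin hτ, one_lt_div (pow_pos hg 2)] at h
      rw [← toT_units, hab]
      have h1 := lt_of_pow_lt_pow_left₀ 2 zero_le (h.trans_le (abs_qform_le hτ a b))
      have h2 : absF b < absF a := by
        by_contra! hle
        rw [max_eq_right hle] at h1
        exact absurd h1 (not_lt.2 (le_max_left _ _))
      have ha : a ≠ 0 := absF_pos.1 (lt_of_le_of_lt zero_le h2)
      refine toT_lin_mem_unitFiltration hτ le_rfl ha ?_
      have h3 : absF (b / a) < 1 := by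
        rw [absF_div, div_lt_one (absF_pos.2 ha)]
        exact h2
      rw [absF_lt_one_iff, absF_div, div_le_iff₀ (absF_pos.2 ha)] at h3
      simpa using h3
  rw [this]
  exact isOpen_Ioi.preimage (continuous_kT hτ 1)

end TorusTopology

/-! ### The Haar measure of the torus in the chart -/

section TorusMeasure

attribute [local instance] torusCommGroup

variable {F K : Type*} [Field F] [ValuativeRel F] [TopologicalSpace F]
  [IsNonarchimedeanLocalField F] [CommRing K] [Algebra F K] [Algebra.IsQuadraticExtension F K]
  [TopologicalSpace K] [IsModuleTopology F K] [IsTopologicalRing K]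
  {ι : K →ₐ[F] Matrix (Fin 2) (Fin 2) F} {τ : K}
  [MeasurableSpace F] [BorelSpace F] [MeasurableSpace (Torus F K)] [BorelSpace (Torus F K)]
  (μ : Measure F) [μ.IsAddHaarMeasure]

lemma continuous_qform : Continuous fun z : F => qform ι τ z 1 := by
  unfold qform
  fun_prop

variable (F) in
/-- The chart of the torus. -/
def chart (τ : K) (z : F) : Torus F K := toT F (lin τ z 1)

variable (ι) in
/-- The density of the Haar measure of the torus in the chart. -/
def chartDensity (τ : K) (z : F) : ℝ≥0 := (absF (qform ι τ z 1))⁻¹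

lemma measurable_chartDensity : Measurable (chartDensity ι τ) :=
  ((measurable_absF (F := F)).comp continuous_qform.measurable).inv

lemma finite_roots : {z : F | qform ι τ z 1 = 0}.Finite := by
  by_cases h : ∃ r : F, qform ι τ r 1 = 0
  · obtain ⟨r, hr⟩ := h
    refine ((Set.finite_singleton r).union (Set.finite_singleton (-trc ι τ - r))).subset ?_
    intro z hz
    have hz' : qform ι τ z 1 = 0 := hz
    rw [qform] at hz' hr
    have : (z - r) * (z - (-trc ι τ - r)) = 0 := by linear_combination hz' - hr
    rcases mul_eq_zero.1 this with h | h
    · left; exact sub_eq_zero.1 h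
    · right; exact sub_eq_zero.1 h
  · push Not at h
    convert Set.finite_empty
    ext z
    simpa using h z

variable (ι τ) in
lemma ae_qform_ne_zero : ∀ᵐ z : F ∂μ, qform ι τ z 1 ≠ 0 := by
  rw [ae_iff]
  simp only [ne_eq, not_not]
  exact finite_roots.measure_zero μ

/-- The chart is continuous off the zeros of the norm form. At the zeros z + τ is not a unit and the
chart takes the default value 1. -/
lemma measurable_chart (hτ : IsGen ι τ) : Measurable (chart F τ) := by
  classical
  have hs : IsClosed {z : F | qform ι τ z 1 = 0} := isClosed_singleton.preimage continuous_qform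
  have h1 : ContinuousOn (chart F τ) {z : F | qform ι τ z 1 = 0}ᶜ := by
    refine (continuousOn_toT hτ.notInBorel).comp
      (continuous_lin.comp (continuous_id.prodMk continuous_const)).continuousOn ?_
    intro z hz
    rw [Set.mem_ofPred_eq, nrm_lin]
    exact hz
  have h2 : ContinuousOn (chart F τ) {z : F | qform ι τ z 1 = 0} := by
    refine (continuousOn_const (c := (1 : Torus F K))).congr fun z hz => ?_
    have : ¬ IsUnit (lin τ z 1) := by
      rintro ⟨u, hu⟩
      have := nrm_units_ne_zero hτ.notInBorel u
      rw [hu, nrm_lin] at this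
      exact this hz
    rw [chart, toT, dif_neg this]
  have := h2.measurable_piecewise h1 hs.measurableSet
  rwa [Set.piecewise_same] at this

variable (ι) in
/-- The measure on the torus given by the chart. -/
def chartMeasure (τ : K) : Measure (Torus F K) :=
  (μ.withDensity fun z => (chartDensity ι τ z : ℝ≥0∞)).map (chart F τ)

lemma lintegral_chartMeasure (hτ : IsGen ι τ) {Ψ : Torus F K → ℝ≥0∞} (hΨ : Measurable Ψ) :
    ∫⁻ t, Ψ t ∂(chartMeasure ι μ τ) = ∫⁻ z, chartDensity ι τ z * Ψ (chart F τ z) ∂μ := by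
  rw [chartMeasure, lintegral_map hΨ (measurable_chart hτ), lintegral_withDensity_eq_lintegral_mul _
    measurable_chartDensity.coe_nnreal_ennreal (by exact hΨ.comp (measurable_chart hτ))]
  rfl

/-- The indicator of A divided by |N| is homogeneous of degree -2 in the coordinates, and
multiplication by u = a + bτ is linear with determinant N(u). The Jacobian |N(u)|⁻¹ cancels the
factor |N(u)| coming from the density. -/
lemma chartMeasure_preimage (hτ : IsGen ι τ) (s : Torus F K) {A : Set (Torus F K)}
    (hA : MeasurableSet A) :
    chartMeasure ι μ τ ((fun t => s * t) ⁻¹' A) = chartMeasure ι μ τ A := by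
  classical
  obtain ⟨u, rfl⟩ := QuotientGroup.mk_surjective s
  obtain ⟨a, b, hab⟩ := exists_lin hτ (u : K)
  have hq : qform ι τ a b ≠ 0 := by
    rw [← nrm_lin, ← hab]
    exact nrm_units_ne_zero hτ.notInBorel u
  set H : F → F → ℝ≥0∞ := fun y x =>
    ((absF (qform ι τ x y))⁻¹ : ℝ≥0) * A.indicator 1 (toT F (lin τ x y)) with hH
  have hHh : ∀ c y x : F, c ≠ 0 → H (c * y) (c * x) = ((absF c ^ 2)⁻¹ : ℝ≥0) * H y x := by
    intro c y x hc
    simp only [hH]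
    rw [qform_mul, ← smul_lin, toT_smul hc, absF_mul, absF_pow, mul_inv, ENNReal.coe_mul, mul_assoc]
  have hd : (a + b * trc ι τ) * a - (-(b * nrm ι τ)) * b ≠ 0 := by
    convert hq using 1
    rw [qform]; ring
  have hm := lintegral_moebius μ hHh hd
  have hsA : MeasurableSet ((fun t => (QuotientGroup.mk u : Torus F K) * t) ⁻¹' A) :=
    hA.preimage (measurable_const_mul _)
  rw [← lintegral_indicator_one hsA, ← lintegral_indicator_one hA,
    lintegral_chartMeasure μ hτ (measurable_one.indicator hsA),
    lintegral_chartMeasure μ hτ (measurable_one.indicator hA)]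
  have h1 : ∀ z : F, chartDensity ι τ z * ((fun t => (QuotientGroup.mk u : Torus F K) * t) ⁻¹' A).indicator
      1 (chart F τ z) = (absF (qform ι τ a b) : ℝ≥0∞) *
        H (a + b * trc ι τ + z * b) (-(b * nrm ι τ) + z * a) := by
    intro z
    have hmul : (u : K) * lin τ z 1 = lin τ (-(b * nrm ι τ) + z * a) (a + b * trc ι τ + z * b) := by
      rw [hab, lin_mul_lin hτ]
      congr 1 <;> ring
    have hqm : qform ι τ (-(b * nrm ι τ) + z * a) (a + b * trc ι τ + z * b) =
        qform ι τ a b * qform ι τ z 1 := by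
      rw [← nrm_lin, ← hmul, nrm_mul, hab, nrm_lin, nrm_lin]
    simp only [hH]
    rw [hqm, absF_mul, mul_inv, ENNReal.coe_mul, ← mul_assoc, ← mul_assoc, ← ENNReal.coe_mul,
      mul_inv_cancel₀ (absF_ne_zero hq), ENNReal.coe_one, one_mul, chartDensity]
    by_cases hz : qform ι τ z 1 = 0
    · simp [hz]
    · congr 1
      rw [← hmul, toT_mul u.isUnit (isUnit_lin hτ hz), toT_units]
      rfl
  simp_rw [h1]
  rw [lintegral_const_mul' _ _ ENNReal.coe_ne_top, hm, ← mul_assoc, ← ENNReal.coe_mul]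
  have h2 : (a + b * trc ι τ) * a - (-(b * nrm ι τ)) * b = qform ι τ a b := by rw [qform]; ring
  rw [h2, mul_inv_cancel₀ (absF_ne_zero hq), ENNReal.coe_one, one_mul]
  rfl

lemma mem_unitFiltration_one_chart (hτ : IsGen ι τ) {n : ℕ} (hn : 1 ≤ n) {z : F}
    (hz : qform ι τ z 1 ≠ 0) : chart F τ z ∈ unitFiltration F K n ↔ z ∉ ballF ((n : ℤ) - 1) := by
  refine ⟨fun h h1 => ?_, fun h => mem_unitFiltration_of_chart hτ hn h⟩
  rw [mem_unitFiltration_iff_kT hτ, chart, kT_chart hτ n hz] at h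
  rw [mem_ballF] at h1
  have h2 : qN F ^ (-(n : ℤ)) * absF z ≤ 1 := by
    calc qN F ^ (-(n : ℤ)) * absF z ≤ qN F ^ (-(n : ℤ)) * qN F ^ ((n : ℤ) - 1) := by gcongr
      _ = qN F ^ (-1 : ℤ) := by rw [← zpow_add₀ (qN_ne_zero F)]; congr 1; ring
      _ ≤ 1 := zpow_le_one_of_nonpos₀ (one_lt_qN F).le (by omega)
  rw [max_eq_left h2, one_pow, div_one] at h
  have h3 := abs_qform_le hτ z 1
  rw [h, absF_one] at h3
  have h4 : max (absF z) 1 ≤ qN F ^ ((n : ℤ) - 1) :=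
    max_le h1 (one_le_zpow₀ (one_lt_qN F).le (by omega))
  have h5 : qN F ^ (2 * (n : ℤ)) ≤ (qN F ^ ((n : ℤ) - 1)) ^ 2 := h3.trans (by gcongr)
  rw [← zpow_natCast, ← zpow_mul, zpow_le_zpow_iff_right₀ (one_lt_qN F)] at h5
  push_cast at h5
  omega

lemma abs_qform_chart_of_notMem (hτ : IsGen ι τ) {z : F} (hz : z ∉ ballF 0) :
    absF (qform ι τ z 1) = absF z ^ 2 := by
  rw [mem_ballF, zpow_zero, not_le] at hz
  exact abs_qform_of_lt hτ (by rwa [absF_one])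

/-- The volumes of the subgroups `H_n` for the measure given by the chart. -/
lemma chartMeasure_unitFiltration (hτ : IsGen ι τ) {n : ℕ} (hn : 1 ≤ n) :
    chartMeasure ι μ τ (unitFiltration F K n) = ((qN F ^ (-(n : ℤ)) * volO μ : ℝ≥0) : ℝ≥0∞) := by
  classical
  have hm := (isClosed_unitFiltration (K := K) hτ n).measurableSet
  rw [← lintegral_indicator_one hm, lintegral_chartMeasure μ hτ (measurable_one.indicator hm)]
  have h := lintegral_tail μ ((n : ℤ) - 1)
  rw [show -((n : ℤ) - 1) - 1 = -(n : ℤ) by ring] at h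
  rw [← h, ← lintegral_indicator (measurableSet_ballF _).compl]
  refine lintegral_congr_ae ?_
  filter_upwards [ae_qform_ne_zero ι τ μ] with z hz
  by_cases hz1 : z ∈ ballF ((n : ℤ) - 1)
  · rw [Set.indicator_of_notMem (by rw [mem_unitFiltration_one_chart hτ hn hz]; simpa using hz1),
      Set.indicator_of_notMem (by simpa using hz1), mul_zero]
  · rw [Set.indicator_of_mem ((mem_unitFiltration_one_chart hτ hn hz).2 hz1),
      Set.indicator_of_mem (by simpa using hz1), chartDensity, abs_qform_chart_of_notMem hτ]
    · simp
    · refine fun h0 => hz1 ?_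
      rw [mem_ballF] at h0 ⊢
      exact h0.trans (zpow_le_zpow_right₀ (one_lt_qN F).le (by omega))

variable (μT : Measure (Torus F K)) [μT.IsHaarMeasure]

/-- The Haar measure of the torus is proportional to the measure given by the chart. -/
lemma exists_chart_const (hτ : IsGen ι τ) : ∃ c : ℝ≥0, 0 < c ∧ μT = c • chartMeasure ι μ τ := by
  have h1 := secondCountable_torus (F := F) hτ
  have h2 := locallyCompact_torus (F := F) hτ
  have hinv : (chartMeasure ι μ τ).IsMulLeftInvariant :=
    (forall_measure_preimage_mul_iff _).1 fun s A hA => chartMeasure_preimage μ hτ s hA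
  have hvol := chartMeasure_unitFiltration μ hτ le_rfl
  have hfin : IsFiniteMeasureOnCompacts (chartMeasure ι μ τ) := by
    refine ⟨fun C hC => measure_lt_top_of_isCompact_of_isMulLeftInvariant (unitFiltration F K 1)
      (isOpen_unitFiltration_one hτ) ⟨1, one_mem_unitFiltration 1⟩ ?_ hC⟩
    rw [hvol]
    exact ENNReal.coe_ne_top
  have h := Measure.isMulLeftInvariant_eq_smul (chartMeasure ι μ τ) μT
  set c := (chartMeasure ι μ τ).haarScalarFactor μT
  -- Uniqueness writes the chart measure as a multiple of the Haar measure. The multiple is nonzero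
  -- because H_1 has positive chart volume, so the relation can be inverted.
  have hc : c ≠ 0 := by
    intro h0
    rw [h0, zero_smul] at h
    rw [h] at hvol
    simp only [Measure.coe_zero, Pi.zero_apply] at hvol
    have := mul_pos (zpow_pos (qN_pos F) (-((1 : ℕ) : ℤ))) (volO_pos μ)
    exact this.ne (by exact_mod_cast hvol)
  refine ⟨c⁻¹, inv_pos.2 (pos_iff_ne_zero.2 hc), ?_⟩
  rw [h, smul_smul, inv_mul_cancel₀ hc, one_smul]

end TorusMeasure

end LocalToric

end

noncomputable section

namespace LocalToric

/-! ### The three types of quadratic algebras -/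

section Types

variable {F K : Type*} [Field F] [ValuativeRel F] [TopologicalSpace F]
  [IsNonarchimedeanLocalField F] [CommRing K] [Algebra F K] [Algebra.IsQuadraticExtension F K]
  {ι : K →ₐ[F] Matrix (Fin 2) (Fin 2) F} {τ : K}

variable (ι τ) in
/-- The norm form has two distinct roots modulo `𝔭`. -/
def HasTwoRoots : Prop :=
  ∃ r s : F, absF r ≤ 1 ∧ absF s ≤ 1 ∧ absF (r - s) = 1 ∧ ∀ z, qform ι τ z 1 = (z - r) * (z - s)

variable (ι τ) in
/-- The norm form has no root modulo `𝔭`. -/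
def HasNoRoot : Prop := ∀ z : F, absF z ≤ 1 → absF (qform ι τ z 1) = 1

variable (ι τ) in
/-- The norm form has a double root modulo `𝔭`, and represents uniformizers. -/
def HasDoubleRoot : Prop :=
  ∃ r : F, absF r ≤ 1 ∧ (∀ z, absF (z - r) < 1 → absF (qform ι τ z 1) = (qN F)⁻¹) ∧
    ∀ z, absF z ≤ 1 → ¬ absF (z - r) < 1 → absF (qform ι τ z 1) = 1

/-- If the norm form were anisotropic, every nonzero element would have nonzero norm and be
invertible. -/
lemma exists_root_of_isSplit (hτ : IsGen ι τ) (h : IsSplit K) : ∃ r : F, qform ι τ r 1 = 0 := by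
  by_contra! hne
  refine h ⟨⟨0, 1, ?_⟩, mul_comm, ?_⟩
  · intro h0
    have := nrm_one (ι := ι)
    rw [← h0, nrm, map_zero, Matrix.det_zero] at this
    exact zero_ne_one this
  · intro x hx
    have hq : nrm ι x ≠ 0 := by
      rw [← lin_coA_coB hτ x] at hx ⊢
      set a := coA ι τ x
      set b := coB ι τ x
      rw [nrm_lin]
      by_cases hb : b = 0
      · rw [hb, qform]
        rw [hb, lin_zero_right] at hx
        have ha : a ≠ 0 := by
          rintro h0
          exact hx (by rw [h0, map_zero])
        simpa using ha
      · have e := qform_mul (ι := ι) (τ := τ) b (a / b) 1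
        rw [mul_div_cancel₀ _ hb, mul_one] at e
        rw [e]
        exact mul_ne_zero (pow_ne_zero 2 hb) (hne _)
    obtain ⟨u, rfl⟩ := isUnit_of_nrm_ne_zero hτ.notInBorel hq
    exact ⟨_, u.mul_inv⟩

lemma isSplit_of_root (hτ : IsGen ι τ) {r : F} (h : qform ι τ r 1 = 0) : IsSplit K := by
  intro hf
  have h1 : lin τ r 1 ≠ 0 := by
    intro h0
    have := coB_lin hτ r 1
    rw [h0, coB, map_zero] at this
    simp at this
  obtain ⟨y, hy⟩ := hf.mul_inv_cancel h1
  have := nrm_mul (ι := ι) (lin τ r 1) y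
  rw [hy, nrm_one, nrm_lin, h, zero_mul] at this
  exact one_ne_zero this

/-- The element (r + τ)/ϖ is not integral because τ generates O_K. Its trace and norm are the two
quantities displayed, so maximality of the order enters the classification of the residual roots
through this lemma. -/
lemma isIntegral_lin_div (hτ : IsGen ι τ) {r : F} :
    ¬ (absF ((trc ι τ + 2 * r) / unif F) ≤ 1 ∧ absF (qform ι τ r 1 / unif F ^ 2) ≤ 1) := by
  have hu := unif_ne_zero F
  have h1 : ¬ IsIntegral 𝒪[F] (lin τ (r / unif F) (1 / unif F)) := by
    rw [hτ.isIntegral_iff]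
    rintro ⟨-, h⟩
    rw [absF_div, absF_one, absF_unif, one_div, inv_inv] at h
    exact absurd h (not_le.2 (one_lt_qN F))
  rw [isIntegral_iff hτ.notInBorel] at h1
  refine fun h2 => h1 ?_
  have e1 : trc ι (lin τ (r / unif F) (1 / unif F)) = (trc ι τ + 2 * r) / unif F := by
    simp only [trc, lin, map_add, map_smul, ι.commutes, Matrix.trace_add, Matrix.trace_smul,
      Matrix.trace_fin_two, Matrix.algebraMap_matrix_apply]
    simp
    field_simp
    ring
  have e2 : nrm ι (lin τ (r / unif F) (1 / unif F)) = qform ι τ r 1 / unif F ^ 2 := by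
    rw [nrm_lin, qform, qform]
    field_simp
  rwa [e1, e2]

/-- Roots are integral since the form has absolute value |z|² for |z| > 1. If they were congruent
modulo 𝔭, the derivative at r would be divisible by ϖ while the value is 0, against maximality. -/
lemma hasTwoRoots_of_root (hτ : IsGen ι τ) {r : F} (h : qform ι τ r 1 = 0) : HasTwoRoots ι τ := by
  have hfac : ∀ z, qform ι τ z 1 = (z - r) * (z - (-trc ι τ - r)) := by
    intro z
    rw [qform] at h ⊢
    linear_combination h
  have hint : ∀ z, qform ι τ z 1 = 0 → absF z ≤ 1 := by
    intro z hz
    by_contra! hlt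
    have := abs_qform_of_lt hτ (a := z) (b := 1) (by rwa [absF_one])
    rw [hz, absF_zero] at this
    have h0 := (zero_lt_one.trans hlt).ne'
    exact pow_ne_zero 2 h0 this.symm
  have hs : absF (-trc ι τ - r) ≤ 1 := hint _ (by rw [hfac, sub_self, mul_zero])
  refine ⟨r, -trc ι τ - r, hint r h, hs, ?_, hfac⟩
  refine le_antisymm ((absF_sub_le _ _).trans (max_le (hint r h) hs)) ?_
  by_contra! hlt
  refine isIntegral_lin_div hτ (r := r) ⟨?_, by rw [h, zero_div, absF_zero]; exact zero_le_one⟩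
  rw [absF_lt_one_iff] at hlt
  rw [absF_div, absF_unif, div_le_one (inv_pos.2 (qN_pos F))]
  convert hlt using 2
  ring

/-- Hensel's lemma by compactness: take a minimum of |f| on the residue disc of r. There the
derivative is a unit, and a Newton step replaces |f(z)| by |f(z)|², which is smaller unless f(z) =
0. -/
lemma exists_root_of_simple {r : F} (h : absF (qform ι τ r 1) < 1)
    (hd : absF (trc ι τ + 2 * r) = 1) : ∃ z : F, qform ι τ z 1 = 0 := by
  have hcpt : IsCompact {z : F | absF (z - r) ≤ qN F ^ (-1 : ℤ)} := by
    have h1 := (isCompact_ballF (F := F) (-1)).image (continuous_add_const r)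
    convert h1 using 1
    ext z
    simp only [Set.mem_ofPred_eq, Set.mem_image, mem_ballF]
    exact ⟨fun h => ⟨z - r, h, by ring⟩, by rintro ⟨y, hy, rfl⟩; simpa using hy⟩
  have hcont : Continuous fun z : F => absF (qform ι τ z 1) := by
    refine continuous_absF.comp ?_
    unfold qform
    fun_prop
  obtain ⟨z, hz, hmin⟩ := hcpt.exists_isMinOn ⟨r, by simp [absF_zero]⟩ hcont.continuousOn
  refine ⟨z, ?_⟩
  by_contra hne
  have hzr : absF (z - r) < 1 := by
    rw [absF_lt_one_iff]; simpa using hz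
  have hdz : absF (trc ι τ + 2 * z) = 1 := by
    have e : trc ι τ + 2 * z = (trc ι τ + 2 * r) + ((z - r) + (z - r)) := by ring
    rw [e, absF_add_eq_of_lt, hd]
    rw [hd]
    exact (absF_add_le _ _).trans_lt (max_lt hzr hzr)
  have hfz : absF (qform ι τ z 1) < 1 := by
    have := hmin (show r ∈ {z : F | absF (z - r) ≤ qN F ^ (-1 : ℤ)} by simp [absF_zero])
    exact lt_of_le_of_lt this h
  have hd0 : trc ι τ + 2 * z ≠ 0 := by
    rw [← absF_pos, hdz]; exact one_pos
  have hqz := absF_pos.2 hne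
  have hfd : absF (qform ι τ z 1 / (trc ι τ + 2 * z)) = absF (qform ι τ z 1) := by
    rw [absF_div, hdz, div_one]
  set w := z - qform ι τ z 1 / (trc ι τ + 2 * z) with hw
  have hq : qform ι τ w 1 = (qform ι τ z 1 / (trc ι τ + 2 * z)) ^ 2 := by
    have : qform ι τ w 1 = qform ι τ z 1 - (qform ι τ z 1 / (trc ι τ + 2 * z)) * (trc ι τ + 2 * z) +
        (qform ι τ z 1 / (trc ι τ + 2 * z)) ^ 2 := by
      rw [hw]
      simp only [qform]
      ring
    rw [this, div_mul_cancel₀ _ hd0]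
    ring
  have hwr : w ∈ {z : F | absF (z - r) ≤ qN F ^ (-1 : ℤ)} := by
    have h1 : absF (w - r) < 1 := by
      have e : w - r = (z - r) - qform ι τ z 1 / (trc ι τ + 2 * z) := by rw [hw]; ring
      rw [e]
      exact (absF_sub_le _ _).trans_lt (max_lt hzr (by rwa [hfd]))
    rw [absF_lt_one_iff] at h1
    simpa using h1
  have h2 := hmin hwr
  simp only [Set.mem_ofPred_eq] at h2
  rw [hq, absF_pow, hfd] at h2
  have h3 : absF (qform ι τ z 1) ^ 2 < absF (qform ι τ z 1) := by
    rw [pow_two]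
    exact mul_lt_of_lt_one_left hqz hfz
  exact absurd h2 (not_le.2 h3)

/-- Without a root in F, Hensel's lemma forces the derivative to vanish modulo 𝔭 at each residual
root. Maximality then excludes values divisible by ϖ², so the value there has valuation exactly one.
-/
lemma hasDoubleRoot_of_residual_root (hτ : IsGen ι τ) (hns : ∀ z : F, qform ι τ z 1 ≠ 0) {r : F}
    (hr : absF r ≤ 1) (h : absF (qform ι τ r 1) < 1) : HasDoubleRoot ι τ := by
  have key : ∀ z : F, absF z ≤ 1 → absF (qform ι τ z 1) < 1 →
      absF (trc ι τ + 2 * z) < 1 ∧ absF (qform ι τ z 1) = (qN F)⁻¹ := by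
    intro z hz hq
    have hle : absF (trc ι τ + 2 * z) ≤ 1 := by
      rw [two_mul]
      exact (absF_add_le _ _).trans (max_le (abs_trc_gen hτ)
        ((absF_add_le _ _).trans (max_le hz hz)))
    have hlt : absF (trc ι τ + 2 * z) < 1 := by
      refine lt_of_le_of_ne hle fun h1 => ?_
      obtain ⟨w, hw⟩ := exists_root_of_simple hq h1
      exact hns w hw
    refine ⟨hlt, le_antisymm (absF_lt_one_iff.1 hq) ?_⟩
    by_contra! h1
    refine isIntegral_lin_div hτ (r := z) ⟨?_, ?_⟩
    · rw [absF_lt_one_iff] at hlt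
      rwa [absF_div, absF_unif, div_le_one (inv_pos.2 (qN_pos F))]
    · rw [absF_div, absF_pow, absF_unif, div_le_one (pow_pos (inv_pos.2 (qN_pos F)) 2)]
      have h2 : absF (qform ι τ z 1) < qN F ^ (-2 + 1 : ℤ) := by simpa using h1
      rw [absF_lt_zpow_iff] at h2
      convert h2 using 1
      rw [zpow_neg, inv_pow]
      rfl
  have hexp : ∀ z : F, qform ι τ z 1 =
      qform ι τ r 1 + ((z - r) * (trc ι τ + 2 * r) + (z - r) ^ 2) := by
    intro z
    simp only [qform]
    ring
  refine ⟨r, hr, fun z hz => ?_, fun z hz hzr => ?_⟩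
  · have hz1 : absF z ≤ 1 := by
      have e : z = (z - r) + r := by ring
      rw [e]
      exact (absF_add_le _ _).trans (max_le hz.le hr)
    refine (key z hz1 ?_).2
    rw [hexp z]
    refine (absF_add_le _ _).trans_lt (max_lt h ((absF_add_le _ _).trans_lt (max_lt ?_ ?_)))
    · rw [absF_mul]
      exact mul_lt_one_of_nonneg_of_lt_one_left zero_le hz (key r hr h).1.le
    · rw [absF_pow]
      exact pow_lt_one₀ zero_le hz two_ne_zero
  · have hq1 : absF (qform ι τ z 1) ≤ 1 := by
      refine (abs_qform_le hτ z 1).trans ?_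
      rw [absF_one, max_eq_right hz, one_pow]
    refine le_antisymm hq1 ?_
    by_contra! hlt
    apply hzr
    have e : (z - r) ^ 2 = qform ι τ z 1 - (qform ι τ r 1 + (z - r) * (trc ι τ + 2 * r)) := by
      rw [hexp z]; ring
    have hzr1 : absF (z - r) ≤ 1 := (absF_sub_le _ _).trans (max_le hz hr)
    have h2 : absF ((z - r) ^ 2) < 1 := by
      rw [e]
      refine (absF_sub_le _ _).trans_lt (max_lt hlt ((absF_add_le _ _).trans_lt (max_lt h ?_)))
      rw [absF_mul]
      exact mul_lt_one_of_nonneg_of_lt_one_right hzr1 zero_le (key r hr h).1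
    rw [absF_pow] at h2
    exact (pow_lt_one_iff_of_nonneg zero_le two_ne_zero).1 h2

lemma abs_nrm_eq_one_of_hasNoRoot (hτ : IsGen ι τ) (h : HasNoRoot ι τ) {a b : F}
    (hab : max (absF a) (absF b) = 1) : absF (qform ι τ a b) = 1 := by
  rcases lt_or_ge (absF b) 1 with hb | hb
  · have ha : absF a = 1 := by
      rcases max_choice (absF a) (absF b) with h1 | h1
      · rw [← h1, hab]
      · rw [h1] at hab; exact absurd hab hb.ne
    rw [abs_qform_of_lt hτ (by rwa [ha]), ha, one_pow]
  · have hb1 : absF b = 1 := le_antisymm (hab ▸ le_max_right _ _) hb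
    have hb0 : b ≠ 0 := by rw [← absF_pos, hb1]; exact one_pos
    have e := qform_mul (ι := ι) (τ := τ) b (a / b) 1
    rw [mul_div_cancel₀ _ hb0, mul_one] at e
    rw [e, absF_mul, absF_pow, hb1, one_pow, one_mul, h]
    rw [absF_div, hb1, div_one, ← hab]
    exact le_max_left _ _

lemma maximalIdeal_map_eq : Ideal.map (algebraMap 𝒪[F] (integralClosure 𝒪[F] K)) 𝓂[F] =
    Ideal.span {algebraMap 𝒪[F] (integralClosure 𝒪[F] K) ⟨unif F, mem_integer_iff.2
      (by rw [absF_unif]; exact (inv_lt_one_of_one_lt₀ (one_lt_qN F)).le)⟩} := by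
  rw [maximalIdeal_eq_span, Ideal.map_span, Set.image_singleton]

/-- The ideal generated by `𝔭` in terms of coordinates. -/
lemma mem_map_maximalIdeal_iff (hτ : IsGen ι τ) (x : integralClosure 𝒪[F] K) :
    x ∈ Ideal.map (algebraMap 𝒪[F] (integralClosure 𝒪[F] K)) 𝓂[F] ↔
      max (absF (coA ι τ (x : K))) (absF (coB ι τ (x : K))) < 1 := by
  have hu := unif_ne_zero F
  rw [maximalIdeal_map_eq, Ideal.mem_span_singleton]
  have hlt : absF (unif F) < 1 := by rw [absF_unif]; exact inv_lt_one_of_one_lt₀ (one_lt_qN F)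
  constructor
  · rintro ⟨y, rfl⟩
    have hy : IsIntegral 𝒪[F] (y : K) := y.2
    rw [← lin_coA_coB hτ (y : K), hτ.isIntegral_iff] at hy
    have e : ((algebraMap 𝒪[F] (integralClosure 𝒪[F] K) ⟨unif F, mem_integer_iff.2 hlt.le⟩ * y :
        integralClosure 𝒪[F] K) : K) = lin τ (unif F * coA ι τ (y : K)) (unif F * coB ι τ (y : K)) := by
      rw [← smul_lin, lin_coA_coB hτ, Algebra.smul_def]
      rfl
    rw [e, coA_lin hτ, coB_lin hτ, absF_mul, absF_mul]
    exact max_lt (mul_lt_one_of_nonneg_of_lt_one_left zero_le hlt hy.1)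
      (mul_lt_one_of_nonneg_of_lt_one_left zero_le hlt hy.2)
  · intro h
    obtain ⟨h1, h2⟩ := max_lt_iff.1 h
    rw [absF_lt_one_iff] at h1 h2
    have hy : IsIntegral 𝒪[F] (lin τ (coA ι τ (x : K) / unif F) (coB ι τ (x : K) / unif F)) := by
      rw [hτ.isIntegral_iff, absF_div, absF_div, absF_unif, div_le_one (inv_pos.2 (qN_pos F)),
        div_le_one (inv_pos.2 (qN_pos F))]
      exact ⟨h1, h2⟩
    refine ⟨⟨_, hy⟩, Subtype.ext ?_⟩
    have e : (x : K) = unif F • lin τ (coA ι τ (x : K) / unif F) (coB ι τ (x : K) / unif F) := by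
      rw [smul_lin, mul_div_cancel₀ _ hu, mul_div_cancel₀ _ hu, lin_coA_coB hτ]
    rw [Algebra.smul_def] at e
    exact e

/-- Without residual roots a primitive element has unit norm, so an integer lies in 𝔭O_K exactly
when its norm is not a unit. Primality follows from multiplicativity of the norm. -/
lemma isPrime_of_hasNoRoot (hτ : IsGen ι τ) (h : HasNoRoot ι τ) :
    (Ideal.map (algebraMap 𝒪[F] (integralClosure 𝒪[F] K)) 𝓂[F]).IsPrime := by
  have key : ∀ x : integralClosure 𝒪[F] K,
      x ∈ Ideal.map (algebraMap 𝒪[F] (integralClosure 𝒪[F] K)) 𝓂[F] ↔ absF (nrm ι (x : K)) < 1 := by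
    intro x
    have hx : IsIntegral 𝒪[F] (x : K) := x.2
    rw [← lin_coA_coB hτ (x : K), hτ.isIntegral_iff] at hx
    rw [mem_map_maximalIdeal_iff hτ]
    conv_rhs => rw [← lin_coA_coB hτ (x : K), nrm_lin]
    constructor
    · intro hlt
      exact (abs_qform_le hτ _ _).trans_lt (pow_lt_one₀ zero_le hlt two_ne_zero)
    · intro hlt
      refine lt_of_le_of_ne (max_le hx.1 hx.2) fun h1 => ?_
      exact hlt.ne (abs_nrm_eq_one_of_hasNoRoot hτ h h1)
  refine ⟨?_, ?_⟩
  · rw [Ideal.ne_top_iff_one, key]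
    change ¬ absF (nrm ι (1 : K)) < 1
    rw [nrm_one, absF_one]
    exact lt_irrefl _
  · intro x y hxy
    have hx1 : absF (nrm ι (x : K)) ≤ 1 := ((isIntegral_iff hτ.notInBorel).1 x.2).2
    rw [key] at hxy
    rw [key, key]
    change absF (nrm ι ((x : K) * (y : K))) < 1 at hxy
    rw [nrm_mul, absF_mul] at hxy
    by_contra! hne
    rw [le_antisymm hx1 hne.1, one_mul] at hxy
    exact absurd hxy (not_lt.2 hne.2)

/-- If N(z + τ) were in 𝔭, the product of z + τ and its conjugate would lie in 𝔭O_K. Neither factor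
does, as their coefficients of τ are 1 and -1. -/
lemma hasNoRoot_of_isPrime (hτ : IsGen ι τ)
    (h : (Ideal.map (algebraMap 𝒪[F] (integralClosure 𝒪[F] K)) 𝓂[F]).IsPrime) :
    HasNoRoot ι τ := by
  intro z hz
  have hle : absF (qform ι τ z 1) ≤ 1 := by
    refine (abs_qform_le hτ z 1).trans ?_
    rw [absF_one, max_eq_right hz, one_pow]
  refine le_antisymm hle ?_
  by_contra! hlt
  have hx : IsIntegral 𝒪[F] (lin τ z 1) := (hτ.isIntegral_iff z 1).2 ⟨hz, absF_one.le⟩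
  have hx' := isIntegral_cnj hτ.notInBorel hx
  have hmul : (⟨_, hx⟩ * ⟨_, hx'⟩ : integralClosure 𝒪[F] K) ∈
      Ideal.map (algebraMap 𝒪[F] (integralClosure 𝒪[F] K)) 𝓂[F] := by
    rw [mem_map_maximalIdeal_iff hτ]
    change max (absF (coA ι τ (lin τ z 1 * cnj ι (lin τ z 1)))) _ < 1
    change max _ (absF (coB ι τ (lin τ z 1 * cnj ι (lin τ z 1)))) < 1
    rw [mul_cnj hτ.notInBorel, nrm_lin, ← lin_zero_right (τ := τ), coA_lin hτ, coB_lin hτ, absF_zero]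
    exact max_lt hlt zero_lt_one
  rcases h.mem_or_mem hmul with h1 | h1
  · rw [mem_map_maximalIdeal_iff hτ] at h1
    have h2 := (max_lt_iff.1 h1).2
    rw [coB_lin hτ, absF_one] at h2
    exact lt_irrefl _ h2
  · rw [mem_map_maximalIdeal_iff hτ] at h1
    have h2 := (max_lt_iff.1 h1).2
    change absF (coB ι τ (cnj ι (lin τ z 1))) < 1 at h2
    rw [cnj_lin, coB_lin hτ, absF_neg, absF_one] at h2
    exact lt_irrefl _ h2

/-- The type of `K` in terms of the roots of the norm form. -/
lemma type_trichotomy (hτ : IsGen ι τ) :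
    (IsSplit K ∧ HasTwoRoots ι τ) ∨ (¬ IsSplit K ∧ IsInert F K ∧ HasNoRoot ι τ) ∨
      (¬ IsSplit K ∧ ¬ IsInert F K ∧ HasDoubleRoot ι τ) := by
  by_cases hs : IsSplit K
  · obtain ⟨r, hr⟩ := exists_root_of_isSplit hτ hs
    exact Or.inl ⟨hs, hasTwoRoots_of_root hτ hr⟩
  · right
    have hf : IsField K := not_not.1 hs
    by_cases hn : HasNoRoot ι τ
    · exact Or.inl ⟨hs, ⟨hf, isPrime_of_hasNoRoot hτ hn⟩, hn⟩
    · refine Or.inr ⟨hs, fun hi => hn (hasNoRoot_of_isPrime hτ hi.2), ?_⟩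
      simp only [HasNoRoot, not_forall] at hn
      obtain ⟨r, hr, hne⟩ := hn
      refine hasDoubleRoot_of_residual_root hτ (fun z hz => hs (isSplit_of_root hτ hz)) hr ?_
      refine lt_of_le_of_ne ((abs_qform_le hτ r 1).trans ?_) hne
      rw [absF_one, max_eq_right hr, one_pow]

end Types

end LocalToric

end

noncomputable section

namespace LocalToric

/-! ### Integration over the torus -/

section TorusIntegral

attribute [local instance] torusCommGroup

variable {F K : Type*} [Field F] [ValuativeRel F] [TopologicalSpace F]
  [IsNonarchimedeanLocalField F] [CommRing K] [Algebra F K] [Algebra.IsQuadraticExtension F K]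
  [TopologicalSpace K] [IsModuleTopology F K] [IsTopologicalRing K]
  {ι : K →ₐ[F] Matrix (Fin 2) (Fin 2) F} {τ : K}
  [MeasurableSpace F] [BorelSpace F] [MeasurableSpace (Torus F K)] [BorelSpace (Torus F K)]
  {μ : Measure F} [μ.IsAddHaarMeasure] {μT : Measure (Torus F K)} {c : ℝ≥0}

lemma integral_torus (hτ : IsGen ι τ) (hμ : μT = c • chartMeasure ι μ τ) {Ψ : Torus F K → ℂ}
    (hΨ : StronglyMeasurable Ψ) :
    ∫ t, Ψ t ∂μT = (c : ℝ) * ∫ z, ((chartDensity ι τ z : ℝ) : ℂ) * Ψ (chart F τ z) ∂μ := by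
  rw [hμ, integral_smul_nnreal_measure, chartMeasure,
    integral_map (measurable_chart hτ).aemeasurable hΨ.aestronglyMeasurable,
    integral_withDensity_eq_integral_smul measurable_chartDensity, NNReal.smul_def, Complex.real_smul]
  simp_rw [NNReal.smul_def, Complex.real_smul]

/-- A scalar invariant function on `GL₂`, as a function on the torus. -/
def torusFun (ι : K →ₐ[F] Matrix (Fin 2) (Fin 2) F) (h : GL (Fin 2) F → ℂ) (t : Torus F K) : ℂ :=
  h (unitsEmb ι t.out)

/-- Invariance of a function on `GL₂` under scalar matrices. -/
def IsScalarInvariant (h : GL (Fin 2) F → ℂ) : Prop :=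
  ∀ z g : GL (Fin 2) F, z 1 0 = 0 → z 1 1 = z 0 0 → h (z * g) = h g

lemma torusFun_mk {h : GL (Fin 2) F → ℂ} (hh : IsScalarInvariant h) (u : Kˣ) :
    torusFun ι h (QuotientGroup.mk u : Torus F K) = h (unitsEmb ι u) := by
  obtain ⟨c, hc, he⟩ := out_mk (F := F) u
  set z : GL (Fin 2) F := unitsEmb ι (Units.map (algebraMap F K : F →* K) (Units.mk0 c hc))
  have hz : (z : Matrix (Fin 2) (Fin 2) F) = algebraMap F _ c := ι.commutes _
  have h2 : (QuotientGroup.mk u : Torus F K).out =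
      Units.map (algebraMap F K : F →* K) (Units.mk0 c hc) * u := by
    ext
    rw [he, Algebra.smul_def]
    rfl
  rw [torusFun, h2, map_mul]
  refine hh z _ ?_ ?_ <;> rw [hz] <;> simp [Matrix.algebraMap_matrix_apply]

lemma continuous_torusFun {h : GL (Fin 2) F → ℂ} (hh : IsScalarInvariant h) (hc : Continuous h) :
    Continuous (torusFun ι h : Torus F K → ℂ) := by
  refine continuous_of_units ?_
  simp_rw [torusFun_mk hh]
  exact hc.comp (continuous_unitsEmb ι)

lemma HasModularLaw.isScalarInvariant {h : GL (Fin 2) F → ℂ} (hh : HasModularLaw h) :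
    IsScalarInvariant h := by
  intro z g h0 h1
  rw [hh z g h0, modChar_eq h0, h1, div_self (diag_ne_zero h0).1, absF_one]
  simp

/-- The comparison of the integrals over the torus and the big cell. -/
lemma torusIntegral_eq (hτ : IsGen ι τ) (hμ : μT = c • chartMeasure ι μ τ) {h : GL (Fin 2) F → ℂ}
    (hh : HasModularLaw h) (hc : Continuous h) :
    (absF (ι τ 1 0) : ℝ) * torusIntegral ι μT h = (c : ℝ) * ∫ x, h (lowerUnipOmega x) ∂μ := by
  have hcτ := absF_ne_zero hτ.lower_ne_zero
  have hm := (continuous_torusFun (ι := ι) (K := K) hh.isScalarInvariant hc).stronglyMeasurable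
  have h1 : torusIntegral ι μT h = ∫ t, torusFun ι h t ∂μT := rfl
  -- The density |N|⁻¹ cancels the factor |det| of the modular function. What remains is a function
  -- of the big-cell coordinate, affine in z because the bottom row of ι(z + τ) is (ι(τ)₁₀, z +
  -- ι(τ)₁₁).
  have h2 : ∀ᵐ z ∂μ, ((chartDensity ι τ z : ℝ) : ℂ) * torusFun ι h (chart F τ z) =
      (((absF (ι τ 1 0) ^ 2)⁻¹ : ℝ≥0) : ℝ) *
        h (lowerUnipOmega (-(ι τ 1 1 / ι τ 1 0) + (-(ι τ 1 0))⁻¹ * z)) := by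
    filter_upwards [ae_qform_ne_zero ι τ μ] with z hz
    have hq := absF_ne_zero hz
    obtain ⟨u, hu⟩ := isUnit_lin hτ hz
    have hval : ∀ i j, (unitsEmb ι u : GL (Fin 2) F) i j = ι (lin τ z 1) i j := by
      intro i j; rw [← hu]; rfl
    have h10 : (unitsEmb ι u : GL (Fin 2) F) 1 0 = ι τ 1 0 := by
      rw [hval, emb_lin_lower, one_mul]
    have h11 : (unitsEmb ι u : GL (Fin 2) F) 1 1 = z + ι τ 1 1 := by
      rw [hval, emb_lin_diag, one_mul]
    have hdet : ((unitsEmb ι u : GL (Fin 2) F) : Matrix (Fin 2) (Fin 2) F).det = qform ι τ z 1 := by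
      rw [unitsEmb_val, hu]; exact nrm_lin _ _
    rw [chart, ← hu, toT_units, torusFun_mk hh.isScalarInvariant,
      hh.apply (by rw [h10]; exact hτ.lower_ne_zero), hdet, h10, h11, chartDensity, ← mul_assoc]
    push_cast
    rw [inv_mul_cancel₀ (by exact_mod_cast hq), one_mul]
    congr 3
    have := hτ.lower_ne_zero
    field_simp
    ring
  rw [h1, integral_torus hτ hμ hm, integral_congr_ae h2, integral_const_mul,
    integral_affine μ (inv_ne_zero (neg_ne_zero.2 hτ.lower_ne_zero))
      (-(ι τ 1 1 / ι τ 1 0)) (fun x => h (lowerUnipOmega x)), absF_inv, absF_neg, inv_inv]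
  push_cast
  have : ((absF (ι τ 1 0) : ℝ) : ℂ) ≠ 0 := by exact_mod_cast hcτ
  field_simp

lemma isUnipotentComparison (hτ : IsGen ι τ) (hμ : μT = c • chartMeasure ι μ τ) (hc : 0 < c) :
    IsUnipotentComparison ι μ μT (absF (ι τ 1 0) / c : ℝ≥0) := by
  intro h hh
  have := torusIntegral_eq hτ hμ hh.2 hh.1.continuous
  have hc' : ((c : ℝ) : ℂ) ≠ 0 := by exact_mod_cast hc.ne'
  push_cast
  rw [div_mul_eq_mul_div, eq_div_iff hc', mul_comm, this]

variable (μ) in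
lemma measureReal_closedBall (x : F) (n : ℤ) :
    μ.real {y | absF (y - x) ≤ qN F ^ n} = qN F ^ n * volO μ := by
  rw [Measure.real, measure_closedBall]
  push_cast
  rfl

lemma isClosed_closedBall (x : F) (n : ℤ) : IsClosed {y | absF (y - x) ≤ qN F ^ n} :=
  isClosed_le (continuous_absF.comp (continuous_id.sub continuous_const)) continuous_const

variable (ι τ) in
/-- The integers at which the norm form is a unit. -/
def unitValues : Set F := {z | absF z ≤ 1 ∧ absF (qform ι τ z 1) = 1}

lemma measurableSet_unitValues : MeasurableSet (unitValues ι τ) :=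
  (measurable_absF measurableSet_Iic).inter
    ((measurable_absF.comp continuous_qform.measurable) (measurableSet_singleton 1))

variable (μ) in
-- Outside O the norm has absolute value |z|² and the chart always lands in H_0; the density |z|⁻²
-- gives this tail volume q⁻¹ vol(O). Inside O membership means that the norm is a unit, and the
-- density is 1.
lemma chartMeasure_unitFiltration_zero (hτ : IsGen ι τ) :
    chartMeasure ι μ τ (unitFiltration F K 0) =
      μ (unitValues ι τ) + ((qN F ^ (-1 : ℤ) * volO μ : ℝ≥0) : ℝ≥0∞) := by
  classical
  have hm := (isClosed_unitFiltration (K := K) hτ 0).measurableSet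
  have hb := (measurableSet_ballF (F := F) 0).compl
  have h := lintegral_tail μ 0
  rw [← lintegral_indicator hb] at h
  rw [← lintegral_indicator_one hm, lintegral_chartMeasure μ hτ (measurable_one.indicator hm)]
  simp only [neg_zero, zero_sub] at h
  rw [← h, ← lintegral_indicator_one (measurableSet_unitValues (ι := ι) (τ := τ)),
    ← lintegral_add_left (measurable_one.indicator measurableSet_unitValues)]
  refine lintegral_congr_ae ?_
  filter_upwards [ae_qform_ne_zero ι τ μ] with z hz
  have hmem := mem_unitFiltration_iff_kT hτ 0 (chart F τ z)
  rw [chart, kT_chart hτ 0 hz] at hmem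
  simp only [Nat.cast_zero, neg_zero, zpow_zero, one_mul, mul_zero] at hmem
  by_cases hz1 : absF z ≤ 1
  · have h2 : z ∉ (ballF 0 : Set F)ᶜ := by simpa [mem_ballF] using hz1
    rw [Set.indicator_of_notMem h2, add_zero]
    rw [max_eq_left hz1, one_pow, div_one] at hmem
    by_cases hq : absF (qform ι τ z 1) = 1
    · rw [chart, Set.indicator_of_mem (hmem.2 hq),
        Set.indicator_of_mem (show z ∈ unitValues ι τ from ⟨hz1, hq⟩), chartDensity, hq]
      simp
    · rw [chart, Set.indicator_of_notMem (mt hmem.1 hq),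
        Set.indicator_of_notMem (fun h : z ∈ unitValues ι τ => hq h.2), mul_zero]
  · have h2 : z ∈ (ballF 0 : Set F)ᶜ := by simpa [mem_ballF] using hz1
    have h3 : z ∉ ballF 0 := h2
    have h4 := abs_qform_chart_of_notMem hτ h3
    have h5 : absF z ≠ 0 := (zero_lt_one.trans (not_le.1 hz1)).ne'
    rw [max_eq_right (not_le.1 hz1).le, h4, div_self (pow_ne_zero 2 h5)] at hmem
    rw [Set.indicator_of_mem h2, Set.indicator_of_notMem (fun h : z ∈ unitValues ι τ => hz1 h.1),
      chart, Set.indicator_of_mem (hmem.2 rfl), chartDensity, h4]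
    simp

/-- The normalisation of the measures. -/
lemma chart_const_mul_volO (hτ : IsGen ι τ) (hμ : μT = c • chartMeasure ι μ τ)
    (h0 : μT (unitFiltration F K 0) = 1) : (((c * volO μ : ℝ≥0) : ℝ) : ℂ) = lEta F K 1 := by
  have hfin : μ (unitValues ι τ) ≠ ∞ :=
    measure_ne_top_of_subset (fun z hz => by rw [mem_ballF, zpow_zero]; exact hz.1)
      (measure_ballF_ne_top μ 0)
  have hR : (c : ℝ) * (μ.real (unitValues ι τ) + (qN F : ℝ)⁻¹ * volO μ) = 1 := by
    rw [hμ, Measure.smul_apply, chartMeasure_unitFiltration_zero μ hτ] at h0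
    have := congrArg ENNReal.toReal h0
    rw [ENNReal.smul_def, smul_eq_mul, ENNReal.toReal_mul, ENNReal.toReal_add hfin
      ENNReal.coe_ne_top] at this
    simpa [Measure.real] using this
  have hO : μ.real (ballF 0) = volO μ := by rw [measureReal_ballF]; simp
  have hq1 : (1 : ℝ) < qN F := by exact_mod_cast one_lt_qN F
  have hq0 : (qN F : ℝ) ≠ 0 := by positivity
  have hcpow : (resCard F : ℂ) ^ (-(1 : ℂ)) = ((qN F : ℝ) : ℂ)⁻¹ := by
    rw [coe_qN, Complex.cpow_neg_one]
  rw [lEta, hcpow]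
  have hb : ∀ x : F, μ {y | absF (y - x) ≤ qN F ^ (-1 : ℤ)} ≠ ∞ := by
    intro x
    rw [measure_closedBall]
    exact ENNReal.coe_ne_top
  have hball : ∀ x : F, {y | absF (y - x) ≤ qN F ^ (-1 : ℤ)} = {y | absF (y - x) < 1} := by
    intro x
    ext y
    rw [Set.mem_ofPred_eq, Set.mem_ofPred_eq, absF_lt_one_iff, zpow_neg_one]
  have hsub : ∀ x : F, absF x ≤ 1 → {y | absF (y - x) ≤ qN F ^ (-1 : ℤ)} ⊆ ballF 0 := by
    intro x hx y hy
    rw [hball] at hy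
    rw [mem_ballF, zpow_zero, ← sub_add_cancel y x]
    exact (absF_add_le _ _).trans (max_le (le_of_lt hy) hx)
  -- The integers with unit norm have volume 1 - 2/q, 1 or 1 - 1/q times vol(O) in the split, inert
  -- and ramified cases. With the tail 1/q the totals are 1 - 1/q, 1 + 1/q and 1, the inverses of
  -- L(1, η).
  rcases type_trichotomy hτ with ⟨hs, r, s, hr, hs1, hrs, hf⟩ | ⟨hs, hi, hn⟩ | ⟨hs, hi, r, hr, h1, h2⟩
  · rw [if_pos hs]
    have hA : unitValues ι τ = ballF 0 \ ({y | absF (y - r) ≤ qN F ^ (-1 : ℤ)} ∪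
        {y | absF (y - s) ≤ qN F ^ (-1 : ℤ)}) := by
      ext z
      rw [hball, hball, Set.mem_sdiff, mem_ballF, zpow_zero]
      refine and_congr_right fun hz => ?_
      rw [hf, absF_mul, Set.mem_union, not_or, Set.mem_ofPred_eq, Set.mem_ofPred_eq, not_lt, not_lt]
      have e1 : absF (z - r) ≤ 1 := (absF_sub_le _ _).trans (max_le hz hr)
      have e2 : absF (z - s) ≤ 1 := (absF_sub_le _ _).trans (max_le hz hs1)
      constructor
      · intro h
        constructor
        · by_contra! hlt
          exact (mul_lt_one_of_nonneg_of_lt_one_left zero_le hlt e2).ne h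
        · by_contra! hlt
          exact (mul_lt_one_of_nonneg_of_lt_one_right e1 zero_le hlt).ne h
      · rintro ⟨h3, h4⟩
        rw [le_antisymm e1 h3, le_antisymm e2 h4, one_mul]
    have hdisj : Disjoint {y | absF (y - r) ≤ qN F ^ (-1 : ℤ)} {y | absF (y - s) ≤ qN F ^ (-1 : ℤ)} := by
      rw [hball, hball, Set.disjoint_left]
      intro y hy1 hy2
      rw [Set.mem_ofPred_eq] at hy1 hy2
      rw [absF_sub_comm] at hy1
      have e : r - s = (r - y) + (y - s) := by ring
      rw [e] at hrs
      exact ((absF_add_le _ _).trans_lt (max_lt hy1 hy2)).ne hrs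
    have hmA : μ.real (unitValues ι τ) = volO μ - 2 * ((qN F : ℝ)⁻¹ * volO μ) := by
      rw [hA, measureReal_sdiff (Set.union_subset (hsub r hr) (hsub s hs1))
        ((isClosed_closedBall r _).measurableSet.union (isClosed_closedBall s _).measurableSet)
        (measure_ballF_ne_top μ 0),
        measureReal_union hdisj (isClosed_closedBall s _).measurableSet (hb r)
          (hb s), hO, measureReal_closedBall, measureReal_closedBall]
      simp
      ring
    rw [hmA] at hR
    refine eq_inv_of_mul_eq_one_left ?_
    rw [NNReal.coe_mul, ← Complex.ofReal_inv, ← Complex.ofReal_one, ← Complex.ofReal_sub,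
      ← Complex.ofReal_mul]
    congr 1
    linear_combination hR
  · rw [if_neg hs, if_pos hi]
    have hA : unitValues ι τ = ballF 0 := by
      ext z
      rw [mem_ballF, zpow_zero]
      exact ⟨fun h => h.1, fun h => ⟨h, hn z h⟩⟩
    rw [hA, hO] at hR
    refine eq_inv_of_mul_eq_one_left ?_
    rw [NNReal.coe_mul, ← Complex.ofReal_inv, ← Complex.ofReal_one, ← Complex.ofReal_add,
      ← Complex.ofReal_mul]
    congr 1
    linear_combination hR
  · rw [if_neg hs, if_neg hi]
    have hA : unitValues ι τ = ballF 0 \ {y | absF (y - r) ≤ qN F ^ (-1 : ℤ)} := by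
      ext z
      rw [hball, Set.mem_sdiff, mem_ballF, zpow_zero]
      refine and_congr_right fun hz => ⟨fun h h3 => ?_, h2 z hz⟩
      rw [h1 z h3] at h
      exact (inv_lt_one_of_one_lt₀ (one_lt_qN F)).ne h
    have hmA : μ.real (unitValues ι τ) = volO μ - (qN F : ℝ)⁻¹ * volO μ := by
      rw [hA, measureReal_sdiff (hsub r hr) (isClosed_closedBall r _).measurableSet
        (measure_ballF_ne_top μ 0), hO, measureReal_closedBall]
      simp
    rw [hmA] at hR
    rw [NNReal.coe_mul, ← Complex.ofReal_one, ← hR]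
    congr 1
    ring

end TorusIntegral

end LocalToric

end

noncomputable section

namespace LocalToric

/-! ### Convolutions on abelian groups -/

section Convolution

variable {G : Type*} [CommGroup G] [TopologicalSpace G]

/-- A continuous unitary character. -/
structure IsUnitaryChar (χ : G →* ℂˣ) : Prop where
  continuous : Continuous χ
  norm_eq_one : ∀ t, ‖(χ t : ℂ)‖ = 1

lemma IsUnitaryChar.continuous_coe {χ : G →* ℂˣ} (hχ : IsUnitaryChar χ) :
    Continuous fun t => (χ t : ℂ) := Units.continuous_val.comp hχ.continuous

lemma IsUnitaryChar.conj_eq {χ : G →* ℂˣ} (hχ : IsUnitaryChar χ) (t : G) :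
    conj (χ t : ℂ) = ((χ t)⁻¹ : ℂˣ) := by
  rw [Units.val_inv_eq_inv_val, Complex.inv_def, Complex.normSq_eq_norm_sq, hχ.norm_eq_one]
  simp

lemma IsUnitaryChar.mul {χ ψ : G →* ℂˣ} (hχ : IsUnitaryChar χ) (hψ : IsUnitaryChar ψ) :
    IsUnitaryChar (χ * ψ) :=
  ⟨hχ.continuous.mul hψ.continuous, fun t => by
    rw [MonoidHom.mul_apply, Units.val_mul, norm_mul, hχ.norm_eq_one, hψ.norm_eq_one, one_mul]⟩

lemma isUnitaryChar_one : IsUnitaryChar (1 : G →* ℂˣ) :=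
  ⟨continuous_const, fun t => by simp⟩

variable [IsTopologicalGroup G] [SecondCountableTopology G] [MeasurableSpace G] [BorelSpace G]
  {μ : Measure G} [μ.IsMulLeftInvariant] [SFinite μ]

lemma IsUnitaryChar.integrable_mul {χ : G →* ℂˣ} (hχ : IsUnitaryChar χ) {A : G → ℂ}
    (hA : Integrable A μ) : Integrable (fun t => χ t * A t) μ :=
  hA.bdd_mul (c := 1) hχ.continuous_coe.aestronglyMeasurable
    (Eventually.of_forall fun t => (hχ.norm_eq_one t).le)

lemma integral_char_translate (χ : G →* ℂˣ) (A : G → ℂ) (v : G) :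
    ∫ t, χ t * A (v * t) ∂μ = ((χ v)⁻¹ : ℂˣ) * ∫ t, χ t * A t ∂μ := by
  rw [← integral_mul_left_eq_self (fun t => χ t * A t) v, ← integral_const_mul]
  congr 1
  funext t
  rw [map_mul, Units.val_mul, ← mul_assoc, ← mul_assoc, Units.inv_mul, one_mul]

/-- The map (v, t) ↦ (v, vt) preserves the product measure, so this is the integrability of a
product of functions in separate variables. -/
lemma integrable_translate_mul {A B : G → ℂ} (hA : Integrable A μ) (hB : Integrable B μ) :
    Integrable (fun p : G × G => A (p.1 * p.2) * B p.1) (μ.prod μ) := by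
  have h := (measurePreserving_prod_mul μ μ).integrable_comp_of_integrable (hB.mul_prod hA)
  refine h.congr (Eventually.of_forall fun p => ?_)
  simp [mul_comm]

lemma integrable_convolution {χ : G →* ℂˣ} (hχ : IsUnitaryChar χ) {A B : G → ℂ}
    (hA : Integrable A μ) (hB : Integrable B μ) :
    Integrable (fun t => (∫ v, A (v * t) * B v ∂μ) * χ t) μ := by
  have h := (integrable_translate_mul hA hB).integral_prod_right
  refine (hχ.integrable_mul h).congr (Eventually.of_forall fun t => ?_)
  simp [mul_comm]

/-- The Fourier coefficient of a convolution. -/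
lemma integral_convolution {χ : G →* ℂˣ} (hχ : IsUnitaryChar χ) {A B : G → ℂ}
    (hA : Integrable A μ) (hB : Integrable B μ) :
    ∫ t, (∫ v, A (v * t) * conj (B v) ∂μ) * χ t ∂μ =
      (∫ t, χ t * A t ∂μ) * conj (∫ t, χ t * B t ∂μ) := by
  have hB' : Integrable (fun v => conj (B v)) μ :=
    Complex.conjLIE.integrable_comp_iff.2 hB
  have h : Integrable (Function.uncurry fun v t => χ t * (A (v * t) * conj (B v))) (μ.prod μ) := by
    refine (integrable_translate_mul hA hB').bdd_mul (c := 1) ?_ ?_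
    · exact (hχ.continuous_coe.comp continuous_snd).aestronglyMeasurable
    · exact Eventually.of_forall fun p => (hχ.norm_eq_one p.2).le
  have h1 : ∀ t, (∫ v, A (v * t) * conj (B v) ∂μ) * χ t =
      ∫ v, χ t * (A (v * t) * conj (B v)) ∂μ := by
    intro t
    rw [integral_const_mul, mul_comm]
  simp_rw [h1]
  rw [← integral_integral_swap h, ← integral_conj, ← integral_const_mul]
  congr 1
  funext v
  simp_rw [← mul_assoc]
  rw [integral_mul_const, integral_char_translate, map_mul, hχ.conj_eq]
  ring

variable {X : Type*} [MeasurableSpace X] {ν : Measure X} [SFinite ν] {p : X → G}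

variable (ν p) in
/-- The operator `F ↦ ∫ (F(p(z) u) - F(u)) dz`. -/
def diffOp (A : G → ℂ) (u : G) : ℂ := ∫ z, (A (p z * u) - A u) ∂ν

/-- The difference vanishes for z outside S. Over S, which has finite measure, both terms are
integrable separately, the first because (z, u) ↦ (z, p(z)u) preserves the measure. -/
lemma integrable_diff (hp : Measurable p) {A : G → ℂ} (hA : Integrable A μ) {S : Set X}
    (hSν : ν S ≠ ∞) (h : ∀ z ∉ S, ∀ u, A (p z * u) = A u) :
    Integrable (fun q : X × G => A (p q.1 * q.2) - A q.2) (ν.prod μ) := by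
  have hfin : IsFiniteMeasure (ν.restrict S) := ⟨by simpa using hSν.lt_top⟩
  have hskew : MeasurePreserving (fun q : X × G => (q.1, p q.1 * q.2))
      ((ν.restrict S).prod μ) ((ν.restrict S).prod μ) := by
    refine (MeasurePreserving.id (ν.restrict S)).skew_product (g := fun z u => p z * u) ?_ ?_
    · exact (hp.comp measurable_fst).mul measurable_snd
    · exact Eventually.of_forall fun z => map_mul_left_eq_self μ (p z)
  have h1 : Integrable (fun q : X × G => A q.2) ((ν.restrict S).prod μ) := hA.comp_snd _
  have h2 := (hskew.integrable_comp_of_integrable h1).sub h1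
  have h3 : (ν.restrict S).prod μ = (ν.prod μ).restrict (S ×ˢ Set.univ) := by
    rw [← Measure.prod_restrict, Measure.restrict_univ]
  rw [h3] at h2
  refine (integrableOn_iff_integrable_of_support_subset ?_).1 h2
  intro q hq
  refine ⟨?_, trivial⟩
  by_contra hn
  exact hq (by simp [h q.1 hn])

lemma integrable_diffOp (hp : Measurable p) {A : G → ℂ} (hA : Integrable A μ) {S : Set X}
    (hSν : ν S ≠ ∞) (h : ∀ z ∉ S, ∀ u, A (p z * u) = A u) :
    Integrable (diffOp ν p A) μ :=
  (integrable_diff hp hA hSν h).integral_prod_right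

/-- The Fourier coefficients of `diffOp`. -/
lemma integral_diffOp (hp : Measurable p) {χ : G →* ℂˣ} (hχ : IsUnitaryChar χ) {A : G → ℂ}
    (hA : Integrable A μ) {S : Set X}
    (hSν : ν S ≠ ∞) (h : ∀ z ∉ S, ∀ u, A (p z * u) = A u) :
    ∫ t, χ t * diffOp ν p A t ∂μ =
      (∫ z, ((((χ (p z))⁻¹ : ℂˣ) : ℂ) - 1) ∂ν) * ∫ t, χ t * A t ∂μ := by
  have h1 : Integrable (Function.uncurry fun z t => χ t * (A (p z * t) - A t)) (ν.prod μ) := by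
    refine (integrable_diff hp hA hSν h).bdd_mul (c := 1) ?_ ?_
    · exact (hχ.continuous_coe.measurable.comp measurable_snd).aestronglyMeasurable
    · exact Eventually.of_forall fun p => (hχ.norm_eq_one p.2).le
  have h2 : ∀ t, χ t * diffOp ν p A t = ∫ z, χ t * (A (p z * t) - A t) ∂ν := by
    intro t
    rw [diffOp, integral_const_mul]
  simp_rw [h2]
  rw [← integral_integral_swap h1, ← integral_mul_const]
  congr 1
  funext z
  have hAz : Integrable (fun t => A (p z * t)) μ := hA.comp_mul_left (p z)
  simp_rw [mul_sub]
  rw [integral_sub (hχ.integrable_mul hAz) (hχ.integrable_mul hA), integral_char_translate]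
  ring

end Convolution

end LocalToric

end

noncomputable section

namespace LocalToric

/-! ### Powers of the absolute value on complements of balls -/

section Tail

variable {F : Type*} [Field F] [ValuativeRel F] [TopologicalSpace F] [IsNonarchimedeanLocalField F]

lemma ord_eq_of_shell {x : F} {n : ℤ} (h1 : x ∈ ballF (n + 1)) (h2 : x ∉ ballF n) :
    ord x = -(n + 1) := by
  have hx : x ≠ 0 := by
    rintro rfl
    rw [mem_ballF, absF_zero] at h2
    exact h2 zero_le
  rw [ord_eq_iff hx, neg_neg]
  refine le_antisymm h1 ?_
  by_contra! hlt
  exact h2 (absF_lt_zpow_iff.1 hlt)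

lemma compl_ballF_eq (n : ℤ) :
    (ballF n : Set F)ᶜ = (ballF (n + 1) \ ballF n) ∪ (ballF (n + 1))ᶜ := by
  have h : (ballF n : Set F) ⊆ ballF (n + 1) := fun x hx =>
    le_trans (b := qN F ^ n) hx (zpow_le_zpow_right₀ (one_lt_qN F).le (by omega))
  ext x
  have := @h x
  simp only [Set.mem_compl_iff, Set.mem_union, Set.mem_sdiff]
  tauto

variable (F) in
/-- The function `|x|^{-2s}`. -/
def absPow (s : ℂ) (x : F) : ℂ := (resCard F : ℂ) ^ (2 * s * (ord x : ℂ))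

lemma norm_absPow (s : ℂ) (x : F) : ‖absPow F s x‖ = (qN F : ℝ) ^ (2 * s.re * (ord x : ℝ)) := by
  have hq : (0 : ℝ) < qN F := by exact_mod_cast qN_pos F
  rw [absPow, ← coe_qN, Complex.norm_cpow_eq_rpow_re_of_pos hq]
  congr 1
  simp

variable [MeasurableSpace F] [BorelSpace F] (μ : Measure F) [μ.IsAddHaarMeasure]

lemma measurable_ord : Measurable (ord : F → ℤ) := by
  refine measurable_to_countable' fun n => ?_
  -- The valuation of 0 is a default integer, so the fibre over that integer contains 0 besides a
  -- sphere.
  by_cases h : n = ord (0 : F)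
  · have : (ord : F → ℤ) ⁻¹' {n} = {x | absF x = qN F ^ (-n)} ∪ {0} := by
      ext x
      by_cases hx : x = 0
      · simp [hx, h]
      · simp [hx, ord_eq_iff hx]
    rw [this]
    exact (measurable_absF (measurableSet_singleton _)).union (measurableSet_singleton _)
  · have : (ord : F → ℤ) ⁻¹' {n} = {x | absF x = qN F ^ (-n)} \ {0} := by
      ext x
      by_cases hx : x = 0
      · simp [hx, Ne.symm h]
      · simp [hx, ord_eq_iff hx]
    rw [this]
    exact (measurable_absF (measurableSet_singleton _)).diff (measurableSet_singleton _)

lemma measurable_absPow (s : ℂ) : Measurable (absPow F s) :=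
  (measurable_of_countable fun n : ℤ => (resCard F : ℂ) ^ (2 * s * (n : ℂ))).comp measurable_ord

/-- On the shells |x| = q^{n+j+1} the integrals of the absolute value are bounded by a geometric
series in j of ratio q^{1 - 2 Re s} < 1. -/
lemma integrableOn_absPow {s : ℂ} (hs : 1 / 2 < s.re) (n : ℤ) :
    IntegrableOn (absPow F s) (ballF n)ᶜ μ := by
  have hq1 : (1 : ℝ) < qN F := by exact_mod_cast one_lt_qN F
  have hq : (0 : ℝ) < qN F := by positivity
  refine ⟨(measurable_absPow s).aestronglyMeasurable, ?_⟩
  rw [hasFiniteIntegral_iff_enorm]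
  set S : ℕ → Set F := fun j => ballF (n + j + 1) \ ballF (n + j) with hS
  have hcov : (ballF n : Set F)ᶜ ⊆ ⋃ j, S j := by
    intro x hx
    have hex : ∃ j : ℕ, x ∈ ballF (n + j) := by
      obtain ⟨k, hk⟩ := exists_lt_zpow (F := F) (absF x)
      refine ⟨(k - n).toNat, ?_⟩
      rw [mem_ballF]
      exact hk.le.trans (zpow_le_zpow_right₀ (one_lt_qN F).le (by omega))
    classical
    have h0 : Nat.find hex ≠ 0 := by
      intro h
      have := Nat.find_spec hex
      rw [h] at this
      exact hx (by simpa using this)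
    obtain ⟨j, hj⟩ := Nat.exists_eq_succ_of_ne_zero h0
    refine Set.mem_iUnion.2 ⟨j, ?_, Nat.find_min hex (by omega)⟩
    have := Nat.find_spec hex
    rw [hj] at this
    push_cast at this
    rwa [← add_assoc] at this
  set r : ℝ := (qN F : ℝ) ^ (1 - 2 * s.re) with hr
  have hr0 : 0 < r := Real.rpow_pos_of_pos hq _
  have hr1 : r < 1 := Real.rpow_lt_one_of_one_lt_of_neg hq1 (by linarith)
  have hbound : ∀ j, ∫⁻ x in S j, ‖absPow F s x‖ₑ ∂μ ≤
      ENNReal.ofReal (volO μ * (qN F : ℝ) ^ ((1 - 2 * s.re) * (n + 1)) * r ^ j) := by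
    intro j
    have h1 : ∫⁻ x in S j, ‖absPow F s x‖ₑ ∂μ ≤
        ∫⁻ x in S j, ENNReal.ofReal ((qN F : ℝ) ^ (2 * s.re * (-(n + j + 1) : ℝ))) ∂μ := by
      refine setLIntegral_mono measurable_const fun x hx => ?_
      rw [← ofReal_norm, norm_absPow, ord_eq_of_shell hx.1 hx.2]
      push_cast
      exact le_rfl
    refine h1.trans ?_
    rw [setLIntegral_const]
    have h2 : μ (S j) ≤ ENNReal.ofReal ((qN F : ℝ) ^ ((n + j + 1 : ℤ) : ℝ) * volO μ) := by
      refine (measure_mono (Set.sdiff_subset)).trans ?_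
      rw [measure_ballF, Real.rpow_intCast, ENNReal.ofReal, Real.toNNReal_mul (by positivity)]
      rw [Real.toNNReal_coe, ← NNReal.coe_zpow, Real.toNNReal_coe]
    refine (mul_le_mul_right h2 _).trans ?_
    rw [← ENNReal.ofReal_mul (by positivity)]
    refine ENNReal.ofReal_le_ofReal (le_of_eq ?_)
    rw [hr, ← Real.rpow_natCast, ← Real.rpow_mul hq.le, mul_assoc (volO μ : ℝ), ← Real.rpow_add hq,
      ← mul_assoc, ← Real.rpow_add hq, mul_comm]
    congr 2
    push_cast
    ring
  refine (lintegral_mono_set hcov).trans_lt ?_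
  refine (lintegral_iUnion_le _ _).trans_lt ?_
  refine (ENNReal.tsum_le_tsum hbound).trans_lt ?_
  refine (Summable.tsum_ofReal_lt_top ?_)
  exact (summable_geometric_of_lt_one hr0.le hr1).mul_left _

lemma cpow_split (a b : ℂ) : (resCard F : ℂ) ^ (a + b) = (resCard F : ℂ) ^ a * (resCard F : ℂ) ^ b :=
  Complex.cpow_add _ _ (resCard_ne_zero F)

lemma one_sub_cpow_ne_zero {s : ℂ} (hs : 1 / 2 < s.re) : 1 - (resCard F : ℂ) ^ (1 - 2 * s) ≠ 0 := by
  have hq1 : (1 : ℝ) < qN F := by exact_mod_cast one_lt_qN F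
  have hq : (0 : ℝ) < qN F := by positivity
  intro h
  have h1 : ‖(resCard F : ℂ) ^ (1 - 2 * s)‖ = 1 := by
    rw [← sub_eq_zero.1 h, norm_one]
  rw [← coe_qN, Complex.norm_cpow_eq_rpow_re_of_pos hq] at h1
  have : (qN F : ℝ) ^ (1 - 2 * s).re < 1 :=
    Real.rpow_lt_one_of_one_lt_of_neg hq1 (by simp; linarith)
  exact this.ne h1

/-- The integral of `|x|^{-2s}` over the complement of a ball. -/
lemma integral_absPow {s : ℂ} (hs : 1 / 2 < s.re) (n : ℤ) :
    ∫ x in (ballF n)ᶜ, absPow F s x ∂μ =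
      (volO μ : ℝ) * (((qN F : ℝ) : ℂ) ^ (n + 1) - ((qN F : ℝ) : ℂ) ^ n) *
        (resCard F : ℂ) ^ (-(2 * s * (n + 1))) / (1 - (resCard F : ℂ) ^ (1 - 2 * s)) := by
  have hmb := fun k : ℤ => measurableSet_ballF (F := F) k
  have hsub : (ballF n : Set F) ⊆ ballF (n + 1) := fun x hx =>
    le_trans (b := qN F ^ n) hx (zpow_le_zpow_right₀ (one_lt_qN F).le (by omega))
  have h1 : ∫ x in (ballF n)ᶜ, absPow F s x ∂μ =
      ∫ x in ballF (n + 1) \ ballF n, absPow F s x ∂μ + ∫ x in (ballF (n + 1))ᶜ, absPow F s x ∂μ := by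
    have hi := integrableOn_absPow μ hs n
    rw [compl_ballF_eq] at hi ⊢
    refine setIntegral_union ?_ (hmb _).compl (hi.mono_set Set.subset_union_left)
      (hi.mono_set Set.subset_union_right)
    exact Set.disjoint_compl_right_iff_subset.2 Set.sdiff_subset
  have h2 : ∫ x in ballF (n + 1) \ ballF n, absPow F s x ∂μ =
      (volO μ : ℝ) * (((qN F : ℝ) : ℂ) ^ (n + 1) - ((qN F : ℝ) : ℂ) ^ n) *
        (resCard F : ℂ) ^ (-(2 * s * (n + 1))) := by
    rw [setIntegral_congr_fun (g := fun _ => (resCard F : ℂ) ^ (-(2 * s * (n + 1))))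
      ((hmb _).diff (hmb _)), setIntegral_const,
      measureReal_sdiff hsub (hmb n) (measure_ballF_ne_top μ _), measureReal_ballF, measureReal_ballF,
      Complex.real_smul]
    · push_cast
      ring
    · intro x hx
      simp only [absPow]
      rw [ord_eq_of_shell hx.1 hx.2]
      congr 1
      push_cast
      ring
  -- Scaling by the uniformizer multiplies the tail integral by q^{1-2s}. Together with the value on
  -- one shell this is a linear equation for the tail.
  have h3 : ∫ x in (ballF (n + 1))ᶜ, absPow F s x ∂μ =
      (resCard F : ℂ) ^ (1 - 2 * s) * ∫ x in (ballF n)ᶜ, absPow F s x ∂μ := by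
    rw [← integral_indicator (hmb _).compl, ← integral_indicator (hmb _).compl]
    have hu := unif_ne_zero F
    have h4 := integral_mul_left_eq μ (inv_ne_zero hu) ((ballF (n + 1))ᶜ.indicator (absPow F s))
    have h5 : ∀ x : F, (ballF (n + 1))ᶜ.indicator (absPow F s) ((unif F)⁻¹ * x) =
        (resCard F : ℂ) ^ (-(2 * s)) * (ballF n)ᶜ.indicator (absPow F s) x := by
      intro x
      have hmem : (unif F)⁻¹ * x ∈ (ballF (n + 1) : Set F)ᶜ ↔ x ∈ (ballF n : Set F)ᶜ := by
        rw [Set.mem_compl_iff, Set.mem_compl_iff, mem_ballF, mem_ballF, absF_mul, absF_inv, absF_unif,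
          inv_inv, zpow_add_one₀ (qN_ne_zero F), mul_comm, mul_le_mul_iff_left₀ (qN_pos F)]
      by_cases hx : x ∈ (ballF n : Set F)ᶜ
      · have hx0 : x ≠ 0 := by
          rintro rfl
          exact hx (by rw [mem_ballF, absF_zero]; exact zero_le)
        rw [Set.indicator_of_mem (hmem.2 hx), Set.indicator_of_mem hx, absPow, absPow,
          ord_mul (inv_ne_zero hu) hx0, ord_inv, ord_unif, ← cpow_split]
        congr 1
        push_cast
        ring
      · rw [Set.indicator_of_notMem (mt hmem.1 hx), Set.indicator_of_notMem hx, mul_zero]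
    simp_rw [h5] at h4
    rw [integral_const_mul, absF_inv, absF_unif, inv_inv] at h4
    have hq0 := resCard_ne_zero F
    have h6 : ((qN F : ℝ≥0) : ℂ) = resCard F := coe_qN
    rw [h6, eq_inv_mul_iff_mul_eq₀ hq0] at h4
    rw [← h4, ← mul_assoc, sub_eq_add_neg, cpow_split, Complex.cpow_one]
  rw [eq_div_iff (one_sub_cpow_ne_zero hs), ← h2]
  rw [h3] at h1
  linear_combination h1

end Tail

/-! ### The intertwining operator -/

section Intertwiner

variable {F : Type*} [Field F] [ValuativeRel F] [TopologicalSpace F] [IsNonarchimedeanLocalField F]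

/-- The difference vanishes near 1, so it has infinite order there, hence everywhere on the
connected plane. Continuity at 0 passes from a punctured neighbourhood to the value, so the value at
0 is independent of the chosen continuation. -/
lemma eq_of_meromorphic {J₁ J₂ : ℂ → ℂ} (h1 : Meromorphic J₁) (h2 : Meromorphic J₂)
    (h1' : ContinuousAt J₁ 0) (h2' : ContinuousAt J₂ 0)
    (h : ∀ s : ℂ, 1 / 2 < s.re → J₁ s = J₂ s) : J₁ 0 = J₂ 0 := by
  have hm : Meromorphic (J₁ - J₂) := fun x => (h1 x).sub (h2 x)
  have htop : ∀ u : ℂ, meromorphicOrderAt (J₁ - J₂) u = ⊤ := by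
    by_contra! hne
    have := (Meromorphic.exists_meromorphicOrderAt_ne_top_iff_forall hm).1 hne 1
    refine this (meromorphicOrderAt_eq_top_iff.2 ?_)
    refine eventually_nhdsWithin_of_eventually_nhds ?_
    have ho : IsOpen {s : ℂ | 1 / 2 < s.re} := isOpen_lt continuous_const Complex.continuous_re
    filter_upwards [ho.mem_nhds (show (1 : ℂ) ∈ {s : ℂ | 1 / 2 < s.re} by simp; norm_num)] with s hs
    rw [Pi.sub_apply, h s hs, sub_self]
  have h0 := meromorphicOrderAt_eq_top_iff.1 (htop 0)
  have hc : ContinuousAt (J₁ - J₂) 0 := h1'.sub h2'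
  have hlim : Tendsto (J₁ - J₂) (𝓝[≠] 0) (𝓝 0) :=
    tendsto_const_nhds.congr' (h0.mono fun z hz => hz.symm)
  have := tendsto_nhds_unique (hc.tendsto.mono_left nhdsWithin_le_nhds) hlim
  exact sub_eq_zero.1 this

/-- Behaviour at infinity of the big cell: the factor after b tends to 1 as x grows. The diagonal
ratio of b is a square, so the inducing character is trivial on b when α² = 1. -/
lemma lowerUnipOmega_eq {x : F} (hx : x ≠ 0) : ∃ b : GL (Fin 2) F, b 1 0 = 0 ∧ b 1 1 / b 0 0 = x ^ 2 ∧
    lowerUnipOmega x = b * (lowerUnipOmega (-x⁻¹) * (lowerUnipOmega 0)⁻¹) := by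
  have h10 : (lowerUnipOmega x * lowerUnipOmega 0 : GL (Fin 2) F) 1 0 = -x := by
    rw [Units.val_mul, lowerUnipOmega_val, lowerUnipOmega_val, Matrix.mul_apply, Fin.sum_univ_two]
    simp
  have h11 : (lowerUnipOmega x * lowerUnipOmega 0 : GL (Fin 2) F) 1 1 = -1 := by
    rw [Units.val_mul, lowerUnipOmega_val, lowerUnipOmega_val, Matrix.mul_apply, Fin.sum_univ_two]
    simp
  have hd : ((lowerUnipOmega x * lowerUnipOmega 0 : GL (Fin 2) F) : Matrix (Fin 2) (Fin 2) F).det = 1 := by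
    rw [Units.val_mul, Matrix.det_mul, lowerUnipOmega_val, lowerUnipOmega_val]
    simp
  obtain ⟨b, hb, hb1, hb0, he⟩ := exists_borel_mul_lowerUnipOmega (lowerUnipOmega x * lowerUnipOmega 0)
    (by rw [h10]; exact neg_ne_zero.2 hx)
  refine ⟨b, hb, ?_, ?_⟩
  · rw [hb1, hb0, hd, h10]
    field_simp
  · rw [h10, h11, neg_div_neg_eq, one_div] at he
    rw [← mul_assoc, ← he, mul_inv_cancel_right]

lemma borelChar_of_sq {α : ℂˣ} (hα : α ^ 2 = 1) {b : GL (Fin 2) F} {x : F} (hx : x ≠ 0)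
    (h : b 1 1 / b 0 0 = x ^ 2) : borelChar α b = 1 := by
  rw [borelChar, h, pow_two, ord_mul hx hx, ← two_mul, zpow_mul]
  have : α ^ (2 : ℤ) = 1 := by exact_mod_cast hα
  rw [this, one_zpow, Units.val_one]

/-- Uniform behaviour of `φ(n ω g)` for large `n`. -/
lemma exists_ball_const {α : ℂˣ} (hα : α ^ 2 = 1) (φ : IndSpace F α) (g₀ : GL (Fin 2) F) :
    ∃ n : ℕ, ∀ᶠ g in 𝓝 g₀, ∀ x : F, x ∉ ballF (n : ℤ) →
      iwasawaExp (lowerUnipOmega x * g) = 2 * ord x + iwasawaExp g ∧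
        φ.1 (lowerUnipOmega x * g) = φ.1 g := by
  have hL : IsLocallyConstant (iwasawaExp (F := F)) :=
    (IsLocallyConstant.iff_continuous _).2 continuous_iwasawaExp
  -- This map is continuous with value g at (0, g). Local constancy near (0, g₀), applied at -x⁻¹
  -- for large x, gives one radius valid for all g near g₀.
  set m : F × GL (Fin 2) F → GL (Fin 2) F :=
    fun p => lowerUnipOmega p.1 * (lowerUnipOmega 0)⁻¹ * p.2 with hm
  have hmc : Continuous m :=
    ((continuous_lowerUnipOmega.comp continuous_fst).mul_const _).mul continuous_snd
  have hm0 : m (0, g₀) = g₀ := by simp [hm]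
  have e1 : ∀ᶠ p in 𝓝 ((0 : F), g₀), iwasawaExp (m p) = iwasawaExp g₀ := by
    have := hL.eventually_eq g₀
    rw [← hm0] at this
    simpa [hm0] using (hmc.tendsto (0, g₀)).eventually this
  have e2 : ∀ᶠ p in 𝓝 ((0 : F), g₀), φ.1 (m p) = φ.1 g₀ := by
    have := φ.2.1.eventually_eq g₀
    rw [← hm0] at this
    simpa [hm0] using (hmc.tendsto (0, g₀)).eventually this
  obtain ⟨P, hP, Q, hQ, hPQ⟩ := (eventually_prod_iff (f := 𝓝 (0 : F)) (g := 𝓝 g₀)).1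
    (by rw [← nhds_prod_eq]; exact e1.and e2)
  obtain ⟨n, -, hn⟩ := (hasBasis_nhds (0 : F)).mem_iff.1 hP
  refine ⟨n, ?_⟩
  filter_upwards [hQ, hL.eventually_eq g₀, φ.2.1.eventually_eq g₀] with g hg hg1 hg2 x hx
  have hx0 : x ≠ 0 := by
    rintro rfl
    exact hx (by rw [mem_ballF, absF_zero]; exact zero_le)
  obtain ⟨b, hb, hbx, hbe⟩ := lowerUnipOmega_eq hx0
  have hPx : P (-x⁻¹) := by
    refine hn ?_
    change absF (-x⁻¹ - 0) ≤ _
    rw [sub_zero, absF_neg, absF_inv, zpow_neg]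
    rw [mem_ballF, not_le] at hx
    exact inv_anti₀ (zpow_pos (qN_pos F) _) hx.le
  obtain ⟨h1, h2⟩ := hPQ hPx hg
  rw [hbe, mul_assoc]
  constructor
  · rw [iwasawaExp_borel_mul hb, hbx, pow_two, ord_mul hx0 hx0, hg1, ← h1]
    ring
  · rw [φ.2.2 b _ hb, borelChar_of_sq hα hx0 hbx, one_mul, hg2, ← h2]

variable [MeasurableSpace F] [BorelSpace F] (μ : Measure F) [μ.IsAddHaarMeasure]

/-- A regularisation of the intertwining integral at `s = 0`. -/
def regIntertwiner (φ : GL (Fin 2) F → ℂ) (g : GL (Fin 2) F) : ℂ :=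
  ∫ x, (φ (lowerUnipOmega x * g) - φ g) ∂μ

lemma regIntertwiner_eq {φ : GL (Fin 2) F → ℂ} (hφ : Continuous φ) {g : GL (Fin 2) F} {n : ℤ}
    (h : ∀ x : F, x ∉ ballF n → φ (lowerUnipOmega x * g) = φ g) :
    regIntertwiner μ φ g = ∫ x in ballF n, φ (lowerUnipOmega x * g) ∂μ -
      ((qN F : ℝ) : ℂ) ^ n * (volO μ : ℝ) * φ g := by
  have hc : Continuous fun x : F => φ (lowerUnipOmega x * g) :=
    hφ.comp (continuous_lowerUnipOmega.mul continuous_const)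
  have hfin : IsFiniteMeasure (μ.restrict (ballF n)) :=
    ⟨by simpa using (measure_ballF_ne_top μ n).lt_top⟩
  rw [regIntertwiner, ← setIntegral_eq_integral_of_forall_compl_eq_zero (s := ballF n)
    (fun x hx => by rw [h x hx, sub_self]), integral_sub
      (hc.continuousOn.integrableOn_compact (isCompact_ballF n)) (integrable_const _),
    setIntegral_const, measureReal_ballF, Complex.real_smul]
  push_cast
  rfl

/-- On a compact ball the Iwasawa exponent takes finitely many values, so this part of the
intertwining integral is a finite sum of exponentials, hence entire in s. -/
lemma integral_flatSection_ball {φ : GL (Fin 2) F → ℂ} (hφ : Continuous φ) (g : GL (Fin 2) F) (n : ℤ) :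
    ∃ (S : Finset ℤ) (a : ℤ → ℂ), ∀ s : ℂ, ∫ x in ballF n, flatSection φ s (lowerUnipOmega x * g) ∂μ =
      ∑ k ∈ S, (resCard F : ℂ) ^ (s * k) * a k := by
  classical
  have hc : Continuous fun x : F => φ (lowerUnipOmega x * g) :=
    hφ.comp (continuous_lowerUnipOmega.mul continuous_const)
  have hE : Continuous fun x : F => iwasawaExp (lowerUnipOmega x * g) :=
    continuous_iwasawaExp.comp (continuous_lowerUnipOmega.mul continuous_const)
  have hfin : ((fun x : F => iwasawaExp (lowerUnipOmega x * g)) '' ballF n).Finite :=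
    ((isCompact_ballF n).image hE).finite_of_discrete
  refine ⟨hfin.toFinset, fun k => ∫ x in ballF n,
    ({x : F | iwasawaExp (lowerUnipOmega x * g) = k}.indicator
      (fun x => φ (lowerUnipOmega x * g)) x) ∂μ, fun s => ?_⟩
  simp_rw [← integral_const_mul]
  rw [← integral_finsetSum]
  · refine setIntegral_congr_fun (measurableSet_ballF n) fun x hx => ?_
    have hmem : iwasawaExp (lowerUnipOmega x * g) ∈ hfin.toFinset := by
      rw [Set.Finite.mem_toFinset]
      exact ⟨x, hx, rfl⟩
    simp only [flatSection]
    rw [Finset.sum_eq_single_of_mem _ hmem]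
    · rw [Set.indicator_of_mem (by rfl)]
    · intro k _ hk
      rw [Set.indicator_of_notMem (fun h => hk h.symm), mul_zero]
  · intro k _
    refine Integrable.const_mul ?_ _
    refine Integrable.indicator (hc.continuousOn.integrableOn_compact (isCompact_ballF n)) ?_
    exact hE.measurable (measurableSet_singleton k)

/-- Beyond a large ball the flat section is a constant times |x|^{-2s}, whose integral continues
with denominator 1 - q^{1-2s}, nonzero at 0. At s = 0 the continued tail is minus the volume of the
ball times φ(g), which is the term subtracted in `regIntertwiner`. -/
lemma exists_isContinuation {α : ℂˣ} (hα : α ^ 2 = 1) (φ : IndSpace F α) (g : GL (Fin 2) F) :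
    ∃ J, IsContinuation μ φ.1 g J ∧ J 0 = regIntertwiner μ φ.1 g := by
  obtain ⟨n, hn⟩ := exists_ball_const hα φ g
  have hn := hn.self_of_nhds
  have hφ : Continuous φ.1 := φ.2.1.continuous
  obtain ⟨S, a, hSa⟩ := integral_flatSection_ball μ hφ g n
  have hq0 := resCard_ne_zero F
  have hq1 : (resCard F : ℂ) - 1 ≠ 0 := by
    rw [sub_ne_zero]
    exact_mod_cast (one_lt_resCard F).ne'
  set A : ℂ → ℂ := fun s => ∑ k ∈ S, (resCard F : ℂ) ^ (s * k) * a k with hA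
  set B : ℂ → ℂ := fun s => (resCard F : ℂ) ^ (s * iwasawaExp g) * φ.1 g *
    ((volO μ : ℝ) * (((qN F : ℝ) : ℂ) ^ ((n : ℤ) + 1) - ((qN F : ℝ) : ℂ) ^ (n : ℤ)) *
        (resCard F : ℂ) ^ (-(2 * s * ((n : ℤ) + 1)))) with hB
  set D : ℂ → ℂ := fun s => 1 - (resCard F : ℂ) ^ (1 - 2 * s) with hD
  have dA : Differentiable ℂ A := by
    refine Differentiable.fun_sum fun k _ => ?_
    exact (Differentiable.const_cpow (by fun_prop) (Or.inl hq0)).mul_const _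
  have dB : Differentiable ℂ B := by
    refine Differentiable.mul (Differentiable.mul_const
      (Differentiable.const_cpow (by fun_prop) (Or.inl hq0)) _) (Differentiable.const_mul
      (Differentiable.const_cpow (by fun_prop) (Or.inl hq0)) _)
  have dD : Differentiable ℂ D :=
    (Differentiable.const_cpow (by fun_prop) (Or.inl hq0)).const_sub 1
  have hD0 : D 0 = 1 - resCard F := by simp [hD]
  have hD0' : D 0 ≠ 0 := by rw [hD0, ← neg_sub]; exact neg_ne_zero.2 hq1
  refine ⟨fun s => A s + B s / D s, ⟨?_, ?_, ?_⟩, ?_⟩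
  · intro x
    exact (dA.analyticAt x).meromorphicAt.add
      ((dB.analyticAt x).meromorphicAt.div (dD.analyticAt x).meromorphicAt)
  · exact (dA.analyticAt 0).add ((dB.analyticAt 0).div (dD.analyticAt 0) hD0')
  · intro s hs
    have hcf : ∀ x ∉ ballF (n : ℤ), flatSection φ.1 s (lowerUnipOmega x * g) =
        (resCard F : ℂ) ^ (s * iwasawaExp g) * φ.1 g * absPow F s x := by
      intro x hx
      rw [flatSection, (hn x hx).1, (hn x hx).2, absPow]
      push_cast
      rw [mul_add, cpow_split]
      ring_nf
    have hi := integrableOn_absPow μ hs n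
    have hi1 : IntegrableOn (fun x => flatSection φ.1 s (lowerUnipOmega x * g)) (ballF (n : ℤ))ᶜ μ := by
      refine IntegrableOn.congr_fun (hi.const_mul ((resCard F : ℂ) ^ (s * iwasawaExp g) * φ.1 g))
        (fun x hx => (hcf x hx).symm) (measurableSet_ballF _).compl
    have hi2 : IntegrableOn (fun x => flatSection φ.1 s (lowerUnipOmega x * g)) (ballF (n : ℤ)) μ := by
      refine ContinuousOn.integrableOn_compact (isCompact_ballF _) (Continuous.continuousOn ?_)
      refine Continuous.mul ?_ (hφ.comp (continuous_lowerUnipOmega.mul continuous_const))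
      exact (continuous_of_discreteTopology (f := fun k : ℤ => (resCard F : ℂ) ^ (s * (k : ℂ)))).comp
        (continuous_iwasawaExp.comp (continuous_lowerUnipOmega.mul continuous_const))
    rw [intertwiningIntegral, ← integral_add_compl (measurableSet_ballF (F := F) (n : ℤ))
      (by rw [← integrableOn_univ, ← Set.union_compl_self (ballF (n : ℤ))]; exact hi2.union hi1), hSa s,
      setIntegral_congr_fun (measurableSet_ballF _).compl (fun x hx => hcf x hx), integral_const_mul,
      integral_absPow μ hs]
    simp only [hB, hD]
    ring
  · have hA0 : A 0 = ∫ x in ballF (n : ℤ), φ.1 (lowerUnipOmega x * g) ∂μ := by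
      rw [hA]
      simp only
      rw [← hSa 0]
      simp [flatSection]
    have hB0 : B 0 = φ.1 g * ((volO μ : ℝ) * ((resCard F : ℂ) ^ (n : ℤ) * (resCard F - 1))) := by
      simp only [hB, coe_qN]
      rw [zpow_add₀ hq0, zpow_one]
      simp only [zero_mul, mul_zero, neg_zero, Complex.cpow_zero]
      ring
    simp only
    rw [regIntertwiner_eq μ hφ (fun x hx => (hn x hx).2), hA0, hB0, hD0, coe_qN,
      ← neg_sub (resCard F : ℂ) 1, div_neg, ← sub_eq_add_neg]
    congr 1
    rw [div_eq_iff hq1]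
    ring

lemma intertwiner_eq {α : ℂˣ} (hα : α ^ 2 = 1) (φ : IndSpace F α) :
    intertwiner μ φ.1 = regIntertwiner μ φ.1 := by
  funext g
  obtain ⟨J, hJ, hJ0⟩ := exists_isContinuation μ hα φ g
  have hex : ∃ J, IsContinuation μ φ.1 g J := ⟨J, hJ⟩
  rw [intertwiner, dif_pos hex, ← hJ0]
  have hc := hex.choose_spec
  exact eq_of_meromorphic hc.1 hJ.1 hc.2.1.continuousAt hJ.2.1.continuousAt
    fun s hs => (hc.2.2 s hs).trans (hJ.2.2 s hs).symm

/-- The ball outside which the integrand vanishes can be chosen uniformly near g₀, and on this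
compact ball φ(nωg) is locally constant in g uniformly in n. -/
lemma isLocallyConstant_regIntertwiner {α : ℂˣ} (hα : α ^ 2 = 1) (φ : IndSpace F α) :
    IsLocallyConstant (regIntertwiner μ φ.1) := by
  rw [IsLocallyConstant.iff_eventually_eq]
  intro g₀
  obtain ⟨n, hn⟩ := exists_ball_const hα φ g₀
  have htube : ∀ᶠ g in 𝓝 g₀, ∀ x ∈ (ballF (n : ℤ) : Set F),
      φ.1 (lowerUnipOmega x * g) = φ.1 (lowerUnipOmega x * g₀) := by
    refine (isCompact_ballF (n : ℤ)).eventually_forall_of_forall_eventually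
      (P := fun g x => φ.1 (lowerUnipOmega x * g) = φ.1 (lowerUnipOmega x * g₀)) fun y _ => ?_
    have h1 : IsLocallyConstant fun p : GL (Fin 2) F × F => φ.1 (lowerUnipOmega p.2 * p.1) :=
      φ.2.1.comp_continuous ((continuous_lowerUnipOmega.comp continuous_snd).mul continuous_fst)
    have h2 : IsLocallyConstant fun p : GL (Fin 2) F × F => φ.1 (lowerUnipOmega p.2 * g₀) :=
      φ.2.1.comp_continuous ((continuous_lowerUnipOmega.comp continuous_snd).mul continuous_const)
    filter_upwards [h1.eventually_eq (g₀, y), h2.eventually_eq (g₀, y)] with p hp1 hp2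
    rw [hp1, hp2]
  filter_upwards [hn, htube, φ.2.1.eventually_eq g₀] with g hg hg1 hg2
  rw [regIntertwiner_eq μ φ.2.1.continuous (fun x hx => (hg x hx).2),
    regIntertwiner_eq μ φ.2.1.continuous (fun x hx => (hn.self_of_nhds x hx).2), hg2,
    setIntegral_congr_fun (measurableSet_ballF _) hg1]

/-- Moving b past nω is an affine substitution, whose Jacobian is the modular factor, and replaces
the character of b by its inverse. The two agree since α² = 1, so φ₁ times the conjugate of Λ(φ₂) is
modular. -/
lemma regIntertwiner_borel_mul {α : ℂˣ} (hα : α ^ 2 = 1) (φ : IndSpace F α) {b : GL (Fin 2) F}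
    (hb : b 1 0 = 0) (g : GL (Fin 2) F) :
    regIntertwiner μ φ.1 (b * g) = borelChar α b * (modChar b * regIntertwiner μ φ.1 g) := by
  obtain ⟨hb0, hb1⟩ := diag_ne_zero hb
  have key : ∀ x : F, φ.1 (lowerUnipOmega x * (b * g)) =
      borelChar α b * φ.1 (lowerUnipOmega (-(b 0 1 / b 0 0) + (b 1 1 / b 0 0) * x) * g) := by
    intro x
    have h10 : (lowerUnipOmega x * b : GL (Fin 2) F) 1 0 = b 0 0 := by
      rw [Units.val_mul, lowerUnipOmega_val, Matrix.mul_apply, Fin.sum_univ_two]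
      simp [hb]
    have h11 : (lowerUnipOmega x * b : GL (Fin 2) F) 1 1 = b 0 1 - x * b 1 1 := by
      rw [Units.val_mul, lowerUnipOmega_val, Matrix.mul_apply, Fin.sum_univ_two]
      simp [sub_eq_add_neg]
    have hd : ((lowerUnipOmega x * b : GL (Fin 2) F) : Matrix (Fin 2) (Fin 2) F).det =
        b 0 0 * b 1 1 := by
      rw [Units.val_mul, Matrix.det_mul, lowerUnipOmega_val, Matrix.det_fin_two, Matrix.det_fin_two, hb]
      simp
    obtain ⟨c, hc, hc1, hc0, he⟩ := exists_borel_mul_lowerUnipOmega (lowerUnipOmega x * b)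
      (by rw [h10]; exact hb0)
    have hchar : borelChar α c = borelChar α b := by
      rw [borelChar, borelChar, hc1, hc0, hd, h10, mul_div_cancel_left₀ _ hb0, ord_div hb0 hb1,
        ord_div hb1 hb0]
      congr 1
      rw [← neg_sub, zpow_neg, inv_eq_iff_mul_eq_one, ← zpow_add, ← two_mul, zpow_mul]
      have : α ^ (2 : ℤ) = 1 := by exact_mod_cast hα
      rw [this, one_zpow]
    rw [← mul_assoc, he, mul_assoc, φ.2.2 c _ hc, hchar, h10, h11]
    congr 4
    field_simp
    ring
  rw [regIntertwiner]
  simp_rw [key, φ.2.2 b g hb, ← mul_sub]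
  rw [integral_const_mul, integral_affine μ (div_ne_zero hb1 hb0) _
    (fun x => φ.1 (lowerUnipOmega x * g) - φ.1 g), modChar_eq hb, ← absF_inv, inv_div]
  rfl

end Intertwiner

end LocalToric

end

noncomputable section

namespace LocalToric

/-! ### Integrals of ramified characters in the chart -/

section CharacterIntegral

attribute [local instance] torusCommGroup

variable {F K : Type*} [Field F] [ValuativeRel F] [TopologicalSpace F]
  [IsNonarchimedeanLocalField F] [CommRing K] [Algebra F K] [Algebra.IsQuadraticExtension F K]
  [TopologicalSpace K] [IsModuleTopology F K] [IsTopologicalRing K]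
  {ι : K →ₐ[F] Matrix (Fin 2) (Fin 2) F} {τ : K}

lemma mul_mem_unitFiltration (hτ : IsGen ι τ) {n : ℕ} {s t : Torus F K}
    (hs : s ∈ unitFiltration F K n) (ht : t ∈ unitFiltration F K n) :
    s * t ∈ unitFiltration F K n := by
  rw [mem_unitFiltration_iff_kT hτ, kT_mul hτ n hs, (mem_unitFiltration_iff_kT hτ n t).1 ht]

/-- There are no small subgroups in the unit circle. -/
lemma exists_trivial_on_unitFiltration (hτ : IsGen ι τ) {χ : Torus F K →* ℂˣ}
    (hχ : IsUnitaryChar χ) : ∃ n : ℕ, 1 ≤ n ∧ ∀ t ∈ unitFiltration F K n, χ t = 1 := by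
  have hU : {t : Torus F K | ‖(χ t : ℂ) - 1‖ < 1 / 2} ∈ 𝓝 1 := by
    have hc : Continuous fun t : Torus F K => ‖(χ t : ℂ) - 1‖ :=
      (hχ.continuous_coe.sub continuous_const).norm
    refine (isOpen_lt hc continuous_const).mem_nhds ?_
    simp
  obtain ⟨n, hn, hsub⟩ := exists_unitFiltration_subset hτ hU
  refine ⟨n, hn, fun t ht => ?_⟩
  by_contra hne
  have hpos : 0 < ‖(χ t : ℂ) - 1‖ := by
    rw [norm_pos_iff, sub_ne_zero]
    exact fun h => hne (Units.ext h)
  -- If 0 < |χ(t) - 1| < 1/2, squaring multiplies the distance to 1 by at least 3/2. Iteration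
  -- inside the subgroup contradicts the bound 1/2.
  have key : ∀ k : ℕ, ∃ s ∈ unitFiltration F K n, (3 / 2) ^ k * ‖(χ t : ℂ) - 1‖ ≤ ‖(χ s : ℂ) - 1‖ := by
    intro k
    induction k with
    | zero => exact ⟨t, ht, by simp⟩
    | succ k ih =>
      obtain ⟨s, hs, hle⟩ := ih
      refine ⟨s * s, mul_mem_unitFiltration hτ hs hs, ?_⟩
      have e : ((χ (s * s) : ℂˣ) : ℂ) - 1 = ((χ s : ℂ) - 1) * (((χ s : ℂ) - 1) + 2) := by
        rw [map_mul, Units.val_mul]; ring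
      have h1 : ‖(χ s : ℂ) - 1‖ < 1 / 2 := hsub hs
      have h2 : 3 / 2 ≤ ‖((χ s : ℂ) - 1) + 2‖ := by
        have := norm_sub_norm_le (2 : ℂ) (-((χ s : ℂ) - 1))
        rw [norm_neg, sub_neg_eq_add, add_comm] at this
        have h3 : ‖(2 : ℂ)‖ = 2 := by simp
        linarith
      rw [e, norm_mul, pow_succ]
      nlinarith [norm_nonneg ((χ s : ℂ) - 1), norm_nonneg (((χ s : ℂ) - 1) + 2)]
  obtain ⟨k, hk⟩ := pow_unbounded_of_one_lt (1 / ‖(χ t : ℂ) - 1‖) (show (1 : ℝ) < 3 / 2 by norm_num)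
  obtain ⟨s, hs, hle⟩ := key k
  have h1 : ‖(χ s : ℂ) - 1‖ < 1 / 2 := hsub hs
  rw [div_lt_iff₀ hpos] at hk
  linarith

lemma trivial_on_conductor (hτ : IsGen ι τ) {χ : Torus F K →* ℂˣ} (hχ : IsUnitaryChar χ) :
    ∀ t ∈ unitFiltration F K (conductor χ), χ t = 1 := by
  obtain ⟨n, -, hn⟩ := exists_trivial_on_unitFiltration hτ hχ
  exact Nat.sInf_mem (s := {n : ℕ | ∀ t ∈ unitFiltration F K n, χ t = 1}) ⟨n, hn⟩

variable [MeasurableSpace F] [BorelSpace F] [MeasurableSpace (Torus F K)] [BorelSpace (Torus F K)]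
  (μ : Measure F) [μ.IsAddHaarMeasure] {μT : Measure (Torus F K)} {c : ℝ≥0}

/-- The integral of `χ - 1` in the chart. -/
def chartIntegral (τ : K) (χ : Torus F K →* ℂˣ) : ℂ := ∫ z, ((χ (chart F τ z) : ℂ) - 1) ∂μ

lemma measurable_char_chart (hτ : IsGen ι τ) {χ : Torus F K →* ℂˣ} (hχ : IsUnitaryChar χ) :
    Measurable fun z => (χ (chart F τ z) : ℂ) := by
  have := secondCountable_torus (F := F) hτ
  exact hχ.continuous_coe.measurable.comp (measurable_chart hτ)

lemma integrableOn_char_chart (hτ : IsGen ι τ) {χ : Torus F K →* ℂˣ} (hχ : IsUnitaryChar χ) {S : Set F}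
    (hS : μ S ≠ ∞) : IntegrableOn (fun z => (χ (chart F τ z) : ℂ)) S μ :=
  IntegrableOn.of_bound hS.lt_top (measurable_char_chart hτ hχ).aestronglyMeasurable 1
    (Eventually.of_forall fun _ => (hχ.norm_eq_one _).le)

lemma integrableOn_inv_sq (n : ℤ) :
    IntegrableOn (fun z : F => (((absF z ^ 2)⁻¹ : ℝ≥0) : ℝ)) (ballF n)ᶜ μ := by
  refine ⟨(measurable_coe_nnreal_real.comp measurable_inv_sq).aestronglyMeasurable, ?_⟩
  rw [hasFiniteIntegral_iff_enorm]
  simp_rw [NNReal.enorm_eq]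
  rw [lintegral_tail]
  exact ENNReal.coe_lt_top

lemma integral_inv_sq (n : ℤ) :
    ∫ z in (ballF n)ᶜ, (((absF z ^ 2)⁻¹ : ℝ≥0) : ℝ) ∂μ = ((qN F ^ (-n - 1) * volO μ : ℝ≥0) : ℝ) := by
  have h := lintegral_coe_eq_integral _ (integrableOn_inv_sq μ n)
  rw [lintegral_tail, ENNReal.coe_nnreal_eq, ENNReal.ofReal_eq_ofReal_iff NNReal.zero_le_coe
    (integral_nonneg fun z => NNReal.zero_le_coe)] at h
  exact h.symm

/-- Translation by h multiplies the integral by χ(h) ≠ 1, since `kT` is invariant under H_n. No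
integrability is needed. -/
lemma integral_char_kT (χ : Torus F K →* ℂˣ) (hτ : IsGen ι τ) [μT.IsHaarMeasure] {n : ℕ} {h : Torus F K}
    (hh : h ∈ unitFiltration F K n) (hne : χ h ≠ 1) :
    ∫ t, (χ t : ℂ) * ((kT ι τ n t : ℝ) : ℂ) ∂μT = 0 := by
  have h2 := secondCountable_torus (F := F) hτ
  have h1 := integral_mul_left_eq_self (μ := μT)
    (fun t : Torus F K => (χ t : ℂ) * ((kT ι τ n t : ℝ) : ℂ)) h
  simp_rw [kT_mul hτ n hh, map_mul, Units.val_mul, mul_assoc] at h1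
  rw [integral_const_mul] at h1
  have h3 : ((χ h : ℂ) - 1) * ∫ t, (χ t : ℂ) * ((kT ι τ n t : ℝ) : ℂ) ∂μT = 0 := by
    linear_combination h1
  refine (mul_eq_zero.1 h3).resolve_left ?_
  exact sub_ne_zero.2 fun h => hne (Units.ext h)

/-- The integral of a ramified character in the chart. -/
lemma chartIntegral_ramified (hτ : IsGen ι τ) [μT.IsHaarMeasure] (hμ : μT = c • chartMeasure ι μ τ)
    (hc : 0 < c) {χ : Torus F K →* ℂˣ} (hχ : IsUnitaryChar χ) (hr : ¬ IsUnramified χ) :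
    chartIntegral μ τ χ = -((volO μ : ℝ) * (resCard F : ℂ)⁻¹ * (1 + (resCard F : ℂ)⁻¹)) *
      (resCard F : ℂ) ^ conductor χ := by
  classical
  have hN := trivial_on_conductor hτ hχ
  have hN0 : conductor χ ≠ 0 := by
    intro h0
    rw [h0] at hN
    exact hr hN
  obtain ⟨M, hM⟩ := Nat.exists_eq_succ_of_ne_zero hN0
  -- With M one less than the conductor, χ is nontrivial on H_M by minimality, while it is trivial
  -- on H_{M+1}. The case M = 0 is included.
  have hnot : ¬ ∀ t ∈ unitFiltration F K M, χ t = 1 :=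
    Nat.notMem_of_lt_sInf (s := {n : ℕ | ∀ t ∈ unitFiltration F K n, χ t = 1})
      (show M < conductor χ by omega)
  push Not at hnot
  obtain ⟨h, hh, hne⟩ := hnot
  have h0 := integral_char_kT (μT := μT) χ hτ hh hne
  have hsm : StronglyMeasurable fun t : Torus F K => (χ t : ℂ) * ((kT ι τ M t : ℝ) : ℂ) := by
    have h2 := secondCountable_torus (F := F) hτ
    refine Continuous.stronglyMeasurable (hχ.continuous_coe.mul ?_)
    exact Complex.continuous_ofReal.comp (NNReal.continuous_coe.comp (continuous_kT hτ M))
  have hB := measurableSet_ballF (F := F) (M : ℤ)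
  have hBt := measure_ballF_ne_top μ (M : ℤ)
  have hq0 := resCard_ne_zero F
  have hqN := qN_pos F
  have hcc : ((c : ℝ) : ℂ) ≠ 0 := by exact_mod_cast hc.ne'
  -- For |z| > q^M, that is |z| ≥ q^{M+1}, the chart lands in H_{M+1}, where χ = 1.
  have hout : ∀ z : F, z ∉ ballF (M : ℤ) → χ (chart F τ z) = 1 := by
    intro z hz
    refine hN _ ?_
    rw [hM]
    refine mem_unitFiltration_of_chart hτ (by omega) ?_
    simpa using hz
  rw [integral_torus hτ hμ hsm] at h0
  have h1 := (mul_eq_zero.1 h0).resolve_left hcc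
  -- In the product of the density and `kT` the norm cancels. This leaves 1 on the ball of radius
  -- q^M and q^{2M}|z|⁻² outside, so orthogonality determines the integral of χ over the ball.
  have hae : ∀ᵐ z ∂μ, ((chartDensity ι τ z : ℝ) : ℂ) *
      ((χ (chart F τ z) : ℂ) * ((kT ι τ M (chart F τ z) : ℝ) : ℂ)) =
      (ballF (M : ℤ)).piecewise (fun z => (χ (chart F τ z) : ℂ))
        (fun z => (resCard F : ℂ) ^ (2 * M) * (((((absF z ^ 2)⁻¹ : ℝ≥0) : ℝ)) : ℂ)) z := by
    filter_upwards [ae_qform_ne_zero ι τ μ] with z hz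
    have hq := absF_ne_zero hz
    have e1 : chartDensity ι τ z * kT ι τ M (chart F τ z) =
        (max 1 (qN F ^ (-(M : ℤ)) * absF z) ^ 2)⁻¹ := by
      rw [chart, kT_chart hτ M hz, chartDensity, div_eq_mul_inv, ← mul_assoc, inv_mul_cancel₀ hq, one_mul]
    have e2 : ((chartDensity ι τ z : ℝ) : ℂ) *
      ((χ (chart F τ z) : ℂ) * ((kT ι τ M (chart F τ z) : ℝ) : ℂ)) = (χ (chart F τ z) : ℂ) *
        (((max 1 (qN F ^ (-(M : ℤ)) * absF z) ^ 2)⁻¹ : ℝ≥0) : ℝ) := by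
      rw [← e1]
      push_cast
      ring
    have e3 : qN F ^ (-(M : ℤ)) * absF z ≤ 1 ↔ z ∈ ballF (M : ℤ) := by
      rw [mem_ballF, zpow_neg, inv_mul_le_one₀ (zpow_pos hqN _)]
    rw [e2]
    by_cases hzM : z ∈ ballF (M : ℤ)
    · rw [Set.piecewise_eq_of_mem _ _ _ hzM, max_eq_left (e3.2 hzM)]
      simp
    · rw [Set.piecewise_eq_of_notMem _ _ _ hzM, max_eq_right (not_le.1 (mt e3.1 hzM)).le, hout z hzM]
      rw [mul_pow, mul_inv, ← zpow_natCast, ← zpow_mul, ← zpow_neg]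
      push_cast
      rw [coe_qN, one_mul]
      congr 1
      rw [← zpow_natCast]
      congr 1
      push_cast
      ring
  have hi2 : IntegrableOn (fun z : F => (resCard F : ℂ) ^ (2 * M) *
      (((((absF z ^ 2)⁻¹ : ℝ≥0) : ℝ)) : ℂ)) (ballF (M : ℤ))ᶜ μ :=
    ((integrableOn_inv_sq μ (M : ℤ)).ofReal (𝕜 := ℂ)).const_mul _
  rw [integral_congr_ae hae, integral_piecewise hB (integrableOn_char_chart μ hτ hχ hBt) hi2, integral_const_mul,
    integral_complex_ofReal, integral_inv_sq] at h1
  have hfin : IsFiniteMeasure (μ.restrict (ballF (M : ℤ))) := ⟨by simpa using hBt.lt_top⟩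
  -- The integral of χ over the ball is -q^{2M} · q^{-M-1} vol(O). Subtracting the volume q^M vol(O)
  -- gives -q^M(1 + q⁻¹) vol(O), with M + 1 the conductor.
  rw [chartIntegral, ← setIntegral_eq_integral_of_forall_compl_eq_zero (s := ballF (M : ℤ))
    (fun z hz => by rw [hout z hz]; simp), integral_sub (integrableOn_char_chart μ hτ hχ hBt)
      (integrable_const _), eq_neg_of_add_eq_zero_left h1, setIntegral_const, measureReal_ballF, hM,
      Complex.real_smul]
  push_cast
  rw [coe_qN, zpow_sub₀ hq0, zpow_neg, zpow_natCast, zpow_one, Nat.succ_eq_add_one]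
  field_simp
  ring

end CharacterIntegral

end LocalToric

end

noncomputable section

namespace LocalToric

/-! ### Values of unramified characters in the chart -/

section UnramifiedValues

attribute [local instance] torusCommGroup

variable {F K : Type*} [Field F] [ValuativeRel F] [TopologicalSpace F]
  [IsNonarchimedeanLocalField F] [CommRing K] [Algebra F K] [Algebra.IsQuadraticExtension F K]
  {ι : K →ₐ[F] Matrix (Fin 2) (Fin 2) F} {τ : K}

lemma toT_lin_mem_unitFiltration_zero (hτ : IsGen ι τ) {a b : F} (ha : absF a ≤ 1) (hb : absF b ≤ 1)
    (hq : absF (qform ι τ a b) = 1) : toT F (lin τ a b) ∈ unitFiltration F K 0 := by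
  have hq0 : qform ι τ a b ≠ 0 := by rw [← absF_pos, hq]; exact one_pos
  obtain ⟨u, hu⟩ := isUnit_lin hτ hq0
  rw [← hu, toT_units, mk_mem_unitFiltration_iff hτ]
  exact ⟨1, a, b, one_ne_zero, ha, by simpa using hb, hq, by rw [hu, one_smul]⟩

lemma isUnit_cnj (hι : NotInBorel ι) {x : K} (hx : nrm ι x ≠ 0) : IsUnit (cnj ι x) :=
  isUnit_of_nrm_ne_zero hι (by rwa [nrm_cnj hι])

lemma toT_cnj (hι : NotInBorel ι) {x : K} (hx : nrm ι x ≠ 0) :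
    toT F (cnj ι x) = (toT F x)⁻¹ := by
  rw [eq_inv_iff_mul_eq_one, mul_comm,
    ← toT_mul (isUnit_of_nrm_ne_zero hι hx) (isUnit_cnj hι hx), mul_cnj hι, toT_algebraMap hx]

lemma chart_mem_unitFiltration_zero (hτ : IsGen ι τ) {z : F} (hz : qform ι τ z 1 ≠ 0)
    (h : absF z ≤ 1 → absF (qform ι τ z 1) = 1) : chart F τ z ∈ unitFiltration F K 0 := by
  by_cases hz1 : absF z ≤ 1
  · exact toT_lin_mem_unitFiltration_zero hτ hz1 absF_one.le (h hz1)
  · rw [mem_unitFiltration_iff_kT hτ, chart, kT_chart hτ 0 hz, abs_qform_of_lt hτ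
      (by rw [absF_one]; exact not_le.1 hz1)]
    have h5 : absF z ≠ 0 := (zero_lt_one.trans (not_le.1 hz1)).ne'
    have h6 : (1 : ℝ≥0) ≤ qN F ^ (-((0 : ℕ) : ℤ)) * absF z := by simpa using (not_le.1 hz1).le
    rw [max_eq_right h6]
    simp [h5]

/-- Every element is a scalar multiple of a primitive one. -/
lemma exists_primitive (hτ : IsGen ι τ) {x : K} (hx : nrm ι x ≠ 0) :
    ∃ c a b : F, c ≠ 0 ∧ max (absF a) (absF b) = 1 ∧ x = c • lin τ a b := by
  obtain ⟨a, b, rfl⟩ := exists_lin hτ x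
  rw [nrm_lin] at hx
  rcases le_total (absF a) (absF b) with h | h
  · have hb : b ≠ 0 := by
      rintro rfl
      rw [absF_zero, le_zero_iff, absF_eq_zero] at h
      rw [h] at hx
      simp [qform] at hx
    refine ⟨b, a / b, 1, hb, ?_, by rw [smul_lin, mul_div_cancel₀ _ hb, mul_one]⟩
    rw [absF_one, absF_div]
    exact max_eq_right ((div_le_one (absF_pos.2 hb)).2 h)
  · have ha : a ≠ 0 := by
      rintro rfl
      rw [absF_zero, le_zero_iff, absF_eq_zero] at h
      rw [h] at hx
      simp [qform] at hx
    refine ⟨a, 1, b / a, ha, ?_, by rw [smul_lin, mul_div_cancel₀ _ ha, mul_one]⟩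
    rw [absF_one, absF_div]
    exact max_eq_left ((div_le_one (absF_pos.2 ha)).2 h)

/-- `primeElement` is an unspecified choice, which has its defining property only once some
candidate exists. The element z + τ is such a candidate. -/
lemma abs_nrm_primeElement (hτ : IsGen ι τ) {z : F} (hz : absF z ≤ 1)
    (hq : absF (qform ι τ z 1) = (qN F)⁻¹) :
    IsIntegral 𝒪[F] ((primeElement F K : Kˣ) : K) ∧
      absF (nrm ι ((primeElement F K : Kˣ) : K)) = (qN F)⁻¹ := by
  have hq0 : qform ι τ z 1 ≠ 0 := by
    rw [← absF_pos, hq]; exact inv_pos.2 (qN_pos F)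
  obtain ⟨u, hu⟩ := isUnit_lin hτ hq0
  have hex : ∃ z : Kˣ, IsIntegral 𝒪[F] (z : K) ∧ ord (Algebra.norm F (z : K)) = 1 := by
    refine ⟨u, ?_, ?_⟩
    · rw [hu, hτ.isIntegral_iff]
      exact ⟨hz, absF_one.le⟩
    · rw [norm_eq_nrm hτ.notInBorel, hu, nrm_lin, ord_eq_iff hq0, hq, zpow_neg_one]
  obtain ⟨h1, h2⟩ := Classical.epsilon_spec hex
  refine ⟨h1, ?_⟩
  rw [norm_eq_nrm hτ.notInBorel, ord_eq_iff (nrm_units_ne_zero hτ.notInBorel _), zpow_neg_one] at h2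
  exact h2

/-! ### Unramified characters when the norm form has a double root modulo 𝔭 -/

section DoubleRoot

/-- A primitive element has norm of valuation 0 or 1, and scaling changes the valuation by an even
number. So an element of unit norm has a primitive multiple which is a unit. -/
lemma toT_mem_of_hasDoubleRoot (hτ : IsGen ι τ) (hD : HasDoubleRoot ι τ) {x : K}
    (hx : absF (nrm ι x) = 1) : toT F x ∈ unitFiltration F K 0 := by
  obtain ⟨r, hr, h1, h2⟩ := hD
  have hx0 : nrm ι x ≠ 0 := by rw [← absF_pos, hx]; exact one_pos
  obtain ⟨c, a, b, hc, hab, rfl⟩ := exists_primitive hτ hx0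
  rw [toT_smul hc]
  rw [nrm_smul, nrm_lin, absF_mul, absF_pow] at hx
  have ha : absF a ≤ 1 := hab ▸ le_max_left _ _
  have hb : absF b ≤ 1 := hab ▸ le_max_right _ _
  refine toT_lin_mem_unitFiltration_zero hτ ha hb ?_
  have hor : absF (qform ι τ a b) = 1 ∨ absF (qform ι τ a b) = (qN F)⁻¹ := by
    rcases lt_or_eq_of_le hb with hb1 | hb1
    · have ha1 : absF a = 1 := by
        rcases max_choice (absF a) (absF b) with h | h
        · rw [← h, hab]
        · rw [h] at hab; exact absurd hab hb1.ne
      rw [abs_qform_of_lt hτ (by rwa [ha1]), ha1, one_pow]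
      exact Or.inl rfl
    · have hb0 : b ≠ 0 := by rw [← absF_pos, hb1]; exact one_pos
      have e := qform_mul (ι := ι) (τ := τ) b (a / b) 1
      rw [mul_div_cancel₀ _ hb0, mul_one] at e
      rw [e, absF_mul, absF_pow, hb1, one_pow, one_mul]
      by_cases hz : absF (a / b - r) < 1
      · exact Or.inr (h1 _ hz)
      · refine Or.inl (h2 _ ?_ hz)
        rwa [absF_div, hb1, div_one]
  rcases hor with h | h
  · exact h
  · exfalso
    rw [h, absF_eq_zpow hc, ← zpow_natCast, ← zpow_mul, ← zpow_neg_one (qN F),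
      ← zpow_add₀ (qN_ne_zero F), zpow_eq_one_iff_right₀ zero_le (one_lt_qN F).ne'] at hx
    push_cast at hx
    omega

lemma char_toT_eq_of_hasDoubleRoot (hτ : IsGen ι τ) (hD : HasDoubleRoot ι τ) {χ : Torus F K →* ℂˣ}
    (hu : IsUnramified χ) {x y : K} (hx : absF (nrm ι x) = (qN F)⁻¹)
    (hy : absF (nrm ι y) = (qN F)⁻¹) : χ (toT F x) * χ (toT F y) = 1 := by
  have hpos := inv_pos.2 (qN_pos F)
  have hx0 : nrm ι x ≠ 0 := by rw [← absF_pos, hx]; exact hpos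
  have hy0 : nrm ι y ≠ 0 := by rw [← absF_pos, hy]; exact hpos
  rw [← map_mul, ← toT_mul (isUnit_of_nrm_ne_zero hτ.notInBorel hx0)
    (isUnit_of_nrm_ne_zero hτ.notInBorel hy0), ← toT_smul (inv_ne_zero (unif_ne_zero F))]
  refine hu _ (toT_mem_of_hasDoubleRoot hτ hD ?_)
  rw [nrm_smul, nrm_mul, absF_mul, absF_mul, hx, hy, absF_pow, absF_inv, absF_unif, inv_inv]
  have := qN_ne_zero F
  field_simp

end DoubleRoot

/-! ### Unramified characters near the two roots of the norm form in the split case -/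

section TwoRoots

variable {r s : F}

lemma abs_mul_sub (hrs : absF (r - s) = 1) (hf : ∀ z, qform ι τ z 1 = (z - r) * (z - s))
    {w : F} (hw : absF w < 1) : absF (qform ι τ (r + w) 1) = absF w := by
  have e : qform ι τ (r + w) 1 = w * (r - s + w) := by rw [hf]; ring
  rw [e, absF_mul, absF_add_eq_of_lt (by rwa [hrs]), hrs, mul_one]

lemma trc_eq_of_roots (hf : ∀ z, qform ι τ z 1 = (z - r) * (z - s)) : trc ι τ = -r - s := by
  have h0 := hf 0
  have h1 := hf 1
  simp only [qform] at h0 h1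
  linear_combination h1 - h0

lemma nrm_eq_of_roots (hf : ∀ z, qform ι τ z 1 = (z - r) * (z - s)) : nrm ι τ = r * s := by
  have h0 := hf 0
  simp only [qform] at h0
  linear_combination h0

/-- The product of r + w + τ with the conjugate of r + v + τ has coefficients divisible by w and
norm of absolute value |w|². Divided by w it is a unit of O_K, so an unramified character cannot
distinguish the two points. -/
lemma char_chart_eq_of_abs_eq (hτ : IsGen ι τ) (hr : absF r ≤ 1) (hs : absF s ≤ 1)
    (hrs : absF (r - s) = 1) (hf : ∀ z, qform ι τ z 1 = (z - r) * (z - s)) {χ : Torus F K →* ℂˣ}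
    (hu : IsUnramified χ) {w v : F} (hw0 : w ≠ 0) (hw : absF w < 1) (hwv : absF v = absF w) :
    χ (chart F τ (r + w)) = χ (chart F τ (r + v)) := by
  have hι := hτ.notInBorel
  have hw' := absF_pos.2 hw0
  have hfw := abs_mul_sub hrs hf hw
  have hfv := abs_mul_sub hrs hf (hwv ▸ hw : absF v < 1)
  have hqw : nrm ι (lin τ (r + w) 1) ≠ 0 := by rw [nrm_lin, ← absF_pos, hfw]; exact hw'
  have hqv : nrm ι (lin τ (r + v) 1) ≠ 0 := by rw [nrm_lin, ← absF_pos, hfv, hwv]; exact hw'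
  rw [← mul_inv_eq_one, ← map_inv, ← map_mul, chart, chart, ← toT_cnj hι hqv,
    ← toT_mul (isUnit_of_nrm_ne_zero hι hqw) (isUnit_cnj hι hqv), ← toT_smul (inv_ne_zero hw0)]
  refine hu _ ?_
  have e : w⁻¹ • (lin τ (r + w) 1 * cnj ι (lin τ (r + v) 1)) =
      lin τ (w⁻¹ * (r * v + w * v - w * s)) (w⁻¹ * (v - w)) := by
    rw [cnj_lin, lin_mul_lin hτ, smul_lin, trc_eq_of_roots hf, nrm_eq_of_roots hf]
    congr 2 <;> ring
  have hn : absF (nrm ι (w⁻¹ • (lin τ (r + w) 1 * cnj ι (lin τ (r + v) 1)))) = 1 := by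
    rw [nrm_smul, nrm_mul, nrm_cnj hι, nrm_lin, nrm_lin, absF_mul, absF_mul, hfw, hfv, hwv, absF_pow, absF_inv]
    field_simp
  rw [e] at hn ⊢
  rw [nrm_lin] at hn
  have hle : ∀ x, absF x ≤ absF w → absF (w⁻¹ * x) ≤ 1 := by
    intro x hx
    rw [absF_mul, absF_inv, inv_mul_le_one₀ hw']
    exact hx
  refine toT_lin_mem_unitFiltration_zero hτ (hle _ ?_) (hle _ ?_) hn
  · refine (absF_sub_le _ _).trans (max_le ((absF_add_le _ _).trans (max_le ?_ ?_)) ?_)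
    · rw [absF_mul, hwv]; exact mul_le_of_le_one_left zero_le hr
    · rw [absF_mul, hwv]; exact mul_le_of_le_one_left zero_le hw.le
    · rw [absF_mul]; exact mul_le_of_le_one_right zero_le hs
  · exact (absF_sub_le _ _).trans (max_le hwv.le le_rfl)

/-- The product of the two points is a scalar r - s + w + v times a chart point at r + x. This
scalar is a unit, so valuations of the distance to r add. -/
lemma chart_mul_chart (hτ : IsGen ι τ) (hrs : absF (r - s) = 1)
    (hf : ∀ z, qform ι τ z 1 = (z - r) * (z - s)) {w v : F} (hw0 : w ≠ 0) (hw : absF w < 1)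
    (hv0 : v ≠ 0) (hv : absF v < 1) :
    ∃ x : F, absF x = absF w * absF v ∧
      chart F τ (r + w) * chart F τ (r + v) = chart F τ (r + x) := by
  have hd : absF (r - s + (w + v)) = 1 := by
    rw [absF_add_eq_of_lt, hrs]
    rw [hrs]
    exact (absF_add_le _ _).trans_lt (max_lt hw hv)
  have hd0 : r - s + (w + v) ≠ 0 := by rw [← absF_pos, hd]; exact one_pos
  have hqw : qform ι τ (r + w) 1 ≠ 0 := by
    rw [← absF_pos, abs_mul_sub hrs hf hw]; exact absF_pos.2 hw0
  have hqv : qform ι τ (r + v) 1 ≠ 0 := by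
    rw [← absF_pos, abs_mul_sub hrs hf hv]; exact absF_pos.2 hv0
  refine ⟨w * v / (r - s + (w + v)), by rw [absF_div, hd, div_one, absF_mul], ?_⟩
  rw [chart, chart, chart, ← toT_mul (isUnit_lin hτ hqw) (isUnit_lin hτ hqv), 
    ← toT_smul hd0 (lin τ (r + _) 1), smul_lin,
    lin_mul_lin hτ, trc_eq_of_roots hf, nrm_eq_of_roots hf]
  congr 2
  · field_simp
    ring
  · ring

/-- An unramified character near a root of the norm form. -/
lemma char_chart_eq_zpow (hτ : IsGen ι τ) (hr : absF r ≤ 1) (hs : absF s ≤ 1)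
    (hrs : absF (r - s) = 1) (hf : ∀ z, qform ι τ z 1 = (z - r) * (z - s)) {χ : Torus F K →* ℂˣ}
    (hu : IsUnramified χ) {w : F} (hw0 : w ≠ 0) (hw : absF w < 1) :
    χ (chart F τ (r + w)) = χ (chart F τ (r + unif F)) ^ ord w := by
  have hlt : absF (unif F) < 1 := by rw [absF_unif]; exact inv_lt_one_of_one_lt₀ (one_lt_qN F)
  have key : ∀ (j : ℕ) (w : F), absF w = (qN F)⁻¹ ^ (j + 1) →
      χ (chart F τ (r + w)) = χ (chart F τ (r + unif F)) ^ (j + 1) := by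
    intro j
    have hp := inv_pos.2 (qN_pos F)
    have hw0 : ∀ (j : ℕ) (w : F), absF w = (qN F)⁻¹ ^ (j + 1) → w ≠ 0 := fun j w h => by
      rw [← absF_pos, h]; exact pow_pos hp _
    have hwlt : ∀ (j : ℕ) (w : F), absF w = (qN F)⁻¹ ^ (j + 1) → absF w < 1 := fun j w h => by
      rw [h]; exact pow_lt_one₀ zero_le (inv_lt_one_of_one_lt₀ (one_lt_qN F)) (by omega)
    induction j with
    | zero =>
      intro w h
      rw [zero_add, pow_one]
      exact char_chart_eq_of_abs_eq hτ hr hs hrs hf hu (hw0 0 w h) (hwlt 0 w h)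
        (by rw [h, absF_unif]; simp)
    | succ j ih =>
      intro w h
      have hv : absF (unif F ^ (j + 1)) = (qN F)⁻¹ ^ (j + 1) := by rw [absF_pow, absF_unif]
      obtain ⟨x, hx, he⟩ := chart_mul_chart hτ hrs hf (hw0 j _ hv) (hwlt j _ hv) (unif_ne_zero F) hlt
      rw [pow_succ, ← ih _ hv, ← map_mul, he]
      refine char_chart_eq_of_abs_eq hτ hr hs hrs hf hu (hw0 _ w h) (hwlt _ w h) ?_
      rw [hx, h, hv, absF_unif, ← pow_succ]
  have ho : 0 < ord w := by
    rw [absF_eq_zpow hw0] at hw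
    by_contra! hle
    exact absurd hw (not_lt.2 (one_le_zpow₀ (one_lt_qN F).le (by omega)))
  obtain ⟨j, hj⟩ : ∃ j : ℕ, ord w = ((j + 1 : ℕ) : ℤ) := ⟨(ord w - 1).toNat, by omega⟩
  rw [hj, zpow_natCast]
  refine key j w ?_
  rw [absF_eq_zpow hw0, hj, zpow_neg, zpow_natCast, inv_pow]

/-- Conjugation inverts classes in T and interchanges the roots: the negative of the conjugate of r
- w + τ is s + w + τ. -/
lemma char_chart_other_root (hτ : IsGen ι τ) (hr : absF r ≤ 1) (hs : absF s ≤ 1)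
    (hrs : absF (r - s) = 1) (hf : ∀ z, qform ι τ z 1 = (z - r) * (z - s)) {χ : Torus F K →* ℂˣ}
    (hu : IsUnramified χ) {w : F} (hw0 : w ≠ 0) (hw : absF w < 1) :
    χ (chart F τ (s + w)) = (χ (chart F τ (r + unif F)))⁻¹ ^ ord w := by
  have hw' : absF (-w) < 1 := by rwa [absF_neg]
  have hq : nrm ι (lin τ (r + -w) 1) ≠ 0 := by
    rw [nrm_lin, ← absF_pos, abs_mul_sub hrs hf hw', absF_neg]; exact absF_pos.2 hw0
  have h1 := toT_cnj (F := F) hτ.notInBorel hq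
  rw [cnj_lin, ← toT_smul (neg_ne_zero.2 one_ne_zero), smul_lin, trc_eq_of_roots hf] at h1
  have e : chart F τ (s + w) = (chart F τ (r + -w))⁻¹ := by
    rw [chart, chart, ← h1]
    congr 2 <;> ring
  rw [e, map_inv, char_chart_eq_zpow hτ hr hs hrs hf hu (neg_ne_zero.2 hw0) hw', ord_neg, inv_zpow]

end TwoRoots

end UnramifiedValues

end LocalToric

end

noncomputable section

namespace LocalToric

/-! ### Integrals of unramified characters in the chart -/

section Radial

variable {F : Type*} [Field F] [ValuativeRel F] [TopologicalSpace F] [IsNonarchimedeanLocalField F]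
  [MeasurableSpace F] [BorelSpace F] (μ : Measure F) [μ.IsAddHaarMeasure]

lemma integrableOn_zpow_ord {ε : ℂˣ} (hε : ‖(ε : ℂ)‖ = 1) (n : ℤ) :
    IntegrableOn (fun w : F => ((ε ^ ord w : ℂˣ) : ℂ)) (ballF n) μ := by
  refine IntegrableOn.of_bound (measure_ballF_ne_top μ n).lt_top ?_ 1
    (Eventually.of_forall fun w => ?_)
  · exact ((measurable_of_countable fun k : ℤ => ((ε ^ k : ℂˣ) : ℂ)).comp
      measurable_ord).aestronglyMeasurable
  · rw [Units.val_zpow_eq_zpow_val, norm_zpow, hε, one_zpow]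

/-- The integral of `ε^{ν(w)} - 1` over the maximal ideal. -/
def radialIntegral (ε : ℂˣ) : ℂ := ∫ w in ballF (-1 : ℤ), (((ε ^ ord w : ℂˣ) : ℂ) - 1) ∂μ

/-- The integral over 𝔭 of ε^{ν(w)} is a geometric series. It is summed by scaling with the
uniformizer, which relates it to the integral over O, where the units add (1 - q⁻¹) vol(O). -/
lemma radialIntegral_mul {ε : ℂˣ} (hε : ‖(ε : ℂ)‖ = 1) :
    radialIntegral μ ε * (1 - ε * (resCard F : ℂ)⁻¹) =
      (volO μ : ℝ) * (resCard F : ℂ)⁻¹ * (ε - 1) := by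
  have hq0 := resCard_ne_zero F
  have hB0 := measurableSet_ballF (F := F) 0
  have hB1 := measurableSet_ballF (F := F) (-1)
  have hsub : (ballF (-1) : Set F) ⊆ ballF 0 := fun x hx =>
    le_trans (b := qN F ^ (-1 : ℤ)) hx (zpow_le_zpow_right₀ (one_lt_qN F).le (by omega))
  set I : ℂ := ∫ w in ballF (-1 : ℤ), ((ε ^ ord w : ℂˣ) : ℂ) ∂μ with hI
  have h1 : radialIntegral μ ε = I - (resCard F : ℂ)⁻¹ * (volO μ : ℝ) := by
    have hfin : IsFiniteMeasure (μ.restrict (ballF (-1 : ℤ))) :=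
      ⟨by simpa using (measure_ballF_ne_top μ (-1)).lt_top⟩
    rw [radialIntegral, integral_sub (integrableOn_zpow_ord μ hε _) (integrable_const _),
      setIntegral_const, measureReal_ballF, Complex.real_smul, ← hI, Complex.ofReal_mul,
      Complex.ofReal_zpow, coe_qN, zpow_neg_one, mul_one]
  have h2 : ∫ w in ballF (0 : ℤ), ((ε ^ ord w : ℂˣ) : ℂ) ∂μ =
      I + (1 - (resCard F : ℂ)⁻¹) * (volO μ : ℝ) := by
    have hu : (ballF 0 : Set F) = ballF (-1) ∪ (ballF 0 \ ballF (-1)) :=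
      (Set.union_sdiff_cancel hsub).symm
    have hi := integrableOn_zpow_ord μ hε 0
    rw [hu] at hi
    conv_lhs => rw [hu]
    rw [setIntegral_union Set.disjoint_sdiff_right (hB0.diff hB1)
      (hi.mono_set Set.subset_union_left) (hi.mono_set Set.subset_union_right),
      setIntegral_congr_fun (g := fun _ => (1 : ℂ)) (hB0.diff hB1), setIntegral_const,
      measureReal_sdiff hsub hB1 (measure_ballF_ne_top μ 0), measureReal_ballF, measureReal_ballF,
      Complex.real_smul]
    · rw [← hI, Complex.ofReal_sub, Complex.ofReal_mul, Complex.ofReal_mul, Complex.ofReal_zpow,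
        Complex.ofReal_zpow, coe_qN, zpow_neg_one, zpow_zero]
      ring
    · intro x hx
      have : ord x = 0 := ord_eq_of_shell (n := -1) (by simpa using hx.1) hx.2
      simp only [this]
      simp
  have h3 : (resCard F : ℂ) * I = ε * ∫ w in ballF (0 : ℤ), ((ε ^ ord w : ℂˣ) : ℂ) ∂μ := by
    have hu := unif_ne_zero F
    have h4 := integral_mul_left_eq μ hu
      ((ballF (-1)).indicator (fun w : F => ((ε ^ ord w : ℂˣ) : ℂ)))
    have h5 : ∀ᵐ x : F ∂μ, (ballF (-1)).indicator (fun w : F => ((ε ^ ord w : ℂˣ) : ℂ)) (unif F * x) =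
        ε * (ballF 0).indicator (fun w : F => ((ε ^ ord w : ℂˣ) : ℂ)) x := by
      filter_upwards [ae_ne_zero μ] with x hx
      have hmem : unif F * x ∈ (ballF (-1) : Set F) ↔ x ∈ (ballF 0 : Set F) := by
        rw [mem_ballF, mem_ballF, absF_mul, absF_unif, zpow_neg_one, zpow_zero,
          mul_le_iff_le_one_right (inv_pos.2 (qN_pos F))]
      by_cases hx0 : x ∈ (ballF 0 : Set F)
      · rw [Set.indicator_of_mem (hmem.2 hx0), Set.indicator_of_mem hx0, ord_mul hu hx, ord_unif,
          zpow_add, zpow_one, Units.val_mul]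
      · rw [Set.indicator_of_notMem (mt hmem.1 hx0), Set.indicator_of_notMem hx0, mul_zero]
    have h6 : ((qN F : ℝ≥0) : ℂ) = resCard F := coe_qN
    rw [integral_congr_ae h5, integral_const_mul, integral_indicator hB0, integral_indicator hB1,
      absF_unif, NNReal.coe_inv, Complex.ofReal_inv, inv_inv, coe_qN] at h4
    exact h4.symm
  rw [h2] at h3
  rw [h1]
  have h7 : I = ε * (I + (1 - (resCard F : ℂ)⁻¹) * (volO μ : ℝ)) * (resCard F : ℂ)⁻¹ := by
    rw [← h3]
    field_simp
  linear_combination h7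

end Radial

/-! ### The integral of χ - 1 for unramified χ, by type of K -/

section UnramifiedIntegral

attribute [local instance] torusCommGroup

variable {F K : Type*} [Field F] [ValuativeRel F] [TopologicalSpace F]
  [IsNonarchimedeanLocalField F] [CommRing K] [Algebra F K] [Algebra.IsQuadraticExtension F K]
  {ι : K →ₐ[F] Matrix (Fin 2) (Fin 2) F} {τ : K}
  [TopologicalSpace K] [IsModuleTopology F K] [IsTopologicalRing K]
  [MeasurableSpace F] [BorelSpace F] [MeasurableSpace (Torus F K)] [BorelSpace (Torus F K)]
  (μ : Measure F) [μ.IsAddHaarMeasure]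

lemma closedBall_eq_openBall (x : F) : {y | absF (y - x) ≤ qN F ^ (-1 : ℤ)} = {y | absF (y - x) < 1} := by
  ext y
  rw [Set.mem_ofPred_eq, Set.mem_ofPred_eq, absF_lt_one_iff, zpow_neg_one]

lemma chartIntegral_of_hasNoRoot (hτ : IsGen ι τ) (hn : HasNoRoot ι τ) {χ : Torus F K →* ℂˣ}
    (hu : IsUnramified χ) : chartIntegral μ τ χ = 0 := by
  rw [chartIntegral, integral_eq_zero_of_ae]
  filter_upwards [ae_qform_ne_zero ι τ μ] with z hz
  rw [hu _ (chart_mem_unitFiltration_zero hτ hz (hn z))]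
  simp

/-- Off the residue disc of the double root the chart lands in H_0. On the disc the norm of z + τ
has valuation one, so χ takes the constant value ε = χ(ϖ_K), and ε² = 1 because ϖ_K² is a unit times
a scalar. -/
lemma chartIntegral_of_hasDoubleRoot (hτ : IsGen ι τ) (hD : HasDoubleRoot ι τ) {χ : Torus F K →* ℂˣ}
    (hu : IsUnramified χ) :
    (χ (QuotientGroup.mk (primeElement F K)) : ℂ) ^ 2 = 1 ∧ chartIntegral μ τ χ =
      ((χ (QuotientGroup.mk (primeElement F K)) : ℂ) - 1) * ((resCard F : ℂ)⁻¹ * (volO μ : ℝ)) := by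
  classical
  obtain ⟨r, hr, h1, h2⟩ := id hD
  have hp := (abs_nrm_primeElement hτ hr (h1 r (by rw [sub_self, absF_zero]; exact one_pos))).2
  have hsq := char_toT_eq_of_hasDoubleRoot hτ hD hu hp hp
  rw [toT_units] at hsq
  set ε := χ (QuotientGroup.mk (primeElement F K))
  have hsq' : (ε : ℂ) * ε = 1 := by rw [← Units.val_mul, hsq, Units.val_one]
  refine ⟨by rw [pow_two, hsq'], ?_⟩
  have hae : ∀ᵐ z ∂μ, ((χ (chart F τ z) : ℂ) - 1) =
      {z | absF (z - r) ≤ qN F ^ (-1 : ℤ)}.indicator (fun _ => (ε : ℂ) - 1) z := by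
    filter_upwards [ae_qform_ne_zero ι τ μ] with z hz
    rw [closedBall_eq_openBall]
    by_cases hzr : absF (z - r) < 1
    · rw [Set.indicator_of_mem (by exact hzr)]
      have h3 := char_toT_eq_of_hasDoubleRoot hτ hD hu (x := lin τ z 1)
        (by rw [nrm_lin]; exact h1 z hzr) hp
      rw [toT_units] at h3
      congr 2
      exact (mul_right_cancel (h3.trans hsq.symm))
    · rw [Set.indicator_of_notMem (by exact hzr),
        hu _ (chart_mem_unitFiltration_zero hτ hz fun h => h2 z h hzr)]
      simp
  rw [chartIntegral, integral_congr_ae hae, integral_indicator (isClosed_closedBall r _).measurableSet,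
    setIntegral_const, measureReal_closedBall, Complex.real_smul]
  push_cast
  rw [coe_qN, zpow_neg_one]
  ring

/-- The integrand is supported on the two residue discs, where χ is ε or ε⁻¹ raised to the valuation
of the distance to the root. -/
lemma chartIntegral_of_hasTwoRoots (hτ : IsGen ι τ) (h : HasTwoRoots ι τ) {χ : Torus F K →* ℂˣ}
    (hu : IsUnramified χ) (hχ : ∀ t, ‖(χ t : ℂ)‖ = 1) :
    chartIntegral μ τ χ = radialIntegral μ (χ (QuotientGroup.mk (primeElement F K))) +
      radialIntegral μ (χ (QuotientGroup.mk (primeElement F K)))⁻¹ := by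
  classical
  have hplt : absF (unif F) < 1 := by rw [absF_unif]; exact inv_lt_one_of_one_lt₀ (one_lt_qN F)
  have hpos := inv_pos.2 (qN_pos F)
  have hlt1 := inv_lt_one_of_one_lt₀ (one_lt_qN F)
  -- The roots are labelled so that the chart coordinate of the chosen prime element is near r. This
  -- identifies ε with the value of χ on that element; the labelling is otherwise irrelevant.
  obtain ⟨r, s, hr, hs, hrs, hf, hε⟩ : ∃ r s : F, absF r ≤ 1 ∧ absF s ≤ 1 ∧ absF (r - s) = 1 ∧
      (∀ z, qform ι τ z 1 = (z - r) * (z - s)) ∧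
      χ (QuotientGroup.mk (primeElement F K)) = χ (chart F τ (r + unif F)) := by
    obtain ⟨r, s, hr, hs, hrs, hf⟩ := h
    have hz1 : absF (r + unif F) ≤ 1 := (absF_add_le _ _).trans (max_le hr hplt.le)
    obtain ⟨hpi, hp⟩ := abs_nrm_primeElement hτ hz1 (by rw [abs_mul_sub hrs hf hplt, absF_unif])
    set p : Kˣ := primeElement F K
    obtain ⟨a, b, hab⟩ := exists_lin hτ (p : K)
    rw [hab, hτ.isIntegral_iff] at hpi
    rw [hab, nrm_lin] at hp
    have hb : absF b = 1 := by
      refine le_antisymm hpi.2 ?_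
      by_contra! hb
      rcases lt_or_eq_of_le hpi.1 with ha | ha
      · have h1 := abs_qform_le hτ a b
        rw [hp] at h1
        have h2 : max (absF a) (absF b) ≤ (qN F)⁻¹ :=
          max_le (absF_lt_one_iff.1 ha) (absF_lt_one_iff.1 hb)
        have h3 : (qN F)⁻¹ ≤ (qN F)⁻¹ ^ 2 := h1.trans (by gcongr)
        rw [pow_two] at h3
        exact absurd h3 (not_le.2 (mul_lt_of_lt_one_left hpos hlt1))
      · rw [abs_qform_of_lt hτ (by rwa [ha]), ha, one_pow] at hp
        exact hlt1.ne hp.symm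
    have hb0 : b ≠ 0 := by rw [← absF_pos, hb]; exact one_pos
    set z := a / b with hz
    have e : lin τ a b = b • lin τ z 1 := by rw [smul_lin, hz, mul_div_cancel₀ _ hb0, mul_one]
    have hpz : (QuotientGroup.mk p : Torus F K) = chart F τ z := by
      rw [← toT_units, hab, e, toT_smul hb0, chart]
    have hqz : absF (z - r) * absF (z - s) = (qN F)⁻¹ := by
      rw [← absF_mul, ← hf, ← hp, ← nrm_lin, ← nrm_lin, e, nrm_smul, absF_mul, absF_pow, hb, one_pow,
        one_mul]
    have hz1 : absF z ≤ 1 := by rw [hz, absF_div, hb, div_one]; exact hpi.1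
    have hzr : absF (z - r) ≤ 1 := (absF_sub_le _ _).trans (max_le hz1 hr)
    have hzs : absF (z - s) ≤ 1 := (absF_sub_le _ _).trans (max_le hz1 hs)
    have fin : ∀ r s : F, absF r ≤ 1 → absF s ≤ 1 → absF (r - s) = 1 →
        (∀ z, qform ι τ z 1 = (z - r) * (z - s)) → absF (z - r) * absF (z - s) = (qN F)⁻¹ →
        absF (z - r) < 1 → χ (QuotientGroup.mk p) = χ (chart F τ (r + unif F)) := by
      intro r s hr hs hrs hf hqz hlt
      have hzs1 : absF (z - s) = 1 := by
        have e1 : z - s = (r - s) + (z - r) := by ring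
        rw [e1, absF_add_eq_of_lt (by rwa [hrs]), hrs]
      rw [hzs1, mul_one] at hqz
      have e2 : z = r + (z - r) := by ring
      rw [hpz, e2]
      refine char_chart_eq_of_abs_eq hτ hr hs hrs hf hu ?_ hlt (by rw [absF_unif, hqz])
      rw [← absF_pos, hqz]
      exact hpos
    rcases lt_or_eq_of_le hzr with hlt | heq
    · exact ⟨r, s, hr, hs, hrs, hf, fin r s hr hs hrs hf hqz hlt⟩
    · have hrs' : absF (s - r) = 1 := by rw [absF_sub_comm, hrs]
      have hf' : ∀ z, qform ι τ z 1 = (z - s) * (z - r) := fun z => by rw [hf, mul_comm]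
      refine ⟨s, r, hs, hr, hrs', hf', fin s r hs hr hrs' hf' (by rw [mul_comm, hqz]) ?_⟩
      rw [heq, one_mul] at hqz
      rw [hqz]
      exact hlt1
  rw [hε]
  set ε := χ (chart F τ (r + unif F)) with hεdef
  have hε1 : ‖(ε : ℂ)‖ = 1 := hχ _
  have hε2 : ‖((ε⁻¹ : ℂˣ) : ℂ)‖ = 1 := by rw [Units.val_inv_eq_inv_val, norm_inv, hε1, inv_one]
  set g : ℂˣ → F → ℂ := fun ε => (ballF (-1)).indicator (fun w => ((ε ^ ord w : ℂˣ) : ℂ) - 1) with hg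
  have hgi : ∀ ε : ℂˣ, ‖(ε : ℂ)‖ = 1 → Integrable (g ε) μ := by
    intro ε hε
    have hfin : IsFiniteMeasure (μ.restrict (ballF (-1 : ℤ))) :=
      ⟨by simpa using (measure_ballF_ne_top μ (-1)).lt_top⟩
    exact (integrable_indicator_iff (measurableSet_ballF _)).2
      ((integrableOn_zpow_ord μ hε _).sub (integrable_const 1))
  have hgI : ∀ ε : ℂˣ, ∫ w, g ε w ∂μ = radialIntegral μ ε := fun ε =>
    integral_indicator (measurableSet_ballF _)
  have hmem : ∀ w : F, w ∈ (ballF (-1) : Set F) ↔ absF w < 1 := fun w => by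
    rw [mem_ballF, absF_lt_one_iff, zpow_neg_one]
  have hae : ∀ᵐ z ∂μ, ((χ (chart F τ z) : ℂ) - 1) = g ε (z - r) + g ε⁻¹ (z - s) := by
    filter_upwards [ae_qform_ne_zero ι τ μ] with z hz
    have hz' := hz
    rw [hf] at hz'
    obtain ⟨hzr0, hzs0⟩ := mul_ne_zero_iff.1 hz'
    have hexcl : ¬ (absF (z - r) < 1 ∧ absF (z - s) < 1) := by
      rintro ⟨h1, h2⟩
      have e : r - s = (z - s) - (z - r) := by ring
      rw [e] at hrs
      exact ((absF_sub_le _ _).trans_lt (max_lt h2 h1)).ne hrs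
    by_cases hzr : absF (z - r) < 1
    · have hzs : ¬ absF (z - s) < 1 := fun h => hexcl ⟨hzr, h⟩
      have e : z = r + (z - r) := by ring
      simp only [hg]
      rw [Set.indicator_of_mem ((hmem _).2 hzr), Set.indicator_of_notMem (mt (hmem _).1 hzs), add_zero,
        ← char_chart_eq_zpow hτ hr hs hrs hf hu hzr0 hzr, ← e]
    · by_cases hzs : absF (z - s) < 1
      · have e : z = s + (z - s) := by ring
        simp only [hg]
        rw [Set.indicator_of_notMem (mt (hmem _).1 hzr), Set.indicator_of_mem ((hmem _).2 hzs), zero_add,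
          ← char_chart_other_root hτ hr hs hrs hf hu hzs0 hzs, ← e]
      · simp only [hg]
        rw [Set.indicator_of_notMem (mt (hmem _).1 hzr), Set.indicator_of_notMem (mt (hmem _).1 hzs),
          hu _ (chart_mem_unitFiltration_zero hτ hz fun hz1 => ?_)]
        · simp
        · have h1 : absF (z - r) ≤ 1 := (absF_sub_le _ _).trans (max_le hz1 hr)
          have h2 : absF (z - s) ≤ 1 := (absF_sub_le _ _).trans (max_le hz1 hs)
          rw [hf, absF_mul, le_antisymm h1 (not_lt.1 hzr), le_antisymm h2 (not_lt.1 hzs), one_mul]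
  rw [chartIntegral, integral_congr_ae hae, integral_add ((hgi ε hε1).comp_sub_right r)
    ((hgi ε⁻¹ hε2).comp_sub_right s), integral_sub_right_eq_self (g ε), integral_sub_right_eq_self (g ε⁻¹),
    hgI, hgI]

end UnramifiedIntegral

/-! ### The norm character -/

section NormCharacter

attribute [local instance] torusCommGroup

variable {F K : Type*} [Field F] [ValuativeRel F] [TopologicalSpace F]
  [IsNonarchimedeanLocalField F] [CommRing K] [Algebra F K] [Algebra.IsQuadraticExtension F K]
  {ι : K →ₐ[F] Matrix (Fin 2) (Fin 2) F} {τ : K}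

lemma zpow_mul_two {α : ℂˣ} (hα : α ^ 2 = 1) (n : ℤ) : α ^ (2 * n) = 1 := by
  rw [zpow_mul]
  have : α ^ (2 : ℤ) = 1 := by exact_mod_cast hα
  rw [this, one_zpow]

/-- The character `t ↦ α^{ν(N t)}` of the torus, if `α² = 1`. -/
def normChar (hι : NotInBorel ι) {α : ℂˣ} (hα : α ^ 2 = 1) : Torus F K →* ℂˣ :=
  QuotientGroup.lift (scalarUnits F K)
    { toFun := fun u => α ^ ord (nrm ι (u : K))
      map_one' := by rw [Units.val_one, nrm_one, ord_one, zpow_zero]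
      map_mul' := fun u v => by
        rw [Units.val_mul, nrm_mul, ord_mul (nrm_units_ne_zero hι u) (nrm_units_ne_zero hι v), zpow_add] }
    (by
      rintro _ ⟨c, rfl⟩
      change α ^ ord (nrm ι (algebraMap F K (c : F))) = 1
      rw [nrm_algebraMap, pow_two, ord_mul c.ne_zero c.ne_zero, ← two_mul, zpow_mul_two hα])

lemma normChar_mk (hι : NotInBorel ι) {α : ℂˣ} (hα : α ^ 2 = 1) (u : Kˣ) :
    normChar hι hα (QuotientGroup.mk u : Torus F K) = α ^ ord (nrm ι (u : K)) := rfl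

lemma normChar_sq (hι : NotInBorel ι) {α : ℂˣ} (hα : α ^ 2 = 1) (t : Torus F K) :
    normChar hι hα t * normChar hι hα t = 1 := by
  obtain ⟨u, rfl⟩ := QuotientGroup.mk_surjective t
  rw [normChar_mk, ← zpow_add, ← two_mul, zpow_mul_two hα]

lemma normChar_unitFiltration (hι : NotInBorel ι) {α : ℂˣ} (hα : α ^ 2 = 1) {n : ℕ} {t : Torus F K}
    (ht : t ∈ unitFiltration F K n) : normChar hι hα t = 1 := by
  obtain ⟨u, rfl, hu, hu', -⟩ := ht
  have h1 := ((isIntegral_iff hι).1 hu).2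
  have h2 := ((isIntegral_iff hι).1 hu').2
  have h3 : absF (nrm ι (u : K)) * absF (nrm ι ((u⁻¹ : Kˣ) : K)) = 1 := by
    rw [← absF_mul, ← nrm_mul, Units.mul_inv, nrm_one, absF_one]
  have h4 : absF (nrm ι (u : K)) = 1 := by
    refine le_antisymm h1 ?_
    rw [← h3]
    exact mul_le_of_le_one_right zero_le h2
  have h5 : ord (nrm ι (u : K)) = 0 := by
    rw [ord_eq_iff (nrm_units_ne_zero hι u), h4]
    simp
  rw [normChar_mk, h5, zpow_zero]

lemma isUnramified_mul_normChar (hι : NotInBorel ι) {α : ℂˣ} (hα : α ^ 2 = 1) (χ : Torus F K →* ℂˣ) :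
    IsUnramified (χ * normChar hι hα) ↔ IsUnramified χ := by
  refine forall₂_congr fun t ht => ?_
  rw [MonoidHom.mul_apply, normChar_unitFiltration hι hα ht, mul_one]

lemma conductor_mul_normChar (hι : NotInBorel ι) {α : ℂˣ} (hα : α ^ 2 = 1) (χ : Torus F K →* ℂˣ) :
    conductor (χ * normChar hι hα) = conductor χ := by
  unfold conductor
  congr 1
  ext n
  refine forall₂_congr fun t ht => ?_
  rw [MonoidHom.mul_apply, normChar_unitFiltration hι hα ht, mul_one]

lemma norm_of_sq {α : ℂˣ} (hα : α ^ 2 = 1) : ‖(α : ℂ)‖ = 1 := by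
  have h : ‖(α : ℂ)‖ ^ 2 = 1 := by
    rw [← norm_pow, ← Units.val_pow_eq_pow_val, hα, Units.val_one, norm_one]
  exact (pow_eq_one_iff_of_nonneg (norm_nonneg _) two_ne_zero).1 h

variable [TopologicalSpace K] [IsModuleTopology F K] [IsTopologicalRing K]

lemma isUnitaryChar_normChar (hτ : IsGen ι τ) {α : ℂˣ} (hα : α ^ 2 = 1) :
    IsUnitaryChar (normChar (F := F) hτ.notInBorel hα) := by
  refine ⟨continuous_of_units ?_, fun t => ?_⟩
  · simp_rw [normChar_mk]
    exact (continuous_of_discreteTopology (f := fun n : ℤ => α ^ n)).comp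
      (continuous_ord (continuous_nrm.comp Units.continuous_val) (nrm_units_ne_zero hτ.notInBorel))
  · obtain ⟨u, rfl⟩ := QuotientGroup.mk_surjective t
    rw [normChar_mk, Units.val_zpow_eq_zpow_val, norm_zpow, norm_of_sq hα, one_zpow]

variable [MeasurableSpace F] [BorelSpace F] [MeasurableSpace (Torus F K)] [BorelSpace (Torus F K)]
  (μ : Measure F) [μ.IsAddHaarMeasure] {μT : Measure (Torus F K)} {c : ℝ≥0}

open Classical in
/-- The integral in the chart in terms of Euler factors. -/
lemma chartIntegral_mul_eulerPoly (hτ : IsGen ι τ) [μT.IsHaarMeasure]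
    (hμ : μT = c • chartMeasure ι μ τ) (hc : 0 < c) {α : ℂˣ} (hα : α ^ 2 = 1) {χ : Torus F K →* ℂˣ}
    (hχ : IsUnitaryChar χ) :
    chartIntegral μ τ (χ * normChar hτ.notInBorel hα) * eulerPoly χ α (1 / 2) =
      -((volO μ : ℝ) * (resCard F : ℂ)⁻¹ * (1 + (resCard F : ℂ)⁻¹)) *
        (if IsUnramified χ then eulerPoly χ α (-1 / 2) else (resCard F : ℂ) ^ conductor χ) := by
  have hι := hτ.notInBorel
  have hχ' := hχ.mul (isUnitaryChar_normChar hτ hα)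
  have hq0 := resCard_ne_zero F
  have ep1 : (resCard F : ℂ) ^ (-(1 / 2) - 1 / 2 : ℂ) = (resCard F : ℂ)⁻¹ := by
    rw [← Complex.cpow_neg_one]; norm_num
  have ep2 : (resCard F : ℂ) ^ (-(-1 / 2) - 1 / 2 : ℂ) = 1 := by
    rw [← Complex.cpow_zero (resCard F : ℂ)]; norm_num
  have ep3 : (resCard F : ℂ) ^ (-2 * (-1 / 2) - 1 : ℂ) = 1 := by
    rw [← Complex.cpow_zero (resCard F : ℂ)]; norm_num
  have hα2 : (α : ℂ) ^ 2 = 1 := by rw [← Units.val_pow_eq_pow_val, hα, Units.val_one]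
  by_cases hu : IsUnramified χ
  · have hu' : IsUnramified (χ * normChar hι hα) := (isUnramified_mul_normChar hι hα χ).2 hu
    rw [if_pos hu, eulerPoly, eulerPoly, if_neg (not_not.2 hu), if_neg (not_not.2 hu)]
    -- The norm of ϖ_K has valuation one, so the twist replaces χ(ϖ_K) by αχ(ϖ_K), the coefficient
    -- in the Euler factor.
    have hpe : ∀ z : F, absF z ≤ 1 → absF (qform ι τ z 1) = (qN F)⁻¹ →
        (χ * normChar hι hα) (QuotientGroup.mk (primeElement F K)) =
          α * χ (QuotientGroup.mk (primeElement F K)) := by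
      intro z hz hq
      have h1 := (abs_nrm_primeElement hτ hz hq).2
      have h2 : ord (nrm ι ((primeElement F K : Kˣ) : K)) = 1 := by
        rw [ord_eq_iff (nrm_units_ne_zero hι _), h1, zpow_neg_one]
      rw [MonoidHom.mul_apply, normChar_mk, h2, zpow_one, mul_comm]
    rcases type_trichotomy hτ with ⟨hs, ht⟩ | ⟨hs, hi, hn⟩ | ⟨hs, hi, hD⟩
    · rw [if_pos hs, if_pos hs, ep1, ep2, chartIntegral_of_hasTwoRoots μ hτ ht hu' hχ'.norm_eq_one]
      obtain ⟨r, s, hr, -, hrs, hf⟩ := ht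
      have hplt : absF (unif F) < 1 := by rw [absF_unif]; exact inv_lt_one_of_one_lt₀ (one_lt_qN F)
      have hp := hpe (r + unif F) ((absF_add_le _ _).trans (max_le hr hplt.le))
        (by rw [abs_mul_sub hrs hf hplt, absF_unif])
      have hn := hχ'.norm_eq_one (QuotientGroup.mk (primeElement F K))
      have hαinv : (α : ℂ) = ((α⁻¹ : ℂˣ) : ℂ) := by
        congr 1
        rw [eq_inv_iff_mul_eq_one, ← pow_two, hα]
      have hn2 : ‖((((χ * normChar hι hα) (QuotientGroup.mk (primeElement F K)))⁻¹ : ℂˣ) : ℂ)‖ = 1 := by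
        rw [Units.val_inv_eq_inv_val, norm_inv, hn, inv_one]
      have h1 := radialIntegral_mul μ hn
      have h2 := radialIntegral_mul μ hn2
      rw [hp] at h1 h2 ⊢
      have h3 : (((α * χ (QuotientGroup.mk (primeElement F K)))⁻¹ : ℂˣ) : ℂ) =
          α * ((χ (QuotientGroup.mk (primeElement F K)))⁻¹ : ℂˣ) := by
        rw [mul_inv, Units.val_mul, ← hαinv]
      have h4 : ((α : ℂ) * χ (QuotientGroup.mk (primeElement F K))) *
          (α * ((χ (QuotientGroup.mk (primeElement F K)))⁻¹ : ℂˣ)) = 1 := by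
        rw [mul_mul_mul_comm, ← pow_two, hα2, one_mul, Units.mul_inv]
      rw [Units.val_mul] at h1
      rw [h3] at h2
      set A := (α : ℂ) * χ (QuotientGroup.mk (primeElement F K))
      set B := (α : ℂ) * ((χ (QuotientGroup.mk (primeElement F K)))⁻¹ : ℂˣ)
      set Q := (resCard F : ℂ)⁻¹
      -- A and B are αχ(ϖ_K) and αχ(ϖ_K)⁻¹, with AB = α² = 1. The factors of E_α(1/2) are the
      -- denominators 1 - Aq⁻¹ and 1 - Bq⁻¹ of the two radial integrals.
      linear_combination (1 - B * Q) * h1 + (1 - A * Q) * h2 +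
        ((volO μ : ℝ) * Q * (1 + Q) - 2 * (volO μ : ℝ) * Q * Q) * h4
    -- In the inert case both sides vanish: the integrand is zero almost everywhere, and E_α(-1/2) =
    -- 1 - α² = 0.
    · rw [if_neg hs, if_neg hs, if_pos hi, if_pos hi, ep3, hα2,
        chartIntegral_of_hasNoRoot μ hτ hn hu']
      simp
    · rw [if_neg hs, if_neg hs, if_neg hi, if_neg hi, ep1, ep2]
      obtain ⟨hsq, hI⟩ := chartIntegral_of_hasDoubleRoot μ hτ hD hu'
      obtain ⟨r, hr, h1, -⟩ := hD
      have hp := hpe r hr (h1 r (by rw [sub_self, absF_zero]; exact one_pos))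
      rw [hI]
      rw [hp, Units.val_mul] at hsq ⊢
      linear_combination (-(volO μ : ℝ) * (resCard F : ℂ)⁻¹ ^ 2) * hsq
  · have hu' : ¬ IsUnramified (χ * normChar hι hα) := mt (isUnramified_mul_normChar hι hα χ).1 hu
    rw [if_neg hu, eulerPoly, if_pos hu, mul_one, chartIntegral_ramified μ hτ hμ hc hχ' hu',
      conductor_mul_normChar]

end NormCharacter

end LocalToric

end

noncomputable section

namespace LocalToric

/-! ### Test functions on the torus -/

section TestFunctions

attribute [local instance] torusCommGroup

variable {F K : Type*} [Field F] [ValuativeRel F] [TopologicalSpace F]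
  [IsNonarchimedeanLocalField F] [CommRing K] [Algebra F K] [Algebra.IsQuadraticExtension F K]
  [TopologicalSpace K] [IsModuleTopology F K] [IsTopologicalRing K]
  {ι : K →ₐ[F] Matrix (Fin 2) (Fin 2) F} {τ : K}

/-- A locally constant function with compact support is invariant under a group `H_n`. -/
lemma exists_unitFiltration_invariant (hτ : IsGen ι τ) (f : TestSpace F K) :
    ∃ n : ℕ, 1 ≤ n ∧ ∀ h ∈ unitFiltration F K n, ∀ t, f.1 (t * h) = f.1 t := by
  set P : Torus F K → Prop := fun h => ∀ t ∈ tsupport f.1, f.1 (t * h) = f.1 t with hP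
  have h1 : ∀ᶠ h in 𝓝 (1 : Torus F K), P h := by
    refine f.2.2.isCompact.eventually_forall_of_forall_eventually
      (P := fun h t => f.1 (t * h) = f.1 t) fun t _ => ?_
    have e1 : IsLocallyConstant fun p : Torus F K × Torus F K => f.1 (p.2 * p.1) :=
      f.2.1.comp_continuous (continuous_snd.mul continuous_fst)
    have e2 : IsLocallyConstant fun p : Torus F K × Torus F K => f.1 p.2 :=
      f.2.1.comp_continuous continuous_snd
    filter_upwards [e1.eventually_eq (1, t), e2.eventually_eq (1, t)] with p hp1 hp2
    rw [hp1, hp2, mul_one]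
  -- The inverse covers points t outside the support for which th lies inside it.
  have h2 : ∀ᶠ h in 𝓝 (1 : Torus F K), P h⁻¹ := by
    have : Tendsto (fun h : Torus F K => h⁻¹) (𝓝 1) (𝓝 1) := by
      simpa using (continuous_inv (G := Torus F K)).tendsto 1
    exact this.eventually h1
  obtain ⟨n, hn, hsub⟩ := exists_unitFiltration_subset hτ (h1.and h2)
  refine ⟨n, hn, fun h hh t => ?_⟩
  obtain ⟨e1, e2⟩ := hsub hh
  by_cases ht : t ∈ tsupport f.1
  · exact e1 t ht
  · by_cases ht' : t * h ∈ tsupport f.1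
    · have := e2 _ ht'
      rw [mul_inv_cancel_right] at this
      exact this.symm
    · rw [image_eq_zero_of_notMem_tsupport ht, image_eq_zero_of_notMem_tsupport ht']

/-- The function `t ↦ ω(t) f(t⁻¹)`. -/
def reflectTwist (ω : Torus F K →* ℂˣ) (f : Torus F K → ℂ) (t : Torus F K) : ℂ := ω t * f t⁻¹

variable [MeasurableSpace (Torus F K)] [BorelSpace (Torus F K)] {μT : Measure (Torus F K)}
  [μT.IsHaarMeasure]

lemma integrable_reflectTwist {ω : Torus F K →* ℂˣ} (hω : IsUnitaryChar ω) (f : TestSpace F K) :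
    Integrable (reflectTwist ω f.1) μT := by
  refine Continuous.integrable_of_hasCompactSupport ?_ ?_
  · exact hω.continuous_coe.mul (f.2.1.continuous.comp continuous_inv)
  · exact HasCompactSupport.mul_left (f.2.2.comp_homeomorph (Homeomorph.inv (Torus F K)))

/-- The twist occurs twice and cancels by ω² = 1; inversion preserves the Haar measure of T. -/
lemma integral_mul_reflectTwist (hτ : IsGen ι τ) (χ : Torus F K →* ℂˣ) {ω : Torus F K →* ℂˣ}
    (hω : ∀ t, ω t * ω t = 1) (f : Torus F K → ℂ) :
    ∫ t, ((χ * ω) t : ℂ) * reflectTwist ω f t ∂μT = ∫ t, f t * ((χ t)⁻¹ : ℂˣ) ∂μT := by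
  have h1 := secondCountable_torus (F := F) hτ
  have h2 := locallyCompact_torus (F := F) hτ
  rw [← integral_inv_eq_self (fun t => f t * (((χ t)⁻¹ : ℂˣ) : ℂ)) μT]
  congr 1
  funext t
  rw [reflectTwist, ← mul_assoc, ← Units.val_mul, MonoidHom.mul_apply, mul_assoc, hω,
    mul_one, map_inv, inv_inv, mul_comm]

lemma reflectTwist_mul {ω : Torus F K →* ℂˣ} {n : ℕ} (hω : ∀ h ∈ unitFiltration F K n, ω h = 1)
    {f : Torus F K → ℂ} (hf : ∀ h ∈ unitFiltration F K n, ∀ t, f (t * h) = f t)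
    {h : Torus F K} (hh : h ∈ unitFiltration F K n) (t : Torus F K) :
    reflectTwist ω f (h * t) = reflectTwist ω f t := by
  have e : t⁻¹ = (h * t)⁻¹ * h := by rw [mul_inv_rev, inv_mul_cancel_right]
  rw [reflectTwist, reflectTwist, map_mul, hω h hh, one_mul, e, hf h hh]

end TestFunctions

/-! ### Restriction of the induced representation to the torus -/

section Restriction

attribute [local instance] torusCommGroup

variable {F K : Type*} [Field F] [ValuativeRel F] [TopologicalSpace F]
  [IsNonarchimedeanLocalField F] [CommRing K] [Algebra F K] [Algebra.IsQuadraticExtension F K]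
  [TopologicalSpace K] [IsModuleTopology F K]
  {ι : K →ₐ[F] Matrix (Fin 2) (Fin 2) F} {τ : K}

lemma deltaFun_unitsEmb (hι : NotInBorel ι) (α : ℂˣ) (f : Torus F K → ℂ) (u : Kˣ) :
    deltaFun ι α f (unitsEmb ι u) = f (QuotientGroup.mk u)⁻¹ := by
  have := deltaFun_mul hι α f 1 u (by simp)
  rw [one_mul] at this
  rw [this, borelChar]
  simp [ord_one]

lemma torusRep_mk_deltaT (hι : NotInBorel ι) (α : ℂˣ) (f : TestSpace F K) (s : Kˣ) :
    torusRep ι α (QuotientGroup.mk s) (deltaT hι α f) = (detLine F α).mkQ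
      (rightTranslate α (unitsEmb ι s) ⟨deltaFun ι α f.1, deltaFun_mem hι α f⟩) := rfl

/-- The pairing uses an arbitrary set-theoretic section of the quotient map. The only information
about the section is that it changes a representative by an element of the subrepresentation divided
out. -/
lemma sub_mem_detLine (α : ℂˣ) (φ : IndSpace F α) :
    Function.surjInv (detLine F α).mkQ_surjective ((detLine F α).mkQ φ) - φ ∈ detLine F α := by
  have := Function.surjInv_eq (detLine F α).mkQ_surjective ((detLine F α).mkQ φ)
  rwa [← sub_eq_zero, ← map_sub, Submodule.mkQ_apply, Submodule.Quotient.mk_eq_zero] at this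

lemma ne_of_norm_sq {α : ℂˣ} (hα : ‖(α : ℂ)‖ ^ 2 = resCard F) : ¬ (α = 1 ∨ α = -1) := by
  have h1 : (1 : ℝ) < resCard F := by exact_mod_cast one_lt_resCard F
  rintro (rfl | rfl) <;> · simp at hα; rw [← hα] at h1; exact lt_irrefl _ h1

lemma representative_of_norm_sq {α : ℂˣ} (hα : ‖(α : ℂ)‖ ^ 2 = resCard F) (φ : IndSpace F α) :
    Function.surjInv (detLine F α).mkQ_surjective ((detLine F α).mkQ φ) = φ := by
  have h0 : detLine F α = ⊥ := if_neg (ne_of_norm_sq hα)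
  have h := h0.le (sub_mem_detLine α φ)
  rwa [Submodule.mem_bot, sub_eq_zero] at h

lemma exists_representative {α : ℂˣ} (hα : α = 1 ∨ α = -1) (φ : IndSpace F α) : ∃ a : ℂ, ∀ g,
    (Function.surjInv (detLine F α).mkQ_surjective ((detLine F α).mkQ φ)).1 g =
      φ.1 g + a * detChar α g := by
  have h0 : detLine F α = (Submodule.span ℂ {detChar α}).comap (IndSpace F α).subtype := if_pos hα
  have h := h0.le (sub_mem_detLine α φ)
  obtain ⟨a, ha⟩ := Submodule.mem_span_singleton.1 (Submodule.mem_comap.1 h)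
  refine ⟨a, fun g => ?_⟩
  have hg := congrFun ha g
  change a * detChar α g =
    (Function.surjInv (detLine F α).mkQ_surjective ((detLine F α).mkQ φ)).1 g - φ.1 g at hg
  rw [hg]
  ring

variable [MeasurableSpace F] [MeasurableSpace (GL (Fin 2) F)] [MeasurableSpace (Torus F K)]
  {μN : Measure F} {μG : Measure (GL (Fin 2) F)} {μT : Measure (Torus F K)} {cT : ℝ}

/-- The pairing of `δ_T(f₁)` and `δ_T(f₂)` for a unitarily induced representation. -/
lemma pairing_deltaT_of_norm_sq (hι : NotInBorel ι) (hcT : IsCompactComparison ι μG μT cT) {α : ℂˣ}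
    (hα : ‖(α : ℂ)‖ ^ 2 = resCard F) (f₁ f₂ : TestSpace F K) (t : Torus F K) :
    pairing μN μG α (torusRep ι α t (deltaT hι α f₁)) (deltaT hι α f₂) =
      cT * ∫ v, reflectTwist 1 f₁.1 (v * t) * conj (reflectTwist 1 f₂.1 v) ∂μT := by
  obtain ⟨s, rfl⟩ := QuotientGroup.mk_surjective t
  rw [torusRep_mk_deltaT, pairing, representative_of_norm_sq hα, deltaT, representative_of_norm_sq hα,
    pairingBar, if_pos hα]
  set φ₁ := rightTranslate α (unitsEmb ι s) ⟨deltaFun ι α f₁.1, deltaFun_mem hι α f₁⟩ with hφ₁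
  set φ₂ : IndSpace F α := ⟨deltaFun ι α f₂.1, deltaFun_mem hι α f₂⟩ with hφ₂
  rw [hcT (fun g => φ₁.1 g * conj (φ₂.1 g)) ⟨φ₁.2.1.mul (φ₂.2.1.comp conj), fun b g hb => ?_⟩,
    torusIntegral]
  · congr 2
    funext v
    have h1 : φ₁.1 (unitsEmb ι v.out) = reflectTwist 1 f₁.1 (v * QuotientGroup.mk s) := by
      change deltaFun ι α f₁.1 (unitsEmb ι v.out * unitsEmb ι s) = _
      rw [← map_mul, deltaFun_unitsEmb hι, QuotientGroup.mk_mul, QuotientGroup.out_eq', reflectTwist]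
      simp
    have h2 : φ₂.1 (unitsEmb ι v.out) = reflectTwist 1 f₂.1 v := by
      rw [hφ₂]
      simp only
      rw [deltaFun_unitsEmb hι, QuotientGroup.out_eq', reflectTwist]
      simp
    rw [h1, h2]
  -- The product is modular because |α|² = q makes the squared absolute value of the inducing
  -- character equal to q^{ν(t₂/t₁)} = |t₁/t₂|.
  · simp only
    rw [φ₁.2.2 b g hb, φ₂.2.2 b g hb, map_mul, mul_mul_mul_comm, Complex.mul_conj, Complex.normSq_eq_norm_sq]
    congr 1
    obtain ⟨h0, h1⟩ := diag_ne_zero hb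
    rw [borelChar, Units.val_zpow_eq_zpow_val, norm_zpow, ← zpow_natCast, zpow_comm, zpow_natCast, hα,
      modChar, ord_div h0 h1, ord_div h1 h0, neg_sub]
    push_cast
    rfl

end Restriction

/-! ### The intertwining operator and the pairing for α = ±1 -/

section Special

attribute [local instance] torusCommGroup

variable {F K : Type*} [Field F] [ValuativeRel F] [TopologicalSpace F]
  [IsNonarchimedeanLocalField F] [CommRing K] [Algebra F K] [Algebra.IsQuadraticExtension F K]
  [TopologicalSpace K] [IsModuleTopology F K] [IsTopologicalRing K]
  {ι : K →ₐ[F] Matrix (Fin 2) (Fin 2) F} {τ : K}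
  [MeasurableSpace F] [BorelSpace F] [MeasurableSpace (Torus F K)] [BorelSpace (Torus F K)]
  {μ : Measure F} [μ.IsAddHaarMeasure]

/-- The intertwining operator on the torus. -/
lemma regIntertwiner_unitsEmb (hτ : IsGen ι τ) {α : ℂˣ} (hα : α ^ 2 = 1) (φ : IndSpace F α)
    {A : Torus F K → ℂ}
    (hA : ∀ u : Kˣ, φ.1 (unitsEmb ι u) =
      normChar hτ.notInBorel hα (QuotientGroup.mk u : Torus F K) * A (QuotientGroup.mk u)) (u : Kˣ) :
    regIntertwiner μ φ.1 (unitsEmb ι u) = ((absF (ι τ 1 0) : ℝ) : ℂ)⁻¹ *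
      (normChar hτ.notInBorel hα (QuotientGroup.mk u : Torus F K) *
        diffOp μ (chart F τ) A (QuotientGroup.mk u)) := by
  have hcτ := hτ.lower_ne_zero
  have hcτ' : ((absF (ι τ 1 0) : ℝ) : ℂ) ≠ 0 := by exact_mod_cast absF_ne_zero hcτ
  set ω := normChar (F := F) hτ.notInBorel hα
  have h := integral_affine μ (inv_ne_zero (neg_ne_zero.2 hcτ)) (-(ι τ 1 1 / ι τ 1 0))
    (fun x => φ.1 (lowerUnipOmega x * unitsEmb ι u) - φ.1 (unitsEmb ι u))
  have hae : ∀ᵐ z ∂μ, φ.1 (lowerUnipOmega (-(ι τ 1 1 / ι τ 1 0) + (-(ι τ 1 0))⁻¹ * z) * unitsEmb ι u) -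
      φ.1 (unitsEmb ι u) = ω (QuotientGroup.mk u : Torus F K) *
        (A (chart F τ z * QuotientGroup.mk u) - A (QuotientGroup.mk u)) := by
    filter_upwards [ae_qform_ne_zero ι τ μ] with z hz
    obtain ⟨w, hw⟩ := isUnit_lin hτ hz
    have hval : ∀ i j, (unitsEmb ι w : GL (Fin 2) F) i j = ι (lin τ z 1) i j := by
      intro i j; rw [← hw]; rfl
    have h10 : (unitsEmb ι w : GL (Fin 2) F) 1 0 = ι τ 1 0 := by
      rw [hval, emb_lin_lower, one_mul]
    have h11 : (unitsEmb ι w : GL (Fin 2) F) 1 1 = z + ι τ 1 1 := by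
      rw [hval, emb_lin_diag, one_mul]
    have hdet : ((unitsEmb ι w : GL (Fin 2) F) : Matrix (Fin 2) (Fin 2) F).det = nrm ι (w : K) := rfl
    have hN := nrm_units_ne_zero hτ.notInBorel w
    obtain ⟨b, hb, hb1, hb0, he⟩ := exists_borel_mul_lowerUnipOmega (unitsEmb ι w)
      (by rw [h10]; exact hcτ)
    have hx : -((unitsEmb ι w : GL (Fin 2) F) 1 1 / (unitsEmb ι w : GL (Fin 2) F) 1 0) =
        -(ι τ 1 1 / ι τ 1 0) + (-(ι τ 1 0))⁻¹ * z := by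
      rw [h10, h11]
      field_simp
      ring
    rw [hx] at he
    -- The exponent differs from ν(N w) by an even integer, so α² = 1 identifies the inducing
    -- character of the Bruhat factor with the norm character.
    have hbc : borelChar α b = ω (QuotientGroup.mk w : Torus F K) := by
      rw [borelChar, hb1, hb0, hdet, h10, ord_div hcτ (div_ne_zero hN hcτ), ord_div hN hcτ]
      congr 1
      change _ = α ^ ord (nrm ι (w : K))
      have e : ord (ι τ 1 0) - (ord (nrm ι (w : K)) - ord (ι τ 1 0)) =
          ord (nrm ι (w : K)) + 2 * (ord (ι τ 1 0) - ord (nrm ι (w : K))) := by ring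
      rw [e, zpow_add, zpow_mul_two hα, mul_one]
    have hφ := φ.2.2 b (lowerUnipOmega (-(ι τ 1 1 / ι τ 1 0) + (-(ι τ 1 0))⁻¹ * z) * unitsEmb ι u) hb
    rw [← mul_assoc, ← he, ← map_mul, hA, hbc, QuotientGroup.mk_mul, map_mul, Units.val_mul,
      mul_assoc] at hφ
    have hch : chart F τ z = QuotientGroup.mk w := by rw [chart, ← hw, toT_units]
    rw [← mul_left_cancel₀ (Units.ne_zero _) hφ, hA, hch, mul_sub]
  rw [integral_congr_ae hae, integral_const_mul, absF_inv, absF_neg] at h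
  rw [regIntertwiner, diffOp, h]
  push_cast
  rw [inv_inv]
  field_simp

/-- After the twist by ω the function φ₀ is constant on T, so the operator does not see the choice
of representative in the second argument. -/
lemma diffOp_add_const {G X : Type*} [CommGroup G] [MeasurableSpace X] (ν : Measure X) (p : X → G)
    (A : G → ℂ) (a : ℂ) : diffOp ν p (fun t => A t + a) = diffOp ν p A := by
  funext u
  simp only [diffOp, add_sub_add_right_eq_sub]

variable [MeasurableSpace (GL (Fin 2) F)] {μG : Measure (GL (Fin 2) F)} {μT : Measure (Torus F K)}
  [μT.IsHaarMeasure] {cT : ℝ}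

/-- The twisted function is invariant under some H_n, and the chart lands in H_n outside a ball. So
the defining integral of the operator runs over a set of finite measure. -/
lemma exists_diffOp_support (hτ : IsGen ι τ) {α : ℂˣ} (hα : α ^ 2 = 1) (f : TestSpace F K) :
    ∃ S : Set F, μ S ≠ ∞ ∧ ∀ z ∉ S, ∀ u, reflectTwist (normChar hτ.notInBorel hα) f.1 (chart F τ z * u) =
      reflectTwist (normChar hτ.notInBorel hα) f.1 u := by
  obtain ⟨n, hn, hf⟩ := exists_unitFiltration_invariant hτ f
  refine ⟨ballF ((n : ℤ) - 1), measure_ballF_ne_top μ _, fun z hz u => ?_⟩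
  exact reflectTwist_mul (fun h hh => normChar_unitFiltration _ hα hh) hf
    (mem_unitFiltration_of_chart hτ hn hz) u

/-- The pairing of `δ_T(f₁)` and `δ_T(f₂)` for a special representation. -/
lemma pairing_deltaT_of_sq (hτ : IsGen ι τ) (hcT : IsCompactComparison ι μG μT cT) {α : ℂˣ}
    (hα' : α = 1 ∨ α = -1) (hα : α ^ 2 = 1) (f₁ f₂ : TestSpace F K) (t : Torus F K) :
    pairing μ μG α (torusRep ι α t (deltaT hτ.notInBorel α f₁)) (deltaT hτ.notInBorel α f₂) =
      cT * ((absF (ι τ 1 0) : ℝ) : ℂ)⁻¹ * (normChar hτ.notInBorel hα t *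
        ∫ v, reflectTwist (normChar hτ.notInBorel hα) f₁.1 (v * t) *
          conj (diffOp μ (chart F τ) (reflectTwist (normChar hτ.notInBorel hα) f₂.1) v) ∂μT) := by
  have hι := hτ.notInBorel
  have hsc := secondCountable_torus (F := F) hτ
  have hlc := locallyCompact_torus (F := F) hτ
  have hne : ¬ ‖(α : ℂ)‖ ^ 2 = resCard F := fun h => ne_of_norm_sq h hα'
  obtain ⟨s, rfl⟩ := QuotientGroup.mk_surjective t
  obtain ⟨a₁, h₁⟩ := exists_representative hα'
    (rightTranslate α (unitsEmb ι s) ⟨deltaFun ι α f₁.1, deltaFun_mem hι α f₁⟩)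
  obtain ⟨a₂, h₂⟩ := exists_representative hα' ⟨deltaFun ι α f₂.1, deltaFun_mem hι α f₂⟩
  rw [torusRep_mk_deltaT, pairing, deltaT, pairingBar, if_neg hne]
  set φ₁ := Function.surjInv (detLine F α).mkQ_surjective ((detLine F α).mkQ
    (rightTranslate α (unitsEmb ι s) ⟨deltaFun ι α f₁.1, deltaFun_mem hι α f₁⟩))
  set φ₂ := Function.surjInv (detLine F α).mkQ_surjective ((detLine F α).mkQ
    ⟨deltaFun ι α f₂.1, deltaFun_mem hι α f₂⟩)
  set ω := normChar (F := F) hι hα with hω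
  have hωu := isUnitaryChar_normChar (F := F) hτ hα
  have hsq : ∀ v, (ω v : ℂ) * ω v = 1 := fun v => by
    rw [← Units.val_mul, hω, normChar_sq, Units.val_one]
  set A₁ := reflectTwist ω f₁.1
  set A₂ := reflectTwist ω f₂.1
  have hA : ∀ (f : Torus F K → ℂ) v, f v⁻¹ = ω v * reflectTwist ω f v := fun f v => by
    rw [reflectTwist, ← mul_assoc, hsq, one_mul]
  have e1 : ∀ u : Kˣ, φ₁.1 (unitsEmb ι u) = ω (QuotientGroup.mk u : Torus F K) *
      (ω (QuotientGroup.mk s : Torus F K) * A₁ (QuotientGroup.mk u * QuotientGroup.mk s) + a₁) := by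
    intro u
    rw [h₁]
    change deltaFun ι α f₁.1 (unitsEmb ι u * unitsEmb ι s) +
      a₁ * ω (QuotientGroup.mk u : Torus F K) = _
    rw [← map_mul, deltaFun_unitsEmb hι, QuotientGroup.mk_mul, hA f₁.1, map_mul, Units.val_mul]
    ring
  have e2 : ∀ u : Kˣ, φ₂.1 (unitsEmb ι u) =
      ω (QuotientGroup.mk u : Torus F K) * (A₂ (QuotientGroup.mk u) + a₂) := by
    intro u
    rw [h₂]
    change deltaFun ι α f₂.1 (unitsEmb ι u) + a₂ * ω (QuotientGroup.mk u : Torus F K) = _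
    rw [deltaFun_unitsEmb hι, hA f₂.1]
    ring
  obtain ⟨S, hS, hS'⟩ := exists_diffOp_support (μ := μ) hτ hα f₂
  have hA₁ : Integrable A₁ μT := integrable_reflectTwist hωu f₁
  have hA₂ : Integrable A₂ μT := integrable_reflectTwist hωu f₂
  have hD := integrable_diffOp (measurable_chart hτ) hA₂ hS hS'
  have hDc : Integrable (fun v => conj (diffOp μ (chart F τ) A₂ v)) μT :=
    Complex.conjLIE.integrable_comp_iff.2 hD
  -- The multiplier of the operator at the trivial character is zero. Hence the multiple a₁ of φ₀ in
  -- the first representative pairs to zero.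
  have hD0 : ∫ v, diffOp μ (chart F τ) A₂ v ∂μT = 0 := by
    have := integral_diffOp (measurable_chart hτ) isUnitaryChar_one hA₂ hS hS'
    simpa using this
  rw [intertwiner_eq μ hα, hcT (fun g => φ₁.1 g * conj (regIntertwiner μ φ₂.1 g))
    ⟨φ₁.2.1.mul ((isLocallyConstant_regIntertwiner μ hα φ₂).comp conj), fun b g hb => ?_⟩,
    torusIntegral, mul_assoc]
  · congr 1
    have hI : ∀ v : Torus F K, φ₁.1 (unitsEmb ι v.out) * conj (regIntertwiner μ φ₂.1 (unitsEmb ι v.out)) =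
        ((absF (ι τ 1 0) : ℝ) : ℂ)⁻¹ * (ω (QuotientGroup.mk s : Torus F K) *
          (A₁ (v * QuotientGroup.mk s) * conj (diffOp μ (chart F τ) A₂ v)) +
          a₁ * conj (diffOp μ (chart F τ) A₂ v)) := by
      intro v
      rw [e1, regIntertwiner_unitsEmb hτ hα φ₂ (A := fun t => A₂ t + a₂) e2, diffOp_add_const, QuotientGroup.out_eq', map_mul,
        map_mul, hωu.conj_eq, map_inv₀, Complex.conj_ofReal,
        inv_eq_of_mul_eq_one_left (normChar_sq hι hα v)]
      linear_combination (((absF (ι τ 1 0) : ℝ) : ℂ)⁻¹ * (ω (QuotientGroup.mk s : Torus F K) *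
        A₁ (v * QuotientGroup.mk s) + a₁) * conj (diffOp μ (chart F τ) A₂ v)) * hsq v
    simp_rw [hI]
    have hJ : Integrable (fun v => A₁ (v * QuotientGroup.mk s) *
        conj (diffOp μ (chart F τ) A₂ v)) μT := by
      obtain ⟨M, hM⟩ := f₁.2.2.exists_bound_of_continuous f₁.2.1.continuous
      have hAc : Continuous A₁ := hωu.continuous_coe.mul (f₁.2.1.continuous.comp continuous_inv)
      refine hDc.bdd_mul (c := M) (hAc.comp (continuous_mul_const _)).aestronglyMeasurable
        (Eventually.of_forall fun v => ?_)
      change ‖(ω (v * QuotientGroup.mk s) : ℂ) * f₁.1 (v * QuotientGroup.mk s)⁻¹‖ ≤ M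
      rw [norm_mul, hωu.norm_eq_one, one_mul]
      exact hM _
    rw [integral_const_mul, integral_add (hJ.const_mul _) (hDc.const_mul _), integral_const_mul,
      integral_const_mul, integral_conj, hD0, map_zero, mul_zero, add_zero]
  · simp only
    obtain ⟨h0, h1⟩ := diag_ne_zero hb
    have hmod : conj (modChar b) = modChar b := by
      rw [modChar_eq hb, Complex.conj_ofReal]
    have hbn : borelChar α b * conj (borelChar α b) = 1 := by
      rw [Complex.mul_conj, Complex.normSq_eq_norm_sq, borelChar, Units.val_zpow_eq_zpow_val, norm_zpow,
        norm_of_sq hα]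
      simp
    rw [φ₁.2.2 b g hb, regIntertwiner_borel_mul μ hα φ₂ hb, map_mul, map_mul, hmod]
    linear_combination (modChar b * φ₁.1 g * conj (regIntertwiner μ φ₂.1 g)) * hbn

end Special

end LocalToric

end

noncomputable section

namespace LocalToric

/-! ### The toric pairing -/

section ToricFormula

attribute [local instance] torusCommGroup

variable {F K : Type*} [Field F] [ValuativeRel F] [TopologicalSpace F]
  [IsNonarchimedeanLocalField F] [CommRing K] [Algebra F K] [Algebra.IsQuadraticExtension F K]
  [TopologicalSpace K] [IsModuleTopology F K] [IsTopologicalRing K]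
  {ι : K →ₐ[F] Matrix (Fin 2) (Fin 2) F} {τ : K}
  [MeasurableSpace F] [BorelSpace F] [MeasurableSpace (Torus F K)] [BorelSpace (Torus F K)]
  {μ : Measure F} [μ.IsAddHaarMeasure]
  [MeasurableSpace (GL (Fin 2) F)] {μG : Measure (GL (Fin 2) F)} {μT : Measure (Torus F K)}
  [μT.IsHaarMeasure] {cT : ℝ}

/-- The matrix coefficient is c_T times a convolution on T of two integrable functions, so it is
integrable and its Fourier coefficient factors. -/
lemma toricPairing_of_norm_sq (hτ : IsGen ι τ) (hcT : IsCompactComparison ι μG μT cT) {α : ℂˣ}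
    (hα : ‖(α : ℂ)‖ ^ 2 = resCard F) {χ : Torus F K →* ℂˣ} (hχ : IsUnitaryChar χ)
    (f₁ f₂ : TestSpace F K) :
    Integrable (toricIntegrand ι μ μG α χ (deltaT hτ.notInBorel α f₁) (deltaT hτ.notInBorel α f₂)) μT ∧
      betaPairing ι μ μG μT α χ (deltaT hτ.notInBorel α f₁) (deltaT hτ.notInBorel α f₂) =
        cT * ((∫ t, f₁.1 t * ((χ t)⁻¹ : ℂˣ) ∂μT) * conj (∫ t, f₂.1 t * ((χ t)⁻¹ : ℂˣ) ∂μT)) := by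
  have hsc := secondCountable_torus (F := F) hτ
  have hlc := locallyCompact_torus (F := F) hτ
  have h1 : Integrable (reflectTwist 1 f₁.1) μT := integrable_reflectTwist isUnitaryChar_one f₁
  have h2 : Integrable (reflectTwist 1 f₂.1) μT := integrable_reflectTwist isUnitaryChar_one f₂
  have h2' : Integrable (fun v => conj (reflectTwist 1 f₂.1 v)) μT :=
    Complex.conjLIE.integrable_comp_iff.2 h2
  have he : toricIntegrand ι μ μG α χ (deltaT hτ.notInBorel α f₁) (deltaT hτ.notInBorel α f₂) =
      fun t => cT * ((∫ v, reflectTwist 1 f₁.1 (v * t) * conj (reflectTwist 1 f₂.1 v) ∂μT) * χ t) := by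
    funext t
    rw [toricIntegrand, pairing_deltaT_of_norm_sq hτ.notInBorel hcT hα, mul_assoc]
  have hr : ∀ f : Torus F K → ℂ, ∫ t, (χ t : ℂ) * reflectTwist 1 f t ∂μT =
      ∫ t, f t * ((χ t)⁻¹ : ℂˣ) ∂μT := fun f => by
    have := integral_mul_reflectTwist (μT := μT) hτ χ (ω := 1) (fun t => by simp) f
    simpa only [MonoidHom.mul_apply, MonoidHom.one_apply, mul_one] using this
  rw [betaPairing, he]
  refine ⟨(integrable_convolution hχ h1 h2').const_mul _, ?_⟩
  rw [integral_const_mul, integral_convolution hχ h1 h2, hr, hr]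

/-- The matrix coefficient is ω times a convolution, so the relevant character is χω. The operator
in the second slot contributes its multiplier, whose conjugate is `chartIntegral` because χω is
unitary. -/
lemma toricPairing_of_sq (hτ : IsGen ι τ) (hcT : IsCompactComparison ι μG μT cT) {α : ℂˣ}
    (hα' : α = 1 ∨ α = -1) (hα : α ^ 2 = 1) {χ : Torus F K →* ℂˣ} (hχ : IsUnitaryChar χ)
    (f₁ f₂ : TestSpace F K) :
    Integrable (toricIntegrand ι μ μG α χ (deltaT hτ.notInBorel α f₁) (deltaT hτ.notInBorel α f₂)) μT ∧
      betaPairing ι μ μG μT α χ (deltaT hτ.notInBorel α f₁) (deltaT hτ.notInBorel α f₂) =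
        cT * ((absF (ι τ 1 0) : ℝ) : ℂ)⁻¹ * chartIntegral μ τ (χ * normChar hτ.notInBorel hα) *
          ((∫ t, f₁.1 t * ((χ t)⁻¹ : ℂˣ) ∂μT) * conj (∫ t, f₂.1 t * ((χ t)⁻¹ : ℂˣ) ∂μT)) := by
  have hsc := secondCountable_torus (F := F) hτ
  have hlc := locallyCompact_torus (F := F) hτ
  have hω := isUnitaryChar_normChar (F := F) hτ hα
  have hχω := hχ.mul hω
  obtain ⟨S, hS, hS'⟩ := exists_diffOp_support (μ := μ) hτ hα f₂
  set ω := normChar (F := F) hτ.notInBorel hα with hωdef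
  have h1 : Integrable (reflectTwist ω f₁.1) μT := integrable_reflectTwist hω f₁
  have h2 : Integrable (reflectTwist ω f₂.1) μT := integrable_reflectTwist hω f₂
  have hD := integrable_diffOp (measurable_chart hτ) h2 hS hS'
  have hD' : Integrable (fun v => conj (diffOp μ (chart F τ) (reflectTwist ω f₂.1) v)) μT :=
    Complex.conjLIE.integrable_comp_iff.2 hD
  have he : toricIntegrand ι μ μG α χ (deltaT hτ.notInBorel α f₁) (deltaT hτ.notInBorel α f₂) =
      fun t => cT * ((absF (ι τ 1 0) : ℝ) : ℂ)⁻¹ * ((∫ v, reflectTwist ω f₁.1 (v * t) *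
        conj (diffOp μ (chart F τ) (reflectTwist ω f₂.1) v) ∂μT) * (χ * ω) t) := by
    funext t
    rw [toricIntegrand, pairing_deltaT_of_sq hτ hcT hα' hα, MonoidHom.mul_apply, Units.val_mul]
    ring
  have hr : ∀ f : Torus F K → ℂ, ∫ t, ((χ * ω) t : ℂ) * reflectTwist ω f t ∂μT =
      ∫ t, f t * ((χ t)⁻¹ : ℂˣ) ∂μT :=
    integral_mul_reflectTwist hτ χ (normChar_sq hτ.notInBorel hα)
  have hm : conj (∫ z, (((((χ * ω) (chart F τ z))⁻¹ : ℂˣ) : ℂ) - 1) ∂μ) =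
      chartIntegral μ τ (χ * ω) := by
    rw [chartIntegral, ← integral_conj]
    congr 1
    funext z
    rw [map_sub, map_one, ← hχω.conj_eq, Complex.conj_conj]
  rw [betaPairing, he]
  refine ⟨(integrable_convolution hχω h1 hD').const_mul _, ?_⟩
  rw [integral_const_mul, integral_convolution hχω h1 hD,
    integral_diffOp (measurable_chart hτ) hχω h2 hS hS', hr, hr, map_mul, hm]
  ring

lemma zetaLoc_two_ne_zero : zetaLoc F 2 ≠ 0 := by
  rw [zetaLoc]
  refine inv_ne_zero (sub_ne_zero.2 ?_)
  have hq : (1 : ℝ) < resCard F := by exact_mod_cast one_lt_resCard F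
  intro h
  have e : (-2 : ℂ) = -(2 : ℕ) := by norm_num
  rw [e, Complex.cpow_neg, Complex.cpow_natCast] at h
  have h2 : ((resCard F : ℂ) ^ 2)⁻¹ = (((resCard F : ℝ) ^ 2)⁻¹ : ℝ) := by push_cast; rfl
  rw [h2] at h
  have h3 : ((resCard F : ℝ) ^ 2)⁻¹ = 1 := by exact_mod_cast h.symm
  exact (inv_lt_one_of_one_lt₀ (one_lt_pow₀ hq two_ne_zero)).ne h3

lemma zetaLoc_neg_one : zetaLoc F (-1) = (1 - (resCard F : ℂ))⁻¹ := by
  rw [zetaLoc, neg_neg, Complex.cpow_one]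

lemma lAdjoint_one_of_sq {α : ℂˣ} (hα : α = 1 ∨ α = -1) :
    lAdjoint F α 1 = (1 - (resCard F : ℂ)⁻¹ ^ 2)⁻¹ := by
  rw [lAdjoint, if_pos hα]
  congr 2
  have e : (-1 - 1 : ℂ) = -(2 : ℕ) := by norm_num
  rw [e, Complex.cpow_neg, Complex.cpow_natCast, inv_pow]

/-- The local factors of a special representation. -/
lemma lAdjoint_mul_chartIntegral (hτ : IsGen ι τ) {c : ℝ≥0} (hμ : μT = c • chartMeasure ι μ τ)
    (hc : 0 < c) {α : ℂˣ} (hα' : α = 1 ∨ α = -1) (hα : α ^ 2 = 1) {χ : Torus F K →* ℂˣ}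
    (hχ : IsUnitaryChar χ) :
    lAdjoint F α 1 * eulerPoly χ α (1 / 2) * chartIntegral μ τ (χ * normChar hτ.notInBorel hα) =
      (volO μ : ℝ) * zetaLoc F (-1) * eulerFactor α χ := by
  classical
  have hne : ¬ ‖(α : ℂ)‖ ^ 2 = resCard F := fun h => ne_of_norm_sq h hα'
  have he : eulerFactor α χ =
      if IsUnramified χ then eulerPoly χ α (-1 / 2) else (resCard F : ℂ) ^ conductor χ := by
    rw [eulerFactor, if_neg hne, lBaseChange, lBaseChange, if_pos hα', if_pos hα']
    by_cases hu : IsUnramified χ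
    · rw [if_pos hu, if_pos hu, one_div, inv_inv]
    · rw [if_neg hu, if_neg hu, eulerPoly, if_pos hu, inv_one, div_one]
  have hq0 := resCard_ne_zero F
  have hq : (1 : ℝ) < resCard F := by exact_mod_cast one_lt_resCard F
  have h1 : (1 : ℂ) - resCard F ≠ 0 := sub_ne_zero.2 (by exact_mod_cast hq.ne)
  have h2 : (1 : ℂ) + resCard F ≠ 0 := by
    have : (1 : ℝ) + resCard F ≠ 0 := by positivity
    exact_mod_cast this
  -- The constant of the chart integral times L(1, ad): -q⁻¹(1 + q⁻¹)/(1 - q⁻²) = 1/(1 - q) = ζ(-1).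
  have key : (1 - (resCard F : ℂ)⁻¹ ^ 2)⁻¹ * -((resCard F : ℂ)⁻¹ * (1 + (resCard F : ℂ)⁻¹)) =
      (1 - (resCard F : ℂ))⁻¹ := by
    have e : (1 : ℂ) - (resCard F : ℂ)⁻¹ ^ 2 =
        -((1 - resCard F) * (1 + resCard F) * (resCard F : ℂ)⁻¹ ^ 2) := by
      field_simp
      ring
    rw [e]
    field_simp
    ring
  have h := chartIntegral_mul_eulerPoly μ hτ hμ hc hα hχ
  rw [lAdjoint_one_of_sq hα', mul_assoc, mul_comm (eulerPoly _ _ _), h, ← he, zetaLoc_neg_one, ← key]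
  ring

/-- The normalized toric pairing on the image of `δ_T`. -/
theorem alphaPairing_deltaT (hτ : IsGen ι τ) {c : ℝ≥0} (hμ : μT = c • chartMeasure ι μ τ)
    (hc : 0 < c) (h0 : μT (unitFiltration F K 0) = 1) (hcT0 : 0 < cT)
    (hcT : IsCompactComparison ι μG μT cT) {α : ℂˣ}
    (hα : ‖(α : ℂ)‖ ^ 2 = resCard F ∨ α = 1 ∨ α = -1) :
    toricConstant F K cT (absF (ι τ 1 0) / c : ℝ≥0) (ord (ι τ 1 0)) α ≠ 0 ∧
      ∀ χ : Torus F K →* ℂˣ, Continuous χ → (∀ t, ‖(χ t : ℂ)‖ = 1) → ∀ f₁ f₂ : TestSpace F K,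
        Integrable (toricIntegrand ι μ μG α χ (deltaT hτ.notInBorel α f₁)
          (deltaT hτ.notInBorel α f₂)) μT ∧
        alphaPairing ι μ μG μT α χ (deltaT hτ.notInBorel α f₁) (deltaT hτ.notInBorel α f₂) =
          toricConstant F K cT (absF (ι τ 1 0) / c : ℝ≥0) (ord (ι τ 1 0)) α * eulerFactor α χ *
            (∫ t, f₁.1 t * ((χ t)⁻¹ : ℂˣ) ∂μT) * conj (∫ t, f₂.1 t * ((χ t)⁻¹ : ℂˣ) ∂μT) := by
  have hL := chart_const_mul_volO hτ hμ h0
  have hV := volO_pos μ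
  have hL0 : lEta F K 1 ≠ 0 := by
    rw [← hL]
    exact_mod_cast (mul_pos hc hV).ne'
  have hcT' : (cT : ℂ) ≠ 0 := by exact_mod_cast hcT0.ne'
  have hζ := zetaLoc_two_ne_zero (F := F)
  by_cases hn : ‖(α : ℂ)‖ ^ 2 = resCard F
  · rw [toricConstant, if_pos hn]
    refine ⟨mul_ne_zero hcT' (div_ne_zero hL0 hζ), fun χ hχc hχn f₁ f₂ => ?_⟩
    obtain ⟨h1, h2⟩ := toricPairing_of_norm_sq (μ := μ) hτ hcT hn ⟨hχc, hχn⟩ f₁ f₂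
    refine ⟨h1, ?_⟩
    rw [alphaPairing, h2, eulerFactor, if_pos hn, div_eq_mul_inv, mul_inv, div_eq_mul_inv, div_eq_mul_inv]
    ring
  · have hα' := hα.resolve_left hn
    have hα2 : α ^ 2 = 1 := by rcases hα' with rfl | rfl <;> simp
    have hcτ := hτ.lower_ne_zero
    have hA : ((absF (ι τ 1 0) : ℝ) : ℂ) ≠ 0 := by exact_mod_cast absF_ne_zero hcτ
    have hc' : ((c : ℝ) : ℂ) ≠ 0 := by exact_mod_cast hc.ne'
    have hq : (1 : ℝ) < resCard F := by exact_mod_cast one_lt_resCard F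
    have hζ1 : zetaLoc F (-1) ≠ 0 := by
      rw [zetaLoc_neg_one]
      exact inv_ne_zero (sub_ne_zero.2 (by exact_mod_cast hq.ne))
    have hpow : (resCard F : ℂ) ^ (2 * ord (ι τ 1 0)) = (((absF (ι τ 1 0) : ℝ) : ℂ) ^ 2)⁻¹ := by
      rw [coe_absF hcτ, ← zpow_natCast, ← zpow_mul, ← zpow_neg]
      congr 1
      push_cast
      ring
    -- With C_T = |ι(τ)₁₀|/c, q^{2n_T} = |ι(τ)₁₀|⁻² and one factor L(1, η) written as c · vol(O),
    -- the constant c of the chart cancels.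
    have hK : toricConstant F K cT (absF (ι τ 1 0) / c : ℝ≥0) (ord (ι τ 1 0)) α =
        cT * ((absF (ι τ 1 0) : ℝ) : ℂ)⁻¹ * lEta F K 1 * (volO μ : ℝ) * zetaLoc F (-1) *
          (zetaLoc F 2)⁻¹ := by
      rw [toricConstant, if_neg hn, hpow, ← hL]
      push_cast
      field_simp
    have hV' : ((volO μ : ℝ) : ℂ) ≠ 0 := by exact_mod_cast hV.ne'
    rw [hK]
    refine ⟨mul_ne_zero (mul_ne_zero (mul_ne_zero (mul_ne_zero (mul_ne_zero hcT' (inv_ne_zero hA)) hL0)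
      hV') hζ1) (inv_ne_zero hζ), fun χ hχc hχn f₁ f₂ => ?_⟩
    obtain ⟨h1, h2⟩ := toricPairing_of_sq (μ := μ) hτ hcT hα' hα2 ⟨hχc, hχn⟩ f₁ f₂
    refine ⟨h1, ?_⟩
    have h3 := lAdjoint_mul_chartIntegral hτ hμ hc hα' hα2 ⟨hχc, hχn⟩
    rw [alphaPairing, h2, lBaseChange, if_pos hα', div_eq_mul_inv, mul_inv, inv_inv]
    set I₁ := ∫ t, f₁.1 t * ((χ t)⁻¹ : ℂˣ) ∂μT
    set I₂ := conj (∫ t, f₂.1 t * ((χ t)⁻¹ : ℂˣ) ∂μT)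
    linear_combination (lEta F K 1 * (zetaLoc F 2)⁻¹ * cT * ((absF (ι τ 1 0) : ℝ) : ℂ)⁻¹ * I₁ * I₂) * h3

end ToricFormula

end LocalToric

end


open LocalToric
theorem corollary3p17
    {F : Type*} [Field F] [CharZero F] [ValuativeRel F] [TopologicalSpace F]
    [IsNonarchimedeanLocalField F] [MeasurableSpace F] [BorelSpace F]
    {K : Type*} [CommRing K] [Algebra F K] [Algebra.Etale F K] [Algebra.IsQuadraticExtension F K]
    [TopologicalSpace K] [IsModuleTopology F K]
    [MeasurableSpace (GL (Fin 2) F)] [BorelSpace (GL (Fin 2) F)]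
    [MeasurableSpace (Torus F K)] [BorelSpace (Torus F K)]
    (ι : K →ₐ[F] Matrix (Fin 2) (Fin 2) F) (hι : NotInBorel ι)
    (μN : Measure F) [μN.IsAddHaarMeasure]
    (μG : Measure (GL (Fin 2) F)) [μG.IsHaarMeasure]
    (μT : Measure (Torus F K)) [μT.IsHaarMeasure] (hμT : μT (unitFiltration F K 0) = 1) :
    ∃ (c C : ℝ) (n : ℤ), 0 < c ∧ 0 < C ∧
      IsCompactComparison ι μG μT c ∧ IsUnipotentComparison ι μN μT C ∧ IsEmbeddingExponent ι n ∧
      ∀ α : ℂˣ, (‖(α : ℂ)‖ ^ 2 = resCard F ∨ α = 1 ∨ α = -1) →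
        toricConstant F K c C n α ≠ 0 ∧
        ∀ χ : Torus F K →* ℂˣ, Continuous χ → (∀ t, ‖(χ t : ℂ)‖ = 1) →
          ∀ f₁ f₂ : TestSpace F K,
            Integrable (toricIntegrand ι μN μG α χ (deltaT hι α f₁) (deltaT hι α f₂)) μT ∧
            alphaPairing ι μN μG μT α χ (deltaT hι α f₁) (deltaT hι α f₂) =
              toricConstant F K c C n α * eulerFactor α χ *
                (∫ t, f₁.1 t * ((χ t)⁻¹ : ℂˣ) ∂μT) *
                conj (∫ t, f₂.1 t * ((χ t)⁻¹ : ℂˣ) ∂μT) := by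
  have := finite_of_quadratic (F := F) (K := K)
  have := IsModuleTopology.isTopologicalRing F K
  obtain ⟨τ, hτ⟩ := exists_isGen hι
  obtain ⟨c, hc, hμ⟩ := exists_chart_const μN μT hτ
  obtain ⟨c₀, hc₀, hG⟩ := exists_maxCompact_const μN μG
  have hC : (0 : ℝ) < (absF (ι τ 1 0) / c : NNReal) := by
    exact_mod_cast div_pos (absF_pos.2 hτ.lower_ne_zero) hc
  have hN := isUnipotentComparison hτ hμ hc
  -- The constant c_T is the product of the constant comparing GL₂(O) with the big cell and C_T.
  have hK : IsCompactComparison ι μG μT (c₀ * (absF (ι τ 1 0) / c : NNReal)) := by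
    intro h hh
    rw [hG h hh, hN h hh, Complex.ofReal_mul, mul_assoc]
  exact ⟨_, _, ord (ι τ 1 0), mul_pos hc₀ hC, hC, hK, hN, isEmbeddingExponent_gen hτ,
    fun α hα => alphaPairing_deltaT hτ hμ hc hμT (mul_pos hc₀ hC) hK hα⟩
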